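/- **Theorem.** Let $k$ be an algebraically closed field of characteristic $0$ and let $A$ be a Hopf algebra over $k$. Notation: * For a commutative $k$-algebra $R$ and $t\in R$, $\mathrm{Rep}(S_t,R)$ is Deligne's category: the pseudo-abelian envelope of the category whose objects are formal symbols $[U]$ ($U$ a finite set), with $\mathrm{Hom}([U],[V])$ free over $R$ on the recollements of $U,V$ (finite sets $C$ with a jointly surjective pair of injections $U\to C\leftarrow V$, up to isomorphism), with $(D)\circ(C)=\sum_E P^E_{C,D}(t)\,(E)$, where $P^E_{C,D}(T)=\sum_F\prod_{|E|\le m<|F|}(T-m)$, the sum running over the recollements $F$ of the three sets which restrict to $C,D,E$; its tensor product is $[U]\otimes[V]=\bigoplus_C[C]$, the sum over the recollements of $U,V$. Let $\mathfrak h=[\{1\}]$ (for $t=n$, the permutation representation of $S_n$ on $k^n$), let $\rho\colon\mathfrak h\otimes\mathfrak h\to\mathfrak h$ and $r\colon\mathfrak h\to\mathfrak h\otimes\mathfrak h$ interpolate $e_i\otimes e_j\mapsto\delta_{ij}e_i$ and $e_i\mapsto e_i\otimes e_i$, and let $s\colon\mathfrak h\to\mathbf 1$ interpolate $e_i\mapsto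 1$. * $\mathrm{Rep}(\mathbf A_t)_R$ is the category of objects $M\in\mathrm{Rep}(S_t,R)$ with a $k$-linear family of morphisms $y_a\colon\mathfrak h\otimes M\to M$ ($a\in A$) such that $y_1=s\otimes\mathrm{id}_M$, $y_a(\mathrm{id}_{\mathfrak h}\otimes y_b)(r\otimes\mathrm{id}_M)=y_{ab}$ and $y_a(\mathrm{id}_{\mathfrak h}\otimes y_b)-y_b(\mathrm{id}_{\mathfrak h}\otimes y_a)P_{1,2}=y_{[a,b]}(\rho\otimes\mathrm{id}_M)$, where $P_{1,2}$ exchanges the two factors $\mathfrak h$; morphisms are the morphisms of $\mathrm{Rep}(S_t,R)$ which commute with all $y_a$. Write $\mathrm{Rep}(\mathbf A_t)=\mathrm{Rep}(\mathbf A_t)_k$ for $t\in k$. Then for all $R$ and $t$ the monoidal structure of $\mathrm{Rep}(S_t,R)$ lifts to $\mathrm{Rep}(\mathbf A_t)_R$, with the following properties. 1. On $M\otimes N$, if $\Delta(a)=\sum_j x_j\otimes z_j$, the map $y_a$ is the composite of $r\otimes\mathrm{id}\colon\mathfrak h\otimes M\otimes N\to\mathfrak h\otimes\mathfrak h\otimes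 M\otimes N\cong(\mathfrak h\otimes M)\otimes(\mathfrak h\otimes N)$ with $\sum_j y_{x_j}\otimes y_{z_j}$; on the unit object $y_a=\varepsilon(a)\,s$. The tensor product is $R$-bilinear on morphisms. 2. Every object $M$ has a right dual $M^\vee$ in $\mathrm{Rep}(\mathbf A_t)_R$ (with morphisms $M^\vee\otimes M\to\mathbf 1$ and $\mathbf 1\to M\otimes M^\vee$ satisfying the zigzag identities). If the antipode of $A$ is bijective, every object also has a left dual, so $\mathrm{Rep}(\mathbf A_t)_R$ is rigid. 3. (Interpolation.) For every integer $n\ge0$ there is a strong monoidal functor from $\mathrm{Rep}(\mathbf A_{t=n})$ to the category of modules over $S_n\ltimes A^{\otimes n}$, with its usual tensor product ($S_n$ acts diagonally, and each tensor factor $A$ acts through $\Delta$). It is compatible with the usual functor $[U]\mapsto k^{\mathrm{Inj}(U,\{1,\dots,n\})}$ from $\mathrm{Rep}(S_{t=n},k)$ to representations of $S_n$ and with the isomorphisms $k^{\mathrm{Inj}(U,\{1,\dots,n\})}\otimes k^{\mathrm{Inj}(V,\{1,\dots,n\})}\cong\bigoplus_C k^{\mathrm{Inj}(C,\{1,\dots,n\})}$,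 and the $i$-th tensor factor $A$ acts by $a\cdot v=y_a(e_i\otimes v)$. 4. There is a category $\mathfrak K=(\mathrm{ob},\mathrm{mor})$ internal to schemes over $\mathbb A^1_k=\mathrm{Spec}\,k[T]$ which is the category of the $\mathrm{Rep}(\mathbf A_t)$: the schemes $\mathrm{ob}$ and $\mathrm{mor}$ are coproducts of affine schemes parametrizing the objects, resp. morphisms, of $\mathrm{Rep}(\mathbf A_t)_R$ (with $\mathrm{Spec}\,R\to\mathbb A^1_k$ given by $T\mapsto t$) whose underlying objects are given by idempotents of fixed formal direct sums $[U_1]\oplus\dots\oplus[U_m]$, compatibly with extension of scalars, and the structure maps of $\mathfrak K$ are given by source, target, identities and composition. The tensor products of the $\mathrm{Rep}(\mathbf A_t)_R$, on objects and morphisms, are induced by a bifunctor $\mathfrak K\times_{\mathbb A^1_k}\mathfrak K\to\mathfrak K$ over $\mathbb A^1_k$. -/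

import Mathlib

open CategoryTheory MonoidalCategory

noncomputable section

namespace DeligneCat

/-! ### Recollements -/

/-- A recollement of `{1, …, a}` and `{1, …, b}` up to equivalence: an equivalence relation on the
disjoint union which is trivial on both parts (the underlying set `C` is the quotient). -/
def Rec (a b : ℕ) : Type :=
  {s : Setoid (Fin a ⊕ Fin b) //
    (∀ x y, s (Sum.inl x) (Sum.inl y) → x = y) ∧ (∀ x y, s (Sum.inr x) (Sum.inr y) → x = y)}

/-- A recollement of three finite sets, up to equivalence. -/
def Rec3 (a b c : ℕ) : Type :=
  {s : Setoid (Fin a ⊕ (Fin b ⊕ Fin c)) //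
    (∀ x y, s (Sum.inl x) (Sum.inl y) → x = y) ∧
    (∀ x y, s (Sum.inr (Sum.inl x)) (Sum.inr (Sum.inl y)) → x = y) ∧
    (∀ x y, s (Sum.inr (Sum.inr x)) (Sum.inr (Sum.inr y)) → x = y)}

theorem finite_setoid (α : Type) [Finite α] : Finite (Setoid α) :=
  Finite.of_injective (fun s : Setoid α => fun x y => s x y)
    (fun _ _ h => Setoid.ext fun x y => iff_of_eq (congrFun (congrFun h x) y))

instance (a b : ℕ) : Finite (Rec a b) :=
  have := finite_setoid (Fin a ⊕ Fin b)
  Subtype.finite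

instance (a b c : ℕ) : Finite (Rec3 a b c) :=
  have := finite_setoid (Fin a ⊕ (Fin b ⊕ Fin c))
  Subtype.finite

instance (a b : ℕ) : Fintype (Rec a b) := Fintype.ofFinite _
instance (a b c : ℕ) : Fintype (Rec3 a b c) := Fintype.ofFinite _

/-- The underlying set of a recollement. -/
abbrev Rec.Carrier {a b : ℕ} (E : Rec a b) : Type := Quotient E.1

instance {a b : ℕ} (E : Rec a b) : Fintype E.Carrier := Fintype.ofFinite _

/-- The number of elements of the underlying set of a recollement. -/
def Rec.card {a b : ℕ} (E : Rec a b) : ℕ := Fintype.card E.Carrier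

instance {a b c : ℕ} (F : Rec3 a b c) : Fintype (Quotient F.1) := Fintype.ofFinite _

def Rec3.card {a b c : ℕ} (F : Rec3 a b c) : ℕ := Fintype.card (Quotient F.1)

/-- Restriction of a recollement along injections. -/
def Rec.restrict {a b a' b' : ℕ} (E : Rec a b) (u : Fin a' ↪ Fin a) (v : Fin b' ↪ Fin b) :
    Rec a' b' :=
  ⟨E.1.comap (Sum.map u v), fun _ _ h => u.injective (E.2.1 _ _ h),
    fun _ _ h => v.injective (E.2.2 _ _ h)⟩

def Rec3.r12 {a b c : ℕ} (F : Rec3 a b c) : Rec a b :=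
  ⟨F.1.comap (Sum.map id Sum.inl), fun x y h => F.2.1 x y h, fun x y h => F.2.2.1 x y h⟩

def Rec3.r13 {a b c : ℕ} (F : Rec3 a b c) : Rec a c :=
  ⟨F.1.comap (Sum.map id Sum.inr), fun x y h => F.2.1 x y h, fun x y h => F.2.2.2 x y h⟩

def Rec3.r23 {a b c : ℕ} (F : Rec3 a b c) : Rec b c :=
  ⟨F.1.comap Sum.inr, fun x y h => F.2.2.1 x y h, fun x y h => F.2.2.2 x y h⟩

/-- The recollement induced by two injections into a common set. -/
def Rec.ind {I : Type} {a b : ℕ} (u : Fin a ↪ I) (v : Fin b ↪ I) : Rec a b :=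
  ⟨Setoid.ker (Sum.elim u v), fun _ _ h => u.injective h, fun _ _ h => v.injective h⟩

def Rec3.ind {I : Type} {a b c : ℕ} (u : Fin a ↪ I) (v : Fin b ↪ I) (w : Fin c ↪ I) :
    Rec3 a b c :=
  ⟨Setoid.ker (Sum.elim u (Sum.elim v w)), fun _ _ h => u.injective h,
    fun _ _ h => v.injective h, fun _ _ h => w.injective h⟩

theorem Rec3.ind_r12 {I : Type} {a b c : ℕ} (u : Fin a ↪ I) (v : Fin b ↪ I) (w : Fin c ↪ I) :
    (Rec3.ind u v w).r12 = Rec.ind u v :=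
  Subtype.ext <| Setoid.ext fun x y => by
    rcases x with x | x <;> rcases y with y | y <;> exact Iff.rfl

theorem Rec3.ind_r13 {I : Type} {a b c : ℕ} (u : Fin a ↪ I) (v : Fin b ↪ I) (w : Fin c ↪ I) :
    (Rec3.ind u v w).r13 = Rec.ind u w :=
  Subtype.ext <| Setoid.ext fun x y => by
    rcases x with x | x <;> rcases y with y | y <;> exact Iff.rfl

theorem Rec3.ind_r23 {I : Type} {a b c : ℕ} (u : Fin a ↪ I) (v : Fin b ↪ I) (w : Fin c ↪ I) :
    (Rec3.ind u v w).r23 = Rec.ind v w :=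
  Subtype.ext <| Setoid.ext fun x y => Iff.rfl

theorem Rec.ind_restrict {I : Type} {a b a' b' : ℕ} (u : Fin a ↪ I) (v : Fin b ↪ I)
    (u' : Fin a' ↪ Fin a) (v' : Fin b' ↪ Fin b) :
    (Rec.ind u v).restrict u' v' = Rec.ind (u'.trans u) (v'.trans v) :=
  Subtype.ext <| Setoid.ext fun x y => by
    rcases x with x | x <;> rcases y with y | y <;> exact Iff.rfl

/-- The injection of the underlying set induced by two injections. -/
def Rec.indEmb {I : Type} {a b : ℕ} (u : Fin a ↪ I) (v : Fin b ↪ I) :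
    (Rec.ind u v).Carrier ↪ I :=
  ⟨Quotient.lift (Sum.elim u v) fun _ _ h => h, by
    rintro ⟨x⟩ ⟨y⟩ h
    exact Quotient.sound h⟩

theorem card_extensions {α γ : Type} [Fintype α] [Fintype γ] [DecidableEq γ] {n : ℕ}
    (ι : α ↪ γ) (κ : α ↪ Fin n) :
    Fintype.card {g : γ ↪ Fin n // ∀ x, g (ι x) = κ x} =
      (n - Fintype.card α).descFactorial (Fintype.card γ - Fintype.card α) := by
  classical
  have e : {g : γ ↪ Fin n // ∀ x, g (ι x) = κ x} ≃
      (((Set.range ι)ᶜ : Set γ) ↪ ((Set.range κ)ᶜ : Set (Fin n))) := by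
    refine
      { toFun := fun g => ⟨fun y => ⟨g.1 y.1, ?_⟩, ?_⟩
        invFun := fun h => ⟨⟨fun y => if hy : y ∈ Set.range ι then κ hy.choose
          else (h ⟨y, hy⟩ : Fin n), ?_⟩, ?_⟩
        left_inv := ?_
        right_inv := ?_ }
    · rintro ⟨x, hx⟩
      rw [← g.2 x] at hx
      exact y.2 ⟨x, g.1.injective hx⟩
    · intro y y' h
      exact Subtype.ext (g.1.injective (congrArg Subtype.val h))
    · intro y y' hyy
      by_cases h1 : y ∈ Set.range ι <;> by_cases h2 : y' ∈ Set.range ι <;>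
        simp only [h1, h2, dif_pos, dif_neg, not_false_eq_true] at hyy
      · have := κ.injective hyy
        rw [← h1.choose_spec, ← h2.choose_spec, this]
      · exact ((h ⟨y', h2⟩).2 ⟨_, hyy⟩).elim
      · exact ((h ⟨y, h1⟩).2 ⟨_, hyy.symm⟩).elim
      · exact congrArg Subtype.val (h.injective (Subtype.ext hyy))
    · intro x
      have hx : ι x ∈ Set.range ι := ⟨x, rfl⟩
      have := ι.injective hx.choose_spec
      refine (dif_pos hx).trans ?_
      rw [this]
    · intro g
      refine Subtype.ext (Function.Embedding.ext fun y => ?_)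
      by_cases h1 : y ∈ Set.range ι
      · refine (dif_pos h1).trans ?_
        rw [← g.2, h1.choose_spec]
      · exact dif_neg h1
    · intro h
      refine Function.Embedding.ext fun y => Subtype.ext ?_
      have h1 : ¬ (y : γ) ∈ Set.range ι := y.2
      exact dif_neg h1
  rw [Fintype.card_congr e, Fintype.card_embedding_eq, Fintype.card_compl_set,
    Fintype.card_compl_set, Fintype.card_range, Fintype.card_range, Fintype.card_fin]

theorem cast_descFactorial_eq {R : Type*} [CommRing R] {n a c : ℕ} (h : a ≤ n) :
    (((n - a).descFactorial (c - a) : ℕ) : R) = ∏ m ∈ Finset.Ico a c, ((n : R) - m) := by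
  rw [← descPochhammer_eval_eq_descFactorial, descPochhammer_eval_eq_prod_range,
    Finset.prod_Ico_eq_prod_range]
  refine Finset.prod_congr rfl fun i _ => ?_
  rw [Nat.cast_sub h]
  push_cast
  ring

/-- Injections of the middle set which induce a given triple recollement. -/
theorem card_ind3 {a b c n : ℕ} (u : Fin a ↪ Fin n) (w : Fin c ↪ Fin n) (F : Rec3 a b c)
    (hF : F.r13 = Rec.ind u w) [DecidablePred fun v : Fin b ↪ Fin n => Rec3.ind u v w = F] :
    (Finset.univ.filter fun v : Fin b ↪ Fin n => Rec3.ind u v w = F).card =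
      (n - (Rec.ind u w).card).descFactorial (F.card - (Rec.ind u w).card) := by
  classical
  have hF' : ∀ x y : Fin a ⊕ Fin c, F.1 (Sum.map id Sum.inr x) (Sum.map id Sum.inr y) ↔
      Sum.elim u w x = Sum.elim u w y := fun x y => by
    have := congrArg (fun s : Rec a c => s.1 x y) hF
    exact iff_of_eq this
  let ι : (Rec.ind u w).Carrier ↪ Quotient F.1 :=
    ⟨Quotient.map' (Sum.map id Sum.inr) fun x y h => (hF' x y).2 h, by
      rintro ⟨x⟩ ⟨y⟩ h
      exact Quotient.sound ((hF' x y).1 (Quotient.exact h))⟩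
  have := card_extensions ι (Rec.indEmb u w)
  unfold Rec.card Rec3.card
  rw [← this, ← Fintype.card_subtype]
  refine Fintype.card_congr ?_
  refine
    { toFun := fun v => ⟨⟨Quotient.lift (Sum.elim u (Sum.elim v.1 w)) fun x y h => ?_, ?_⟩, ?_⟩
      invFun := fun g => ⟨⟨fun y => g.1 (Quotient.mk _ (Sum.inr (Sum.inl y))), ?_⟩, ?_⟩
      left_inv := ?_
      right_inv := ?_ }
  · have h' : F.1 x y := h
    rw [← v.2] at h'
    exact h'
  · rintro ⟨x⟩ ⟨y⟩ h
    refine Quotient.sound (?_ : F.1 x y)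
    rw [← v.2]
    exact h
  · rintro ⟨x | x⟩ <;> rfl
  · intro y y' h
    exact F.2.2.1 _ _ (Quotient.exact (g.1.injective h))
  · have key : ∀ x, Sum.elim u (Sum.elim (fun y => g.1 (Quotient.mk _ (Sum.inr (Sum.inl y)))) w) x
        = g.1 (Quotient.mk _ x) := by
      rintro (x | x | x)
      · exact (g.2 (Quotient.mk _ (Sum.inl x))).symm
      · rfl
      · exact (g.2 (Quotient.mk _ (Sum.inr x))).symm
    refine Subtype.ext (Setoid.ext fun x y => ?_)
    refine Iff.trans (b := g.1 (Quotient.mk _ x) = g.1 (Quotient.mk _ y)) ?_ ?_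
    · rw [← key, ← key]
      exact Iff.rfl
    · exact g.1.injective.eq_iff.trans Quotient.eq
  · intro v
    rfl
  · intro g
    refine Subtype.ext (Function.Embedding.ext ?_)
    rintro ⟨x | x | x⟩
    · exact (g.2 (Quotient.mk _ (Sum.inl x))).symm
    · rfl
    · exact (g.2 (Quotient.mk _ (Sum.inr x))).symm

/-! ### Formal direct sums of the objects `[U]` and their morphisms -/

/-- A formal direct sum `[U₁] ⊕ ⋯ ⊕ [U_len]` with `|U_i| = deg i`. -/
@[ext]
structure Shape : Type where
  len : ℕ
  deg : Fin len → ℕ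

/-- Matrices of formal linear combinations of recollements. -/
def Coef (R : Type*) (X Y : Shape) : Type _ :=
  ∀ (i : Fin X.len) (j : Fin Y.len), Rec (X.deg i) (Y.deg j) → R

@[ext]
theorem Coef.ext {R : Type*} {X Y : Shape} {f g : Coef R X Y}
    (h : ∀ i j E, f i j E = g i j E) : f = g :=
  funext fun i => funext fun j => funext fun E => h i j E

instance Coef.addCommGroup (R : Type*) [CommRing R] (X Y : Shape) : AddCommGroup (Coef R X Y) :=
  inferInstanceAs (AddCommGroup (∀ i j, Rec (X.deg i) (Y.deg j) → R))

instance Coef.module (R : Type*) [CommRing R] (X Y : Shape) : Module R (Coef R X Y) :=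
  inferInstanceAs (Module R (∀ i j, Rec (X.deg i) (Y.deg j) → R))

open scoped Classical in
/-- The morphism whose coefficients are `1` on the recollements satisfying `P` and `0` on the
others. -/
def Coef.ofProp (R : Type*) [CommRing R] {X Y : Shape}
    (P : ∀ (i : Fin X.len) (j : Fin Y.len), Rec (X.deg i) (Y.deg j) → Prop) : Coef R X Y :=
  fun i j E => if P i j E then 1 else 0

/-- `i = i'`, and the relation `s` identifies `u x` with `u' x` for all `x ∈ U_i`. -/
def Agree (X : Shape) {Q : Type} (s : Setoid Q) (i i' : Fin X.len)
    (u : Fin (X.deg i) → Q) (u' : Fin (X.deg i') → Q) : Prop :=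
  i = i' ∧ ∀ (x : Fin (X.deg i)) (x' : Fin (X.deg i')), (x : ℕ) = (x' : ℕ) → s (u x) (u' x')

/-- The identity: the recollements of `U, U` given by the two identity maps of `U`. -/
def Coef.id (R : Type*) [CommRing R] (X : Shape) : Coef R X X :=
  Coef.ofProp R fun i j E => Agree X E.1 i j Sum.inl Sum.inr

open scoped Classical in
/-- Composition, `(D) ∘ (C) = ∑_E P^E_{C,D}(t) (E)`, where `P^E_{C,D}(T)` is the sum over the
recollements `F` of `U, V, W` which restrict to `C, D, E` of `∏_{|E| ≤ m < |F|} (T - m)`. For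
`T = n` this is the number of injections `V → {1, …, n}` which induce `C` and `D` together with
given injections of `U` and `W` inducing `E`; see `ev_comp`. -/
def Coef.comp {R : Type*} [CommRing R] (t : R) {X Y Z : Shape}
    (f : Coef R X Y) (g : Coef R Y Z) : Coef R X Z := fun i k E =>
  ∑ j, ∑ F : Rec3 (X.deg i) (Y.deg j) (Z.deg k),
    if F.r13 = E then f i j F.r12 * g j k F.r23 * ∏ m ∈ Finset.Ico E.card F.card, (t - m) else 0

/-- Base change of coefficients. -/
def Coef.map {R S : Type*} [CommRing R] [CommRing S] (φ : R →+* S) {X Y : Shape}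
    (f : Coef R X Y) : Coef S X Y := fun i j E => φ (f i j E)

theorem Coef.map_ofProp {R S : Type*} [CommRing R] [CommRing S] (φ : R →+* S) {X Y : Shape}
    (P : ∀ (i : Fin X.len) (j : Fin Y.len), Rec (X.deg i) (Y.deg j) → Prop) :
    (Coef.ofProp R P).map φ = Coef.ofProp S P := by
  ext i j E
  simp [Coef.map, Coef.ofProp, apply_ite φ]

theorem Coef.map_id {R S : Type*} [CommRing R] [CommRing S] (φ : R →+* S) (X : Shape) :
    (Coef.id R X).map φ = Coef.id S X := Coef.map_ofProp φ _

theorem Coef.map_comp {R S : Type*} [CommRing R] [CommRing S] (φ : R →+* S) (t : R)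
    {X Y Z : Shape} (f : Coef R X Y) (g : Coef R Y Z) :
    (Coef.comp t f g).map φ = Coef.comp (φ t) (f.map φ) (g.map φ) := by
  ext i k E
  simp [Coef.map, Coef.comp, map_sum, apply_ite φ]

/-! ### Evaluation at natural numbers -/

/-- The basis of the permutation module `⊕ᵢ Inj(Uᵢ, {1, …, n})` of the symmetric group. -/
def Shape.Pt (X : Shape) (n : ℕ) : Type := Σ i : Fin X.len, (Fin (X.deg i) ↪ Fin n)

instance (X : Shape) (n : ℕ) : Fintype (X.Pt n) :=
  inferInstanceAs (Fintype (Σ i : Fin X.len, (Fin (X.deg i) ↪ Fin n)))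

instance (X : Shape) (n : ℕ) : DecidableEq (X.Pt n) := Classical.decEq _

/-- The matrix of the map of permutation modules given by a linear combination of recollements;
its `(f, g)` entry is the coefficient of the recollement induced by `f` and `g`. -/
def ev {R : Type*} (n : ℕ) {X Y : Shape} (f : Coef R X Y) : Matrix (X.Pt n) (Y.Pt n) R :=
  Matrix.of fun z w => f z.1 w.1 (Rec.ind z.2 w.2)

theorem ev_apply {R : Type*} (n : ℕ) {X Y : Shape} (f : Coef R X Y) (z : X.Pt n) (w : Y.Pt n) :
    ev n f z w = f z.1 w.1 (Rec.ind z.2 w.2) := rfl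

theorem ev_comp {R : Type*} [CommRing R] (n : ℕ) {X Y Z : Shape}
    (f : Coef R X Y) (g : Coef R Y Z) :
    ev n (Coef.comp (n : R) f g) = ev n f * ev n g := by
  classical
  ext z w
  obtain ⟨i, u⟩ := z
  obtain ⟨k, w⟩ := w
  refine Eq.trans ?_ (Matrix.mul_apply (M := ev n f) (N := ev n g)
    (i := (⟨i, u⟩ : X.Pt n)) (k := (⟨k, w⟩ : Z.Pt n))).symm
  change Coef.comp (n : R) f g i k (Rec.ind u w) =
    ∑ y : (Σ j : Fin Y.len, (Fin (Y.deg j) ↪ Fin n)),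
      f i y.1 (Rec.ind u y.2) * g y.1 k (Rec.ind y.2 w)
  rw [Fintype.sum_sigma]
  refine Finset.sum_congr rfl fun j _ => ?_
  have h1 : ∀ v : Fin (Y.deg j) ↪ Fin n,
      f i j (Rec.ind u v) * g j k (Rec.ind v w) =
        ∑ F : Rec3 (X.deg i) (Y.deg j) (Z.deg k),
          if Rec3.ind u v w = F then f i j F.r12 * g j k F.r23 else 0 := fun v => by
    rw [Finset.sum_ite_eq, if_pos (Finset.mem_univ _), Rec3.ind_r12, Rec3.ind_r23]
  simp_rw [h1]
  rw [Finset.sum_comm]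
  refine Finset.sum_congr rfl fun F _ => ?_
  rw [← Finset.sum_filter, Finset.sum_const, nsmul_eq_mul]
  split_ifs with hF
  · rw [card_ind3 u w F hF, cast_descFactorial_eq, mul_comm]
    have := Fintype.card_le_of_embedding (Rec.indEmb u w)
    rwa [Fintype.card_fin] at this
  · rw [Finset.filter_eq_empty_iff.2, Finset.card_empty, Nat.cast_zero, zero_mul]
    intro v _ hv
    exact hF (by rw [← hv, Rec3.ind_r13])

theorem agree_ker {X : Shape} {Q : Type} {n : ℕ} (e : Q → Fin n) {i i' : Fin X.len}
    {u : Fin (X.deg i) → Q} {u' : Fin (X.deg i') → Q}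
    (v : Fin (X.deg i) ↪ Fin n) (v' : Fin (X.deg i') ↪ Fin n)
    (hv : ∀ x, e (u x) = v x) (hv' : ∀ x, e (u' x) = v' x) :
    Agree X (Setoid.ker e) i i' u u' ↔ (⟨i, v⟩ : X.Pt n) = ⟨i', v'⟩ := by
  constructor
  · rintro ⟨rfl, h⟩
    congr 1
    exact Function.Embedding.ext fun x => by rw [← hv, ← hv']; exact h x x rfl
  · intro h
    have h1 : i = i' := congrArg Sigma.fst h
    subst h1
    refine ⟨rfl, fun x x' hx => ?_⟩
    obtain rfl : x = x' := Fin.ext hx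
    have h2 := eq_of_heq (Sigma.mk.inj h).2
    change e (u x) = e (u' x)
    rw [hv, hv', h2]

theorem ev_ofProp {R : Type*} [CommRing R] (n : ℕ) {X Y : Shape}
    (P : ∀ (i : Fin X.len) (j : Fin Y.len), Rec (X.deg i) (Y.deg j) → Prop)
    (z : X.Pt n) (w : Y.Pt n) [Decidable (P z.1 w.1 (Rec.ind z.2 w.2))] :
    ev n (Coef.ofProp R P) z w = if P z.1 w.1 (Rec.ind z.2 w.2) then 1 else 0 := by
  rw [ev_apply, Coef.ofProp]
  congr

theorem ev_id {R : Type*} [CommRing R] (n : ℕ) (X : Shape) : ev n (Coef.id R X) = 1 := by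
  classical
  ext z w
  rw [Coef.id, ev_ofProp, Matrix.one_apply]
  refine if_congr ?_ rfl rfl
  exact agree_ker (Sum.elim z.2 w.2) z.2 w.2 (fun _ => rfl) (fun _ => rfl)

/-- A ring of polynomials in `X = T` of which every `(R, t)` is a specialization. -/
abbrev Gen (R : Type*) : Type _ := Polynomial (MvPolynomial R ℤ)

/-- The specialization `T ↦ t`. -/
def Gen.spec {R : Type*} [CommRing R] (t : R) : Gen R →+* R :=
  Polynomial.eval₂RingHom (MvPolynomial.aeval (R := ℤ) (id : R → R)).toRingHom t

theorem Gen.spec_X {R : Type*} [CommRing R] (t : R) : Gen.spec t Polynomial.X = t := by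
  simp [Gen.spec]

theorem Coef.exists_lift {R : Type*} [CommRing R] (t : R) {X Y : Shape} (f : Coef R X Y) :
    ∃ f' : Coef (Gen R) X Y, f'.map (Gen.spec t) = f :=
  ⟨fun i j E => Polynomial.C (MvPolynomial.X (f i j E)), by
    ext i j E
    simp [Coef.map, Gen.spec]⟩

/-- Evaluation at `T = n`. -/
def evn {R : Type*} [CommRing R] (n : ℕ) {X Y : Shape} (f : Coef (Gen R) X Y) :
    Matrix (X.Pt n) (Y.Pt n) (MvPolynomial R ℤ) :=
  ev n (f.map (Polynomial.evalRingHom (n : MvPolynomial R ℤ)))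

theorem exists_ind {a b : ℕ} (E : Rec a b) {n : ℕ} (hn : E.card ≤ n) :
    ∃ (u : Fin a ↪ Fin n) (v : Fin b ↪ Fin n), Rec.ind u v = E := by
  classical
  have : Nonempty (E.Carrier ↪ Fin n) :=
    Function.Embedding.nonempty_of_card_le (by rwa [Fintype.card_fin])
  obtain ⟨g⟩ := this
  refine ⟨⟨fun x => g (Quotient.mk _ (Sum.inl x)), fun x y h =>
    E.2.1 _ _ (Quotient.exact (g.injective h))⟩,
    ⟨fun x => g (Quotient.mk _ (Sum.inr x)), fun x y h =>
    E.2.2 _ _ (Quotient.exact (g.injective h))⟩, Subtype.ext (Setoid.ext fun x y => ?_)⟩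
  have key : ∀ x, Sum.elim (fun x => g (Quotient.mk _ (Sum.inl x)))
      (fun x => g (Quotient.mk _ (Sum.inr x))) x = g (Quotient.mk E.1 x) := by
    rintro (x | x) <;> rfl
  refine Iff.trans (b := g (Quotient.mk _ x) = g (Quotient.mk _ y)) ?_
    (g.injective.eq_iff.trans Quotient.eq)
  rw [← key, ← key]
  exact Iff.rfl

theorem evn_faithful {R : Type*} [CommRing R] {X Y : Shape} {f g : Coef (Gen R) X Y}
    (h : ∀ n, evn n f = evn n g) : f = g := by
  ext1 i j E
  refine Polynomial.eq_of_infinite_eval_eq _ _ (Set.Infinite.mono ?_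
    (Set.infinite_range_of_injective (f := fun n : ℕ => ((E.card + n : ℕ) : MvPolynomial R ℤ))
      fun a b hab => by simpa using hab))
  rintro _ ⟨n, rfl⟩
  obtain ⟨u, v, huv⟩ := exists_ind E (Nat.le_add_right E.card n)
  have := congrFun (congrFun (h (E.card + n)) ⟨i, u⟩) ⟨j, v⟩
  change Polynomial.eval _ (f i j (Rec.ind u v)) = Polynomial.eval _ (g i j (Rec.ind u v)) at this
  rwa [huv] at this

theorem evn_comp {R : Type*} [CommRing R] (n : ℕ) {X Y Z : Shape}
    (f : Coef (Gen R) X Y) (g : Coef (Gen R) Y Z) :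
    evn n (Coef.comp Polynomial.X f g) = evn n f * evn n g := by
  rw [evn, Coef.map_comp, Polynomial.coe_evalRingHom, Polynomial.eval_X, ev_comp]
  rfl

theorem Coef.comp_spec {R : Type*} [CommRing R] (t : R) {X Y Z : Shape}
    (f : Coef (Gen R) X Y) (g : Coef (Gen R) Y Z) :
    Coef.comp t (f.map (Gen.spec t)) (g.map (Gen.spec t)) =
      (Coef.comp Polynomial.X f g).map (Gen.spec t) := by
  rw [Coef.map_comp, Gen.spec_X]

theorem Coef.id_comp {R : Type*} [CommRing R] (t : R) {X Y : Shape} (f : Coef R X Y) :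
    Coef.comp t (Coef.id R X) f = f := by
  obtain ⟨f, rfl⟩ := f.exists_lift t
  rw [← Coef.map_id (Gen.spec t), Coef.comp_spec]
  congr 1
  refine evn_faithful fun n => ?_
  rw [evn_comp, evn, Coef.map_id, ev_id, Matrix.one_mul]

theorem Coef.comp_id {R : Type*} [CommRing R] (t : R) {X Y : Shape} (f : Coef R X Y) :
    Coef.comp t f (Coef.id R Y) = f := by
  obtain ⟨f, rfl⟩ := f.exists_lift t
  rw [← Coef.map_id (Gen.spec t), Coef.comp_spec]
  congr 1
  refine evn_faithful fun n => ?_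
  rw [evn_comp, evn, evn, Coef.map_id, ev_id, Matrix.mul_one]

theorem Coef.assoc {R : Type*} [CommRing R] (t : R) {X Y Z W : Shape} (f : Coef R X Y)
    (g : Coef R Y Z) (h : Coef R Z W) :
    Coef.comp t (Coef.comp t f g) h = Coef.comp t f (Coef.comp t g h) := by
  obtain ⟨f, rfl⟩ := f.exists_lift t
  obtain ⟨g, rfl⟩ := g.exists_lift t
  obtain ⟨h, rfl⟩ := h.exists_lift t
  simp only [Coef.comp_spec]
  congr 1
  refine evn_faithful fun n => ?_
  simp only [evn_comp, Matrix.mul_assoc]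

/-! ### The tensor product -/

/-- The summands of the tensor product of two formal direct sums: pairs of summands `[U]`, `[V]`
and a recollement of `U` and `V`. -/
def TIdx (X Y : Shape) : Type :=
  Σ (i : Fin X.len) (j : Fin Y.len), Rec (X.deg i) (Y.deg j)

instance (X Y : Shape) : Fintype (TIdx X Y) :=
  inferInstanceAs (Fintype (Σ (i : Fin X.len) (j : Fin Y.len), Rec (X.deg i) (Y.deg j)))

/-- `[U] ⊗ [V] = ⨁ [C]`, the sum over the recollements `C` of `U` and `V`, extended to formal
direct sums. The summands and the elements of each `C` are numbered in a fixed way. -/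
def Shape.tensor (X Y : Shape) : Shape where
  len := Fintype.card (TIdx X Y)
  deg p := ((Fintype.equivFin (TIdx X Y)).symm p).2.2.card

variable {X Y Z W X' Y' Z' : Shape}

/-- The pair of summands and the recollement with a given number. -/
def idx (p : Fin (X.tensor Y).len) : TIdx X Y := (Fintype.equivFin (TIdx X Y)).symm p

/-- The number of the first of the two summands. -/
abbrev il (p : Fin (X.tensor Y).len) : Fin X.len := (idx p).1

/-- The number of the second of the two summands. -/
abbrev ir (p : Fin (X.tensor Y).len) : Fin Y.len := (idx p).2.1

/-- The elements of the underlying set of a recollement, numbered. -/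
def num {X Y : Shape} (p : Fin (X.tensor Y).len) :
    (idx p).2.2.Carrier ≃ Fin ((X.tensor Y).deg p) :=
  Fintype.equivFin (idx p).2.2.Carrier

/-- The injection `U → C`. -/
def tl (p : Fin (X.tensor Y).len) : Fin (X.deg (il p)) ↪ Fin ((X.tensor Y).deg p) :=
  ⟨fun x => num p (Quotient.mk _ (Sum.inl x)), fun _ _ h =>
    (idx p).2.2.2.1 _ _ (Quotient.exact ((num p).injective h))⟩

/-- The injection `V → C`. -/
def tr (p : Fin (X.tensor Y).len) : Fin (Y.deg (ir p)) ↪ Fin ((X.tensor Y).deg p) :=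
  ⟨fun x => num p (Quotient.mk _ (Sum.inr x)), fun _ _ h =>
    (idx p).2.2.2.2 _ _ (Quotient.exact ((num p).injective h))⟩

def sigmaPtEquiv (X Y : Shape) (n : ℕ) :
    (Σ q : TIdx X Y, (q.2.2.Carrier ↪ Fin n)) ≃ X.Pt n × Y.Pt n where
  toFun z :=
    (⟨z.1.1, ⟨fun x => z.2 (Quotient.mk _ (Sum.inl x)), fun _ _ h =>
      z.1.2.2.2.1 _ _ (Quotient.exact (z.2.injective h))⟩⟩,
     ⟨z.1.2.1, ⟨fun x => z.2 (Quotient.mk _ (Sum.inr x)), fun _ _ h =>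
      z.1.2.2.2.2 _ _ (Quotient.exact (z.2.injective h))⟩⟩)
  invFun z := ⟨⟨z.1.1, z.2.1, Rec.ind z.1.2 z.2.2⟩, Rec.indEmb z.1.2 z.2.2⟩
  left_inv := by
    rintro ⟨⟨i, j, E⟩, g⟩
    have key : ∀ (E' : Rec (X.deg i) (Y.deg j)) (_ : E' = E) (g' : E'.Carrier ↪ Fin n),
        (∀ x, g' (Quotient.mk _ x) = g (Quotient.mk _ x)) →
        (⟨⟨i, j, E'⟩, g'⟩ : Σ q : TIdx X Y, (q.2.2.Carrier ↪ Fin n)) = ⟨⟨i, j, E⟩, g⟩ := by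
      rintro E' rfl g' h
      congr 1
      ext ⟨x⟩
      exact congrArg Fin.val (h x)
    refine key _ (Subtype.ext (Setoid.ext fun x y => ?_)) _ ?_
    · refine Iff.trans (b := g (Quotient.mk _ x) = g (Quotient.mk _ y)) ?_
        (g.injective.eq_iff.trans Quotient.eq)
      rcases x with x | x <;> rcases y with y | y <;> exact Iff.rfl
    · rintro (x | x) <;> rfl
  right_inv := by
    rintro ⟨⟨i, u⟩, ⟨j, v⟩⟩
    rfl

/-- `Inj(U, {1, …, n}) × Inj(V, {1, …, n})` is the disjoint union of the `Inj(C, {1, …, n})` over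
the recollements `C` of `U` and `V`. -/
def ptEquiv (X Y : Shape) (n : ℕ) : (X.tensor Y).Pt n ≃ X.Pt n × Y.Pt n :=
  (Equiv.sigmaCongr (Fintype.equivFin (TIdx X Y)).symm
    (fun p => Equiv.embeddingCongr (num p).symm (Equiv.refl (Fin n)))).trans (sigmaPtEquiv X Y n)

theorem ptEquiv_apply {n : ℕ} (z : (X.tensor Y).Pt n) :
    ptEquiv X Y n z = (⟨il z.1, (tl z.1).trans z.2⟩, ⟨ir z.1, (tr z.1).trans z.2⟩) := rfl

section coef
variable {R S : Type*} [CommRing R] [CommRing S]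

/-- The tensor product of morphisms: the coefficient of a recollement of `C` and `C'` is the
product of the coefficients of the induced recollements of `U, U'` and of `V, V'`. -/
def Coef.tensor (f : Coef R X X') (g : Coef R Y Y') : Coef R (X.tensor Y) (X'.tensor Y') :=
  fun p q E => f (il p) (il q) (E.restrict (tl p) (tl q)) *
    g (ir p) (ir q) (E.restrict (tr p) (tr q))

def Rec.swap {a b : ℕ} (E : Rec a b) : Rec b a :=
  ⟨E.1.comap Sum.swap, fun x y h => E.2.2 x y h, fun x y h => E.2.1 x y h⟩

theorem Rec.ind_swap {I : Type} {a b : ℕ} (u : Fin a ↪ I) (v : Fin b ↪ I) :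
    (Rec.ind u v).swap = Rec.ind v u :=
  Subtype.ext <| Setoid.ext fun x y => by
    rcases x with x | x <;> rcases y with y | y <;> exact Iff.rfl

/-- The adjoint of a morphism with respect to the standard bilinear forms. -/
def Coef.transpose (f : Coef R X Y) : Coef R Y X := fun j i E => f i j E.swap

/-- The unit object `[∅]`. -/
def Shape.unit : Shape := ⟨1, fun _ => 0⟩

/-- The associativity constraint. -/
def Coef.assoc' (R : Type*) [CommRing R] (X Y Z : Shape) :
    Coef R ((X.tensor Y).tensor Z) (X.tensor (Y.tensor Z)) :=
  Coef.ofProp R fun p q E =>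
    Agree X E.1 (il (il p)) (il q)
      (fun x => Sum.inl (tl p (tl (il p) x))) (fun x => Sum.inr (tl q x)) ∧
    Agree Y E.1 (ir (il p)) (il (ir q))
      (fun x => Sum.inl (tl p (tr (il p) x))) (fun x => Sum.inr (tr q (tl (ir q) x))) ∧
    Agree Z E.1 (ir p) (ir (ir q))
      (fun x => Sum.inl (tr p x)) (fun x => Sum.inr (tr q (tr (ir q) x)))

/-- The left unit constraint. -/
def Coef.lunit (R : Type*) [CommRing R] (X : Shape) : Coef R (Shape.unit.tensor X) X :=
  Coef.ofProp R fun p q E => Agree X E.1 (ir p) q (fun x => Sum.inl (tr p x)) Sum.inr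

/-- The right unit constraint. -/
def Coef.runit (R : Type*) [CommRing R] (X : Shape) : Coef R (X.tensor Shape.unit) X :=
  Coef.ofProp R fun p q E => Agree X E.1 (il p) q (fun x => Sum.inl (tl p x)) Sum.inr

/-- The symmetry. -/
def Coef.braid (R : Type*) [CommRing R] (X Y : Shape) : Coef R (X.tensor Y) (Y.tensor X) :=
  Coef.ofProp R fun p q E =>
    Agree X E.1 (il p) (ir q) (fun x => Sum.inl (tl p x)) (fun x => Sum.inr (tr q x)) ∧
    Agree Y E.1 (ir p) (il q) (fun x => Sum.inl (tr p x)) (fun x => Sum.inr (tl q x))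

theorem Coef.map_tensor (φ : R →+* S) (f : Coef R X X') (g : Coef R Y Y') :
    (Coef.tensor f g).map φ = Coef.tensor (f.map φ) (g.map φ) := by
  ext p q E
  exact map_mul φ _ _

theorem Coef.map_transpose (φ : R →+* S) (f : Coef R X Y) :
    f.transpose.map φ = (f.map φ).transpose := rfl

theorem ev_tensor (n : ℕ) (f : Coef R X X') (g : Coef R Y Y') (z : (X.tensor Y).Pt n)
    (w : (X'.tensor Y').Pt n) :
    ev n (Coef.tensor f g) z w = ev n f (ptEquiv X Y n z).1 (ptEquiv X' Y' n w).1 *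
      ev n g (ptEquiv X Y n z).2 (ptEquiv X' Y' n w).2 := by
  rw [ev_apply, Coef.tensor, Rec.ind_restrict, Rec.ind_restrict]
  rfl

theorem ev_transpose (n : ℕ) (f : Coef R X Y) (z : Y.Pt n) (w : X.Pt n) :
    ev n f.transpose z w = ev n f w z := by
  rw [ev_apply, Coef.transpose, Rec.ind_swap]
  rfl

theorem ev_assoc' (n : ℕ) (z : ((X.tensor Y).tensor Z).Pt n) (w : (X.tensor (Y.tensor Z)).Pt n) :
    ev n (Coef.assoc' R X Y Z) z w =
      if (ptEquiv _ _ n (ptEquiv _ _ n z).1).1 = (ptEquiv _ _ n w).1 ∧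
        (ptEquiv _ _ n (ptEquiv _ _ n z).1).2 = (ptEquiv _ _ n (ptEquiv _ _ n w).2).1 ∧
        (ptEquiv _ _ n z).2 = (ptEquiv _ _ n (ptEquiv _ _ n w).2).2 then 1 else 0 := by
  classical
  rw [Coef.assoc', ev_ofProp]
  refine if_congr (and_congr ?_ (and_congr ?_ ?_)) rfl rfl
  · exact agree_ker (Sum.elim z.2 w.2) ((tl (il z.1)).trans ((tl z.1).trans z.2))
      ((tl w.1).trans w.2) (fun _ => rfl) (fun _ => rfl)
  · exact agree_ker (Sum.elim z.2 w.2) ((tr (il z.1)).trans ((tl z.1).trans z.2))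
      ((tl (ir w.1)).trans ((tr w.1).trans w.2)) (fun _ => rfl) (fun _ => rfl)
  · exact agree_ker (Sum.elim z.2 w.2) ((tr z.1).trans z.2)
      ((tr (ir w.1)).trans ((tr w.1).trans w.2)) (fun _ => rfl) (fun _ => rfl)

theorem ev_lunit (n : ℕ) (z : (Shape.unit.tensor X).Pt n) (w : X.Pt n) :
    ev n (Coef.lunit R X) z w = if (ptEquiv _ _ n z).2 = w then 1 else 0 := by
  classical
  rw [Coef.lunit, ev_ofProp]
  refine if_congr ?_ rfl rfl
  exact agree_ker (Sum.elim z.2 w.2) ((tr z.1).trans z.2)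
      w.2 (fun _ => rfl) (fun _ => rfl)

theorem ev_runit (n : ℕ) (z : (X.tensor Shape.unit).Pt n) (w : X.Pt n) :
    ev n (Coef.runit R X) z w = if (ptEquiv _ _ n z).1 = w then 1 else 0 := by
  classical
  rw [Coef.runit, ev_ofProp]
  refine if_congr ?_ rfl rfl
  exact agree_ker (Sum.elim z.2 w.2) ((tl z.1).trans z.2)
      w.2 (fun _ => rfl) (fun _ => rfl)

theorem ev_braid (n : ℕ) (z : (X.tensor Y).Pt n) (w : (Y.tensor X).Pt n) :
    ev n (Coef.braid R X Y) z w =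
      if (ptEquiv _ _ n z).1 = (ptEquiv _ _ n w).2 ∧ (ptEquiv _ _ n z).2 = (ptEquiv _ _ n w).1
      then 1 else 0 := by
  classical
  rw [Coef.braid, ev_ofProp]
  refine if_congr (and_congr ?_ ?_) rfl rfl
  · exact agree_ker (Sum.elim z.2 w.2) ((tl z.1).trans z.2)
      ((tr w.1).trans w.2) (fun _ => rfl) (fun _ => rfl)
  · exact agree_ker (Sum.elim z.2 w.2) ((tr z.1).trans z.2)
      ((tl w.1).trans w.2) (fun _ => rfl) (fun _ => rfl)

/-- The unique point of the unit object. -/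
instance (n : ℕ) : Unique (Shape.unit.Pt n) where
  default := ⟨(0 : Fin 1), ⟨fun x => Fin.elim0 x, fun x => Fin.elim0 x⟩⟩
  uniq := by
    rintro ⟨i, u⟩
    obtain rfl : i = (0 : Fin 1) := Subsingleton.elim (α := Fin 1) _ _
    congr 1
    exact Function.Embedding.ext fun x => Fin.elim0 x

def assocPt (X Y Z : Shape) (n : ℕ) :
    ((X.tensor Y).tensor Z).Pt n ≃ (X.tensor (Y.tensor Z)).Pt n :=
  (ptEquiv _ _ n).trans <| ((ptEquiv _ _ n).prodCongr (Equiv.refl _)).trans <|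
    (Equiv.prodAssoc _ _ _).trans <|
    ((Equiv.refl _).prodCongr (ptEquiv _ _ n).symm).trans (ptEquiv _ _ n).symm

def lunitPt (X : Shape) (n : ℕ) : (Shape.unit.tensor X).Pt n ≃ X.Pt n :=
  (ptEquiv _ _ n).trans (Equiv.uniqueProd _ _)

def runitPt (X : Shape) (n : ℕ) : (X.tensor Shape.unit).Pt n ≃ X.Pt n :=
  (ptEquiv _ _ n).trans (Equiv.prodUnique _ _)

def braidPt (X Y : Shape) (n : ℕ) : (X.tensor Y).Pt n ≃ (Y.tensor X).Pt n :=
  (ptEquiv _ _ n).trans ((Equiv.prodComm _ _).trans (ptEquiv _ _ n).symm)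

theorem assocPt_1 {n : ℕ} (z : ((X.tensor Y).tensor Z).Pt n) :
    (ptEquiv _ _ n (assocPt X Y Z n z)).1 = (ptEquiv _ _ n (ptEquiv _ _ n z).1).1 := by
  simp [assocPt]

theorem assocPt_2 {n : ℕ} (z : ((X.tensor Y).tensor Z).Pt n) :
    (ptEquiv _ _ n (ptEquiv _ _ n (assocPt X Y Z n z)).2).1 =
      (ptEquiv _ _ n (ptEquiv _ _ n z).1).2 := by
  simp [assocPt]

theorem assocPt_3 {n : ℕ} (z : ((X.tensor Y).tensor Z).Pt n) :
    (ptEquiv _ _ n (ptEquiv _ _ n (assocPt X Y Z n z)).2).2 = (ptEquiv _ _ n z).2 := by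
  simp [assocPt]

theorem braidPt_1 {n : ℕ} (z : (X.tensor Y).Pt n) :
    (ptEquiv _ _ n (braidPt X Y n z)).1 = (ptEquiv _ _ n z).2 := by
  simp [braidPt]

theorem braidPt_2 {n : ℕ} (z : (X.tensor Y).Pt n) :
    (ptEquiv _ _ n (braidPt X Y n z)).2 = (ptEquiv _ _ n z).1 := by
  simp [braidPt]

theorem ptEquiv_ext {n : ℕ} {z w : (X.tensor Y).Pt n} :
    z = w ↔ (ptEquiv _ _ n z).1 = (ptEquiv _ _ n w).1 ∧ (ptEquiv _ _ n z).2 = (ptEquiv _ _ n w).2 := by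
  rw [← Prod.ext_iff, (ptEquiv _ _ n).apply_eq_iff_eq]

/-- The permutation matrix of a bijection. -/
def permMat (R : Type*) [CommRing R] {n : ℕ} (e : X.Pt n ≃ Y.Pt n) :
    Matrix (X.Pt n) (Y.Pt n) R :=
  Matrix.of fun z w => if e z = w then 1 else 0

theorem permMat_mul {n : ℕ} (e : X.Pt n ≃ Y.Pt n) (M : Matrix (Y.Pt n) (Z.Pt n) R)
    (z : X.Pt n) (w : Z.Pt n) : (permMat R e * M) z w = M (e z) w := by
  simp [permMat, Matrix.mul_apply]

theorem mul_permMat {n : ℕ} (e : Y.Pt n ≃ Z.Pt n) (M : Matrix (X.Pt n) (Y.Pt n) R)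
    (z : X.Pt n) (w : Y.Pt n) : (M * permMat R e) z (e w) = M z w := by
  simp [permMat, Matrix.mul_apply]

theorem ev_assoc'_eq (n : ℕ) : ev n (Coef.assoc' R X Y Z) = permMat R (assocPt X Y Z n) := by
  ext z w
  rw [ev_assoc', permMat, Matrix.of_apply]
  refine if_congr ?_ rfl rfl
  rw [ptEquiv_ext, ptEquiv_ext (z := (ptEquiv _ _ n (assocPt X Y Z n z)).2),
    assocPt_1, assocPt_2, assocPt_3]

theorem ev_lunit_eq (n : ℕ) : ev n (Coef.lunit R X) = permMat R (lunitPt X n) := by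
  ext z w
  rw [ev_lunit]
  rfl

theorem ev_runit_eq (n : ℕ) : ev n (Coef.runit R X) = permMat R (runitPt X n) := by
  ext z w
  rw [ev_runit]
  rfl

theorem ev_braid_eq (n : ℕ) : ev n (Coef.braid R X Y) = permMat R (braidPt X Y n) := by
  ext z w
  rw [ev_braid, permMat, Matrix.of_apply]
  refine if_congr ?_ rfl rfl
  rw [ptEquiv_ext, braidPt_1, braidPt_2, and_comm]

/-- An identity between composites of morphisms which are defined over `ℤ[T]` can be checked at
`T = n` for all `n`. -/
theorem Coef.eq_of_ev (t : R) {f g : Coef R X Y} (f' g' : Coef (Gen R) X Y)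
    (hf : f'.map (Gen.spec t) = f) (hg : g'.map (Gen.spec t) = g)
    (h : ∀ n, evn n f' = evn n g') : f = g := by
  rw [← hf, ← hg, evn_faithful h]

theorem evn_tensor (n : ℕ) (f : Coef (Gen R) X X') (g : Coef (Gen R) Y Y')
    (z : (X.tensor Y).Pt n) (w : (X'.tensor Y').Pt n) :
    evn n (Coef.tensor f g) z w = evn n f (ptEquiv X Y n z).1 (ptEquiv X' Y' n w).1 *
      evn n g (ptEquiv X Y n z).2 (ptEquiv X' Y' n w).2 := by
  rw [evn, Coef.map_tensor, ev_tensor]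
  rfl

theorem evn_id (n : ℕ) : evn n (Coef.id (Gen R) X) = 1 := by
  rw [evn, Coef.map_id, ev_id]

theorem evn_assoc' (n : ℕ) : evn n (Coef.assoc' (Gen R) X Y Z) = permMat _ (assocPt X Y Z n) := by
  rw [evn, Coef.assoc', Coef.map_ofProp, ← ev_assoc'_eq]
  rfl

theorem evn_lunit (n : ℕ) : evn n (Coef.lunit (Gen R) X) = permMat _ (lunitPt X n) := by
  rw [evn, Coef.lunit, Coef.map_ofProp, ← ev_lunit_eq]
  rfl

theorem evn_runit (n : ℕ) : evn n (Coef.runit (Gen R) X) = permMat _ (runitPt X n) := by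
  rw [evn, Coef.runit, Coef.map_ofProp, ← ev_runit_eq]
  rfl

theorem evn_braid (n : ℕ) : evn n (Coef.braid (Gen R) X Y) = permMat _ (braidPt X Y n) := by
  rw [evn, Coef.braid, Coef.map_ofProp, ← ev_braid_eq]
  rfl

theorem evn_transpose (n : ℕ) (f : Coef (Gen R) X Y) :
    evn n f.transpose = (evn n f).transpose := by
  ext z w
  rw [evn, Coef.map_transpose, ev_transpose]
  rfl

theorem permMat_mul_transpose {n : ℕ} (e : X.Pt n ≃ Y.Pt n) :
    permMat R e * (permMat R e).transpose = 1 := by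
  ext z w
  rw [permMat_mul, Matrix.transpose_apply, permMat, Matrix.of_apply, Matrix.one_apply]
  exact if_congr (by rw [e.apply_eq_iff_eq, eq_comm]) rfl rfl

theorem transpose_mul_permMat {n : ℕ} (e : X.Pt n ≃ Y.Pt n) :
    (permMat R e).transpose * permMat R e = 1 := by
  ext z w
  obtain ⟨w, rfl⟩ := e.surjective w
  rw [mul_permMat, Matrix.transpose_apply, permMat, Matrix.of_apply, Matrix.one_apply]
  exact if_congr (by rw [eq_comm]) rfl rfl

theorem Coef.ofProp_iso (t : R)
    (P : ∀ (i : Fin X.len) (j : Fin Y.len), Rec (X.deg i) (Y.deg j) → Prop)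
    (e : ∀ n, X.Pt n ≃ Y.Pt n)
    (h : ∀ n, evn n (Coef.ofProp (Gen R) P) = permMat _ (e n)) :
    Coef.comp t (Coef.ofProp R P) (Coef.ofProp R P).transpose = Coef.id R X ∧
      Coef.comp t (Coef.ofProp R P).transpose (Coef.ofProp R P) = Coef.id R Y := by
  rw [← Coef.map_ofProp (Gen.spec t), ← Coef.map_transpose, Coef.comp_spec, Coef.comp_spec]
  constructor
  · refine Coef.eq_of_ev t _ (Coef.id _ _) rfl (Coef.map_id _ _) fun n => ?_
    rw [evn_comp, evn_transpose, h, permMat_mul_transpose, evn_id]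
  · refine Coef.eq_of_ev t _ (Coef.id _ _) rfl (Coef.map_id _ _) fun n => ?_
    rw [evn_comp, evn_transpose, h, transpose_mul_permMat, evn_id]

end coef

/-! ### The symmetric monoidal category -/

/-- The additive envelope of Deligne's category `Rep'(S_t, R)`. -/
def Del (R : Type*) [CommRing R] (_t : R) : Type := Shape

section del
variable {R : Type*} [CommRing R] {t : R}

instance : Category (Del R t) where
  Hom X Y := Coef R X Y
  id X := Coef.id R X
  comp f g := Coef.comp t f g
  id_comp f := Coef.id_comp t f
  comp_id f := Coef.comp_id t f
  assoc f g h := Coef.assoc t f g h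

theorem Coef.add_comp (t : R) (f f' : Coef R X Y) (g : Coef R Y Z) :
    Coef.comp t (f + f') g = Coef.comp t f g + Coef.comp t f' g := by
  ext i k E
  change Coef.comp t (f + f') g i k E = Coef.comp t f g i k E + Coef.comp t f' g i k E
  simp only [Coef.comp, ← Finset.sum_add_distrib]
  refine Finset.sum_congr rfl fun j _ => Finset.sum_congr rfl fun F _ => ?_
  split_ifs
  · change (f i j F.r12 + f' i j F.r12) * _ * _ = _
    ring
  · rw [add_zero]

theorem Coef.comp_add (t : R) (f : Coef R X Y) (g g' : Coef R Y Z) :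
    Coef.comp t f (g + g') = Coef.comp t f g + Coef.comp t f g' := by
  ext i k E
  change Coef.comp t f (g + g') i k E = Coef.comp t f g i k E + Coef.comp t f g' i k E
  simp only [Coef.comp, ← Finset.sum_add_distrib]
  refine Finset.sum_congr rfl fun j _ => Finset.sum_congr rfl fun F _ => ?_
  split_ifs
  · change _ * (g j k F.r23 + g' j k F.r23) * _ = _
    ring
  · rw [add_zero]

theorem Coef.smul_comp (t c : R) (f : Coef R X Y) (g : Coef R Y Z) :
    Coef.comp t (c • f) g = c • Coef.comp t f g := by
  ext i k E
  change Coef.comp t (c • f) g i k E = c * Coef.comp t f g i k E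
  simp only [Coef.comp, Finset.mul_sum]
  refine Finset.sum_congr rfl fun j _ => Finset.sum_congr rfl fun F _ => ?_
  split_ifs
  · change (c * f i j F.r12) * _ * _ = _
    ring
  · rw [mul_zero]

theorem Coef.comp_smul (t c : R) (f : Coef R X Y) (g : Coef R Y Z) :
    Coef.comp t f (c • g) = c • Coef.comp t f g := by
  ext i k E
  change Coef.comp t f (c • g) i k E = c * Coef.comp t f g i k E
  simp only [Coef.comp, Finset.mul_sum]
  refine Finset.sum_congr rfl fun j _ => Finset.sum_congr rfl fun F _ => ?_
  split_ifs
  · change _ * (c * g j k F.r23) * _ = _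
    ring
  · rw [mul_zero]

instance : Preadditive (Del R t) where
  homGroup X Y := Coef.addCommGroup R X Y
  add_comp X Y Z f f' g := Coef.add_comp (X := X) (Y := Y) (Z := Z) t f f' g
  comp_add X Y Z f g g' := Coef.comp_add (X := X) (Y := Y) (Z := Z) t f g g'

instance : Linear R (Del R t) where
  homModule X Y := Coef.module R X Y
  smul_comp X Y Z c f g := Coef.smul_comp (X := X) (Y := Y) (Z := Z) t c f g
  comp_smul X Y Z f c g := Coef.comp_smul (X := X) (Y := Y) (Z := Z) t c f g

/-- The isomorphism given by a linear combination of recollements with coefficients `0` and `1`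
which induces bijections at all `n`; its inverse is the adjoint. -/
def isoOfProp {X Y : Del R t} (P : ∀ (i : Fin (Shape.len X)) (j : Fin (Shape.len Y)),
      Rec (Shape.deg X i) (Shape.deg Y j) → Prop)
    (e : ∀ n, Shape.Pt X n ≃ Shape.Pt Y n)
    (h : ∀ n, evn n (Coef.ofProp (Gen R) P) = permMat _ (e n)) : X ≅ Y where
  hom := Coef.ofProp R P
  inv := (Coef.ofProp R P).transpose
  hom_inv_id := (Coef.ofProp_iso t P e h).1
  inv_hom_id := (Coef.ofProp_iso t P e h).2

instance : MonoidalCategoryStruct (Del R t) where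
  tensorObj X Y := Shape.tensor X Y
  tensorHom f g := Coef.tensor f g
  whiskerLeft X _ _ g := Coef.tensor (Coef.id R X) g
  whiskerRight f Y := Coef.tensor f (Coef.id R Y)
  tensorUnit := Shape.unit
  associator X Y Z := isoOfProp _ (assocPt X Y Z) evn_assoc'
  leftUnitor X := isoOfProp _ (lunitPt X) evn_lunit
  rightUnitor X := isoOfProp _ (runitPt X) evn_runit

theorem Coef.id_tensor_id (t : R) :
    Coef.tensor (Coef.id R X) (Coef.id R Y) = Coef.id R (X.tensor Y) := by
  refine Coef.eq_of_ev t (Coef.tensor (Coef.id _ X) (Coef.id _ Y)) (Coef.id _ _)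
    (by rw [Coef.map_tensor, Coef.map_id, Coef.map_id]) (Coef.map_id _ _) fun n => ?_
  ext1 z w
  simp only [evn_tensor, evn_id, Matrix.one_apply, ptEquiv_ext (z := z), ite_and,
    mul_ite, mul_one, mul_zero]
  split_ifs <;> rfl

theorem Coef.tensor_comp (t : R) {X₁ Y₁ Z₁ X₂ Y₂ Z₂ : Shape} (f₁ : Coef R X₁ Y₁)
    (f₂ : Coef R X₂ Y₂) (g₁ : Coef R Y₁ Z₁) (g₂ : Coef R Y₂ Z₂) :
    Coef.comp t (Coef.tensor f₁ f₂) (Coef.tensor g₁ g₂) =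
      Coef.tensor (Coef.comp t f₁ g₁) (Coef.comp t f₂ g₂) := by
  obtain ⟨f₁, rfl⟩ := f₁.exists_lift t
  obtain ⟨f₂, rfl⟩ := f₂.exists_lift t
  obtain ⟨g₁, rfl⟩ := g₁.exists_lift t
  obtain ⟨g₂, rfl⟩ := g₂.exists_lift t
  simp only [Coef.comp_spec, ← Coef.map_tensor]
  congr 1
  refine evn_faithful fun n => ?_
  ext1 z w
  simp only [evn_tensor, evn_comp, Matrix.mul_apply, Finset.sum_mul_sum]
  rw [← (ptEquiv _ _ n).symm.sum_comp, Fintype.sum_prod_type]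
  refine Finset.sum_congr rfl fun a _ => Finset.sum_congr rfl fun b _ => ?_
  simp only [Equiv.apply_symm_apply]
  ring

theorem Coef.map_assoc' (t : R) :
    (Coef.assoc' (Gen R) X Y Z).map (Gen.spec t) = Coef.assoc' R X Y Z := Coef.map_ofProp _ _

theorem Coef.map_lunit (t : R) :
    (Coef.lunit (Gen R) X).map (Gen.spec t) = Coef.lunit R X := Coef.map_ofProp _ _

theorem Coef.map_runit (t : R) :
    (Coef.runit (Gen R) X).map (Gen.spec t) = Coef.runit R X := Coef.map_ofProp _ _

theorem Coef.map_braid (t : R) :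
    (Coef.braid (Gen R) X Y).map (Gen.spec t) = Coef.braid R X Y := Coef.map_ofProp _ _

theorem Coef.assoc'_naturality (t : R) (f : Coef R X X') (g : Coef R Y Y') (h : Coef R Z Z') :
    Coef.comp t (Coef.tensor (Coef.tensor f g) h) (Coef.assoc' R X' Y' Z') =
      Coef.comp t (Coef.assoc' R X Y Z) (Coef.tensor f (Coef.tensor g h)) := by
  obtain ⟨f, rfl⟩ := f.exists_lift t
  obtain ⟨g, rfl⟩ := g.exists_lift t
  obtain ⟨h, rfl⟩ := h.exists_lift t
  simp only [← Coef.map_assoc' t, ← Coef.map_tensor, Coef.comp_spec]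
  congr 1
  refine evn_faithful fun n => ?_
  ext1 z w
  obtain ⟨w, rfl⟩ := (assocPt X' Y' Z' n).surjective w
  rw [evn_comp, evn_comp, evn_assoc', evn_assoc', mul_permMat, permMat_mul]
  simp only [evn_tensor, assocPt_1, assocPt_2, assocPt_3, mul_assoc]

theorem Coef.lunit_naturality (t : R) (f : Coef R X X') :
    Coef.comp t (Coef.tensor (Coef.id R Shape.unit) f) (Coef.lunit R X') =
      Coef.comp t (Coef.lunit R X) f := by
  obtain ⟨f, rfl⟩ := f.exists_lift t
  simp only [← Coef.map_lunit t, ← Coef.map_id (Gen.spec t), ← Coef.map_tensor, Coef.comp_spec]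
  congr 1
  refine evn_faithful fun n => ?_
  ext1 z w
  obtain ⟨w, rfl⟩ := (lunitPt X' n).surjective w
  rw [evn_comp, evn_comp, evn_lunit, evn_lunit, mul_permMat, permMat_mul, evn_tensor, evn_id,
    Matrix.one_apply, if_pos (Subsingleton.elim _ _), one_mul]
  rfl

theorem Coef.runit_naturality (t : R) (f : Coef R X X') :
    Coef.comp t (Coef.tensor f (Coef.id R Shape.unit)) (Coef.runit R X') =
      Coef.comp t (Coef.runit R X) f := by
  obtain ⟨f, rfl⟩ := f.exists_lift t
  simp only [← Coef.map_runit t, ← Coef.map_id (Gen.spec t), ← Coef.map_tensor, Coef.comp_spec]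
  congr 1
  refine evn_faithful fun n => ?_
  ext1 z w
  obtain ⟨w, rfl⟩ := (runitPt X' n).surjective w
  rw [evn_comp, evn_comp, evn_runit, evn_runit, mul_permMat, permMat_mul, evn_tensor, evn_id,
    Matrix.one_apply, if_pos (Subsingleton.elim _ _), mul_one]
  rfl

theorem permMat_tensor {n : ℕ} (f : Coef (Gen R) X X') (g : Coef (Gen R) Y Y')
    (e : X.Pt n ≃ X'.Pt n) (e' : Y.Pt n ≃ Y'.Pt n)
    (hf : evn n f = permMat _ e) (hg : evn n g = permMat _ e') :
    evn n (Coef.tensor f g) = permMat _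
      ((ptEquiv _ _ n).trans ((e.prodCongr e').trans (ptEquiv _ _ n).symm)) := by
  ext1 z w
  rw [evn_tensor, hf, hg]
  simp only [permMat, Matrix.of_apply, mul_ite, mul_one, mul_zero, ptEquiv_ext (w := w)]
  simp only [Equiv.trans_apply, Equiv.apply_symm_apply, Equiv.prodCongr_apply, Prod.map_fst,
    Prod.map_snd]
  split_ifs <;> simp_all

theorem permMat_id (n : ℕ) : evn n (Coef.id (Gen R) X) = permMat _ (Equiv.refl (X.Pt n)) := by
  rw [evn_id]
  rfl

theorem permMat_comp {n : ℕ} {f : Coef (Gen R) X Y} {g : Coef (Gen R) Y Z}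
    {e : X.Pt n ≃ Y.Pt n} {e' : Y.Pt n ≃ Z.Pt n}
    (hf : evn n f = permMat _ e) (hg : evn n g = permMat _ e') :
    evn n (Coef.comp Polynomial.X f g) = permMat _ (e.trans e') := by
  rw [evn_comp, hf, hg]
  ext1 z w
  rw [permMat_mul]
  rfl

theorem Coef.pentagon (t : R) (W X Y Z : Shape) :
    Coef.comp t (Coef.tensor (Coef.assoc' R W X Y) (Coef.id R Z))
      (Coef.comp t (Coef.assoc' R W (X.tensor Y) Z)
        (Coef.tensor (Coef.id R W) (Coef.assoc' R X Y Z))) =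
      Coef.comp t (Coef.assoc' R (W.tensor X) Y Z) (Coef.assoc' R W X (Y.tensor Z)) := by
  simp only [← Coef.map_assoc' t, ← Coef.map_id (Gen.spec t), ← Coef.map_tensor, Coef.comp_spec]
  congr 1
  refine evn_faithful fun n => ?_
  rw [permMat_comp (permMat_tensor _ _ _ _ (evn_assoc' n) (permMat_id n))
    (permMat_comp (evn_assoc' n) (permMat_tensor _ _ _ _ (permMat_id n) (evn_assoc' n))),
    permMat_comp (evn_assoc' n) (evn_assoc' n)]
  congr 1
  ext1 z
  simp [assocPt]

theorem Coef.triangle (t : R) (X Y : Shape) :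
    Coef.comp t (Coef.assoc' R X Shape.unit Y) (Coef.tensor (Coef.id R X) (Coef.lunit R Y)) =
      Coef.tensor (Coef.runit R X) (Coef.id R Y) := by
  simp only [← Coef.map_assoc' t, ← Coef.map_lunit t, ← Coef.map_runit t,
    ← Coef.map_id (Gen.spec t), ← Coef.map_tensor, Coef.comp_spec]
  congr 1
  refine evn_faithful fun n => ?_
  rw [permMat_comp (evn_assoc' n) (permMat_tensor _ _ _ _ (permMat_id n) (evn_lunit n)),
    permMat_tensor _ _ _ _ (evn_runit n) (permMat_id n)]
  congr 1
  ext1 z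
  simp [assocPt, lunitPt, runitPt]
  rfl

instance : MonoidalCategory (Del R t) :=
  MonoidalCategory.ofTensorHom
    (id_tensorHom := fun _ _ _ _ => rfl)
    (tensorHom_id := fun _ _ => rfl)
    (id_tensorHom_id := fun _ _ => Coef.id_tensor_id t)
    (tensorHom_comp_tensorHom := fun f₁ f₂ g₁ g₂ => Coef.tensor_comp t f₁ f₂ g₁ g₂)
    (associator_naturality := fun f g h => Coef.assoc'_naturality t f g h)
    (leftUnitor_naturality := fun f => Coef.lunit_naturality t f)
    (rightUnitor_naturality := fun f => Coef.runit_naturality t f)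
    (pentagon := fun W X Y Z => Coef.pentagon t W X Y Z)
    (triangle := fun X Y => Coef.triangle t X Y)

theorem Coef.braid_naturality (t : R) (f : Coef R X X') (g : Coef R Y Y') :
    Coef.comp t (Coef.tensor f g) (Coef.braid R X' Y') =
      Coef.comp t (Coef.braid R X Y) (Coef.tensor g f) := by
  obtain ⟨f, rfl⟩ := f.exists_lift t
  obtain ⟨g, rfl⟩ := g.exists_lift t
  simp only [← Coef.map_braid t, ← Coef.map_tensor, Coef.comp_spec]
  congr 1
  refine evn_faithful fun n => ?_
  ext1 z w
  obtain ⟨w, rfl⟩ := (braidPt X' Y' n).surjective w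
  rw [evn_comp, evn_comp, evn_braid, evn_braid, mul_permMat, permMat_mul]
  simp only [evn_tensor, braidPt_1, braidPt_2]
  ring

theorem Coef.hexagon_forward (t : R) (X Y Z : Shape) :
    Coef.comp t (Coef.assoc' R X Y Z) (Coef.comp t (Coef.braid R X (Y.tensor Z))
      (Coef.assoc' R Y Z X)) =
    Coef.comp t (Coef.tensor (Coef.braid R X Y) (Coef.id R Z)) (Coef.comp t (Coef.assoc' R Y X Z)
      (Coef.tensor (Coef.id R Y) (Coef.braid R X Z))) := by
  simp only [← Coef.map_assoc' t, ← Coef.map_braid t, ← Coef.map_id (Gen.spec t),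
    ← Coef.map_tensor, Coef.comp_spec]
  congr 1
  refine evn_faithful fun n => ?_
  rw [permMat_comp (evn_assoc' n) (permMat_comp (evn_braid n) (evn_assoc' n)),
    permMat_comp (permMat_tensor _ _ _ _ (evn_braid n) (permMat_id n)) (permMat_comp (evn_assoc' n)
      (permMat_tensor _ _ _ _ (permMat_id n) (evn_braid n)))]
  congr 1
  ext1 z
  simp [assocPt, braidPt]

theorem Coef.braid_symmetry (t : R) (X Y : Shape) :
    Coef.comp t (Coef.braid R X Y) (Coef.braid R Y X) = Coef.id R (X.tensor Y) := by
  simp only [← Coef.map_braid t, ← Coef.map_id (Gen.spec t), Coef.comp_spec]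
  congr 1
  refine evn_faithful fun n => ?_
  rw [permMat_comp (evn_braid n) (evn_braid n), permMat_id]
  congr 1
  ext1 z
  simp [braidPt]

/-- The braiding of `Del R t`. -/
def braidIso (X Y : Del R t) : X ⊗ Y ≅ Y ⊗ X where
  hom := Coef.braid R X Y
  inv := Coef.braid R Y X
  hom_inv_id := Coef.braid_symmetry t X Y
  inv_hom_id := Coef.braid_symmetry t Y X

instance : BraidedCategory (Del R t) where
  braiding := braidIso
  braiding_naturality_right X _ _ f := Coef.braid_naturality t (Coef.id R X) f
  braiding_naturality_left f Z := Coef.braid_naturality t f (Coef.id R Z)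
  hexagon_forward X Y Z := Coef.hexagon_forward t X Y Z
  hexagon_reverse X Y Z := by
    have h : α_ Z X Y ≪≫ braidIso Z (X ⊗ Y) ≪≫ α_ X Y Z =
        whiskerRightIso (braidIso Z X) Y ≪≫ α_ X Z Y ≪≫ whiskerLeftIso X (braidIso Z Y) :=
      Iso.ext (Coef.hexagon_forward t Z X Y)
    have h' := congrArg Iso.inv h
    simp only [Iso.trans_inv, Category.assoc, whiskerRightIso_inv, whiskerLeftIso_inv] at h'
    exact h'

instance : SymmetricCategory (Del R t) where
  symmetry X Y := Coef.braid_symmetry t X Y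

end del
section bilinear
variable {R : Type*} [CommRing R] {t : R}

theorem Coef.tensor_add (f : Coef R X X') (g g' : Coef R Y Y') :
    Coef.tensor f (g + g') = Coef.tensor f g + Coef.tensor f g' := by
  ext p q E
  exact mul_add _ _ _

theorem Coef.add_tensor (f f' : Coef R X X') (g : Coef R Y Y') :
    Coef.tensor (f + f') g = Coef.tensor f g + Coef.tensor f' g := by
  ext p q E
  exact add_mul _ _ _

theorem Coef.tensor_smul (c : R) (f : Coef R X X') (g : Coef R Y Y') :
    Coef.tensor f (c • g) = c • Coef.tensor f g := by
  ext p q E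
  exact mul_left_comm _ _ _

theorem Coef.smul_tensor (c : R) (f : Coef R X X') (g : Coef R Y Y') :
    Coef.tensor (c • f) g = c • Coef.tensor f g := by
  ext p q E
  exact mul_assoc _ _ _

theorem Coef.tensor_zero (f : Coef R X X') :
    Coef.tensor f (0 : Coef R Y Y') = 0 := by
  ext p q E
  exact mul_zero _

theorem Coef.zero_tensor (g : Coef R Y Y') :
    Coef.tensor (0 : Coef R X X') g = 0 := by
  ext p q E
  exact zero_mul _

instance : MonoidalPreadditive (Del R t) where
  whiskerLeft_zero := Coef.tensor_zero _
  zero_whiskerRight := Coef.zero_tensor _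
  whiskerLeft_add := Coef.tensor_add _
  add_whiskerRight _ _ := Coef.add_tensor _ _ _

instance : MonoidalLinear R (Del R t) where
  whiskerLeft_smul _ _ _ _ _ := Coef.tensor_smul _ _ _
  smul_whiskerRight _ _ _ _ _ := Coef.smul_tensor _ _ _

end bilinear

/-! ### Karoubi envelopes of symmetric monoidal linear categories -/

open Idempotents

section karoubi
universe v₁ u₁
variable {C : Type u₁} [Category.{v₁} C] [MonoidalCategory C]

namespace Kar

theorem α_nat {X₁ Y₁ X₂ Y₂ X₃ Y₃ : C} (f : X₁ ⟶ Y₁) (g : X₂ ⟶ Y₂) (h : X₃ ⟶ Y₃) :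
    (α_ X₁ X₂ X₃).hom ≫ (f ⊗ₘ (g ⊗ₘ h)) = ((f ⊗ₘ g) ⊗ₘ h) ≫ (α_ Y₁ Y₂ Y₃).hom :=
  (associator_naturality f g h).symm

theorem α_nat_assoc {X₁ Y₁ X₂ Y₂ X₃ Y₃ : C} (f : X₁ ⟶ Y₁) (g : X₂ ⟶ Y₂) (h : X₃ ⟶ Y₃) {Z : C}
    (k : Y₁ ⊗ (Y₂ ⊗ Y₃) ⟶ Z) :
    (α_ X₁ X₂ X₃).hom ≫ (f ⊗ₘ (g ⊗ₘ h)) ≫ k = ((f ⊗ₘ g) ⊗ₘ h) ≫ (α_ Y₁ Y₂ Y₃).hom ≫ k := by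
  rw [associator_naturality_assoc]

theorem α_inv_nat {X₁ Y₁ X₂ Y₂ X₃ Y₃ : C} (f : X₁ ⟶ Y₁) (g : X₂ ⟶ Y₂) (h : X₃ ⟶ Y₃) :
    (α_ X₁ X₂ X₃).inv ≫ ((f ⊗ₘ g) ⊗ₘ h) = (f ⊗ₘ (g ⊗ₘ h)) ≫ (α_ Y₁ Y₂ Y₃).inv :=
  (associator_inv_naturality f g h).symm

theorem α_inv_nat_assoc {X₁ Y₁ X₂ Y₂ X₃ Y₃ : C} (f : X₁ ⟶ Y₁) (g : X₂ ⟶ Y₂) (h : X₃ ⟶ Y₃) {Z : C}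
    (k : (Y₁ ⊗ Y₂) ⊗ Y₃ ⟶ Z) :
    (α_ X₁ X₂ X₃).inv ≫ ((f ⊗ₘ g) ⊗ₘ h) ≫ k = (f ⊗ₘ (g ⊗ₘ h)) ≫ (α_ Y₁ Y₂ Y₃).inv ≫ k := by
  rw [associator_inv_naturality_assoc]

theorem lu_nat {X Y : C} (f : X ⟶ Y) :
    (λ_ X).hom ≫ f = (𝟙 (𝟙_ C) ⊗ₘ f) ≫ (λ_ Y).hom := by simp

theorem ru_nat {X Y : C} (f : X ⟶ Y) :
    (ρ_ X).hom ≫ f = (f ⊗ₘ 𝟙 (𝟙_ C)) ≫ (ρ_ Y).hom := by simp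

theorem whiskerRight_nat {X₁ Y₁ X₂ Y₂ X₃ Y₃ : C} (f : X₁ ⟶ X₂) (f' : X₂ ⟶ Y₁) (g : X₁ ⟶ Y₂)
    (g' : Y₂ ⟶ Y₁) (e : f ≫ f' = g ≫ g') (h : X₃ ⟶ Y₃) {Z : C} (k : Y₁ ⊗ Y₃ ⟶ Z) :
    f ▷ X₃ ≫ (f' ⊗ₘ h) ≫ k = (g ⊗ₘ h) ≫ g' ▷ Y₃ ≫ k := by
  rw [← tensorHom_id, ← tensorHom_id, tensorHom_comp_tensorHom_assoc,
    tensorHom_comp_tensorHom_assoc, e, Category.id_comp, Category.comp_id]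

theorem whiskerLeft_nat {X₁ Y₁ X₂ Y₂ X₃ Y₃ : C} (f : X₁ ⟶ X₂) (f' : X₂ ⟶ Y₁) (g : X₁ ⟶ Y₂)
    (g' : Y₂ ⟶ Y₁) (e : f ≫ f' = g ≫ g') (h : X₃ ⟶ Y₃) {Z : C} (k : Y₃ ⊗ Y₁ ⟶ Z) :
    X₃ ◁ f ≫ (h ⊗ₘ f') ≫ k = (h ⊗ₘ g) ≫ Y₃ ◁ g' ≫ k := by
  rw [← id_tensorHom, ← id_tensorHom, tensorHom_comp_tensorHom_assoc,
    tensorHom_comp_tensorHom_assoc, e, Category.id_comp, Category.comp_id]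

theorem tensorHom_comp_left {X₁ Y₁ Z₁ X₂ Y₂ : C} (f : X₁ ⟶ Y₁) (g : Y₁ ⟶ Z₁) (h : X₂ ⟶ Y₂) :
    (f ≫ g) ⊗ₘ h = (f ⊗ₘ h) ≫ g ▷ Y₂ := by
  rw [← tensorHom_id, tensorHom_comp_tensorHom, Category.comp_id]

theorem tensorHom_comp_right {X₁ Y₁ Z₁ X₂ Y₂ : C} (f : X₁ ⟶ Y₁) (g : Y₁ ⟶ Z₁) (h : X₂ ⟶ Y₂) :
    h ⊗ₘ (f ≫ g) = (h ⊗ₘ f) ≫ Y₂ ◁ g := by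
  rw [← id_tensorHom, tensorHom_comp_tensorHom, Category.comp_id]

theorem β_nat [BraidedCategory C] {X₁ Y₁ X₂ Y₂ : C} (f : X₁ ⟶ Y₁) (g : X₂ ⟶ Y₂) :
    (β_ X₁ X₂).hom ≫ (g ⊗ₘ f) = (f ⊗ₘ g) ≫ (β_ Y₁ Y₂).hom :=
  (BraidedCategory.braiding_naturality f g).symm

theorem β_nat_assoc [BraidedCategory C] {X₁ Y₁ X₂ Y₂ : C} (f : X₁ ⟶ Y₁) (g : X₂ ⟶ Y₂)
    {Z : C} (k : Y₂ ⊗ Y₁ ⟶ Z) :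
    (β_ X₁ X₂).hom ≫ (g ⊗ₘ f) ≫ k = (f ⊗ₘ g) ≫ (β_ Y₁ Y₂).hom ≫ k := by
  rw [BraidedCategory.braiding_naturality_assoc]

theorem β_inv_nat [BraidedCategory C] {X₁ Y₁ X₂ Y₂ : C} (f : X₁ ⟶ Y₁) (g : X₂ ⟶ Y₂) :
    (β_ X₁ X₂).inv ≫ (f ⊗ₘ g) = (g ⊗ₘ f) ≫ (β_ Y₁ Y₂).inv := by
  rw [Iso.inv_comp_eq, ← Category.assoc, β_nat, Category.assoc, Iso.hom_inv_id, Category.comp_id]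

end Kar

open Kar

instance : MonoidalCategoryStruct (Karoubi C) where
  tensorObj P Q := ⟨P.X ⊗ Q.X, P.p ⊗ₘ Q.p, by rw [tensorHom_comp_tensorHom, P.idem, Q.idem]⟩
  tensorHom f g := ⟨f.f ⊗ₘ g.f, by
    simp only [tensorHom_comp_tensorHom, Karoubi.p_comp, Karoubi.comp_p]⟩
  whiskerLeft P _ _ g := ⟨P.p ⊗ₘ g.f, by
    simp only [tensorHom_comp_tensorHom, Karoubi.p_comp, Karoubi.comp_p, Karoubi.idem]⟩
  whiskerRight f Q := ⟨f.f ⊗ₘ Q.p, by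
    simp only [tensorHom_comp_tensorHom, Karoubi.p_comp, Karoubi.comp_p, Karoubi.idem]⟩
  tensorUnit := ⟨𝟙_ C, 𝟙 _, Category.comp_id _⟩
  associator P Q T :=
    { hom := ⟨((P.p ⊗ₘ Q.p) ⊗ₘ T.p) ≫ (α_ P.X Q.X T.X).hom, by
        simp only [α_nat, Category.assoc, Karoubi.idem, tensorHom_comp_tensorHom,
          tensorHom_comp_tensorHom_assoc]⟩
      inv := ⟨(P.p ⊗ₘ (Q.p ⊗ₘ T.p)) ≫ (α_ P.X Q.X T.X).inv, by
        simp only [α_inv_nat, Category.assoc, Karoubi.idem, tensorHom_comp_tensorHom,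
          tensorHom_comp_tensorHom_assoc]⟩
      hom_inv_id := by
        ext
        simp only [Karoubi.comp_f, Karoubi.id_f, Category.assoc, α_nat_assoc,
          tensorHom_comp_tensorHom, Karoubi.idem, Iso.hom_inv_id, Category.comp_id]
      inv_hom_id := by
        ext
        simp only [Karoubi.comp_f, Karoubi.id_f, Category.assoc, α_inv_nat_assoc,
          tensorHom_comp_tensorHom, Karoubi.idem, Iso.inv_hom_id, Category.comp_id] }
  leftUnitor P :=
    { hom := ⟨(𝟙 _ ⊗ₘ P.p) ≫ (λ_ P.X).hom, by simp⟩
      inv := ⟨P.p ≫ (λ_ P.X).inv, by simp⟩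
      hom_inv_id := by ext; simp
      inv_hom_id := by ext; simp }
  rightUnitor P :=
    { hom := ⟨(P.p ⊗ₘ 𝟙 _) ≫ (ρ_ P.X).hom, by simp⟩
      inv := ⟨P.p ≫ (ρ_ P.X).inv, by simp⟩
      hom_inv_id := by ext; simp
      inv_hom_id := by ext; simp }

namespace Kar

theorem tensorObj_X (P Q : Karoubi C) : (P ⊗ Q).X = (P.X ⊗ Q.X) := rfl
theorem tensorObj_p (P Q : Karoubi C) : (P ⊗ Q).p = P.p ⊗ₘ Q.p := rfl
theorem tensorUnit_X : (𝟙_ (Karoubi C)).X = 𝟙_ C := rfl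
theorem tensorUnit_p : (𝟙_ (Karoubi C)).p = 𝟙 (𝟙_ C) := rfl
theorem tensorHom_f {P P' Q Q' : Karoubi C} (f : P ⟶ P') (g : Q ⟶ Q') :
    (f ⊗ₘ g).f = f.f ⊗ₘ g.f := rfl
theorem whiskerLeft_f (P : Karoubi C) {Q Q' : Karoubi C} (g : Q ⟶ Q') :
    (P ◁ g).f = P.p ⊗ₘ g.f := rfl
theorem whiskerRight_f {P P' : Karoubi C} (f : P ⟶ P') (Q : Karoubi C) :
    (f ▷ Q).f = f.f ⊗ₘ Q.p := rfl
theorem associator_hom_f (P Q T : Karoubi C) :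
    (α_ P Q T).hom.f = ((P.p ⊗ₘ Q.p) ⊗ₘ T.p) ≫ (α_ P.X Q.X T.X).hom := rfl
theorem associator_inv_f (P Q T : Karoubi C) :
    (α_ P Q T).inv.f = (P.p ⊗ₘ (Q.p ⊗ₘ T.p)) ≫ (α_ P.X Q.X T.X).inv := rfl
theorem leftUnitor_hom_f (P : Karoubi C) :
    (λ_ P).hom.f = (𝟙 (𝟙_ C) ⊗ₘ P.p) ≫ (λ_ P.X).hom := rfl
theorem rightUnitor_hom_f (P : Karoubi C) :
    (ρ_ P).hom.f = (P.p ⊗ₘ 𝟙 (𝟙_ C)) ≫ (ρ_ P.X).hom := rfl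

end Kar

instance : MonoidalCategory (Karoubi C) :=
  MonoidalCategory.ofTensorHom
    (id_tensorHom := fun _ _ _ _ => rfl)
    (tensorHom_id := fun _ _ => rfl)
    (id_tensorHom_id := fun _ _ => rfl)
    (tensorHom_comp_tensorHom := fun f₁ f₂ g₁ g₂ => by
      ext
      simp only [Karoubi.comp_f, tensorHom_f, tensorHom_comp_tensorHom])
    (associator_naturality := fun f g h => by
      ext
      simp only [Karoubi.comp_f, tensorHom_f, associator_hom_f, tensorHom_comp_tensorHom_assoc,
        tensorHom_comp_tensorHom, Karoubi.comp_p, Category.assoc, α_nat, Karoubi.p_comp])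
    (leftUnitor_naturality := fun f => by
      ext
      simp only [Karoubi.comp_f, tensorHom_f, leftUnitor_hom_f, Category.assoc, lu_nat,
        Karoubi.id_f]
      change (𝟙 (𝟙_ C) ⊗ₘ f.f) ≫ (𝟙 (𝟙_ C) ⊗ₘ _) ≫ _ = _
      simp only [tensorHom_comp_tensorHom_assoc, Karoubi.p_comp, Karoubi.comp_p])
    (rightUnitor_naturality := fun f => by
      ext
      simp only [Karoubi.comp_f, tensorHom_f, rightUnitor_hom_f, Category.assoc, ru_nat,
        Karoubi.id_f]
      change (f.f ⊗ₘ 𝟙 (𝟙_ C)) ≫ (_ ⊗ₘ 𝟙 (𝟙_ C)) ≫ _ = _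
      simp only [tensorHom_comp_tensorHom_assoc, Karoubi.p_comp, Karoubi.comp_p])
    (pentagon := fun W X Y Z => by
      ext
      simp only [Karoubi.comp_f, tensorHom_f, associator_hom_f, tensorObj_p, tensorObj_X,
        Karoubi.id_f, tensorHom_comp_left, tensorHom_comp_right, Category.assoc]
      rw [whiskerRight_nat _ _ _ _ (α_nat _ _ _), α_nat_assoc, α_nat_assoc,
        whiskerRight_nat _ _ _ _ (α_nat _ _ _)]
      simp only [tensorHom_comp_tensorHom_assoc, tensorHom_comp_tensorHom, Karoubi.idem]
      rw [MonoidalCategory.pentagon])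
    (triangle := fun X Y => by
      ext
      simp only [Karoubi.comp_f, tensorHom_f, associator_hom_f, leftUnitor_hom_f, tensorUnit_p,
        tensorUnit_X, rightUnitor_hom_f, Karoubi.id_f, tensorHom_comp_left, tensorHom_comp_right,
        Category.assoc]
      rw [α_nat_assoc]
      simp only [tensorHom_comp_tensorHom_assoc, tensorHom_comp_tensorHom, Karoubi.idem]
      rw [Category.comp_id, MonoidalCategory.triangle])

instance [BraidedCategory C] : BraidedCategory (Karoubi C) where
  braiding P Q :=
    { hom := ⟨(P.p ⊗ₘ Q.p) ≫ (β_ P.X Q.X).hom, by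
        simp only [tensorObj_p, β_nat, Category.assoc,
          tensorHom_comp_tensorHom, tensorHom_comp_tensorHom_assoc, Karoubi.idem]⟩
      inv := ⟨(Q.p ⊗ₘ P.p) ≫ (β_ P.X Q.X).inv, by
        simp only [tensorObj_p, β_inv_nat, Category.assoc,
          tensorHom_comp_tensorHom, tensorHom_comp_tensorHom_assoc, Karoubi.idem]⟩
      hom_inv_id := by
        ext
        simp only [Karoubi.comp_f, Karoubi.id_f, tensorObj_p, Category.assoc,
          β_nat_assoc, Iso.hom_inv_id, Category.comp_id, tensorHom_comp_tensorHom_assoc,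
          tensorHom_comp_tensorHom, Karoubi.idem]
      inv_hom_id := by
        ext
        simp only [Karoubi.comp_f, Karoubi.id_f, tensorObj_p, Category.assoc]
        rw [← Category.assoc (β_ P.X Q.X).inv, β_inv_nat, Category.assoc]
        simp only [Iso.inv_hom_id, Category.comp_id, tensorHom_comp_tensorHom_assoc,
          tensorHom_comp_tensorHom, Karoubi.idem] }
  braiding_naturality_right X _ _ f := by
    ext
    simp only [Karoubi.comp_f, whiskerLeft_f, whiskerRight_f, tensorHom_comp_tensorHom_assoc,
      β_nat, Category.assoc, Karoubi.idem, Karoubi.comp_p, Karoubi.p_comp]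
  braiding_naturality_left f Z := by
    ext
    simp only [Karoubi.comp_f, whiskerLeft_f, whiskerRight_f, tensorHom_comp_tensorHom_assoc,
      β_nat, Category.assoc, Karoubi.idem, Karoubi.comp_p, Karoubi.p_comp]
  hexagon_forward X Y Z := by
    ext
    simp only [Karoubi.comp_f, whiskerRight_f, whiskerLeft_f, associator_hom_f, tensorObj_p,
      tensorObj_X, tensorHom_comp_left, tensorHom_comp_right, Category.assoc]
    rw [β_nat_assoc, α_nat_assoc, α_nat_assoc, whiskerRight_nat _ _ _ _ (β_nat _ _),
      α_nat_assoc, whiskerRight_nat _ _ _ _ (β_nat _ _)]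
    simp only [tensorHom_comp_tensorHom_assoc, tensorHom_comp_tensorHom, Karoubi.idem]
    rw [BraidedCategory.hexagon_forward]
  hexagon_reverse X Y Z := by
    ext
    simp only [Karoubi.comp_f, whiskerRight_f, whiskerLeft_f, associator_inv_f, tensorObj_p,
      tensorObj_X, tensorHom_comp_left, tensorHom_comp_right, Category.assoc]
    rw [β_nat_assoc, α_inv_nat_assoc, α_inv_nat_assoc, whiskerLeft_nat _ _ _ _ (β_nat _ _),
      α_inv_nat_assoc, whiskerLeft_nat _ _ _ _ (β_nat _ _)]
    simp only [tensorHom_comp_tensorHom_assoc, tensorHom_comp_tensorHom, Karoubi.idem]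
    rw [BraidedCategory.hexagon_reverse]

theorem Kar.braiding_hom_f [BraidedCategory C] (P Q : Karoubi C) :
    (β_ P Q).hom.f = (P.p ⊗ₘ Q.p) ≫ (β_ P.X Q.X).hom := rfl

instance [SymmetricCategory C] : SymmetricCategory (Karoubi C) where
  symmetry P Q := by
    ext
    simp only [Karoubi.comp_f, braiding_hom_f, Category.assoc, β_nat_assoc, Karoubi.id_f,
      tensorHom_comp_tensorHom, Karoubi.idem, SymmetricCategory.symmetry,
      Category.comp_id, tensorObj_p]

section linear
variable {R : Type*} [CommRing R] [Preadditive C] [Linear R C]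

instance (P Q : Karoubi C) : SMul R (P ⟶ Q) :=
  ⟨fun c f => ⟨c • f.f, by
    rw [Linear.smul_comp, Linear.comp_smul, f.comm]⟩⟩

theorem Kar.smul_f {P Q : Karoubi C} (c : R) (f : P ⟶ Q) : (c • f).f = c • f.f := rfl

instance : Linear R (Karoubi C) where
  homModule P Q := Function.Injective.module R
    (⟨⟨fun f : P ⟶ Q => f.f, rfl⟩, fun _ _ => rfl⟩ : (P ⟶ Q) →+ (P.X ⟶ Q.X))
    (fun _ _ h => Karoubi.hom_ext _ _ h) (fun _ _ => rfl)
  smul_comp _ _ _ c f g := Karoubi.hom_ext _ _ (Linear.smul_comp _ _ _ c f.f g.f)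
  comp_smul _ _ _ f c g := Karoubi.hom_ext _ _ (Linear.comp_smul _ _ _ f.f c g.f)

instance [MonoidalPreadditive C] : MonoidalPreadditive (Karoubi C) where
  whiskerLeft_zero := Karoubi.hom_ext _ _ (MonoidalPreadditive.tensor_zero _)
  zero_whiskerRight := Karoubi.hom_ext _ _ (MonoidalPreadditive.zero_tensor _)
  whiskerLeft_add _ _ := Karoubi.hom_ext _ _ (MonoidalPreadditive.tensor_add _ _ _)
  add_whiskerRight _ _ := Karoubi.hom_ext _ _ (MonoidalPreadditive.add_tensor _ _ _)

instance [MonoidalPreadditive C] [MonoidalLinear R C] : MonoidalLinear R (Karoubi C) where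
  whiskerLeft_smul P _ _ c f := Karoubi.hom_ext _ _ (by
    simp only [whiskerLeft_f, smul_f, MonoidalCategory.tensorHom_def,
      MonoidalLinear.whiskerLeft_smul, Linear.comp_smul])
  smul_whiskerRight c _ _ f P := Karoubi.hom_ext _ _ (by
    simp only [whiskerRight_f, smul_f, MonoidalCategory.tensorHom_def,
      MonoidalLinear.smul_whiskerRight, Linear.smul_comp])

end linear

end karoubi

/-! ### Deligne's category and the objects `Rep(A_t)` -/

/-- Deligne's category `Rep(S_t, R)`: the pseudo-abelian envelope of `Rep'(S_t, R)`. -/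
abbrev RepS (R : Type*) [CommRing R] (t : R) : Type _ := Karoubi (Del R t)

/-- An object `𝔥` with maps `ρ : 𝔥 ⊗ 𝔥 ⟶ 𝔥`, `r : 𝔥 ⟶ 𝔥 ⊗ 𝔥` and `s : 𝔥 ⟶ 𝟙`. -/
structure PermData (C : Type*) [Category* C] [MonoidalCategory C] where
  h : C
  mul : h ⊗ h ⟶ h
  comul : h ⟶ h ⊗ h
  aug : h ⟶ 𝟙_ C

/-- The object `[{1}]`. -/
def Shape.point : Shape := ⟨1, fun _ => 1⟩

/-- The interpolation of `e_i ⊗ e_j ↦ δ_{ij} e_i`. -/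
def Coef.hmul (R : Type*) [CommRing R] :
    Coef R (Shape.point.tensor Shape.point) Shape.point :=
  Coef.ofProp R fun p q E =>
    Agree Shape.point E.1 (il p) q (fun x => Sum.inl (tl p x)) Sum.inr ∧
    Agree Shape.point E.1 (ir p) q (fun x => Sum.inl (tr p x)) Sum.inr

/-- The interpolation of `e_i ↦ 1`. -/
def Coef.haug (R : Type*) [CommRing R] : Coef R Shape.point Shape.unit := fun _ _ _ => 1

theorem ev_hmul {R : Type*} [CommRing R] (n : ℕ) (z : (Shape.point.tensor Shape.point).Pt n)
    (w : Shape.point.Pt n) :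
    ev n (Coef.hmul R) z w =
      if (ptEquiv _ _ n z).1 = w ∧ (ptEquiv _ _ n z).2 = w then 1 else 0 := by
  classical
  rw [Coef.hmul, ev_ofProp]
  refine if_congr (and_congr ?_ ?_) rfl rfl
  · exact agree_ker (Sum.elim z.2 w.2) ((tl z.1).trans z.2) w.2 (fun _ => rfl) (fun _ => rfl)
  · exact agree_ker (Sum.elim z.2 w.2) ((tr z.1).trans z.2) w.2 (fun _ => rfl) (fun _ => rfl)

/-- The object `𝔥 = [{1}]` of `Rep(S_t, R)`, the interpolation of the permutation representation,
with the algebra structure `ρ`, the dual `r` of `ρ`, and the standard map `s`. -/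
def permData (R : Type*) [CommRing R] (t : R) : PermData (RepS R t) where
  h := (toKaroubi (Del R t)).obj Shape.point
  mul := ⟨Coef.hmul R, by
    change Coef.comp t (Coef.tensor (Coef.id R _) (Coef.id R _))
      (Coef.comp t (Coef.hmul R) (Coef.id R _)) = _
    rw [Coef.id_tensor_id t, Coef.comp_id t, Coef.id_comp t]⟩
  comul := ⟨(Coef.hmul R).transpose, by
    change Coef.comp t (Coef.id R _)
      (Coef.comp t (Coef.transpose (Coef.hmul R)) (Coef.tensor (Coef.id R _) (Coef.id R _))) = _
    rw [Coef.id_tensor_id t, Coef.id_comp t, Coef.comp_id t]⟩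
  aug := ⟨Coef.haug R, by
    change 𝟙 _ ≫ _ ≫ 𝟙 _ = _
    rw [Category.id_comp, Category.comp_id]⟩

section wreath
universe v₁ u₁
variable (k R A : Type*) [CommRing k] [CommRing R] [Algebra k R] [Ring A] [Algebra k A]
variable {C : Type u₁} [Category.{v₁} C] [Preadditive C] [Linear R C] [MonoidalCategory C]
  [BraidedCategory C]

/-- The structure of an object of `Rep(A_t)` on an object `V`: a `k`-linear family of maps
`y_a : 𝔥 ⊗ V ⟶ V` for `a ∈ A` with `y_1 = s ⊗ id`, `y_a ∘ (id ⊗ y_b) ∘ (r ⊗ id) = y_{ab}` and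
`y_a ∘ (id ⊗ y_b) - y_b ∘ (id ⊗ y_a) ∘ P₁₂ = y_{[a,b]} ∘ (ρ ⊗ id)`. -/
@[ext]
structure WreathAction (D : PermData C) (V : C) where
  y : A → (D.h ⊗ V ⟶ V)
  y_add : ∀ a b, y (a + b) = y a + y b
  y_smul : ∀ (c : k) (a : A), y (c • a) = algebraMap k R c • y a
  y_one : y 1 = D.aug ▷ V ≫ (λ_ V).hom
  y_mul : ∀ a b, D.comul ▷ V ≫ (α_ D.h D.h V).hom ≫ D.h ◁ y b ≫ y a = y (a * b)
  y_comm : ∀ a b, D.h ◁ y b ≫ y a -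
      ((α_ D.h D.h V).inv ≫ (β_ D.h D.h).hom ▷ V ≫ (α_ D.h D.h V).hom) ≫ D.h ◁ y a ≫ y b =
    (α_ D.h D.h V).inv ≫ D.mul ▷ V ≫ y (a * b - b * a)

/-- An object equipped with maps `y_a` as above. -/
structure WreathRep (D : PermData C) where
  V : C
  act : WreathAction k R A D V

variable {k R A}

section
variable [MonoidalPreadditive C] [MonoidalLinear R C] {D : PermData C}

/-- The morphisms which commute with the `y`-maps. -/
def equivariant {V W : C} (M : WreathAction k R A D V) (N : WreathAction k R A D W) :
    Submodule R (V ⟶ W) where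
  carrier := {f | ∀ a, D.h ◁ f ≫ N.y a = M.y a ≫ f}
  add_mem' {f g} hf hg a := by
    rw [MonoidalPreadditive.whiskerLeft_add, Preadditive.add_comp, hf a, hg a,
      Preadditive.comp_add]
  zero_mem' a := by
    rw [MonoidalPreadditive.whiskerLeft_zero, Limits.zero_comp, Limits.comp_zero]
  smul_mem' c f hf a := by
    rw [MonoidalLinear.whiskerLeft_smul, Linear.smul_comp, hf a, Linear.comp_smul]

theorem equivariant_id {V : C} (M : WreathAction k R A D V) : 𝟙 V ∈ equivariant M M := fun a => by
  rw [MonoidalCategory.whiskerLeft_id, Category.id_comp, Category.comp_id]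

theorem equivariant_comp {U V W : C} {L : WreathAction k R A D U} {M : WreathAction k R A D V}
    {N : WreathAction k R A D W} {f : U ⟶ V} {g : V ⟶ W} (hf : f ∈ equivariant L M)
    (hg : g ∈ equivariant M N) : f ≫ g ∈ equivariant L N := fun a => by
  rw [MonoidalCategory.whiskerLeft_comp, Category.assoc, hg a, ← Category.assoc, hf a,
    Category.assoc]

theorem equivariant_inv {V W : C} {M : WreathAction k R A D V} {N : WreathAction k R A D W}
    (e : V ≅ W) (h : e.hom ∈ equivariant M N) : e.inv ∈ equivariant N M := fun a => by
  rw [← cancel_mono e.hom, Category.assoc, Category.assoc, ← h a, Iso.inv_hom_id,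
    Category.comp_id, ← MonoidalCategory.whiskerLeft_comp_assoc, Iso.inv_hom_id,
    MonoidalCategory.whiskerLeft_id, Category.id_comp]

instance : Category (WreathRep k R A D) where
  Hom M N := equivariant M.act N.act
  id M := ⟨𝟙 M.V, equivariant_id M.act⟩
  comp f g := ⟨f.1 ≫ g.1, equivariant_comp f.2 g.2⟩
  id_comp f := Subtype.ext (Category.id_comp f.1)
  comp_id f := Subtype.ext (Category.comp_id f.1)
  assoc f g h := Subtype.ext (Category.assoc f.1 g.1 h.1)

instance : Preadditive (WreathRep k R A D) where
  homGroup M N := inferInstanceAs (AddCommGroup (equivariant M.act N.act))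
  add_comp _ _ _ f f' g := Subtype.ext (Preadditive.add_comp _ _ _ f.1 f'.1 g.1)
  comp_add _ _ _ f g g' := Subtype.ext (Preadditive.comp_add _ _ _ f.1 g.1 g'.1)

instance : Linear R (WreathRep k R A D) where
  homModule M N := inferInstanceAs (Module R (equivariant M.act N.act))
  smul_comp _ _ _ c f g := Subtype.ext (Linear.smul_comp _ _ _ c f.1 g.1)
  comp_smul _ _ _ f c g := Subtype.ext (Linear.comp_smul _ _ _ f.1 c g.1)

variable (k R A D) in
/-- The forgetful functor. -/
def WreathRep.forget : WreathRep k R A D ⥤ C where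
  obj M := M.V
  map f := f.1

instance : (WreathRep.forget k R A D).Faithful where
  map_injective h := Subtype.ext h

/-- The isomorphism given by an equivariant isomorphism. -/
def WreathRep.mkIso {M N : WreathRep k R A D} (e : M.V ≅ N.V)
    (h : e.hom ∈ equivariant M.act N.act) : M ≅ N where
  hom := ⟨e.hom, h⟩
  inv := ⟨e.inv, equivariant_inv e h⟩
  hom_inv_id := Subtype.ext e.hom_inv_id
  inv_hom_id := Subtype.ext e.inv_hom_id

variable (k R A D) in
/-- A lift of the monoidal structure along the forgetful functor: `y`-maps on the tensor products
of the underlying objects and on the unit object, such that tensor products of morphisms and the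
associativity and unit constraints commute with the `y`-maps. -/
structure MonoidalLift where
  tensor (M N : WreathRep k R A D) : WreathAction k R A D (M.V ⊗ N.V)
  unit : WreathAction k R A D (𝟙_ C)
  tensorHom_mem {M M' N N' : WreathRep k R A D} (f : M ⟶ M') (g : N ⟶ N') :
    (f.1 ⊗ₘ g.1) ∈ equivariant (tensor M N) (tensor M' N')
  associator_mem (L M N : WreathRep k R A D) :
    (α_ L.V M.V N.V).hom ∈
      equivariant (tensor ⟨_, tensor L M⟩ N) (tensor L ⟨_, tensor M N⟩)
  leftUnitor_mem (M : WreathRep k R A D) :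
    (λ_ M.V).hom ∈ equivariant (tensor ⟨_, unit⟩ M) M.act
  rightUnitor_mem (M : WreathRep k R A D) :
    (ρ_ M.V).hom ∈ equivariant (tensor M ⟨_, unit⟩) M.act

namespace MonoidalLift
variable (L : MonoidalLift k R A D)

/-- The tensor product of objects, of morphisms, and the constraints given by a lift. -/
abbrev monoidalStruct : MonoidalCategoryStruct (WreathRep k R A D) where
  tensorObj M N := ⟨M.V ⊗ N.V, L.tensor M N⟩
  tensorUnit := ⟨𝟙_ C, L.unit⟩
  tensorHom f g := ⟨f.1 ⊗ₘ g.1, L.tensorHom_mem f g⟩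
  whiskerLeft M _ _ g := ⟨M.V ◁ g.1, by
    rw [← id_tensorHom]; exact L.tensorHom_mem (𝟙 M) g⟩
  whiskerRight f N := ⟨f.1 ▷ N.V, by
    rw [← tensorHom_id]; exact L.tensorHom_mem f (𝟙 N)⟩
  associator M N P := WreathRep.mkIso (α_ M.V N.V P.V) (L.associator_mem M N P)
  leftUnitor M := WreathRep.mkIso (λ_ M.V) (L.leftUnitor_mem M)
  rightUnitor M := WreathRep.mkIso (ρ_ M.V) (L.rightUnitor_mem M)

/-- The monoidal category given by a lift. -/
abbrev monoidal : MonoidalCategory (WreathRep k R A D) :=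
  letI := L.monoidalStruct
  MonoidalCategory.ofTensorHom
    (id_tensorHom_id := fun _ _ => Subtype.ext (id_tensorHom_id _ _))
    (id_tensorHom := fun _ _ _ _ => Subtype.ext (id_tensorHom _ _))
    (tensorHom_id := fun _ _ => Subtype.ext (tensorHom_id _ _))
    (tensorHom_comp_tensorHom := fun _ _ _ _ => Subtype.ext (tensorHom_comp_tensorHom _ _ _ _))
    (associator_naturality := fun _ _ _ => Subtype.ext (associator_naturality _ _ _))
    (leftUnitor_naturality := fun f => Subtype.ext
      ((congrArg (· ≫ _) (id_tensorHom _ _)).trans (leftUnitor_naturality f.1)))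
    (rightUnitor_naturality := fun f => Subtype.ext
      ((congrArg (· ≫ _) (tensorHom_id _ _)).trans (rightUnitor_naturality f.1)))
    (pentagon := fun W X Y Z => Subtype.ext (by
      change ((α_ W.V X.V Y.V).hom ⊗ₘ 𝟙 Z.V) ≫ (α_ W.V (X.V ⊗ Y.V) Z.V).hom ≫
        (𝟙 W.V ⊗ₘ (α_ X.V Y.V Z.V).hom) = (α_ (W.V ⊗ X.V) Y.V Z.V).hom ≫ (α_ W.V X.V (Y.V ⊗ Z.V)).hom
      rw [id_tensorHom, tensorHom_id, MonoidalCategory.pentagon]))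
    (triangle := fun X Y => Subtype.ext (by
      change (α_ X.V (𝟙_ C) Y.V).hom ≫ (𝟙 X.V ⊗ₘ (λ_ Y.V).hom) = (ρ_ X.V).hom ⊗ₘ 𝟙 Y.V
      rw [id_tensorHom, tensorHom_id, MonoidalCategory.triangle]))

end MonoidalLift

end

end wreath

/-- The action on a tensor product: `e_i ⊗ v ⊗ w ↦ f (e_i ⊗ v) ⊗ g (e_i ⊗ w)`, interpolated. -/
def PermData.tensorY {C : Type*} [Category* C] [MonoidalCategory C] [BraidedCategory C]
    (D : PermData C) {V W : C} (f : D.h ⊗ V ⟶ V) (g : D.h ⊗ W ⟶ W) : D.h ⊗ (V ⊗ W) ⟶ V ⊗ W :=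
  D.comul ▷ (V ⊗ W) ≫ tensorμ D.h D.h V W ≫ (f ⊗ₘ g)


/-! ### Change of the base ring -/

section baseChange
variable {R S : Type*} [CommRing R] [CommRing S]

theorem Coef.map_comp' (φ : R →+* S) {t : R} {t' : S} (h : φ t = t') {X Y Z : Shape}
    (f : Coef R X Y) (g : Coef R Y Z) :
    (Coef.comp t f g).map φ = Coef.comp t' (f.map φ) (g.map φ) := by
  subst h
  exact Coef.map_comp φ t f g

theorem Coef.map_add (φ : R →+* S) {X Y : Shape} (f g : Coef R X Y) :
    (f + g).map φ = f.map φ + g.map φ := by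
  ext i j E
  exact _root_.map_add φ _ _

theorem Coef.map_neg (φ : R →+* S) {X Y : Shape} (f : Coef R X Y) :
    (-f).map φ = -f.map φ := by
  ext i j E
  exact _root_.map_neg φ _

theorem Coef.map_smul (φ : R →+* S) {X Y : Shape} (c : R) (f : Coef R X Y) :
    (c • f).map φ = φ c • f.map φ := by
  ext i j E
  exact map_mul φ _ _

theorem Coef.map_haug (φ : R →+* S) : (Coef.haug R).map φ = Coef.haug S := by
  ext i j E
  exact map_one φ

/-- `y_b`, then `y_a`. -/
def Coef.yy (t : R) {X : Shape} (ya yb : Coef R (Shape.point.tensor X) X) :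
    Coef R (Shape.point.tensor (Shape.point.tensor X)) X :=
  Coef.comp t (Coef.tensor (Coef.id R _) yb) ya

theorem Coef.map_yy (φ : R →+* S) {t : R} {t' : S} (h : φ t = t') {X : Shape}
    (ya yb : Coef R (Shape.point.tensor X) X) :
    (Coef.yy t ya yb).map φ = Coef.yy t' (ya.map φ) (yb.map φ) := by
  simp only [Coef.yy, Coef.map_comp' φ h, Coef.map_tensor, Coef.map_id]

theorem Coef.map_one_aux (φ : R →+* S) {t : R} {t' : S} (h : φ t = t') {X : Shape}
    (p : Coef R X X) :
    Coef.map φ (Coef.comp t (Coef.tensor (Coef.haug R) p)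
      (Coef.comp t (Coef.tensor (Coef.id R _) p) (Coef.lunit R X))) =
    Coef.comp t' (Coef.tensor (Coef.haug S) (p.map φ))
      (Coef.comp t' (Coef.tensor (Coef.id S _) (p.map φ)) (Coef.lunit S X)) := by
  simp only [Coef.map_comp' φ h, Coef.map_tensor, Coef.map_id, Coef.map_haug, Coef.lunit,
    Coef.map_ofProp]

theorem Coef.map_mul_aux (φ : R →+* S) {t : R} {t' : S} (h : φ t = t') {X : Shape}
    (p : Coef R X X) (ya yb : Coef R (Shape.point.tensor X) X) :
    Coef.map φ (Coef.comp t (Coef.tensor (Coef.hmul R).transpose p)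
      (Coef.comp t (Coef.comp t (Coef.tensor (Coef.tensor (Coef.id R _) (Coef.id R _)) p)
        (Coef.assoc' R _ _ X)) (Coef.yy t ya yb))) =
    Coef.comp t' (Coef.tensor (Coef.hmul S).transpose (p.map φ))
      (Coef.comp t' (Coef.comp t' (Coef.tensor (Coef.tensor (Coef.id S _) (Coef.id S _))
        (p.map φ)) (Coef.assoc' S _ _ X)) (Coef.yy t' (ya.map φ) (yb.map φ))) := by
  simp only [Coef.map_comp' φ h, Coef.map_tensor, Coef.map_id, Coef.map_transpose,
      Coef.hmul, Coef.assoc', Coef.map_ofProp, Coef.map_yy φ h]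

/-- The inverse associativity constraint for `𝔥`, `𝔥` and the image of `p`. -/
def Coef.ainv (t : R) {X : Shape} (p : Coef R X X) :
    Coef R (Shape.point.tensor (Shape.point.tensor X))
      ((Shape.point.tensor Shape.point).tensor X) :=
  Coef.comp t (Coef.tensor (Coef.id R _) (Coef.tensor (Coef.id R _) p))
    (Coef.assoc' R _ _ X).transpose

theorem Coef.map_ainv (φ : R →+* S) {t : R} {t' : S} (h : φ t = t') {X : Shape}
    (p : Coef R X X) : (Coef.ainv t p).map φ = Coef.ainv t' (p.map φ) := by
  simp only [Coef.ainv, Coef.map_comp' φ h, Coef.map_tensor, Coef.map_id, Coef.map_transpose,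
    Coef.assoc', Coef.map_ofProp]

/-- The transposition of the two factors `𝔥` in `𝔥 ⊗ 𝔥 ⊗ V`, for `V` the image of `p`. -/
def Coef.p12 (t : R) {X : Shape} (p : Coef R X X) :
    Coef R (Shape.point.tensor (Shape.point.tensor X))
      (Shape.point.tensor (Shape.point.tensor X)) :=
  Coef.comp t (Coef.ainv t p)
    (Coef.comp t (Coef.tensor (Coef.comp t (Coef.tensor (Coef.id R _) (Coef.id R _))
        (Coef.braid R _ _)) p)
      (Coef.comp t (Coef.tensor (Coef.tensor (Coef.id R _) (Coef.id R _)) p)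
        (Coef.assoc' R _ _ X)))

theorem Coef.map_p12 (φ : R →+* S) {t : R} {t' : S} (h : φ t = t') {X : Shape}
    (p : Coef R X X) : (Coef.p12 t p).map φ = Coef.p12 t' (p.map φ) := by
  simp only [Coef.p12, Coef.map_comp' φ h, Coef.map_tensor, Coef.map_id, Coef.braid,
      Coef.assoc', Coef.map_ofProp, Coef.map_ainv φ h]

/-- `y_a ∘ (id ⊗ y_b) - y_b ∘ (id ⊗ y_a) ∘ P₁₂`. -/
def Coef.comm (t : R) {X : Shape} (p : Coef R X X) (ya yb : Coef R (Shape.point.tensor X) X) :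
    Coef R (Shape.point.tensor (Shape.point.tensor X)) X :=
  Coef.yy t ya yb + -Coef.comp t (Coef.p12 t p) (Coef.yy t yb ya)

theorem Coef.map_comm_aux (φ : R →+* S) {t : R} {t' : S} (h : φ t = t') {X : Shape}
    (p : Coef R X X) (ya yb : Coef R (Shape.point.tensor X) X) :
    (Coef.comm t p ya yb).map φ = Coef.comm t' (p.map φ) (ya.map φ) (yb.map φ) := by
  rw [Coef.comm, Coef.comm, Coef.map_add, Coef.map_neg, Coef.map_comp' φ h, Coef.map_yy φ h, Coef.map_yy φ h,
    Coef.map_p12 φ h]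

theorem Coef.add_neg_congr {X Y : Shape} {a b c d : Coef R X Y} (h : a = b) (h' : c = d) :
    a + -c = b + -d := by
  rw [h, h']

theorem RepS.p12_f {t : R} (V : RepS R t) :
    ((α_ (permData R t).h (permData R t).h V).inv ≫ (β_ (permData R t).h (permData R t).h).hom ▷ V ≫
      (α_ (permData R t).h (permData R t).h V).hom).f = Coef.p12 t V.p := rfl

theorem RepS.comm_f {t : R} (V : RepS R t) (ya yb : (permData R t).h ⊗ V ⟶ V) :
    ((permData R t).h ◁ yb ≫ ya -
      ((α_ (permData R t).h (permData R t).h V).inv ≫ (β_ (permData R t).h (permData R t).h).hom ▷ V ≫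
        (α_ (permData R t).h (permData R t).h V).hom) ≫ (permData R t).h ◁ ya ≫ yb).f =
    Coef.comm t V.p ya.f yb.f := by
  rw [sub_eq_add_neg]
  refine Coef.add_neg_congr (R := R) rfl ?_
  exact congrArg₂ (Coef.comp t) (RepS.p12_f V) rfl

theorem Coef.map_comm_aux' (φ : R →+* S) {t : R} {t' : S} (h : φ t = t') {X : Shape}
    (p : Coef R X X) (y : Coef R (Shape.point.tensor X) X) :
    Coef.map φ (Coef.comp t (Coef.ainv t p) (Coef.comp t (Coef.tensor (Coef.hmul R) p) y)) =
    Coef.comp t' (Coef.ainv t' (p.map φ))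
      (Coef.comp t' (Coef.tensor (Coef.hmul S) (p.map φ)) (y.map φ)) := by
  simp only [Coef.map_comp' φ h, Coef.map_tensor, Coef.hmul, Coef.map_ofProp, Coef.map_ainv φ h]

/-- Extension of scalars, applied to the coefficients of idempotents and morphisms. -/
def RepS.map (φ : R →+* S) {t : R} {t' : S} (h : φ t = t') : RepS R t ⥤ RepS S t' where
  obj P := ⟨P.X, Coef.map φ P.p,
    (Coef.map_comp' φ h P.p P.p).symm.trans (congrArg (Coef.map φ) P.idem)⟩
  map {_ Q} f := ⟨Coef.map φ f.f,
    ((congrArg (Coef.comp t' _) (Coef.map_comp' φ h f.f Q.p).symm).trans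
      (Coef.map_comp' φ h _ _).symm).trans (congrArg (Coef.map φ) f.comm)⟩
  map_id P := rfl
  map_comp f g := Karoubi.hom_ext _ _ (Coef.map_comp' φ h f.f g.f)

variable {k A : Type*} [CommRing k] [Algebra k R] [Algebra k S] [Ring A] [Algebra k A]

/-- Extension of scalars for the `y`-maps. -/
def WreathAction.map (φ : R →ₐ[k] S) {t : R} {t' : S} (h : φ t = t') {V : RepS R t}
    (M : WreathAction k R A (permData R t) V) :
    WreathAction k S A (permData S t') ((RepS.map (φ : R →+* S) h).obj V) where
  y a := ⟨Coef.map φ (M.y a).f, by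
    have := congrArg (Coef.map (φ : R →+* S)) (M.y a).comm
    refine Eq.trans ?_ this
    refine Eq.symm ((Coef.map_comp' (φ : R →+* S) h _ _).trans ?_)
    refine congrArg₂ (Coef.comp t') ?_ (Coef.map_comp' (φ : R →+* S) h _ _)
    refine (Coef.map_tensor (φ : R →+* S) _ _).trans ?_
    exact congrArg₂ Coef.tensor (Coef.map_id _ _) rfl⟩
  y_add a b := Karoubi.hom_ext _ _ ((congrArg (fun g => Coef.map (φ : R →+* S) g.f)
    (M.y_add a b)).trans (Coef.map_add (φ : R →+* S) (M.y a).f (M.y b).f))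
  y_smul c a := Karoubi.hom_ext _ _ ((congrArg (fun g => Coef.map (φ : R →+* S) g.f)
    (M.y_smul c a)).trans ((Coef.map_smul (φ : R →+* S) (algebraMap k R c) (M.y a).f).trans
      (Coef.ext fun i j E => congrArg (· * Coef.map (φ : R →+* S) (M.y a).f i j E)
        (φ.commutes c))))
  y_one := Karoubi.hom_ext _ _ ((congrArg (fun g => Coef.map (φ : R →+* S) g.f) M.y_one).trans
    (Coef.map_one_aux (φ : R →+* S) h V.p))
  y_mul a b := Karoubi.hom_ext _ _ ((Coef.map_mul_aux (φ : R →+* S) h V.p (M.y a).f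
    (M.y b).f).symm.trans (congrArg (fun g => Coef.map (φ : R →+* S) g.f) (M.y_mul a b)))
  y_comm a b := Karoubi.hom_ext _ _ (by
    refine (RepS.comm_f (R := S) (t := t') _ _ _).trans ((Coef.map_comm_aux (φ : R →+* S) h V.p (M.y a).f
      (M.y b).f).symm.trans ?_)
    refine (congrArg (Coef.map (φ : R →+* S)) ((RepS.comm_f V _ _).symm.trans
      (congrArg Karoubi.Hom.f (M.y_comm a b)))).trans ?_
    exact Coef.map_comm_aux' (φ : R →+* S) h V.p (M.y (a * b - b * a)).f)

/-- Extension of scalars `Rep(A_t; R) ⥤ Rep(A_{t'}; S)`. -/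
def baseChange (φ : R →ₐ[k] S) {t : R} {t' : S} (h : φ t = t') :
    WreathRep k R A (permData R t) ⥤ WreathRep k S A (permData S t') where
  obj M := ⟨(RepS.map (φ : R →+* S) h).obj M.V, M.act.map φ h⟩
  map {M N} f := ⟨(RepS.map (φ : R →+* S) h).map f.1, fun a => Karoubi.hom_ext _ _ (by
    have := congrArg (fun g => Coef.map (φ : R →+* S) g.f) (f.2 a)
    refine Eq.trans ?_ (this.trans (Coef.map_comp' (φ : R →+* S) h _ _))
    refine Eq.symm ((Coef.map_comp' (φ : R →+* S) h _ _).trans ?_)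
    refine congrArg (fun z => Coef.comp t' z _) ?_
    refine (Coef.map_tensor (φ : R →+* S) _ _).trans ?_
    exact congrArg₂ Coef.tensor (Coef.map_id _ _) rfl)⟩
  map_id M := rfl
  map_comp f g := Subtype.ext ((RepS.map (φ : R →+* S) h).map_comp f.1 g.1)

end baseChange

/-! ### Modules over `S_n ⋉ A^{⊗ n}` and their tensor product -/

section wreathMod
universe u
variable (k A : Type u) [CommRing k] [Ring A] [Algebra k A] (n : ℕ)

/-- A module over `S_n ⋉ A^{⊗ n}`: a representation `V` of `S_n` with actions `y i` of `A` (through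
the `i`-th tensor factor), such that the actions for different `i` commute and
`σ (y i a) σ⁻¹ = y (σ i) a`. -/
structure WreathMod where
  V : ModuleCat.{u} k
  perm : Equiv.Perm (Fin n) →* Module.End k V
  y : Fin n → A →ₐ[k] Module.End k V
  y_comm : ∀ i j, i ≠ j → ∀ a b, Commute (y i a) (y j b)
  perm_y : ∀ (σ : Equiv.Perm (Fin n)) i a, perm σ * y i a = y (σ i) a * perm σ

variable {k A n}

namespace WreathMod

/-- The linear maps which commute with the actions of `S_n` and of `A`. -/
def IsHom (M N : WreathMod k A n) (f : M.V ⟶ N.V) : Prop :=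
  (∀ σ v, f.hom (M.perm σ v) = N.perm σ (f.hom v)) ∧ ∀ i a v, f.hom (M.y i a v) = N.y i a (f.hom v)

instance : Category (WreathMod k A n) where
  Hom M N := {f : M.V ⟶ N.V // IsHom M N f}
  id M := ⟨𝟙 _, fun _ _ => rfl, fun _ _ _ => rfl⟩
  comp {L M N} f g := ⟨f.1 ≫ g.1,
    fun σ v => (congrArg g.1.hom (f.2.1 σ v)).trans (g.2.1 σ _),
    fun i a v => (congrArg g.1.hom (f.2.2 i a v)).trans (g.2.2 i a _)⟩

variable (k A n) in
/-- The underlying vector space. -/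
def forget : WreathMod k A n ⥤ ModuleCat.{u} k where
  obj M := M.V
  map f := f.1

def mkIso {M N : WreathMod k A n} (e : M.V ≅ N.V) (h : IsHom M N e.hom) : M ≅ N where
  hom := ⟨e.hom, h⟩
  inv := ⟨e.inv, fun σ v => by
      have := h.1 σ (e.inv.hom v)
      rw [← ModuleCat.comp_apply e.inv, e.inv_hom_id, ModuleCat.id_apply] at this
      rw [← this, ← ModuleCat.comp_apply e.hom, e.hom_inv_id, ModuleCat.id_apply],
    fun i a v => by
      have := h.2 i a (e.inv.hom v)
      rw [← ModuleCat.comp_apply e.inv, e.inv_hom_id, ModuleCat.id_apply] at this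
      rw [← this, ← ModuleCat.comp_apply e.hom, e.hom_inv_id, ModuleCat.id_apply]⟩
  hom_inv_id := Subtype.ext e.hom_inv_id
  inv_hom_id := Subtype.ext e.inv_hom_id

end WreathMod

open TensorProduct

/-- The action of `A ⊗ B` on `V ⊗ W`. -/
def tens {B : Type u} [Ring B] [Algebra k B] {V W : Type u} [AddCommGroup V] [Module k V]
    [AddCommGroup W] [Module k W] (f : A →ₐ[k] Module.End k V) (g : B →ₐ[k] Module.End k W) :
    A ⊗[k] B →ₐ[k] Module.End k (V ⊗[k] W) :=
  Module.endTensorEndAlgHom.comp (Algebra.TensorProduct.map f g)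

theorem tens_tmul {B : Type u} [Ring B] [Algebra k B] {V W : Type u} [AddCommGroup V] [Module k V]
    [AddCommGroup W] [Module k W] (f : A →ₐ[k] Module.End k V) (g : B →ₐ[k] Module.End k W)
    (a : A) (b : B) : tens f g (a ⊗ₜ b) = TensorProduct.map (f a) (g b) := rfl

section bialg
variable {A : Type u} [Ring A] [Bialgebra k A]
variable {V W U V' W' : Type u} [AddCommGroup V] [Module k V] [AddCommGroup W] [Module k W]
  [AddCommGroup U] [Module k U] [AddCommGroup V'] [Module k V'] [AddCommGroup W'] [Module k W']
  (f : A →ₐ[k] Module.End k V) (g : A →ₐ[k] Module.End k W) (h : A →ₐ[k] Module.End k U)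

/-- The action of a bialgebra on a tensor product, through the comultiplication. -/
def tensY : A →ₐ[k] Module.End k (V ⊗[k] W) := (tens f g).comp (Bialgebra.comulAlgHom k A)

theorem tensY_apply (a : A) : tensY f g a = tens f g (Coalgebra.comul (R := k) a) := rfl

theorem tensY_hom {f' : A →ₐ[k] Module.End k V'} {g' : A →ₐ[k] Module.End k W'}
    {φ : V →ₗ[k] V'} {ψ : W →ₗ[k] W'} (hf : ∀ a v, φ (f a v) = f' a (φ v))
    (hg : ∀ a v, ψ (g a v) = g' a (ψ v)) (a : A) (x : V ⊗[k] W) :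
    TensorProduct.map φ ψ (tensY f g a x) = tensY f' g' a (TensorProduct.map φ ψ x) := by
  rw [tensY_apply, tensY_apply]
  generalize (Coalgebra.comul (R := k) a) = u
  induction u with
  | zero => simp
  | add u v hu hv => simp only [_root_.map_add, LinearMap.add_apply, hu, hv]
  | tmul a b =>
    rw [tens_tmul, tens_tmul]
    induction x with
    | zero => simp
    | add x y hx hy => simp only [_root_.map_add, hx, hy]
    | tmul v w => simp only [TensorProduct.map_tmul, hf, hg]

theorem tens_tensY (u : A ⊗[k] A) :
    tens (tensY f g) h u = tens (tens f g) h (Coalgebra.comul.rTensor A u) := by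
  induction u with
  | zero => simp
  | add u v hu hv => simp only [_root_.map_add, hu, hv]
  | tmul a b => rfl

theorem tens_tensY' (u : A ⊗[k] A) :
    tens f (tensY g h) u = tens f (tens g h) (Coalgebra.comul.lTensor A u) := by
  induction u with
  | zero => simp
  | add u v hu hv => simp only [_root_.map_add, hu, hv]
  | tmul a b => rfl

theorem tens_assoc (u : (A ⊗[k] A) ⊗[k] A) (x : (V ⊗[k] W) ⊗[k] U) :
    TensorProduct.assoc k V W U (tens (tens f g) h u x) =
      tens f (tens g h) (TensorProduct.assoc k A A A u) (TensorProduct.assoc k V W U x) := by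
  induction x with
  | zero => simp
  | add x y hx hy => simp only [_root_.map_add, hx, hy]
  | tmul x w =>
    induction x with
    | zero => simp
    | add x y hx hy => simp only [_root_.map_add, TensorProduct.add_tmul, hx, hy]
    | tmul v v' =>
      induction u with
      | zero => simp
      | add u u' hu hv => simp only [_root_.map_add, LinearMap.add_apply, hu, hv]
      | tmul u c =>
        induction u with
        | zero => simp
        | add u u' hu hv =>
          simp only [_root_.map_add, TensorProduct.add_tmul, LinearMap.add_apply, hu, hv]
        | tmul a b => rfl

theorem tensY_assoc (a : A) (x : (V ⊗[k] W) ⊗[k] U) :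
    TensorProduct.assoc k V W U (tensY (tensY f g) h a x) =
      tensY f (tensY g h) a (TensorProduct.assoc k V W U x) := by
  rw [tensY_apply, tensY_apply, tens_tensY, tens_tensY', tens_assoc, Coalgebra.coassoc_apply]

/-- The trivial action, through the counit. -/
def unitY (k A : Type u) [CommRing k] [Ring A] [Bialgebra k A] : A →ₐ[k] Module.End k k :=
  (Algebra.ofId k (Module.End k k)).comp (Bialgebra.counitAlgHom k A)

theorem tensY_lid (a : A) (x : k ⊗[k] V) :
    TensorProduct.lid k V (tensY (unitY k A) f a x) = f a (TensorProduct.lid k V x) := by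
  have h1 : ∀ u : A ⊗[k] A, TensorProduct.lid k V (tens (unitY k A) f u x) =
      f (TensorProduct.lid k A (Coalgebra.counit.rTensor A u)) (TensorProduct.lid k V x) := by
    intro u
    induction u with
    | zero => simp
    | add u v hu hv => simp only [_root_.map_add, LinearMap.add_apply, hu, hv]
    | tmul a b =>
      rw [tens_tmul]
      induction x with
      | zero => simp
      | add x y hx hy => simp only [_root_.map_add, hx, hy]
      | tmul c v =>
        simp [unitY, Algebra.ofId_apply, mul_smul]
        rw [smul_comm]
  rw [tensY_apply, h1, Coalgebra.rTensor_counit_comul, TensorProduct.lid_tmul, one_smul]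

theorem tensY_rid (a : A) (x : V ⊗[k] k) :
    TensorProduct.rid k V (tensY f (unitY k A) a x) = f a (TensorProduct.rid k V x) := by
  have h1 : ∀ u : A ⊗[k] A, TensorProduct.rid k V (tens f (unitY k A) u x) =
      f (TensorProduct.rid k A (Coalgebra.counit.lTensor A u)) (TensorProduct.rid k V x) := by
    intro u
    induction u with
    | zero => simp
    | add u v hu hv => simp only [_root_.map_add, LinearMap.add_apply, hu, hv]
    | tmul a b =>
      rw [tens_tmul]
      induction x with
      | zero => simp
      | add x y hx hy => simp only [_root_.map_add, hx, hy]
      | tmul v c =>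
        simp [unitY, Algebra.ofId_apply, mul_smul]
        rw [smul_comm]
  rw [tensY_apply, h1, Coalgebra.lTensor_counit_comul, TensorProduct.rid_tmul, one_smul]

theorem commute_map {p p' : Module.End k V} {q q' : Module.End k W} (h : Commute p p')
    (h' : Commute q q') : Commute (TensorProduct.map p q) (TensorProduct.map p' q') := by
  change TensorProduct.map p q ∘ₗ TensorProduct.map p' q' =
    TensorProduct.map p' q' ∘ₗ TensorProduct.map p q
  rw [← TensorProduct.map_comp, ← TensorProduct.map_comp]
  exact congrArg₂ TensorProduct.map h h'

theorem tensY_commute {f' : A →ₐ[k] Module.End k V} {g' : A →ₐ[k] Module.End k W}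
    (hf : ∀ a b, Commute (f a) (f' b)) (hg : ∀ a b, Commute (g a) (g' b)) (a b : A) :
    Commute (tensY f g a) (tensY f' g' b) := by
  rw [tensY_apply, tensY_apply]
  generalize (Coalgebra.comul (R := k) a) = u
  generalize (Coalgebra.comul (R := k) b) = v
  induction u with
  | zero => rw [_root_.map_zero]; exact Commute.zero_left _
  | add u u' hu hu' => rw [_root_.map_add]; exact hu.add_left hu'
  | tmul a b =>
    induction v with
    | zero => rw [_root_.map_zero]; exact Commute.zero_right _
    | add u u' hu hu' => rw [_root_.map_add]; exact hu.add_right hu'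
    | tmul c d => exact commute_map (hf a c) (hg b d)

variable {n : ℕ}

namespace WreathMod

/-- The tensor product of modules, for the Hopf algebra structure of `S_n ⋉ A^{⊗ n}` in which the
elements of `S_n` are grouplike and the tensor factors are copies of the bialgebra `A`. -/
def tensorObj (M N : WreathMod k A n) : WreathMod k A n where
  V := M.V ⊗ N.V
  perm :=
    { toFun := fun σ => TensorProduct.map (M.perm σ) (N.perm σ)
      map_one' := by rw [map_one, map_one]; exact TensorProduct.map_id
      map_mul' := fun σ τ => by rw [map_mul, map_mul]; exact TensorProduct.map_mul _ _ _ _ }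
  y i := tensY (M.y i) (N.y i)
  y_comm i j hij := tensY_commute _ _ (M.y_comm i j hij) (N.y_comm i j hij)
  perm_y σ i a := LinearMap.ext fun x => tensY_hom (M.y i) (N.y i)
    (fun a v => LinearMap.congr_fun (M.perm_y σ i a) v)
    (fun a v => LinearMap.congr_fun (N.perm_y σ i a) v) a x

/-- The unit module. -/
def tensorUnit : WreathMod k A n where
  V := 𝟙_ (ModuleCat.{u} k)
  perm := 1
  y _ := unitY k A
  y_comm _ _ _ _ _ := by
    change Commute (algebraMap k (Module.End k k) _) _
    exact Algebra.commutes _ _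
  perm_y _ _ _ := (one_mul _).trans (mul_one _).symm

theorem isHom_tensor {M M' N N' : WreathMod k A n} (f : M ⟶ M') (g : N ⟶ N') :
    IsHom (tensorObj M N) (tensorObj M' N') (f.1 ⊗ₘ g.1) :=
  ⟨fun σ v => LinearMap.congr_fun
    (f := (f.1 ⊗ₘ g.1).hom ∘ₗ TensorProduct.map (M.perm σ) (N.perm σ))
    (g := TensorProduct.map (M'.perm σ) (N'.perm σ) ∘ₗ (f.1 ⊗ₘ g.1).hom)
    (TensorProduct.ext' fun v w => congrArg₂ (· ⊗ₜ[k] ·) (f.2.1 σ v) (g.2.1 σ w)) v,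
   fun i a v => tensY_hom (M.y i) (N.y i) (f.2.2 i) (g.2.2 i) a v⟩

instance : MonoidalCategoryStruct (WreathMod k A n) where
  tensorObj := tensorObj
  tensorUnit := tensorUnit
  tensorHom f g := ⟨f.1 ⊗ₘ g.1, isHom_tensor f g⟩
  whiskerLeft M _ _ g := ⟨M.V ◁ g.1, isHom_tensor (𝟙 M) g⟩
  whiskerRight f N := ⟨f.1 ▷ N.V, isHom_tensor f (𝟙 N)⟩
  associator L M N := mkIso (α_ L.V M.V N.V)
    ⟨fun σ v => LinearMap.congr_fun
      (f := (α_ L.V M.V N.V).hom.hom ∘ₗ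
        TensorProduct.map (TensorProduct.map (L.perm σ) (M.perm σ)) (N.perm σ))
      (g := TensorProduct.map (L.perm σ) (TensorProduct.map (M.perm σ) (N.perm σ)) ∘ₗ
        (α_ L.V M.V N.V).hom.hom)
      (TensorProduct.ext_threefold fun _ _ _ => rfl) v,
     fun i a v => tensY_assoc (L.y i) (M.y i) (N.y i) a v⟩
  leftUnitor M := mkIso (λ_ M.V)
    ⟨fun σ v => LinearMap.congr_fun
      (f := (λ_ M.V).hom.hom ∘ₗ TensorProduct.map LinearMap.id (M.perm σ))
      (g := M.perm σ ∘ₗ (λ_ M.V).hom.hom)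
      (TensorProduct.ext' fun c v => (_root_.map_smul (M.perm σ) c v).symm) v,
     fun i a v => tensY_lid (M.y i) a v⟩
  rightUnitor M := mkIso (ρ_ M.V)
    ⟨fun σ v => LinearMap.congr_fun
      (f := (ρ_ M.V).hom.hom ∘ₗ TensorProduct.map (M.perm σ) LinearMap.id)
      (g := M.perm σ ∘ₗ (ρ_ M.V).hom.hom)
      (TensorProduct.ext' fun v c => (_root_.map_smul (M.perm σ) c v).symm) v,
     fun i a v => tensY_rid (M.y i) a v⟩

instance : MonoidalCategory (WreathMod k A n) :=
  MonoidalCategory.ofTensorHom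
    (id_tensorHom_id := fun _ _ => Subtype.ext (id_tensorHom_id _ _))
    (id_tensorHom := fun _ _ _ _ => Subtype.ext (id_tensorHom _ _))
    (tensorHom_id := fun _ _ => Subtype.ext (tensorHom_id _ _))
    (tensorHom_comp_tensorHom := fun _ _ _ _ => Subtype.ext (tensorHom_comp_tensorHom _ _ _ _))
    (associator_naturality := fun _ _ _ => Subtype.ext (associator_naturality _ _ _))
    (leftUnitor_naturality := fun f => Subtype.ext
      ((congrArg (· ≫ _) (id_tensorHom _ _)).trans (leftUnitor_naturality f.1)))
    (rightUnitor_naturality := fun f => Subtype.ext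
      ((congrArg (· ≫ _) (tensorHom_id _ _)).trans (rightUnitor_naturality f.1)))
    (pentagon := fun W X Y Z => Subtype.ext (by
      change ((α_ W.V X.V Y.V).hom ⊗ₘ 𝟙 Z.V) ≫ (α_ W.V (X.V ⊗ Y.V) Z.V).hom ≫
        (𝟙 W.V ⊗ₘ (α_ X.V Y.V Z.V).hom) = (α_ (W.V ⊗ X.V) Y.V Z.V).hom ≫ (α_ W.V X.V (Y.V ⊗ Z.V)).hom
      rw [id_tensorHom, tensorHom_id, MonoidalCategory.pentagon]))
    (triangle := fun X Y => Subtype.ext (by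
      change (α_ X.V (𝟙_ _) Y.V).hom ≫ (𝟙 X.V ⊗ₘ (λ_ Y.V).hom) = (ρ_ X.V).hom ⊗ₘ 𝟙 Y.V
      rw [id_tensorHom, tensorHom_id, MonoidalCategory.triangle]))

end WreathMod

end bialg

end wreathMod

/-! ### Specialization at natural numbers -/

section specialization
universe u

/-- The map of permutation modules given by a linear combination of recollements. -/
def evLin {k : Type u} [CommRing k] (n : ℕ) {X Y : Shape} (f : Coef k X Y) :
    (X.Pt n → k) →ₗ[k] (Y.Pt n → k) :=
  (ev n f).vecMulLinear

theorem evLin_comp {k : Type u} [CommRing k] (n : ℕ) {X Y Z : Shape} (f : Coef k X Y)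
    (g : Coef k Y Z) (v : X.Pt n → k) :
    evLin n (Coef.comp (n : k) f g) v = evLin n g (evLin n f v) := by
  change Matrix.vecMul v (ev n _) = Matrix.vecMul (Matrix.vecMul v _) _
  rw [ev_comp, Matrix.vecMul_vecMul]

/-- The functor from Deligne's category at `t = n` to vector spaces, underlying the functor to
representations of `S_n`: it sends the image of an idempotent of `[U₁] ⊕ ⋯ ⊕ [U_m]` to the image
of the corresponding idempotent of the permutation module `⊕ᵢ k^{Inj(Uᵢ, {1, …, n})}`. -/
def specialize (k : Type u) [CommRing k] (n : ℕ) : RepS k (n : k) ⥤ ModuleCat.{u} k where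
  obj P := ModuleCat.of k (LinearMap.range (evLin n (X := P.X) (Y := P.X) P.p))
  map {P Q} f := ModuleCat.ofHom (LinearMap.restrict (evLin n (X := P.X) (Y := Q.X) f.f) (by
    rintro x -
    refine ⟨evLin n (X := P.X) (Y := Q.X) f.f x, ?_⟩
    exact (evLin_comp n (X := P.X) (Y := Q.X) (Z := Q.X) f.f Q.p x).symm.trans
      (congrArg (fun g => evLin n (X := P.X) (Y := Q.X) g x) (Karoubi.comp_p f))))
  map_id P := by
    refine ModuleCat.hom_ext (LinearMap.ext ?_)
    rintro ⟨_, v, rfl⟩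
    refine Subtype.ext ?_
    exact (evLin_comp n (X := P.X) (Y := P.X) (Z := P.X) P.p P.p v).symm.trans <| congrArg (fun g => evLin n (X := P.X) (Y := P.X) g v) P.idem
  map_comp {P Q T} f g := by
    refine ModuleCat.hom_ext (LinearMap.ext ?_)
    rintro ⟨v, hv⟩
    exact Subtype.ext (evLin_comp n (X := P.X) (Y := Q.X) (Z := T.X) f.f g.f v)

/-- The element `e_i ⊗ v` of the permutation module of `𝔥 ⊗ X`. -/
def insertPt {k : Type u} [CommRing k] {n : ℕ} {X : Shape} (i : Fin n) (v : X.Pt n → k) :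
    (Shape.point.tensor X).Pt n → k := fun z =>
  if (ptEquiv Shape.point X n z).1.2 (0 : Fin 1) = i then v (ptEquiv Shape.point X n z).2 else 0

/-- The action of the symmetric group on the basis of the permutation module. -/
def permPt {n : ℕ} {X : Shape} (σ : Equiv.Perm (Fin n)) (z : X.Pt n) : X.Pt n :=
  ⟨z.1, z.2.trans σ.toEmbedding⟩

variable {k A : Type u} [CommRing k] [Ring A] [Bialgebra k A] {n : ℕ}

/-- A monoidal structure on `Rep(A_t)`, `t = n`, interpolates the tensor product of modules over
`S_n ⋉ A^{⊗ n}`: there is a monoidal functor `Φ` to these modules which on underlying vector spaces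
is the specialization functor, such that the action of `S_n` is the action on the permutation
modules, the action of `y i a` is `v ↦ y_a (e_i ⊗ v)`, and the monoidal structure of `Φ` is given by
the isomorphisms `k^{Inj(U, {1, …, n})} ⊗ k^{Inj(V, {1, …, n})} ≅ ⊕_C k^{Inj(C, {1, …, n})}`. -/
structure Interpolation (L : MonoidalLift k k A (permData k (n : k))) where
  Φ : WreathRep k k A (permData k (n : k)) ⥤ WreathMod k A n
  e : Φ ⋙ WreathMod.forget k A n ≅ WreathRep.forget k k A (permData k (n : k)) ⋙ specialize k n
  perm (M) (σ : Equiv.Perm (Fin n)) (v : (Φ.obj M).V) (z : Shape.Pt M.V.X n) :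
    ((e.hom.app M).hom ((Φ.obj M).perm σ v)).1 z = ((e.hom.app M).hom v).1 (permPt σ⁻¹ z)
  y (M) (i : Fin n) (a : A) (v : (Φ.obj M).V) :
    ((e.hom.app M).hom ((Φ.obj M).y i a v)).1 =
      evLin n (X := Shape.point.tensor M.V.X) (Y := M.V.X) (M.act.y a).f
        (insertPt i ((e.hom.app M).hom v).1)
  monoidal : letI := L.monoidal; Φ.Monoidal
  unit (z : Shape.unit.Pt n) : letI := L.monoidal; letI := monoidal
    ((e.hom.app (𝟙_ _)).hom ((Functor.LaxMonoidal.ε Φ).1.hom (1 : k))).1 z = 1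
  tensor (M N) (v : (Φ.obj M).V) (w : (Φ.obj N).V) (z : (Shape.tensor M.V.X N.V.X).Pt n) :
    letI := L.monoidal; letI := monoidal
    ((e.hom.app (M ⊗ N)).hom ((Functor.LaxMonoidal.μ Φ M N).1.hom (v ⊗ₜ[k] w))).1 z =
      ((e.hom.app M).hom v).1 (ptEquiv M.V.X N.V.X n z).1 *
      ((e.hom.app N).hom w).1 (ptEquiv M.V.X N.V.X n z).2

end specialization

/-! ### Categories over the affine line -/

section internal
open Limits

/-- A category internal to `C`. Here `comp` composes pairs `(f, g)` with `cod f = dom g`. -/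
structure InternalCat (C : Type*) [Category* C] [HasPullbacks C] where
  ob : C
  mor : C
  dom : mor ⟶ ob
  cod : mor ⟶ ob
  one : ob ⟶ mor
  comp : pullback cod dom ⟶ mor
  one_dom : one ≫ dom = 𝟙 ob
  one_cod : one ≫ cod = 𝟙 ob
  comp_dom : comp ≫ dom = pullback.fst cod dom ≫ dom
  comp_cod : comp ≫ cod = pullback.snd cod dom ≫ cod
  one_comp : pullback.lift (dom ≫ one) (𝟙 mor)
    (by rw [Category.assoc, one_cod, Category.comp_id, Category.id_comp]) ≫ comp = 𝟙 mor
  comp_one : pullback.lift (𝟙 mor) (cod ≫ one)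
    (by rw [Category.assoc, one_dom, Category.comp_id, Category.id_comp]) ≫ comp = 𝟙 mor
  assoc {T : C} (f g h : T ⟶ mor) (hfg : f ≫ cod = g ≫ dom) (hgh : g ≫ cod = h ≫ dom) :
    pullback.lift (pullback.lift f g hfg ≫ comp) h
      (by rw [Category.assoc, comp_cod, pullback.lift_snd_assoc, hgh]) ≫ comp =
    pullback.lift f (pullback.lift g h hgh ≫ comp)
      (by rw [Category.assoc, comp_dom, pullback.lift_fst_assoc, hfg]) ≫ comp

/-- An internal functor `K × K ⥤ K`. -/
structure InternalBifunctor {C : Type*} [Category* C] [HasPullbacks C] [HasBinaryProducts C]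
    (K : InternalCat C) where
  ob : K.ob ⨯ K.ob ⟶ K.ob
  mor : K.mor ⨯ K.mor ⟶ K.mor
  dom : mor ≫ K.dom = prod.map K.dom K.dom ≫ ob
  cod : mor ≫ K.cod = prod.map K.cod K.cod ≫ ob
  one : prod.map K.one K.one ≫ mor = ob ≫ K.one
  comp {T : C} (f g f' g' : T ⟶ K.mor) (h : f ≫ K.cod = g ≫ K.dom)
    (h' : f' ≫ K.cod = g' ≫ K.dom) :
    prod.lift (pullback.lift f g h ≫ K.comp) (pullback.lift f' g' h' ≫ K.comp) ≫ mor =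
      pullback.lift (prod.lift f f' ≫ mor) (prod.lift g g' ≫ mor)
        (by simp only [Category.assoc, dom, cod, prod.lift_map_assoc, h, h']) ≫ K.comp

universe u

/-- The affine line over `k`. -/
abbrev A1 (k : Type u) [CommRing k] : AlgebraicGeometry.Scheme.{u} :=
  AlgebraicGeometry.Spec (CommRingCat.of (Polynomial k))

/-- A `k`-algebra with an element `t`, that is, an affine scheme over the affine line. -/
structure Base (k : Type u) [CommRing k] where
  R : Type u
  [ring : CommRing R]
  [alg : Algebra k R]
  t : R

attribute [instance] Base.ring Base.alg

variable {k : Type u} [CommRing k]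

/-- The scheme `Spec R` over the affine line. -/
def Base.spec (B : Base k) : Over (A1 k) :=
  Over.mk (AlgebraicGeometry.Spec.map
    (CommRingCat.ofHom (Polynomial.aeval (R := k) B.t).toRingHom))

/-- Morphisms of `k`-algebras which preserve the elements `t`. -/
def Base.Hom (B B' : Base k) : Type u := {φ : B.R →ₐ[k] B'.R // φ B.t = B'.t}

def Base.Hom.spec {B B' : Base k} (φ : B.Hom B') : B'.spec ⟶ B.spec :=
  Over.homMk (AlgebraicGeometry.Spec.map (CommRingCat.ofHom φ.1.toRingHom)) (by
    change AlgebraicGeometry.Spec.map _ ≫ AlgebraicGeometry.Spec.map _ =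
      AlgebraicGeometry.Spec.map _
    rw [← AlgebraicGeometry.Spec.map_comp, ← CommRingCat.ofHom_comp]
    congr 2
    refine Polynomial.ringHom_ext (fun c => ?_) ?_
    · simp
    · simp [φ.2])

variable (A : Type u) [Ring A] [Algebra k A]

/-- `Rep(A_t)` over the ring `R`. -/
abbrev Base.Rep (B : Base k) := WreathRep k B.R A (permData B.R B.t)

variable {A} in
/-- Extension of scalars. -/
abbrev Base.Hom.map {B B' : Base k} (φ : B.Hom B') : B.Rep A ⥤ B'.Rep A := baseChange φ.1 φ.2

/-- The formal direct sum `⊕ᵢ [Uᵢ]` of which the underlying object of `Rep(S_t)` is a summand. -/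
abbrev Base.shape {B : Base k} (M : B.Rep A) : Shape := M.V.X

/-- The data which identify a category over the affine line with the category of the `Rep(A_t)`:
points `Spec R ⟶ ob` and `Spec R ⟶ mor` for the objects and morphisms over `R`, compatible with the
structure maps and with extension of scalars, such that `ob` is the coproduct over all `j` of affine
schemes which parametrize the objects of shape `j`, and `mor` is the coproduct over all `i`, `j` of
affine schemes which parametrize the morphisms from objects of shape `i` to objects of shape `j`. -/
structure IsRep (K : InternalCat (Over (A1 k))) where
  pt {B : Base k} (M : B.Rep A) : B.spec ⟶ K.ob
  arr {B : Base k} {M N : B.Rep A} (f : M ⟶ N) : B.spec ⟶ K.mor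
  arr_dom {B : Base k} {M N : B.Rep A} (f : M ⟶ N) : arr f ≫ K.dom = pt M
  arr_cod {B : Base k} {M N : B.Rep A} (f : M ⟶ N) : arr f ≫ K.cod = pt N
  arr_id {B : Base k} (M : B.Rep A) : arr (𝟙 M) = pt M ≫ K.one
  arr_comp {B : Base k} {L M N : B.Rep A} (f : L ⟶ M) (g : M ⟶ N) :
    arr (f ≫ g) = pullback.lift (arr f) (arr g) ((arr_cod f).trans (arr_dom g).symm) ≫ K.comp
  pt_map {B B' : Base k} (φ : B.Hom B') (M : B.Rep A) : pt (φ.map.obj M) = φ.spec ≫ pt M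
  arr_map {B B' : Base k} (φ : B.Hom B') {M N : B.Rep A} (f : M ⟶ N) :
    arr (φ.map.map f) = φ.spec ≫ arr f
  obBase : Shape → Base k
  univOb (j : Shape) : (obBase j).Rep A
  shape_univOb (j : Shape) : Base.shape A (univOb j) = j
  existsUnique_ob (B : Base k) (M : B.Rep A) :
    ∃! φ : (obBase (Base.shape A M)).Hom B, φ.map.obj (univOb (Base.shape A M)) = M
  ob_coproduct : IsColimit (Cofan.mk K.ob fun j => pt (univOb j))
  morBase : Shape → Shape → Base k
  univMor (i j : Shape) : Arrow ((morBase i j).Rep A)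
  shape_left (i j : Shape) : Base.shape A (univMor i j).left = i
  shape_right (i j : Shape) : Base.shape A (univMor i j).right = j
  existsUnique_mor (B : Base k) (f : Arrow (B.Rep A)) :
    ∃! φ : (morBase (Base.shape A f.left) (Base.shape A f.right)).Hom B,
      φ.map.mapArrow.obj (univMor (Base.shape A f.left) (Base.shape A f.right)) = f
  mor_coproduct : IsColimit (Cofan.mk K.mor fun p : Shape × Shape => arr (univMor p.1 p.2).hom)

end internal

end DeligneCat

end

open DeligneCat

universe u

/-! The proof reduces identities for general `t` to identities of matrices at `t = n`. A morphism
between formal direct sums is a family of coefficients indexed by recollements. At `t = n` it is a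
matrix indexed by injections into `{1, …, n}`, and its entry at two injections depends only on the
recollement they induce. Such matrices are invariant under injections of the index sets
(`ev_mapPt`), and conversely every invariant function of pairs of points comes from coefficients
(`ev_ofPt`), so operations may be defined by their values at points. Lifting the given coefficients
to indeterminates makes both sides of an identity polynomial in `T`, and polynomials which agree at
all natural numbers are equal. Hence two operations compatible with change of rings agree for every
`t` as soon as they agree at `t = n` over every ring (`Coef.natural_eq₄`), where they are finite
sums.

A map `𝔥 ⊗ V ⟶ V` is at `t = n` a family of `n` endomorphisms. The key reformulation is
`Coef.comm_iff_off`. Given the multiplication rule, the commutator relation holds automatically on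
the diagonal of `𝔥 ⊗ 𝔥`, and off the diagonal it says that the operators belonging to different
indices commute. In this form the relation can be checked in each tensor factor separately
(`Coef.yy₂_tensorFam`, `Coef.off_tensorFam`), so `A ⊗ A` acts on the tensor product of two objects.
Restricting along the comultiplication, a homomorphism of algebras, gives the action of `A`
(`CoefAction.tensor`). Coassociativity and the counit axioms make the constraints equivariant.

For duals, transposing a family reverses products and the antipode restores their order
(`CoefAction.dual`). Invariance of evaluation and coevaluation is expressed by the two antipode
axioms (`CoefAction.comp_cap`, `CoefAction.comp_cup`). The inverse antipode gives left duals.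

At `t = n` the coefficients act on the images of idempotents of permutation modules. The
off-diagonal relation becomes the commutation of different tensor factors `A`, and the image of a
tensor product of idempotents is the tensor product of the images (`imageTensorEquiv`).

For a fixed formal direct sum, objects and morphisms over a ring are families of elements subject to
equations natural in the ring, hence polynomial (`algebraic_eq`). They are parametrized by quotients
of polynomial rings, and the schemes `ob` and `mor` are the coproducts of the spectra. A morphism to
such a coproduct comes from an object or a morphism of `Rep(A_t)` only locally, so composition and
tensor product are glued from rules on small affine charts (`exists_glue`). The rules are well
defined because points over nonzero rings determine objects and morphisms (`obPt_injective`,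
`morPt_injective`), and the tensor rule is functorial because tensor products commute with extension
of scalars on the nose (`map_tensorObj`). -/

open CategoryTheory MonoidalCategory

noncomputable section

namespace DeligneCat

section

variable {X Y Z W X' Y' Z' P Q : Shape}

/-! ### Points and orbit functions -/

/-- The image of a point under an injection of the index sets. -/
def Shape.mapPt {n m : ℕ} (ι : Fin n ↪ Fin m) (z : X.Pt n) : X.Pt m := ⟨z.1, z.2.trans ι⟩

/-- A recollement records only which elements have equal images, and an injection neither creates
nor destroys coincidences. -/
theorem Rec.ind_trans {I J : Type} {a b : ℕ} (u : Fin a ↪ I) (v : Fin b ↪ I) (ι : I ↪ J) :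
    Rec.ind (u.trans ι) (v.trans ι) = Rec.ind u v :=
  Subtype.ext <| Setoid.ext fun x y => by
    rcases x with x | x <;> rcases y with y | y <;> exact ι.injective.eq_iff

/-- Matrix entries depend on the recollement alone. For a bijection of the index set this is
equivariance under the symmetric group, used as `ev_permPt`. -/
theorem ev_mapPt {R : Type*} {n m : ℕ} (ι : Fin n ↪ Fin m) (f : Coef R X Y) (z : X.Pt n)
    (w : Y.Pt n) : ev m f (Shape.mapPt ι z) (Shape.mapPt ι w) = ev n f z w := by
  rw [ev_apply, ev_apply]
  exact congrArg (f z.1 w.1) (Rec.ind_trans _ _ _)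

/-- The point of a tensor product given by a pair of points. -/
def pair {n : ℕ} (a : X.Pt n) (b : Y.Pt n) : (X.tensor Y).Pt n := (ptEquiv X Y n).symm (a, b)

@[simp]
theorem ptEquiv_pair {n : ℕ} (a : X.Pt n) (b : Y.Pt n) : ptEquiv X Y n (pair a b) = (a, b) :=
  (ptEquiv X Y n).apply_symm_apply _

theorem exists_pair {n : ℕ} (z : (X.tensor Y).Pt n) : ∃ a b, z = pair a b :=
  ⟨(ptEquiv X Y n z).1, (ptEquiv X Y n z).2, ((ptEquiv X Y n).symm_apply_apply z).symm⟩

@[simp]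
theorem pair_inj {n : ℕ} {a a' : X.Pt n} {b b' : Y.Pt n} :
    pair a b = pair a' b' ↔ a = a' ∧ b = b' := by
  rw [pair, pair, Equiv.apply_eq_iff_eq, Prod.mk.injEq]

theorem forall_pair {n : ℕ} {p : (X.tensor Y).Pt n → Prop} :
    (∀ z, p z) ↔ ∀ a b, p (pair a b) :=
  ⟨fun h a b => h _, fun h z => by obtain ⟨a, b, rfl⟩ := exists_pair z; exact h a b⟩

theorem sum_pair {M : Type*} [AddCommMonoid M] {n : ℕ} (F : (X.tensor Y).Pt n → M) :
    ∑ z, F z = ∑ a, ∑ b, F (pair a b) := by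
  rw [← (ptEquiv X Y n).symm.sum_comp, Fintype.sum_prod_type]
  rfl

theorem mapPt_pair {n m : ℕ} (ι : Fin n ↪ Fin m) (a : X.Pt n) (b : Y.Pt n) :
    Shape.mapPt ι (pair a b) = pair (Shape.mapPt ι a) (Shape.mapPt ι b) := by
  apply (ptEquiv X Y m).injective
  rw [ptEquiv_pair]
  have h : ∀ z : (X.tensor Y).Pt n, ptEquiv X Y m (Shape.mapPt ι z) =
    (Shape.mapPt ι (ptEquiv X Y n z).1, Shape.mapPt ι (ptEquiv X Y n z).2) := fun z => rfl
  rw [h, ptEquiv_pair]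

theorem ptEquiv_mapPt {n m : ℕ} (ι : Fin n ↪ Fin m) (z : (X.tensor Y).Pt n) :
    ptEquiv X Y m (Shape.mapPt ι z) =
      (Shape.mapPt ι (ptEquiv X Y n z).1, Shape.mapPt ι (ptEquiv X Y n z).2) := rfl

theorem mapPt_injective {n m : ℕ} (ι : Fin n ↪ Fin m) :
    Function.Injective (Shape.mapPt (X := X) ι) := by
  rintro ⟨i, u⟩ ⟨j, v⟩ h
  obtain rfl : i = j := congrArg Sigma.fst h
  have := eq_of_heq (Sigma.mk.inj h).2
  congr 1
  ext x
  exact congrArg Fin.val (ι.injective (congrFun (congrArg DFunLike.coe this) x))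

@[simp]
theorem mapPt_inj {n m : ℕ} (ι : Fin n ↪ Fin m) {z w : X.Pt n} :
    Shape.mapPt ι z = Shape.mapPt ι w ↔ z = w := (mapPt_injective ι).eq_iff

/-- The morphism whose coefficient at a recollement is the value of `F` at a universal pair of
injections inducing it. -/
def Coef.ofPt {R : Type*} (F : ∀ n, X.Pt n → Y.Pt n → R) : Coef R X Y := fun i j E =>
  F E.card
    ⟨i, ⟨fun x => Fintype.equivFin E.Carrier (Quotient.mk _ (Sum.inl x)), fun _ _ h =>
      E.2.1 _ _ (Quotient.exact ((Fintype.equivFin E.Carrier).injective h))⟩⟩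
    ⟨j, ⟨fun x => Fintype.equivFin E.Carrier (Quotient.mk _ (Sum.inr x)), fun _ _ h =>
      E.2.2 _ _ (Quotient.exact ((Fintype.equivFin E.Carrier).injective h))⟩⟩

/-- A converse to `ev_mapPt`: two points live on the union of their images, which is a copy of the
carrier of their recollement, so by invariance the value is the one at the universal pair used in
`Coef.ofPt`. -/
theorem ev_ofPt {R : Type*} {F : ∀ n, X.Pt n → Y.Pt n → R}
    (hF : ∀ {n m : ℕ} (ι : Fin n ↪ Fin m) (z : X.Pt n) (w : Y.Pt n),
      F m (Shape.mapPt ι z) (Shape.mapPt ι w) = F n z w) (n : ℕ) (z : X.Pt n) (w : Y.Pt n) :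
    ev n (Coef.ofPt F) z w = F n z w := by
  obtain ⟨i, u⟩ := z
  obtain ⟨j, v⟩ := w
  -- The numbered carrier of the recollement, included as the union of the images of `u` and `v`.
  let ι : Fin (Rec.ind u v).card ↪ Fin n :=
    (Fintype.equivFin (Rec.ind u v).Carrier).symm.toEmbedding.trans (Rec.indEmb u v)
  change Coef.ofPt F i j (Rec.ind u v) = _
  refine (hF ι _ _).symm.trans ?_
  congr 1
  · refine congrArg (Sigma.mk i) (Function.Embedding.ext fun x => ?_)
    exact congrArg (Rec.indEmb u v) (Equiv.symm_apply_apply _ _)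
  · refine congrArg (Sigma.mk j) (Function.Embedding.ext fun x => ?_)
    exact congrArg (Rec.indEmb u v) (Equiv.symm_apply_apply _ _)

/-- Natural operations which agree at `t = n` for all `n` agree. -/
theorem Coef.natural_eq₄ {X₁ Y₁ X₂ Y₂ X₃ Y₃ X₄ Y₄ : Shape}
    {F G : ∀ (R : Type u) [CommRing R] (_ : R) (_ : Coef R X₁ Y₁) (_ : Coef R X₂ Y₂)
      (_ : Coef R X₃ Y₃) (_ : Coef R X₄ Y₄), Coef R X Y}
    (hF : ∀ {R S : Type u} [CommRing R] [CommRing S] (φ : R →+* S) (t : R) f g h i,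
      (F R t f g h i).map φ = F S (φ t) (f.map φ) (g.map φ) (h.map φ) (i.map φ))
    (hG : ∀ {R S : Type u} [CommRing R] [CommRing S] (φ : R →+* S) (t : R) f g h i,
      (G R t f g h i).map φ = G S (φ t) (f.map φ) (g.map φ) (h.map φ) (i.map φ))
    (H : ∀ (R : Type u) [CommRing R] (n : ℕ) f g h i (z : X.Pt n) (w : Y.Pt n),
      ev n (F R (n : R) f g h i) z w = ev n (G R (n : R) f g h i) z w)
    {R : Type u} [CommRing R] (t : R) (f : Coef R X₁ Y₁) (g : Coef R X₂ Y₂) (h : Coef R X₃ Y₃)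
    (i : Coef R X₄ Y₄) : F R t f g h i = G R t f g h i := by
  obtain ⟨f, rfl⟩ := f.exists_lift t
  obtain ⟨g, rfl⟩ := g.exists_lift t
  obtain ⟨h, rfl⟩ := h.exists_lift t
  obtain ⟨i, rfl⟩ := i.exists_lift t
  -- The arguments are now lifts over `Gen R`, and the parameter is the variable `T`. Naturality
  -- along `T ↦ t` recovers the two sides at `t`.
  have h1 := hF (R := Gen R) (Gen.spec t) Polynomial.X f g h i
  have h2 := hG (R := Gen R) (Gen.spec t) Polynomial.X f g h i
  rw [Gen.spec_X] at h1 h2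
  rw [← h1, ← h2]
  congr 1
  refine evn_faithful fun n => ?_
  ext1 z w
  -- Naturality along the evaluation `T ↦ n` turns the comparison into the hypothesis at `n`, over
  -- the ring of integral polynomials in the indeterminate coefficients.
  have h3 := hF (R := Gen R) (S := MvPolynomial R ℤ)
    (Polynomial.evalRingHom (n : MvPolynomial R ℤ)) Polynomial.X f g h i
  have h4 := hG (R := Gen R) (S := MvPolynomial R ℤ)
    (Polynomial.evalRingHom (n : MvPolynomial R ℤ)) Polynomial.X f g h i
  rw [evn, evn, h3, h4, Polynomial.coe_evalRingHom, Polynomial.eval_X]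
  exact H (MvPolynomial R ℤ) n _ _ _ _ z w

/-- The versions with fewer arguments fill the spare slot with the identity of the unit object,
which the operations ignore. -/
theorem Coef.natural_eq₃ {X₁ Y₁ X₂ Y₂ X₃ Y₃ : Shape}
    {F G : ∀ (R : Type u) [CommRing R] (_ : R) (_ : Coef R X₁ Y₁) (_ : Coef R X₂ Y₂)
      (_ : Coef R X₃ Y₃), Coef R X Y}
    (hF : ∀ {R S : Type u} [CommRing R] [CommRing S] (φ : R →+* S) (t : R) f g h,
      (F R t f g h).map φ = F S (φ t) (f.map φ) (g.map φ) (h.map φ))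
    (hG : ∀ {R S : Type u} [CommRing R] [CommRing S] (φ : R →+* S) (t : R) f g h,
      (G R t f g h).map φ = G S (φ t) (f.map φ) (g.map φ) (h.map φ))
    (H : ∀ (R : Type u) [CommRing R] (n : ℕ) f g h (z : X.Pt n) (w : Y.Pt n),
      ev n (F R (n : R) f g h) z w = ev n (G R (n : R) f g h) z w)
    {R : Type u} [CommRing R] (t : R) (f : Coef R X₁ Y₁) (g : Coef R X₂ Y₂) (h : Coef R X₃ Y₃) :
    F R t f g h = G R t f g h :=
  Coef.natural_eq₄ (F := fun R _ t f g h _ => F R t f g h) (G := fun R _ t f g h _ => G R t f g h)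
    (fun φ t f g h _ => hF φ t f g h) (fun φ t f g h _ => hG φ t f g h)
    (fun R _ n f g h _ => H R n f g h) t f g h (Coef.id R Shape.unit)

theorem Coef.natural_eq₂ {X₁ Y₁ X₂ Y₂ : Shape}
    {F G : ∀ (R : Type u) [CommRing R] (_ : R) (_ : Coef R X₁ Y₁) (_ : Coef R X₂ Y₂), Coef R X Y}
    (hF : ∀ {R S : Type u} [CommRing R] [CommRing S] (φ : R →+* S) (t : R) f g,
      (F R t f g).map φ = F S (φ t) (f.map φ) (g.map φ))
    (hG : ∀ {R S : Type u} [CommRing R] [CommRing S] (φ : R →+* S) (t : R) f g,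
      (G R t f g).map φ = G S (φ t) (f.map φ) (g.map φ))
    (H : ∀ (R : Type u) [CommRing R] (n : ℕ) f g (z : X.Pt n) (w : Y.Pt n),
      ev n (F R (n : R) f g) z w = ev n (G R (n : R) f g) z w)
    {R : Type u} [CommRing R] (t : R) (f : Coef R X₁ Y₁) (g : Coef R X₂ Y₂) :
    F R t f g = G R t f g :=
  Coef.natural_eq₃ (F := fun R _ t f g _ => F R t f g) (G := fun R _ t f g _ => G R t f g)
    (fun φ t f g _ => hF φ t f g) (fun φ t f g _ => hG φ t f g)
    (fun R _ n f g _ => H R n f g) t f g (Coef.id R Shape.unit)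

theorem Coef.natural_eq₁ {X₁ Y₁ : Shape}
    {F G : ∀ (R : Type u) [CommRing R] (_ : R) (_ : Coef R X₁ Y₁), Coef R X Y}
    (hF : ∀ {R S : Type u} [CommRing R] [CommRing S] (φ : R →+* S) (t : R) f,
      (F R t f).map φ = F S (φ t) (f.map φ))
    (hG : ∀ {R S : Type u} [CommRing R] [CommRing S] (φ : R →+* S) (t : R) f,
      (G R t f).map φ = G S (φ t) (f.map φ))
    (H : ∀ (R : Type u) [CommRing R] (n : ℕ) f (z : X.Pt n) (w : Y.Pt n),
      ev n (F R (n : R) f) z w = ev n (G R (n : R) f) z w)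
    {R : Type u} [CommRing R] (t : R) (f : Coef R X₁ Y₁) : F R t f = G R t f :=
  Coef.natural_eq₂ (F := fun R _ t f _ => F R t f) (G := fun R _ t f _ => G R t f)
    (fun φ t f _ => hF φ t f) (fun φ t f _ => hG φ t f)
    (fun R _ n f _ => H R n f) t f (Coef.id R Shape.unit)

/-! ### Values of composites at points -/

section values
variable {R S : Type*} [CommRing R] [CommRing S] {n : ℕ}

attribute [simp] Coef.map_comp Coef.map_tensor Coef.map_id Coef.map_transpose Coef.map_haug
  Coef.map_ofProp

-- These simp lemmas commute the structural morphisms and operations with base change, so that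
-- `simp` can prove the naturality hypotheses of `Coef.natural_eq₄` and its variants.
@[simp] theorem Coef.map_assoc'' (φ : R →+* S) :
    (Coef.assoc' R X Y Z).map φ = Coef.assoc' S X Y Z := Coef.map_ofProp _ _
@[simp] theorem Coef.map_lunit' (φ : R →+* S) :
    (Coef.lunit R X).map φ = Coef.lunit S X := Coef.map_ofProp _ _
@[simp] theorem Coef.map_runit' (φ : R →+* S) :
    (Coef.runit R X).map φ = Coef.runit S X := Coef.map_ofProp _ _
@[simp] theorem Coef.map_braid' (φ : R →+* S) :
    (Coef.braid R X Y).map φ = Coef.braid S X Y := Coef.map_ofProp _ _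
@[simp] theorem Coef.map_hmul (φ : R →+* S) : (Coef.hmul R).map φ = Coef.hmul S :=
  Coef.map_ofProp _ _
@[simp] theorem Coef.map_yy' (φ : R →+* S) (t : R) (ya yb : Coef R (Shape.point.tensor X) X) :
    (Coef.yy t ya yb).map φ = Coef.yy (φ t) (ya.map φ) (yb.map φ) := Coef.map_yy φ rfl ya yb
@[simp] theorem Coef.map_sub (φ : R →+* S) (f g : Coef R X Y) :
    (f - g).map φ = f.map φ - g.map φ := by
  ext i j E
  exact _root_.map_sub φ _ _

theorem ev_comp_apply (f : Coef R X Y) (g : Coef R Y Z) (z : X.Pt n) (w : Z.Pt n) :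
    ev n (Coef.comp (n : R) f g) z w = ∑ y, ev n f z y * ev n g y w := by
  rw [ev_comp, Matrix.mul_apply]

theorem ev_id_apply (z w : X.Pt n) : ev n (Coef.id R X) z w = if z = w then 1 else 0 := by
  rw [ev_id, Matrix.one_apply]

theorem ev_tensor_pair (f : Coef R X X') (g : Coef R Y Y') (a : X.Pt n) (b : Y.Pt n)
    (a' : X'.Pt n) (b' : Y'.Pt n) :
    ev n (Coef.tensor f g) (pair a b) (pair a' b') = ev n f a a' * ev n g b b' := by
  rw [ev_tensor, ptEquiv_pair, ptEquiv_pair]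

theorem ev_haug (z : Shape.point.Pt n) (w : Shape.unit.Pt n) : ev n (Coef.haug R) z w = 1 := rfl

/-- The matrix of a map of points. -/
def IsPtMap (f : Coef R X Y) (e : X.Pt n → Y.Pt n) : Prop :=
  ∀ z w, ev n f z w = if e z = w then 1 else 0

/-- Only one intermediate point contributes to the sum. Composing with a structural map is therefore
a substitution in the arguments. -/
theorem IsPtMap.comp_apply {f : Coef R X Y} {e : X.Pt n → Y.Pt n} (h : IsPtMap f e)
    (g : Coef R Y Z) (z : X.Pt n) (w : Z.Pt n) :
    ev n (Coef.comp (n : R) f g) z w = ev n g (e z) w := by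
  simp [ev_comp_apply, h z]

theorem IsPtMap.comp {f : Coef R X Y} {e : X.Pt n → Y.Pt n} (h : IsPtMap f e)
    {g : Coef R Y Z} {e' : Y.Pt n → Z.Pt n} (h' : IsPtMap g e') :
    IsPtMap (Coef.comp (n : R) f g) (e' ∘ e) := fun z w => by
  rw [h.comp_apply, h']
  rfl

theorem isPtMap_id : IsPtMap (n := n) (Coef.id R X) id := fun z w => ev_id_apply z w

theorem IsPtMap.tensor {f : Coef R X X'} {e : X.Pt n → X'.Pt n} (h : IsPtMap f e)
    {g : Coef R Y Y'} {e' : Y.Pt n → Y'.Pt n} (h' : IsPtMap g e') :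
    IsPtMap (Coef.tensor f g)
      (fun z => pair (e (ptEquiv X Y n z).1) (e' (ptEquiv X Y n z).2)) := fun z w => by
  obtain ⟨a, b, rfl⟩ := exists_pair z
  obtain ⟨c, d, rfl⟩ := exists_pair w
  rw [ev_tensor_pair, h, h']
  simp only [ptEquiv_pair, pair_inj, ite_and]
  split_ifs <;> simp

theorem isPtMap_assoc : IsPtMap (n := n) (Coef.assoc' R X Y Z) (assocPt X Y Z n) := fun z w => by
  rw [ev_assoc'_eq]; rfl

/-- The inverse of a permutation matrix is its transpose. -/
theorem isPtMap_assoc_transpose :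
    IsPtMap (n := n) (Coef.assoc' R X Y Z).transpose (assocPt X Y Z n).symm := fun z w => by
  rw [ev_transpose, ev_assoc'_eq, permMat, Matrix.of_apply]
  exact if_congr (by rw [Equiv.symm_apply_eq, eq_comm]) rfl rfl

theorem isPtMap_lunit : IsPtMap (n := n) (Coef.lunit R X) (lunitPt X n) := fun z w => by
  rw [ev_lunit_eq]; rfl

theorem isPtMap_runit : IsPtMap (n := n) (Coef.runit R X) (runitPt X n) := fun z w => by
  rw [ev_runit_eq]; rfl

theorem isPtMap_braid : IsPtMap (n := n) (Coef.braid R X Y) (braidPt X Y n) := fun z w => by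
  rw [ev_braid_eq]; rfl

/-- The map `r` sends `e_i` to `e_i ⊗ e_i`, which on points is the diagonal. -/
theorem isPtMap_hmul_transpose :
    IsPtMap (n := n) (Coef.hmul R).transpose (fun z => pair z z) := fun z w => by
  obtain ⟨c, d, rfl⟩ := exists_pair w
  rw [ev_transpose, ev_hmul, ptEquiv_pair]
  exact if_congr (by rw [pair_inj, eq_comm, eq_comm (a := d)]) rfl rfl

@[simp] theorem assocPt_pair (a : X.Pt n) (b : Y.Pt n) (c : Z.Pt n) :
    assocPt X Y Z n (pair (pair a b) c) = pair a (pair b c) := by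
  simp [assocPt, pair]

@[simp] theorem assocPt_symm_pair (a : X.Pt n) (b : Y.Pt n) (c : Z.Pt n) :
    (assocPt X Y Z n).symm (pair a (pair b c)) = pair (pair a b) c := by
  rw [Equiv.symm_apply_eq, assocPt_pair]

@[simp] theorem lunitPt_pair (a : Shape.unit.Pt n) (b : X.Pt n) :
    lunitPt X n (pair a b) = b := by
  simp [lunitPt, pair]

@[simp] theorem runitPt_pair (a : Shape.unit.Pt n) (b : X.Pt n) :
    runitPt X n (pair b a) = b := by
  simp [runitPt, pair]

@[simp] theorem braidPt_pair (a : X.Pt n) (b : Y.Pt n) :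
    braidPt X Y n (pair a b) = pair b a := by
  simp [braidPt, pair]

theorem ev_assoc_comp (g : Coef R (X.tensor (Y.tensor Z)) W) (a : X.Pt n) (b : Y.Pt n)
    (c : Z.Pt n) (w : W.Pt n) :
    ev n (Coef.comp (n : R) (Coef.assoc' R X Y Z) g) (pair (pair a b) c) w =
      ev n g (pair a (pair b c)) w := by
  rw [isPtMap_assoc.comp_apply, assocPt_pair]

theorem ev_tensor_id_comp (f : Coef R Y Y') (g : Coef R (X.tensor Y') Z) (a : X.Pt n)
    (b : Y.Pt n) (w : Z.Pt n) :
    ev n (Coef.comp (n : R) (Coef.tensor (Coef.id R X) f) g) (pair a b) w =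
      ∑ c, ev n f b c * ev n g (pair a c) w := by
  simp [ev_comp_apply, sum_pair, ev_tensor_pair, ev_id_apply]

theorem ev_id_tensor_comp (f : Coef R X X') (g : Coef R (X'.tensor Y) Z) (a : X.Pt n)
    (b : Y.Pt n) (w : Z.Pt n) :
    ev n (Coef.comp (n : R) (Coef.tensor f (Coef.id R Y)) g) (pair a b) w =
      ∑ c, ev n f a c * ev n g (pair c b) w := by
  simp [ev_comp_apply, sum_pair, ev_tensor_pair, ev_id_apply]

theorem ev_yy (ya yb : Coef R (Shape.point.tensor X) X) (i j : Shape.point.Pt n) (v w : X.Pt n) :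
    ev n (Coef.yy (n : R) ya yb) (pair i (pair j v)) w =
      ∑ u, ev n yb (pair j v) u * ev n ya (pair i u) w := ev_tensor_id_comp _ _ _ _ _

/-- The equality of the two factors comes first in the condition, so that it can be split off from
the sum over the intermediate point. -/
theorem ev_hmul_pair (i j w : Shape.point.Pt n) :
    ev n (Coef.hmul R) (pair i j) w = if i = j ∧ i = w then 1 else 0 := by
  rw [ev_hmul, ptEquiv_pair]
  dsimp only
  refine if_congr ⟨?_, ?_⟩ rfl rfl
  · rintro ⟨rfl, rfl⟩
    exact ⟨rfl, rfl⟩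
  · rintro ⟨rfl, rfl⟩
    exact ⟨rfl, rfl⟩

theorem ev_add (f g : Coef R X Y) (z : X.Pt n) (w : Y.Pt n) :
    ev n (f + g) z w = ev n f z w + ev n g z w := rfl

theorem ev_sub (f g : Coef R X Y) (z : X.Pt n) (w : Y.Pt n) :
    ev n (f - g) z w = ev n f z w - ev n g z w := rfl

theorem ev_smul (c : R) (f : Coef R X Y) (z : X.Pt n) (w : Y.Pt n) :
    ev n (c • f) z w = c * ev n f z w := rfl

end values

end

section

variable {X Y Z W X' Y' Z' P Q : Shape}

/-! ### Operations on families of morphisms parametrized by an object -/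

section operations
variable {R S : Type*} [CommRing R] [CommRing S] {n : ℕ}

theorem Coef.map_ofPt {φ : R →+* S} (F : ∀ n, X.Pt n → Y.Pt n → R) :
    (Coef.ofPt F).map φ = Coef.ofPt fun n z w => φ (F n z w) := rfl

/-- Change of the parametrizing object. -/
def Coef.pull (t : R) (φ : Coef R P Q) (f : Coef R (Q.tensor X) Y) : Coef R (P.tensor X) Y :=
  Coef.comp t (Coef.tensor φ (Coef.id R X)) f

@[simp] theorem Coef.map_pull (φ : R →+* S) (t : R) (u : Coef R P Q)
    (f : Coef R (Q.tensor X) Y) :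
    (Coef.pull t u f).map φ = Coef.pull (φ t) (u.map φ) (f.map φ) := by
  simp [Coef.pull]

@[simp] theorem ev_pull_hmul_transpose
    (f : Coef R ((Shape.point.tensor Shape.point).tensor X) Y) (i : Shape.point.Pt n) (v : X.Pt n)
    (w : Y.Pt n) :
    ev n (Coef.pull (n : R) (Coef.hmul R).transpose f) (pair i v) w =
      ev n f (pair (pair i i) v) w := by
  rw [Coef.pull, (isPtMap_hmul_transpose.tensor isPtMap_id).comp_apply]
  simp

@[simp] theorem ev_pull_braid (f : Coef R ((Q.tensor P).tensor X) Y)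
    (i : P.Pt n) (j : Q.Pt n) (v : X.Pt n) (w : Y.Pt n) :
    ev n (Coef.pull (n : R) (Coef.braid R P Q) f) (pair (pair i j) v) w =
      ev n f (pair (pair j i) v) w := by
  rw [Coef.pull, (isPtMap_braid.tensor isPtMap_id).comp_apply]
  simp

-- Pulling back along `ρ` extends a family by zero off the diagonal, whereas pulling back along `r`
-- restricts to the diagonal. The two together isolate the diagonal part of a family on `𝔥 ⊗ 𝔥`.
@[simp] theorem ev_pull_hmul (f : Coef R (Shape.point.tensor X) Y) (i j : Shape.point.Pt n)
    (v : X.Pt n) (w : Y.Pt n) :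
    ev n (Coef.pull (n : R) (Coef.hmul R) f) (pair (pair i j) v) w =
      if i = j then ev n f (pair i v) w else 0 := by
  rw [Coef.pull, ev_id_tensor_comp]
  simp [ev_hmul_pair, ite_and]

/-- `y_b`, then `y_a`, as a family parametrized by `𝔥 ⊗ 𝔥`. -/
def Coef.yy₂ (t : R) (ya yb : Coef R (Shape.point.tensor X) X) :
    Coef R ((Shape.point.tensor Shape.point).tensor X) X :=
  Coef.comp t (Coef.assoc' R _ _ X) (Coef.yy t ya yb)

@[simp] theorem Coef.map_yy₂ (φ : R →+* S) (t : R) (ya yb : Coef R (Shape.point.tensor X) X) :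
    (Coef.yy₂ t ya yb).map φ = Coef.yy₂ (φ t) (ya.map φ) (yb.map φ) := by
  simp [Coef.yy₂]

@[simp] theorem ev_yy₂ (ya yb : Coef R (Shape.point.tensor X) X) (i j : Shape.point.Pt n)
    (v w : X.Pt n) :
    ev n (Coef.yy₂ (n : R) ya yb) (pair (pair i j) v) w =
      ∑ u, ev n yb (pair j v) u * ev n ya (pair i u) w := by
  rw [Coef.yy₂, ev_assoc_comp, ev_yy]

/-- The composite `y_a ∘ y_b` of families parametrized by `𝔥`. -/
def Coef.conv (t : R) (ya yb : Coef R (Shape.point.tensor X) X) : Coef R (Shape.point.tensor X) X :=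
  Coef.pull t (Coef.hmul R).transpose (Coef.yy₂ t ya yb)

@[simp] theorem Coef.map_conv (φ : R →+* S) (t : R) (ya yb : Coef R (Shape.point.tensor X) X) :
    (Coef.conv t ya yb).map φ = Coef.conv (φ t) (ya.map φ) (yb.map φ) := by
  simp [Coef.conv]

@[simp] theorem ev_conv (ya yb : Coef R (Shape.point.tensor X) X) (i : Shape.point.Pt n)
    (v w : X.Pt n) :
    ev n (Coef.conv (n : R) ya yb) (pair i v) w =
      ∑ u, ev n yb (pair i v) u * ev n ya (pair i u) w := by
  simp [Coef.conv]

/-- The constant family `f`. -/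
def Coef.const (t : R) (f : Coef R X Y) : Coef R (Shape.point.tensor X) Y :=
  Coef.comp t (Coef.tensor (Coef.haug R) f) (Coef.lunit R Y)

@[simp] theorem Coef.map_const (φ : R →+* S) (t : R) (f : Coef R X Y) :
    (Coef.const t f).map φ = Coef.const (φ t) (f.map φ) := by
  simp [Coef.const]

@[simp] theorem ev_const (f : Coef R X Y) (i : Shape.point.Pt n) (v : X.Pt n) (w : Y.Pt n) :
    ev n (Coef.const (n : R) f) (pair i v) w = ev n f v w := by
  simp [Coef.const, ev_comp_apply, sum_pair, ev_tensor_pair, ev_haug, isPtMap_lunit _ _]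

/-- The tensor product of families with the same parameter. -/
def Coef.tensorFam (f : Coef R (P.tensor X) X') (g : Coef R (P.tensor Y) Y') :
    Coef R (P.tensor (X.tensor Y)) (X'.tensor Y') :=
  Coef.ofPt fun n z w =>
    ev n f (pair (ptEquiv _ _ n z).1 (ptEquiv _ _ n (ptEquiv _ _ n z).2).1) (ptEquiv _ _ n w).1 *
    ev n g (pair (ptEquiv _ _ n z).1 (ptEquiv _ _ n (ptEquiv _ _ n z).2).2) (ptEquiv _ _ n w).2

@[simp] theorem Coef.map_tensorFam (φ : R →+* S) (f : Coef R (P.tensor X) X')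
    (g : Coef R (P.tensor Y) Y') :
    (Coef.tensorFam f g).map φ = Coef.tensorFam (f.map φ) (g.map φ) := by
  ext i j E
  exact map_mul φ _ _

-- Defining the operation by its values makes identities about it identities between finite sums.
-- For `P = 𝔥`, its description as a composite through `r` is `Coef.hmul_transpose_mu_tensor`.
@[simp] theorem ev_tensorFam (f : Coef R (P.tensor X) X') (g : Coef R (P.tensor Y) Y')
    (i : P.Pt n) (v : X.Pt n) (x : Y.Pt n) (v' : X'.Pt n) (x' : Y'.Pt n) :
    ev n (Coef.tensorFam f g) (pair i (pair v x)) (pair v' x') =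
      ev n f (pair i v) v' * ev n g (pair i x) x' := by
  rw [Coef.tensorFam, ev_ofPt]
  · simp
  · intro n m ι z w
    simp only [ptEquiv_mapPt, ← mapPt_pair, ev_mapPt]

/-- A family parametrized by pairs, set to zero on the diagonal. -/
def Coef.off (f : Coef R ((P.tensor P).tensor X) Y) : Coef R ((P.tensor P).tensor X) Y :=
  Coef.ofPt fun n z w =>
    if (ptEquiv _ _ n (ptEquiv _ _ n z).1).1 = (ptEquiv _ _ n (ptEquiv _ _ n z).1).2 then 0
    else ev n f z w

@[simp] theorem Coef.map_off (φ : R →+* S) (f : Coef R ((P.tensor P).tensor X) Y) :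
    (Coef.off f).map φ = Coef.off (f.map φ) := by
  rw [Coef.off, Coef.map_ofPt]
  simp only [apply_ite φ, map_zero]
  rfl

@[simp] theorem ev_off (f : Coef R ((P.tensor P).tensor X) Y) (i j : P.Pt n) (v : X.Pt n)
    (w : Y.Pt n) :
    ev n (Coef.off f) (pair (pair i j) v) w = if i = j then 0 else ev n f (pair (pair i j) v) w := by
  rw [Coef.off, ev_ofPt]
  · simp
  -- An injection preserves and reflects equality of the two parameters, so the case distinction is
  -- invariant.
  · intro n m ι z w
    simp only [ptEquiv_mapPt, mapPt_inj, ev_mapPt]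

/-- The family of adjoints. -/
def Coef.adj (f : Coef R (P.tensor X) Y) : Coef R (P.tensor Y) X :=
  Coef.ofPt fun n z w => ev n f (pair (ptEquiv _ _ n z).1 w) (ptEquiv _ _ n z).2

@[simp] theorem Coef.map_adj (φ : R →+* S) (f : Coef R (P.tensor X) Y) :
    (Coef.adj f).map φ = Coef.adj (f.map φ) := rfl

@[simp] theorem ev_adj (f : Coef R (P.tensor X) Y) (i : P.Pt n) (v : X.Pt n) (w : Y.Pt n) :
    ev n (Coef.adj f) (pair i w) v = ev n f (pair i v) w := by
  rw [Coef.adj, ev_ofPt]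
  · simp
  · intro n m ι z w
    simp only [ptEquiv_mapPt, ← mapPt_pair, ev_mapPt]

/-- The pairing of `X` with itself given by an endomorphism. -/
def Coef.cap (f : Coef R X Y) : Coef R (Y.tensor X) Shape.unit :=
  Coef.ofPt fun n z _ => ev n f (ptEquiv _ _ n z).2 (ptEquiv _ _ n z).1

@[simp] theorem Coef.map_cap (φ : R →+* S) (f : Coef R X Y) :
    (Coef.cap f).map φ = Coef.cap (f.map φ) := rfl

@[simp] theorem ev_cap (f : Coef R X Y) (v : X.Pt n) (w : Y.Pt n) (z : Shape.unit.Pt n) :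
    ev n (Coef.cap f) (pair w v) z = ev n f v w := by
  rw [Coef.cap, ev_ofPt]
  · simp
  · intro n m ι z w
    simp only [ptEquiv_mapPt, ev_mapPt]

/-- The copairing of `X` with itself given by an endomorphism. -/
def Coef.cup (f : Coef R X Y) : Coef R Shape.unit (Y.tensor X) :=
  Coef.ofPt fun n _ z => ev n f (ptEquiv _ _ n z).2 (ptEquiv _ _ n z).1

@[simp] theorem Coef.map_cup (φ : R →+* S) (f : Coef R X Y) :
    (Coef.cup f).map φ = Coef.cup (f.map φ) := rfl

@[simp] theorem ev_cup (f : Coef R X Y) (v : X.Pt n) (w : Y.Pt n) (z : Shape.unit.Pt n) :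
    ev n (Coef.cup f) z (pair w v) = ev n f v w := by
  rw [Coef.cup, ev_ofPt]
  · simp
  · intro n m ι z w
    simp only [ptEquiv_mapPt, ev_mapPt]

/-- The family of pairings given by a family. -/
def Coef.capFam (f : Coef R (P.tensor X) Y) : Coef R (P.tensor (Y.tensor X)) Shape.unit :=
  Coef.ofPt fun n z _ => ev n f (pair (ptEquiv _ _ n z).1 (ptEquiv _ _ n (ptEquiv _ _ n z).2).2)
    (ptEquiv _ _ n (ptEquiv _ _ n z).2).1

@[simp] theorem Coef.map_capFam (φ : R →+* S) (f : Coef R (P.tensor X) Y) :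
    (Coef.capFam f).map φ = Coef.capFam (f.map φ) := rfl

@[simp] theorem ev_capFam (f : Coef R (P.tensor X) Y) (i : P.Pt n) (v : X.Pt n) (w : Y.Pt n)
    (z : Shape.unit.Pt n) :
    ev n (Coef.capFam f) (pair i (pair w v)) z = ev n f (pair i v) w := by
  rw [Coef.capFam, ev_ofPt]
  · simp
  · intro n m ι z w
    simp only [ptEquiv_mapPt, ← mapPt_pair, ev_mapPt]

/-- The family of copairings given by a family. -/
def Coef.cupFam (f : Coef R (P.tensor X) Y) : Coef R (P.tensor Shape.unit) (Y.tensor X) :=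
  Coef.ofPt fun n z w => ev n f (pair (ptEquiv _ _ n z).1 (ptEquiv _ _ n w).2)
    (ptEquiv _ _ n w).1

@[simp] theorem Coef.map_cupFam (φ : R →+* S) (f : Coef R (P.tensor X) Y) :
    (Coef.cupFam f).map φ = Coef.cupFam (f.map φ) := rfl

@[simp] theorem ev_cupFam (f : Coef R (P.tensor X) Y) (i : P.Pt n) (v : X.Pt n) (w : Y.Pt n)
    (z : Shape.unit.Pt n) :
    ev n (Coef.cupFam f) (pair i z) (pair w v) = ev n f (pair i v) w := by
  rw [Coef.cupFam, ev_ofPt]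
  · simp
  · intro n m ι z w
    simp only [ptEquiv_mapPt, ← mapPt_pair, ev_mapPt]

/-! ### Linearity -/

theorem Coef.tensorFam_add (f : Coef R (P.tensor X) X') (g g' : Coef R (P.tensor Y) Y') :
    Coef.tensorFam f (g + g') = Coef.tensorFam f g + Coef.tensorFam f g' := by
  ext i j E
  exact mul_add _ _ _

theorem Coef.add_tensorFam (f f' : Coef R (P.tensor X) X') (g : Coef R (P.tensor Y) Y') :
    Coef.tensorFam (f + f') g = Coef.tensorFam f g + Coef.tensorFam f' g := by
  ext i j E
  exact add_mul _ _ _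

theorem Coef.tensorFam_smul (c : R) (f : Coef R (P.tensor X) X') (g : Coef R (P.tensor Y) Y') :
    Coef.tensorFam f (c • g) = c • Coef.tensorFam f g := by
  ext i j E
  exact mul_left_comm _ _ _

theorem Coef.smul_tensorFam (c : R) (f : Coef R (P.tensor X) X') (g : Coef R (P.tensor Y) Y') :
    Coef.tensorFam (c • f) g = c • Coef.tensorFam f g := by
  ext i j E
  exact mul_assoc _ _ _

/-- `Coef.off` as a linear map. -/
def Coef.offₗ (R : Type*) [CommRing R] (P X Y : Shape) :
    Coef R ((P.tensor P).tensor X) Y →ₗ[R] Coef R ((P.tensor P).tensor X) Y where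
  toFun := Coef.off
  map_add' f g := by
    ext i j E
    simp only [Coef.off, Coef.ofPt]
    change (ite _ _ _ : R) = ite _ _ _ + ite _ _ _
    split_ifs
    · exact (add_zero _).symm
    · rfl
  map_smul' c f := by
    ext i j E
    simp only [Coef.off, Coef.ofPt]
    change (ite _ _ _ : R) = c * ite _ _ _
    split_ifs
    · exact (mul_zero _).symm
    · rfl

/-- `Coef.adj` as a linear map. -/
def Coef.adjₗ (R : Type*) [CommRing R] (P X Y : Shape) :
    Coef R (P.tensor X) Y →ₗ[R] Coef R (P.tensor Y) X where
  toFun := Coef.adj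
  map_add' _ _ := rfl
  map_smul' _ _ := rfl

/-- `Coef.capFam` as a linear map. -/
def Coef.capFamₗ (R : Type*) [CommRing R] (P X Y : Shape) :
    Coef R (P.tensor X) Y →ₗ[R] Coef R (P.tensor (Y.tensor X)) Shape.unit where
  toFun := Coef.capFam
  map_add' _ _ := rfl
  map_smul' _ _ := rfl

/-- `Coef.cupFam` as a linear map. -/
def Coef.cupFamₗ (R : Type*) [CommRing R] (P X Y : Shape) :
    Coef R (P.tensor X) Y →ₗ[R] Coef R (P.tensor Shape.unit) (Y.tensor X) where
  toFun := Coef.cupFam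
  map_add' _ _ := rfl
  map_smul' _ _ := rfl

/-- Composition as a bilinear map. -/
def Coef.compₗ (t : R) (X Y Z : Shape) : Coef R X Y →ₗ[R] Coef R Y Z →ₗ[R] Coef R X Z :=
  LinearMap.mk₂ R (Coef.comp t) (Coef.add_comp t) (Coef.smul_comp t)
    (Coef.comp_add t) (Coef.comp_smul t)

end operations

end

section

variable {X Y Z W X' Y' Z' P Q : Shape}

/-! ### Identities between the operations -/

section identities
variable {R : Type u} [CommRing R] (t : R)

/-- The points of `X ⊗ Y` are pairs, so the sum over intermediate points is a product of two sums
and the composition takes place in each factor separately. -/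
theorem Coef.yy₂_tensorFam (f f' : Coef R (Shape.point.tensor X) X)
    (g g' : Coef R (Shape.point.tensor Y) Y) :
    Coef.yy₂ t (Coef.tensorFam f g) (Coef.tensorFam f' g') =
      Coef.tensorFam (Coef.yy₂ t f f') (Coef.yy₂ t g g') := by
  refine Coef.natural_eq₄
    (F := fun R _ t f f' g g' => Coef.yy₂ t (Coef.tensorFam f g) (Coef.tensorFam f' g'))
    (G := fun R _ t f f' g g' => Coef.tensorFam (Coef.yy₂ t f f') (Coef.yy₂ t g g'))
    ?_ ?_ ?_ t f f' g g'
  · intro _ _ _ _ φ t f f' g g'; simp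
  · intro _ _ _ _ φ t f f' g g'; simp
  simp only [forall_pair, ev_yy₂, ev_tensorFam, sum_pair, Finset.sum_mul_sum]
  intros
  exact Finset.sum_congr rfl fun _ _ => Finset.sum_congr rfl fun _ _ => by ring

theorem Coef.pull_hmul_transpose_tensorFam
    (f : Coef R ((Shape.point.tensor Shape.point).tensor X) X')
    (g : Coef R ((Shape.point.tensor Shape.point).tensor Y) Y') :
    Coef.pull t (Coef.hmul R).transpose (Coef.tensorFam f g) =
      Coef.tensorFam (Coef.pull t (Coef.hmul R).transpose f)
        (Coef.pull t (Coef.hmul R).transpose g) := by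
  refine Coef.natural_eq₂
    (F := fun R _ t f g => Coef.pull t (Coef.hmul R).transpose (Coef.tensorFam f g))
    (G := fun R _ t f g => Coef.tensorFam (Coef.pull t (Coef.hmul R).transpose f) (Coef.pull t (Coef.hmul R).transpose g))
    ?_ ?_ ?_ t f g
  · intro _ _ _ _ φ t f g; simp
  · intro _ _ _ _ φ t f g; simp
  simp only [forall_pair]
  intros
  simp

theorem Coef.pull_braid_tensorFam
    (f : Coef R ((Q.tensor P).tensor X) X') (g : Coef R ((Q.tensor P).tensor Y) Y') :
    Coef.pull t (Coef.braid R P Q) (Coef.tensorFam f g) =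
      Coef.tensorFam (Coef.pull t (Coef.braid R P Q) f) (Coef.pull t (Coef.braid R P Q) g) := by
  refine Coef.natural_eq₂
    (F := fun R _ t f g => Coef.pull t (Coef.braid R P Q) (Coef.tensorFam f g))
    (G := fun R _ t f g => Coef.tensorFam (Coef.pull t (Coef.braid R P Q) f) (Coef.pull t (Coef.braid R P Q) g))
    ?_ ?_ ?_ t f g
  · intro _ _ _ _ φ t f g; simp
  · intro _ _ _ _ φ t f g; simp
  simp only [forall_pair]
  intros
  simp

/-- The two factors share their parameter, so removing the diagonal from the product is the same as
removing it from each factor. This is what makes off-diagonal commutation stable under tensor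
products. -/
theorem Coef.off_tensorFam
    (f : Coef R ((P.tensor P).tensor X) X') (g : Coef R ((P.tensor P).tensor Y) Y') :
    Coef.off (Coef.tensorFam f g) = Coef.tensorFam (Coef.off f) (Coef.off g) := by
  apply Coef.natural_eq₂ (F := fun R _ _ f g => Coef.off (Coef.tensorFam f g))
    (G := fun R _ _ f g => Coef.tensorFam (Coef.off f) (Coef.off g))
    (fun φ t f g => by simp) (fun φ t f g => by simp) _ (0 : R)
  simp only [forall_pair, ev_off, ev_tensorFam]
  intros
  split_ifs <;> simp

theorem Coef.conv_tensorFam (f f' : Coef R (Shape.point.tensor X) X)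
    (g g' : Coef R (Shape.point.tensor Y) Y) :
    Coef.conv t (Coef.tensorFam f g) (Coef.tensorFam f' g') =
      Coef.tensorFam (Coef.conv t f f') (Coef.conv t g g') := by
  rw [Coef.conv, Coef.yy₂_tensorFam, Coef.pull_hmul_transpose_tensorFam]
  rfl

/-- A pullback along `ρ` is supported on the diagonal. -/
theorem Coef.off_pull_hmul (f : Coef R (Shape.point.tensor X) Y) :
    Coef.off (Coef.pull t (Coef.hmul R) f) = 0 := by
  -- Zero is written as the difference of the left side with itself, which is again an operation on
  -- `f` compatible with base change, so that the comparison at natural numbers applies.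
  have h : ∀ (f : Coef R (Shape.point.tensor X) Y),
      Coef.off (Coef.pull t (Coef.hmul R) f) =
        Coef.off (Coef.pull t (Coef.hmul R) f) - Coef.off (Coef.pull t (Coef.hmul R) f) := by
    intro f
    refine Coef.natural_eq₁
      (F := fun R _ t f => Coef.off (Coef.pull t (Coef.hmul R) f))
      (G := fun R _ t f => Coef.off (Coef.pull t (Coef.hmul R) f) - Coef.off (Coef.pull t (Coef.hmul R) f))
      ?_ ?_ ?_ t f
    · intro _ _ _ _ φ t f; simp
    · intro _ _ _ _ φ t f
      simp only [Coef.map_sub, Coef.map_off, Coef.map_pull, Coef.map_hmul]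
    simp only [forall_pair, ev_sub, ev_off, ev_pull_hmul]
    intros
    split_ifs <;> simp
  rw [h, sub_self]

/-- The difference `f - Coef.off f` is supported on the diagonal, and a family with this property is
the extension by zero of its restriction to the diagonal. -/
theorem Coef.eq_pull_hmul (f : Coef R ((Shape.point.tensor Shape.point).tensor X) Y)
    (hf : Coef.off f = 0) :
    f = Coef.pull t (Coef.hmul R) (Coef.pull t (Coef.hmul R).transpose f) := by
  have h : f - Coef.off f =
      Coef.pull t (Coef.hmul R) (Coef.pull t (Coef.hmul R).transpose f) := by
    refine Coef.natural_eq₁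
      (F := fun R _ t f => f - Coef.off f)
      (G := fun R _ t f => Coef.pull t (Coef.hmul R) (Coef.pull t (Coef.hmul R).transpose f))
      ?_ ?_ ?_ t f
    · intro _ _ _ _ φ t f; simp
    · intro _ _ _ _ φ t f; simp
    simp only [forall_pair, ev_sub, ev_off, ev_pull_hmul, ev_pull_hmul_transpose]
    intros
    split_ifs with h
    · subst h
      exact sub_zero _
    · exact sub_self _
  rwa [hf, sub_zero] at h

/-- The exchange of the two parameters fixes the diagonal. -/
theorem Coef.pull_hmul_transpose_pull_braid
    (f : Coef R ((Shape.point.tensor Shape.point).tensor X) Y) :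
    Coef.pull t (Coef.hmul R).transpose (Coef.pull t (Coef.braid R _ _) f) =
      Coef.pull t (Coef.hmul R).transpose f := by
  refine Coef.natural_eq₁
    (F := fun R _ t f => Coef.pull t (Coef.hmul R).transpose (Coef.pull t (Coef.braid R _ _) f))
    (G := fun R _ t f => Coef.pull t (Coef.hmul R).transpose f)
    ?_ ?_ ?_ t f
  · intro _ _ _ _ φ t f; simp
  · intro _ _ _ _ φ t f; simp
  simp only [forall_pair]
  intros
  simp

theorem Coef.pull_braid_pull_braid (f : Coef R ((P.tensor Q).tensor X) Y) :
    Coef.pull t (Coef.braid R P Q) (Coef.pull t (Coef.braid R Q P) f) = f := by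
  apply Coef.natural_eq₁ (F := fun R _ t f =>
    Coef.pull t (Coef.braid R P Q) (Coef.pull t (Coef.braid R Q P) f)) (G := fun R _ _ f => f)
    (fun φ t f => by simp) (fun φ t f => by simp)
  simp only [forall_pair]
  intros
  simp

theorem Coef.tensorFam_assoc (f : Coef R (P.tensor X) X') (g : Coef R (P.tensor Y) Y')
    (h : Coef R (P.tensor Z) Z') :
    Coef.comp t (Coef.tensor (Coef.id R P) (Coef.assoc' R X Y Z))
        (Coef.tensorFam f (Coef.tensorFam g h)) =
      Coef.comp t (Coef.tensorFam (Coef.tensorFam f g) h) (Coef.assoc' R X' Y' Z') := by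
  refine Coef.natural_eq₃
    (F := fun R _ t f g h => Coef.comp t (Coef.tensor (Coef.id R P) (Coef.assoc' R X Y Z)) (Coef.tensorFam f (Coef.tensorFam g h)))
    (G := fun R _ t f g h => Coef.comp t (Coef.tensorFam (Coef.tensorFam f g) h) (Coef.assoc' R X' Y' Z'))
    ?_ ?_ ?_ t f g h
  · intro _ _ _ _ φ t f g h; simp
  · intro _ _ _ _ φ t f g h; simp
  intro R _ n f g h
  -- The associator is a bijection of points, so on the left side it only regroups the arguments;
  -- both sides then become the same triple product.
  have h1 := fun z w => (isPtMap_id.tensor isPtMap_assoc).comp_apply (n := n)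
    (f := Coef.tensor (Coef.id R P) (Coef.assoc' R X Y Z))
    (Coef.tensorFam f (Coef.tensorFam g h)) z w
  simp only [h1, forall_pair]
  intro i v w x v' w' x'
  simp only [ptEquiv_pair, assocPt_pair, id_eq, ev_tensorFam, ev_comp_apply, sum_pair,
    isPtMap_assoc _ _, pair_inj, ite_and, mul_ite, mul_one, mul_zero, Finset.sum_ite_eq',
    Finset.sum_ite_irrel, Finset.sum_const_zero, Finset.mem_univ, if_true, mul_assoc]

/-- The constant family at the identity of the unit object is `s`, and its matrix entries are all
`1`. -/
theorem Coef.tensorFam_lunit (f : Coef R (Shape.point.tensor X) Y) :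
    Coef.comp t (Coef.tensor (Coef.id R Shape.point) (Coef.lunit R X)) f =
      Coef.comp t (Coef.tensorFam (Coef.const t (Coef.id R Shape.unit)) f) (Coef.lunit R Y) := by
  refine Coef.natural_eq₁
    (F := fun R _ t f => Coef.comp t (Coef.tensor (Coef.id R Shape.point) (Coef.lunit R X)) f)
    (G := fun R _ t f => Coef.comp t (Coef.tensorFam (Coef.const t (Coef.id R Shape.unit)) f) (Coef.lunit R Y))
    ?_ ?_ ?_ t f
  · intro _ _ _ _ φ t f; simp
  · intro _ _ _ _ φ t f; simp
  intro R _ n f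
  have h1 := fun z w => (isPtMap_id.tensor isPtMap_lunit).comp_apply (n := n)
    (f := Coef.tensor (Coef.id R Shape.point) (Coef.lunit R X)) f z w
  simp only [h1, forall_pair]
  intro i v w w'
  simp [ev_comp_apply, sum_pair, isPtMap_lunit _ _, ev_id_apply, Subsingleton.elim v default]

theorem Coef.tensorFam_runit (f : Coef R (Shape.point.tensor X) Y) :
    Coef.comp t (Coef.tensor (Coef.id R Shape.point) (Coef.runit R X)) f =
      Coef.comp t (Coef.tensorFam f (Coef.const t (Coef.id R Shape.unit))) (Coef.runit R Y) := by
  refine Coef.natural_eq₁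
    (F := fun R _ t f => Coef.comp t (Coef.tensor (Coef.id R Shape.point) (Coef.runit R X)) f)
    (G := fun R _ t f => Coef.comp t (Coef.tensorFam f (Coef.const t (Coef.id R Shape.unit))) (Coef.runit R Y))
    ?_ ?_ ?_ t f
  · intro _ _ _ _ φ t f; simp
  · intro _ _ _ _ φ t f; simp
  intro R _ n f
  have h1 := fun z w => (isPtMap_id.tensor isPtMap_runit).comp_apply (n := n)
    (f := Coef.tensor (Coef.id R Shape.point) (Coef.runit R X)) f z w
  simp only [h1, forall_pair]
  intro i w v w'
  simp [ev_comp_apply, sum_pair, isPtMap_runit _ _, ev_id_apply, Subsingleton.elim v default]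

theorem Coef.tensorFam_const (f : Coef R X X') (g : Coef R Y Y') :
    Coef.tensorFam (Coef.const t f) (Coef.const t g) = Coef.const t (Coef.tensor f g) := by
  refine Coef.natural_eq₂
    (F := fun R _ t f g => Coef.tensorFam (Coef.const t f) (Coef.const t g))
    (G := fun R _ t f g => Coef.const t (Coef.tensor f g))
    ?_ ?_ ?_ t f g
  · intro _ _ _ _ φ t f g; simp
  · intro _ _ _ _ φ t f g; simp
  simp only [forall_pair]
  intros
  simp [ev_tensor_pair]

theorem Coef.tensor_comp_tensorFam (f : Coef R X X') (g : Coef R Y Y')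
    (u : Coef R (P.tensor X') Z) (v : Coef R (P.tensor Y') W) :
    Coef.comp t (Coef.tensor (Coef.id R P) (Coef.tensor f g)) (Coef.tensorFam u v) =
      Coef.tensorFam (Coef.comp t (Coef.tensor (Coef.id R P) f) u)
        (Coef.comp t (Coef.tensor (Coef.id R P) g) v) := by
  refine Coef.natural_eq₄
    (F := fun R _ t f g u v => Coef.comp t (Coef.tensor (Coef.id R P) (Coef.tensor f g)) (Coef.tensorFam u v))
    (G := fun R _ t f g u v => Coef.tensorFam (Coef.comp t (Coef.tensor (Coef.id R P) f) u) (Coef.comp t (Coef.tensor (Coef.id R P) g) v))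
    ?_ ?_ ?_ t f g u v
  · intro _ _ _ _ φ t f g u v; simp
  · intro _ _ _ _ φ t f g u v; simp
  simp only [forall_pair, ev_tensor_id_comp, ev_tensorFam, sum_pair, Finset.sum_mul_sum,
    ev_tensor_pair]
  intros
  exact Finset.sum_congr rfl fun _ _ => Finset.sum_congr rfl fun _ _ => by ring

theorem Coef.tensorFam_comp_tensor (u : Coef R (P.tensor X) X')
    (v : Coef R (P.tensor Y) Y') (f : Coef R X' Z) (g : Coef R Y' W) :
    Coef.comp t (Coef.tensorFam u v) (Coef.tensor f g) =
      Coef.tensorFam (Coef.comp t u f) (Coef.comp t v g) := by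
  refine Coef.natural_eq₄
    (F := fun R _ t u v f g => Coef.comp t (Coef.tensorFam u v) (Coef.tensor f g))
    (G := fun R _ t u v f g => Coef.tensorFam (Coef.comp t u f) (Coef.comp t v g))
    ?_ ?_ ?_ t u v f g
  · intro _ _ _ _ φ t u v f g; simp
  · intro _ _ _ _ φ t u v f g; simp
  simp only [forall_pair, ev_comp_apply, ev_tensorFam, sum_pair, Finset.sum_mul_sum,
    ev_tensor_pair]
  intros
  exact Finset.sum_congr rfl fun _ _ => Finset.sum_congr rfl fun _ _ => by ring

theorem Coef.adj_adj (f : Coef R (P.tensor X) Y) : Coef.adj (Coef.adj f) = f := by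
  apply Coef.natural_eq₁ (F := fun R _ _ f => Coef.adj (Coef.adj f)) (G := fun R _ _ f => f)
    (fun φ t f => by simp) (fun φ t f => by simp) _ (0 : R)
  simp only [forall_pair]
  intros
  simp

theorem Coef.transpose_transpose (f : Coef R X Y) : f.transpose.transpose = f := by
  apply Coef.natural_eq₁ (F := fun R _ _ f => f.transpose.transpose) (G := fun R _ _ f => f)
    (fun φ t f => by simp) (fun φ t f => by simp) _ (0 : R)
  intros
  simp [ev_transpose]

theorem Coef.comp_transpose (f : Coef R X Y) (g : Coef R Y Z) :
    (Coef.comp t f g).transpose = Coef.comp t g.transpose f.transpose := by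
  refine Coef.natural_eq₂
    (F := fun R _ t f g => (Coef.comp t f g).transpose)
    (G := fun R _ t f g => Coef.comp t g.transpose f.transpose)
    ?_ ?_ ?_ t f g
  · intro _ _ _ _ φ t f g; simp
  · intro _ _ _ _ φ t f g; simp
  intros
  simp [ev_transpose, ev_comp_apply, mul_comm]

/-- Taking adjoints reverses composition, and the braiding returns the two parameters to their
places. -/
theorem Coef.yy₂_adj (f g : Coef R (Shape.point.tensor X) X) :
    Coef.yy₂ t (Coef.adj f) (Coef.adj g) =
      Coef.adj (Coef.pull t (Coef.braid R _ _) (Coef.yy₂ t g f)) := by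
  refine Coef.natural_eq₂
    (F := fun R _ t f g => Coef.yy₂ t (Coef.adj f) (Coef.adj g))
    (G := fun R _ t f g => Coef.adj (Coef.pull t (Coef.braid R _ _) (Coef.yy₂ t g f)))
    ?_ ?_ ?_ t f g
  · intro _ _ _ _ φ t f g; simp
  · intro _ _ _ _ φ t f g; simp
  simp only [forall_pair]
  intros
  simp [mul_comm]

theorem Coef.off_adj (f : Coef R ((P.tensor P).tensor X) Y) :
    Coef.off (Coef.adj f) = Coef.adj (Coef.off f) := by
  apply Coef.natural_eq₁ (F := fun R _ _ f => Coef.off (Coef.adj f))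
    (G := fun R _ _ f => Coef.adj (Coef.off f))
    (fun φ t f => by simp) (fun φ t f => by simp) _ (0 : R)
  simp only [forall_pair]
  intros
  simp

theorem Coef.pull_braid_adj (f : Coef R ((Q.tensor P).tensor X) Y) :
    Coef.pull t (Coef.braid R P Q) (Coef.adj f) =
      Coef.adj (Coef.pull t (Coef.braid R P Q) f) := by
  refine Coef.natural_eq₁
    (F := fun R _ t f => Coef.pull t (Coef.braid R P Q) (Coef.adj f))
    (G := fun R _ t f => Coef.adj (Coef.pull t (Coef.braid R P Q) f))
    ?_ ?_ ?_ t f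
  · intro _ _ _ _ φ t f; simp
  · intro _ _ _ _ φ t f; simp
  simp only [forall_pair]
  intros
  simp

/-- Transposition is antimultiplicative, which is why the action on a dual has to involve an
antihomomorphism of `A`. -/
theorem Coef.conv_adj (f g : Coef R (Shape.point.tensor X) X) :
    Coef.conv t (Coef.adj f) (Coef.adj g) = Coef.adj (Coef.conv t g f) := by
  refine Coef.natural_eq₂
    (F := fun R _ t f g => Coef.conv t (Coef.adj f) (Coef.adj g))
    (G := fun R _ t f g => Coef.adj (Coef.conv t g f))
    ?_ ?_ ?_ t f g
  · intro _ _ _ _ φ t f g; simp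
  · intro _ _ _ _ φ t f g; simp
  simp only [forall_pair]
  intros
  simp [mul_comm]

theorem Coef.adj_const (f : Coef R X Y) :
    Coef.adj (Coef.const t f) = Coef.const t f.transpose := by
  refine Coef.natural_eq₁
    (F := fun R _ t f => Coef.adj (Coef.const t f))
    (G := fun R _ t f => Coef.const t f.transpose)
    ?_ ?_ ?_ t f
  · intro _ _ _ _ φ t f; simp
  · intro _ _ _ _ φ t f; simp
  simp only [forall_pair]
  intros
  simp [ev_transpose]

theorem Coef.transpose_comp_adj (p : Coef R Y Z) (f : Coef R (P.tensor X) Y) :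
    Coef.comp t (Coef.tensor (Coef.id R P) p.transpose) (Coef.adj f) =
      Coef.adj (Coef.comp t f p) := by
  refine Coef.natural_eq₂
    (F := fun R _ t p f => Coef.comp t (Coef.tensor (Coef.id R P) p.transpose) (Coef.adj f))
    (G := fun R _ t p f => Coef.adj (Coef.comp t f p))
    ?_ ?_ ?_ t p f
  · intro _ _ _ _ φ t p f; simp
  · intro _ _ _ _ φ t p f; simp
  simp only [forall_pair]
  intros
  rw [ev_tensor_id_comp, ev_adj]
  simp [ev_transpose, ev_comp_apply, mul_comm]

theorem Coef.adj_comp_transpose (p : Coef R Z X) (f : Coef R (P.tensor X) Y) :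
    Coef.comp t (Coef.adj f) p.transpose =
      Coef.adj (Coef.comp t (Coef.tensor (Coef.id R P) p) f) := by
  refine Coef.natural_eq₂
    (F := fun R _ t p f => Coef.comp t (Coef.adj f) p.transpose)
    (G := fun R _ t p f => Coef.adj (Coef.comp t (Coef.tensor (Coef.id R P) p) f))
    ?_ ?_ ?_ t p f
  · intro _ _ _ _ φ t p f; simp
  · intro _ _ _ _ φ t p f; simp
  simp only [forall_pair]
  intros
  rw [ev_comp_apply, ev_adj, ev_tensor_id_comp]
  simp [ev_transpose, mul_comm]

/-- Adjunction: the adjoint of `f` on the first argument of the pairing moves across it and becomes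
`f` applied after `g` and `p`. -/
theorem Coef.tensorFam_adj_cap (f g : Coef R (Shape.point.tensor X) X) (p : Coef R X X) :
    Coef.comp t (Coef.tensorFam (Coef.adj f) g) (Coef.cap p) =
      Coef.capFam (Coef.conv t f (Coef.comp t g p)) := by
  refine Coef.natural_eq₃
    (F := fun R _ t f g p => Coef.comp t (Coef.tensorFam (Coef.adj f) g) (Coef.cap p))
    (G := fun R _ t f g p => Coef.capFam (Coef.conv t f (Coef.comp t g p)))
    ?_ ?_ ?_ t f g p
  · intro _ _ _ _ φ t f g p; simp
  · intro _ _ _ _ φ t f g p; simp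
  simp only [forall_pair, ev_comp_apply, ev_capFam, ev_conv, sum_pair, ev_tensorFam, ev_cap, ev_adj,
    Finset.sum_mul]
  intros
  exact Finset.sum_congr rfl fun _ _ => Finset.sum_congr rfl fun _ _ => by ring

theorem Coef.cap_comp_const (p : Coef R X Y) :
    Coef.comp t (Coef.tensor (Coef.id R Shape.point) (Coef.cap p))
      (Coef.const t (Coef.id R Shape.unit)) = Coef.capFam (Coef.const t p) := by
  refine Coef.natural_eq₁
    (F := fun R _ t p => Coef.comp t (Coef.tensor (Coef.id R Shape.point) (Coef.cap p)) (Coef.const t (Coef.id R Shape.unit)))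
    (G := fun R _ t p => Coef.capFam (Coef.const t p))
    ?_ ?_ ?_ t p
  · intro _ _ _ _ φ t p; simp
  · intro _ _ _ _ φ t p; simp
  simp only [forall_pair]
  intros
  simp [ev_tensor_id_comp, ev_id_apply, Subsingleton.elim _ default]

/-- The same adjunction for the copairing: the adjoint of `g` on the second factor becomes `g`
applied before `p`, and `f` is applied last. -/
theorem Coef.cup_tensorFam_adj (f g : Coef R (Shape.point.tensor X) X) (p : Coef R X X) :
    Coef.comp t (Coef.tensor (Coef.id R Shape.point) (Coef.cup p))
      (Coef.tensorFam f (Coef.adj g)) =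
      Coef.cupFam (Coef.conv t f (Coef.comp t g p)) := by
  refine Coef.natural_eq₃
    (F := fun R _ t f g p => Coef.comp t (Coef.tensor (Coef.id R Shape.point) (Coef.cup p)) (Coef.tensorFam f (Coef.adj g)))
    (G := fun R _ t f g p => Coef.cupFam (Coef.conv t f (Coef.comp t g p)))
    ?_ ?_ ?_ t f g p
  · intro _ _ _ _ φ t f g p; simp
  · intro _ _ _ _ φ t f g p; simp
  simp only [forall_pair]
  intros
  rw [ev_tensor_id_comp]
  simp only [ev_comp_apply, ev_cupFam, ev_conv, sum_pair, ev_tensorFam, ev_cup, ev_adj,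
    Finset.sum_mul]
  exact Finset.sum_congr rfl fun _ _ => Finset.sum_congr rfl fun _ _ => by ring

theorem Coef.const_comp_cup (p : Coef R X Y) :
    Coef.comp t (Coef.const t (Coef.id R Shape.unit)) (Coef.cup p) =
      Coef.cupFam (Coef.const t p) := by
  refine Coef.natural_eq₁
    (F := fun R _ t p => Coef.comp t (Coef.const t (Coef.id R Shape.unit)) (Coef.cup p))
    (G := fun R _ t p => Coef.cupFam (Coef.const t p))
    ?_ ?_ ?_ t p
  · intro _ _ _ _ φ t p; simp
  · intro _ _ _ _ φ t p; simp
  simp only [forall_pair]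
  intros
  simp [ev_comp_apply, ev_id_apply, Subsingleton.elim _ default]

end identities

end

section

open Idempotents

variable {X Y Z W X' Y' Z' P Q : Shape}

/-! ### Objects of `Rep(A_t)` in terms of coefficients -/

section action
variable {R : Type u} [CommRing R] {t : R}

theorem Coef.assoc_transpose_comp (t : R) :
    Coef.comp t (Coef.assoc' R X Y Z).transpose (Coef.assoc' R X Y Z) = Coef.id R _ :=
  (Coef.ofProp_iso t _ (assocPt X Y Z) evn_assoc').2

theorem Coef.assoc_comp_transpose (t : R) :
    Coef.comp t (Coef.assoc' R X Y Z) (Coef.assoc' R X Y Z).transpose = Coef.id R _ :=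
  (Coef.ofProp_iso t _ (assocPt X Y Z) evn_assoc').1

/-- Since the associator is invertible, relations on `𝔥 ⊗ (𝔥 ⊗ X)` can be tested as relations
between families parametrized by `𝔥 ⊗ 𝔥`. -/
theorem Coef.assoc_comp_cancel {f g : Coef R (X.tensor (Y.tensor Z)) W}
    (h : Coef.comp t (Coef.assoc' R X Y Z) f = Coef.comp t (Coef.assoc' R X Y Z) g) : f = g := by
  have := congrArg (Coef.comp t (Coef.assoc' R X Y Z).transpose) h
  rwa [← Coef.assoc, ← Coef.assoc, Coef.assoc_transpose_comp, Coef.id_comp, Coef.id_comp] at this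

theorem Coef.tensor_comp_assoc (p : Coef R Z W) :
    Coef.comp t (Coef.tensor (Coef.tensor (Coef.id R X) (Coef.id R Y)) p) (Coef.assoc' R X Y W) =
      Coef.comp t (Coef.assoc' R X Y Z)
        (Coef.tensor (Coef.id R X) (Coef.tensor (Coef.id R Y) p)) :=
  Coef.assoc'_naturality t _ _ _

theorem Coef.tensor_eq_comp (t : R) (f : Coef R X X') (g : Coef R Y Y') :
    Coef.tensor f g =
      Coef.comp t (Coef.tensor f (Coef.id R Y)) (Coef.tensor (Coef.id R X') g) := by
  rw [Coef.tensor_comp, Coef.comp_id, Coef.id_comp]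

/-- The inverse associator of the Karoubi envelope carries an idempotent; after cancellation only
this idempotent is left. -/
theorem Coef.assoc_comp_ainv (p : Coef R X X) :
    Coef.comp t (Coef.assoc' R Shape.point Shape.point X) (Coef.ainv t p) =
      Coef.tensor (Coef.id R _) p := by
  rw [Coef.ainv, ← Coef.assoc, ← Coef.tensor_comp_assoc, Coef.assoc, Coef.assoc_comp_transpose,
    Coef.comp_id, Coef.id_tensor_id t]

variable {p : Coef R X X} {ya yb : Coef R (Shape.point.tensor X) X}

theorem Coef.tensor_comp_yy (hb : Coef.comp t (Coef.tensor (Coef.id R _) p) yb = yb) :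
    Coef.comp t (Coef.tensor (Coef.id R _) (Coef.tensor (Coef.id R _) p)) (Coef.yy t ya yb) =
      Coef.yy t ya yb := by
  rw [Coef.yy, ← Coef.assoc, Coef.tensor_comp, Coef.id_comp, hb]

theorem Coef.tensor_comp_yy₂ (hb : Coef.comp t (Coef.tensor (Coef.id R _) p) yb = yb) :
    Coef.comp t (Coef.tensor (Coef.id R _) p) (Coef.yy₂ t ya yb) = Coef.yy₂ t ya yb := by
  rw [Coef.yy₂, ← Coef.id_tensor_id t, ← Coef.assoc, Coef.tensor_comp_assoc, Coef.assoc,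
    Coef.tensor_comp_yy hb]

/-- In the Karoubi envelope each structural map brings along an idempotent. This lemma,
`Coef.mul_eq` and `Coef.assoc_comp_p12` remove these idempotents, which are absorbed by `p` itself
or by the `y`-maps. -/
theorem Coef.one_eq (hp : Coef.comp t p p = p) :
    Coef.comp t (Coef.tensor (Coef.haug R) p)
      (Coef.comp t (Coef.tensor (Coef.id R _) p) (Coef.lunit R X)) = Coef.const t p := by
  rw [← Coef.assoc, Coef.tensor_comp, Coef.comp_id, hp]
  rfl

theorem Coef.mul_eq (hb : Coef.comp t (Coef.tensor (Coef.id R _) p) yb = yb) :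
    Coef.comp t (Coef.tensor (Coef.hmul R).transpose p)
      (Coef.comp t (Coef.comp t (Coef.tensor (Coef.tensor (Coef.id R _) (Coef.id R _)) p)
        (Coef.assoc' R _ _ X)) (Coef.yy t ya yb)) = Coef.conv t ya yb := by
  rw [Coef.assoc, ← Coef.yy₂, Coef.id_tensor_id t, Coef.tensor_comp_yy₂ hb, Coef.tensor_eq_comp t,
    Coef.assoc, Coef.tensor_comp_yy₂ hb]
  rfl

/-- Seen from `(𝔥 ⊗ 𝔥) ⊗ X`, the exchange `P₁₂` is the braiding of the parameters. -/
theorem Coef.assoc_comp_p12 (hb : Coef.comp t (Coef.tensor (Coef.id R _) p) yb = yb) :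
    Coef.comp t (Coef.assoc' R _ _ X) (Coef.comp t (Coef.p12 t p) (Coef.yy t ya yb)) =
      Coef.pull t (Coef.braid R _ _) (Coef.yy₂ t ya yb) := by
  rw [Coef.p12, Coef.assoc, ← Coef.assoc t _ (Coef.ainv t p), Coef.assoc_comp_ainv, Coef.assoc,
    Coef.assoc, ← Coef.yy₂, Coef.id_tensor_id t, Coef.id_comp, Coef.tensor_comp_yy₂ hb,
    ← Coef.assoc, Coef.tensor_comp, Coef.id_comp, Coef.tensor_eq_comp t, Coef.assoc]
  -- Two copies of the idempotent have accumulated, and the inner map `yb` absorbs both.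
  have h : Coef.comp t (Coef.tensor (Coef.id R _) (Coef.comp t p p)) (Coef.yy₂ t ya yb) =
      Coef.yy₂ t ya yb := by
    rw [← Coef.id_comp t (Coef.id R (Shape.point.tensor Shape.point)), ← Coef.tensor_comp,
      Coef.assoc, Coef.tensor_comp_yy₂ hb, Coef.tensor_comp_yy₂ hb]
  rw [h]
  rfl

theorem Coef.comp_sub (t : R) (f : Coef R X Y) (g g' : Coef R Y Z) :
    Coef.comp t f (g - g') = Coef.comp t f g - Coef.comp t f g' :=
  _root_.map_sub (Coef.compₗ t X Y Z f) g g'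

theorem Coef.off_sub (f g : Coef R ((P.tensor P).tensor X) Y) :
    Coef.off (f - g) = Coef.off f - Coef.off g := _root_.map_sub (Coef.offₗ R P X Y) f g

theorem Coef.pull_sub (t : R) (φ : Coef R P Q) (f g : Coef R (Q.tensor X) Y) :
    Coef.pull t φ (f - g) = Coef.pull t φ f - Coef.pull t φ g := Coef.comp_sub _ _ _ _

/-- The relation is composed with the invertible associator. Its terms become families on `𝔥 ⊗ 𝔥`:
the exchange turns into a pullback along the braiding, and `ρ` into a pullback along the
multiplication. -/
theorem Coef.comm_iff (ha : Coef.comp t (Coef.tensor (Coef.id R _) p) ya = ya)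
    {y : Coef R (Shape.point.tensor X) X}
    (hy : Coef.comp t (Coef.tensor (Coef.id R _) p) y = y) :
    Coef.comm t p ya yb =
        Coef.comp t (Coef.ainv t p) (Coef.comp t (Coef.tensor (Coef.hmul R) p) y) ↔
      Coef.yy₂ t ya yb - Coef.pull t (Coef.braid R _ _) (Coef.yy₂ t yb ya) =
        Coef.pull t (Coef.hmul R) y := by
  have h1 : Coef.comp t (Coef.assoc' R _ _ X) (Coef.comm t p ya yb) =
      Coef.yy₂ t ya yb - Coef.pull t (Coef.braid R _ _) (Coef.yy₂ t yb ya) := by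
    rw [Coef.comm, ← sub_eq_add_neg, Coef.comp_sub, Coef.assoc_comp_p12 ha]
    rfl
  have h2 : Coef.comp t (Coef.assoc' R _ _ X)
      (Coef.comp t (Coef.ainv t p) (Coef.comp t (Coef.tensor (Coef.hmul R) p) y)) =
      Coef.pull t (Coef.hmul R) y := by
    rw [← Coef.assoc, Coef.assoc_comp_ainv, ← Coef.assoc, Coef.tensor_comp, Coef.id_comp,
      Coef.tensor_eq_comp t, ← Coef.id_comp t (Coef.id R Shape.point), ← Coef.tensor_comp,
      Coef.assoc, Coef.assoc, hy, hy]
    rfl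
  rw [← h1, ← h2]
  exact ⟨fun h => by rw [h], Coef.assoc_comp_cancel⟩

/-- The relation is split into its diagonal and off-diagonal parts. On the diagonal both sides equal
`y - y'` by the multiplication rule. Off the diagonal the right side vanishes, and what remains is
that `y_a` at one index commutes with `y_b` at another. -/
theorem Coef.comm_iff_off {y y' y'' : Coef R (Shape.point.tensor X) X}
    (hab : Coef.conv t ya yb = y) (hba : Coef.conv t yb ya = y') (hy : y'' = y - y') :
    Coef.yy₂ t ya yb - Coef.pull t (Coef.braid R _ _) (Coef.yy₂ t yb ya) =
        Coef.pull t (Coef.hmul R) y'' ↔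
      Coef.off (Coef.yy₂ t ya yb) =
        Coef.off (Coef.pull t (Coef.braid R _ _) (Coef.yy₂ t yb ya)) := by
  constructor
  · intro h
    rw [← sub_eq_zero, ← Coef.off_sub, h, Coef.off_pull_hmul]
  · intro h
    rw [← sub_eq_zero, ← Coef.off_sub] at h
    rw [Coef.eq_pull_hmul t _ h, Coef.pull_sub, Coef.pull_hmul_transpose_pull_braid]
    exact congrArg (Coef.pull t (Coef.hmul R)) (by rw [hy, ← hab, ← hba]; rfl)

variable {k A : Type*} [CommRing k] [Algebra k R] [Ring A] [Algebra k A]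

variable (k t p) in
/-- The conditions on the coefficients of the `y`-maps of an object of `Rep(A_t)` whose underlying
object is the image of `p`. -/
structure CoefAction (y : A → Coef R (Shape.point.tensor X) X) : Prop where
  left a : Coef.comp t (Coef.tensor (Coef.id R Shape.point) p) (y a) = y a
  right a : Coef.comp t (y a) p = y a
  add a b : y (a + b) = y a + y b
  smul (c : k) a : y (c • a) = algebraMap k R c • y a
  one : y 1 = Coef.const t p
  mul a b : Coef.conv t (y a) (y b) = y (a * b)
  comm a b : Coef.off (Coef.yy₂ t (y a) (y b)) =
    Coef.off (Coef.pull t (Coef.braid R _ _) (Coef.yy₂ t (y b) (y a)))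

theorem CoefAction.sub {y : A → Coef R (Shape.point.tensor X) X} (h : CoefAction t p k y)
    (a b : A) : y (a - b) = y a - y b := by
  have := h.smul (-1) b
  rw [neg_one_smul, map_neg, map_one, neg_one_smul] at this
  rw [sub_eq_add_neg, h.add, this, sub_eq_add_neg]

/-- One direction of the dictionary between `y`-maps and coefficients: the idempotents of the
Karoubi envelope are stripped and the commutator relation is replaced by off-diagonal commutation.
The reverse direction is `CoefAction.act`. -/
theorem WreathAction.coefAction {V : RepS R t} (M : WreathAction k R A (permData R t) V) :
    CoefAction (X := V.X) t V.p k fun a => (M.y a).f := by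
  have left : ∀ a, Coef.comp (X := Shape.point.tensor V.X) (Y := Shape.point.tensor V.X) (Z := V.X)
      t (Coef.tensor (Coef.id R Shape.point) V.p) (M.y a).f = (M.y a).f :=
    fun a => Karoubi.p_comp (M.y a)
  have mul : ∀ a b, Coef.conv (X := V.X) t (M.y a).f (M.y b).f = (M.y (a * b)).f := fun a b =>
    (Coef.mul_eq (X := V.X) (left b)).symm.trans (congrArg Karoubi.Hom.f (M.y_mul a b))
  have sub : ∀ a b, (M.y (a - b)).f = (M.y a).f - (M.y b).f := fun a b => by
    have := M.y_smul (-1) b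
    rw [neg_one_smul, map_neg, map_one, neg_one_smul] at this
    rw [sub_eq_add_neg, M.y_add, this]
    exact (sub_eq_add_neg _ _).symm
  exact
    { left
      right := fun a => Karoubi.comp_p (M.y a)
      add := fun a b => congrArg Karoubi.Hom.f (M.y_add a b)
      smul := fun c a => congrArg Karoubi.Hom.f (M.y_smul c a)
      one := (congrArg Karoubi.Hom.f M.y_one).trans (Coef.one_eq V.idem)
      mul
      comm := fun a b => (Coef.comm_iff_off (mul a b) (mul b a) (sub _ _)).1 <|
        (Coef.comm_iff (X := V.X) (left a) (left _)).1 <|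
          (RepS.comm_f V _ _).symm.trans (congrArg Karoubi.Hom.f (M.y_comm a b)) }

/-- The `y`-maps with given coefficients. -/
def CoefAction.act {V : RepS R t} {y : A → Coef R (Shape.point.tensor V.X) V.X}
    (h : CoefAction (X := V.X) t V.p k y) : WreathAction k R A (permData R t) V where
  y a := ⟨y a, ((congrArg (Coef.comp t _) (h.right a)).trans (h.left a) :)⟩
  y_add a b := Karoubi.hom_ext _ _ (h.add a b)
  y_smul c a := Karoubi.hom_ext _ _ (h.smul c a)
  y_one := Karoubi.hom_ext _ _ (h.one.trans (Coef.one_eq V.idem).symm)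
  y_mul a b := Karoubi.hom_ext _ _ ((Coef.mul_eq (h.left b)).trans (h.mul a b))
  y_comm a b := Karoubi.hom_ext _ _ ((RepS.comm_f V _ _).trans
    ((Coef.comm_iff (h.left a) (h.left _)).2
      ((Coef.comm_iff_off (h.mul a b) (h.mul b a) (h.sub _ _)).2 (h.comm a b))))

/-- The idempotent of `𝔥` is an identity, so whiskering by `𝔥` is tensoring with the identity of
coefficients. -/
theorem mem_equivariant_iff {V W : RepS R t} {M : WreathAction k R A (permData R t) V}
    {N : WreathAction k R A (permData R t) W} {f : V ⟶ W} :
    f ∈ equivariant M N ↔ ∀ a, Coef.comp (X := Shape.point.tensor V.X)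
      (Y := Shape.point.tensor W.X) (Z := W.X) t (Coef.tensor (Coef.id R Shape.point) f.f) (N.y a).f =
      Coef.comp (X := Shape.point.tensor V.X) (Y := V.X) (Z := W.X) t (M.y a).f f.f :=
  ⟨fun h a => congrArg Karoubi.Hom.f (h a), fun h a => Karoubi.hom_ext _ _ (h a)⟩

end action

end

section

open Idempotents TensorProduct

variable {X Y Z W X' Y' Z' P Q : Shape}

/-! ### Tensor products of actions -/

section tensorAction
variable {R : Type u} [CommRing R] {t : R}

/-- `Coef.yy₂` as a bilinear map. -/
def Coef.yy₂ₗ (t : R) (X : Shape) : Coef R (Shape.point.tensor X) X →ₗ[R]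
    Coef R (Shape.point.tensor X) X →ₗ[R] Coef R ((Shape.point.tensor Shape.point).tensor X) X :=
  LinearMap.mk₂ R (Coef.yy₂ t)
    (fun f f' g => by simp only [Coef.yy₂, Coef.yy, Coef.comp_add])
    (fun c f g => by simp only [Coef.yy₂, Coef.yy, Coef.comp_smul])
    (fun f g g' => by
      simp only [Coef.yy₂, Coef.yy, Coef.comp_add, Coef.tensor_add, Coef.add_comp])
    (fun c f g => by
      simp only [Coef.yy₂, Coef.yy, Coef.comp_smul, Coef.tensor_smul, Coef.smul_comp])

/-- `Coef.pull` as a linear map. -/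
def Coef.pullₗ (t : R) (φ : Coef R P Q) (X Y : Shape) :
    Coef R (Q.tensor X) Y →ₗ[R] Coef R (P.tensor X) Y :=
  Coef.compₗ t _ _ _ (Coef.tensor φ (Coef.id R X))

/-- `Coef.conv` as a bilinear map. -/
def Coef.convₗ (t : R) (X : Shape) : Coef R (Shape.point.tensor X) X →ₗ[R]
    Coef R (Shape.point.tensor X) X →ₗ[R] Coef R (Shape.point.tensor X) X :=
  (Coef.yy₂ₗ t X).compr₂ (Coef.pullₗ t (Coef.hmul R).transpose X X)

theorem Coef.compₗ_apply (t : R) (f : Coef R X Y) (g : Coef R Y Z) :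
    Coef.compₗ t X Y Z f g = Coef.comp t f g := rfl

theorem Coef.compₗ_flip_apply (t : R) (f : Coef R X Y) (g : Coef R Y Z) :
    (Coef.compₗ t X Y Z).flip g f = Coef.comp t f g := rfl

theorem Coef.convₗ_apply (t : R) (f g : Coef R (Shape.point.tensor X) X) :
    Coef.convₗ t X f g = Coef.conv t f g := rfl

theorem Coef.yy₂ₗ_apply (t : R) (f g : Coef R (Shape.point.tensor X) X) :
    Coef.yy₂ₗ t X f g = Coef.yy₂ t f g := rfl

theorem Coef.offₗ_apply (f : Coef R ((P.tensor P).tensor X) Y) :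
    Coef.offₗ R P X Y f = Coef.off f := rfl

theorem Coef.pullₗ_apply (t : R) (φ : Coef R P Q) (f : Coef R (Q.tensor X) Y) :
    Coef.pullₗ t φ X Y f = Coef.pull t φ f := rfl

variable {k A : Type*} [CommRing k] [Algebra k R]

/-- The tensor product of linear families of families of morphisms. -/
def Coef.tensorSL {M N : Type*} [AddCommGroup M] [AddCommGroup N] [Module k M] [Module k N]
    (f : M →ₛₗ[algebraMap k R] Coef R (P.tensor X) X')
    (g : N →ₛₗ[algebraMap k R] Coef R (P.tensor Y) Y') :
    M ⊗[k] N →ₛₗ[algebraMap k R] Coef R (P.tensor (X.tensor Y)) (X'.tensor Y') :=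
  TensorProduct.lift (LinearMap.mk₂'ₛₗ _ _ (fun m n => Coef.tensorFam (f m) (g n))
    (fun _ _ _ => by rw [_root_.map_add, Coef.add_tensorFam])
    (fun _ _ _ => by rw [LinearMap.map_smulₛₗ, Coef.smul_tensorFam])
    (fun _ _ _ => by rw [_root_.map_add, Coef.tensorFam_add])
    (fun _ _ _ => by rw [LinearMap.map_smulₛₗ, Coef.tensorFam_smul]))

@[simp] theorem Coef.tensorSL_tmul {M N : Type*} [AddCommGroup M] [AddCommGroup N] [Module k M]
    [Module k N] (f : M →ₛₗ[algebraMap k R] Coef R (P.tensor X) X')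
    (g : N →ₛₗ[algebraMap k R] Coef R (P.tensor Y) Y') (m : M) (n : N) :
    Coef.tensorSL f g (m ⊗ₜ n) = Coef.tensorFam (f m) (g n) := rfl

/-- Stated for every element of the triple tensor product, not only for iterated coproducts, so that
additivity reduces it to pure tensors. -/
theorem Coef.tensorSL_assoc {L M N : Type*} [AddCommGroup L] [AddCommGroup M] [AddCommGroup N]
    [Module k L] [Module k M] [Module k N] (t : R)
    (f : L →ₛₗ[algebraMap k R] Coef R (P.tensor X) X')
    (g : M →ₛₗ[algebraMap k R] Coef R (P.tensor Y) Y')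
    (h : N →ₛₗ[algebraMap k R] Coef R (P.tensor Z) Z') (u : (L ⊗[k] M) ⊗[k] N) :
    Coef.comp t (Coef.tensor (Coef.id R P) (Coef.assoc' R X Y Z))
        (Coef.tensorSL f (Coef.tensorSL g h) (TensorProduct.assoc k L M N u)) =
      Coef.comp t (Coef.tensorSL (Coef.tensorSL f g) h u) (Coef.assoc' R X' Y' Z') := by
  rw [← Coef.compₗ_apply, ← Coef.compₗ_flip_apply]
  induction u with
  | zero => simp
  | add u v hu hv => simp only [_root_.map_add, hu, hv]
  | tmul u n =>
    induction u with
    | zero => simp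
    | add u v hu hv => simp only [TensorProduct.add_tmul, _root_.map_add, hu, hv]
    | tmul l m => exact Coef.tensorFam_assoc t _ _ _

variable [Ring A]

section algebra
variable [Algebra k A] {p : Coef R X X} {q : Coef R Y Y}

/-- The family of `y`-maps as a semilinear map. -/
def CoefAction.toSL {y : A → Coef R (Shape.point.tensor X) X} (h : CoefAction t p k y) :
    A →ₛₗ[algebraMap k R] Coef R (Shape.point.tensor X) X where
  toFun := y
  map_add' := h.add
  map_smul' := h.smul

theorem Coef.conv_const (t : R) (f g : Coef R X X) :
    Coef.conv t (Coef.const t f) (Coef.const t g) = Coef.const t (Coef.comp t g f) := by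
  refine Coef.natural_eq₂
    (F := fun R _ t f g => Coef.conv t (Coef.const t f) (Coef.const t g))
    (G := fun R _ t f g => Coef.const t (Coef.comp t g f)) ?_ ?_ ?_ t f g
  · intro _ _ _ _ φ t f g; simp
  · intro _ _ _ _ φ t f g; simp
  simp only [forall_pair]
  intros
  simp [ev_comp_apply]

/-- A composite of constant families does not depend on the parameters, so exchanging them changes
nothing. -/
theorem Coef.pull_braid_yy₂_const (t : R) (f g : Coef R X X) :
    Coef.pull t (Coef.braid R _ _) (Coef.yy₂ t (Coef.const t f) (Coef.const t g)) =
      Coef.yy₂ t (Coef.const t f) (Coef.const t g) := by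
  refine Coef.natural_eq₂
    (F := fun R _ t f g =>
      Coef.pull t (Coef.braid R _ _) (Coef.yy₂ t (Coef.const t f) (Coef.const t g)))
    (G := fun R _ t f g => Coef.yy₂ t (Coef.const t f) (Coef.const t g)) ?_ ?_ ?_ t f g
  · intro _ _ _ _ φ t f g; simp
  · intro _ _ _ _ φ t f g; simp
  simp only [forall_pair]
  intros
  simp

/-- The whole algebra `A ⊗ A` acts on the tensor product. On pure tensors composition is computed
factor by factor, and bilinearity does the rest. -/
theorem CoefAction.tensorSL_mul {y : A → Coef R (Shape.point.tensor X) X}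
    {y' : A → Coef R (Shape.point.tensor Y) Y} (h : CoefAction t p k y)
    (h' : CoefAction t q k y') (u v : A ⊗[k] A) :
    Coef.conv t (Coef.tensorSL h.toSL h'.toSL u) (Coef.tensorSL h.toSL h'.toSL v) =
      Coef.tensorSL h.toSL h'.toSL (u * v) := by
  rw [← Coef.convₗ_apply]
  induction u with
  | zero => simp
  | add u u' hu hu' => simp only [_root_.map_add, LinearMap.add_apply, add_mul, hu, hu']
  | tmul a b =>
    induction v with
    | zero => simp
    | add v v' hv hv' => simp only [_root_.map_add, mul_add, hv, hv']
    | tmul c d =>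
      rw [Algebra.TensorProduct.tmul_mul_tmul]
      simp only [Coef.tensorSL_tmul, Coef.convₗ_apply, Coef.conv_tensorFam]
      exact congrArg₂ Coef.tensorFam (h.mul a c) (h'.mul b d)

/-- Off-diagonal commutation in each factor gives it for pure tensors, and bilinearity extends it to
`A ⊗ A`. The commutator relation itself would not reduce in this way, because a commutator of pure
tensors is not computed factor by factor. -/
theorem CoefAction.tensorSL_comm {y : A → Coef R (Shape.point.tensor X) X}
    {y' : A → Coef R (Shape.point.tensor Y) Y} (h : CoefAction t p k y)
    (h' : CoefAction t q k y') (u v : A ⊗[k] A) :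
    Coef.off (Coef.yy₂ t (Coef.tensorSL h.toSL h'.toSL u)
        (Coef.tensorSL h.toSL h'.toSL v)) =
      Coef.off (Coef.pull t (Coef.braid R _ _)
        (Coef.yy₂ t (Coef.tensorSL h.toSL h'.toSL v) (Coef.tensorSL h.toSL h'.toSL u))) := by
  simp only [← Coef.offₗ_apply, ← Coef.pullₗ_apply, ← Coef.yy₂ₗ_apply]
  induction u with
  | zero => simp
  | add u u' hu hu' => simp only [_root_.map_add, LinearMap.add_apply, hu, hu']
  | tmul a b =>
    induction v with
    | zero => simp
    | add v v' hv hv' => simp only [_root_.map_add, LinearMap.add_apply, hv, hv']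
    | tmul c d =>
      change Coef.off (Coef.yy₂ t (Coef.tensorFam (y a) (y' b)) (Coef.tensorFam (y c) (y' d))) =
        Coef.off (Coef.pull t _ (Coef.yy₂ t (Coef.tensorFam (y c) (y' d))
          (Coef.tensorFam (y a) (y' b))))
      rw [Coef.yy₂_tensorFam, Coef.yy₂_tensorFam, Coef.off_tensorFam, h.comm, h'.comm,
        Coef.pull_braid_tensorFam, Coef.off_tensorFam]

/-- This gives equivariance of tensor products of morphisms. The maps at the source and at the
target are independent, so taking one pair to be identities also yields the absorption of
idempotents in `Coef.comp_tensorSL_left` and `Coef.comp_tensorSL_right`. -/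
theorem Coef.comp_tensorSL (t : R) {M N : Type*} [AddCommGroup M] [AddCommGroup N] [Module k M]
    [Module k N] {f : M →ₛₗ[algebraMap k R] Coef R (P.tensor X) X'}
    {g : N →ₛₗ[algebraMap k R] Coef R (P.tensor Y) Y'}
    {f' : M →ₛₗ[algebraMap k R] Coef R (P.tensor Z) Z'}
    {g' : N →ₛₗ[algebraMap k R] Coef R (P.tensor W) Q} {c : Coef R X Z} {c' : Coef R X' Z'}
    {d : Coef R Y W} {d' : Coef R Y' Q}
    (hf : ∀ m, Coef.comp t (Coef.tensor (Coef.id R P) c) (f' m) = Coef.comp t (f m) c')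
    (hg : ∀ n, Coef.comp t (Coef.tensor (Coef.id R P) d) (g' n) = Coef.comp t (g n) d')
    (u : M ⊗[k] N) :
    Coef.comp t (Coef.tensor (Coef.id R P) (Coef.tensor c d)) (Coef.tensorSL f' g' u) =
      Coef.comp t (Coef.tensorSL f g u) (Coef.tensor c' d') := by
  rw [← Coef.compₗ_apply, ← Coef.compₗ_flip_apply]
  induction u with
  | zero => simp
  | add u u' hu hu' => simp only [_root_.map_add, hu, hu']
  | tmul m n =>
    refine (Coef.tensor_comp_tensorFam t _ _ _ _).trans ?_
    rw [hf, hg]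
    exact (Coef.tensorFam_comp_tensor t _ _ _ _).symm

theorem Coef.comp_tensorSL_left (t : R) {M N : Type*} [AddCommGroup M] [AddCommGroup N]
    [Module k M] [Module k N] {f : M →ₛₗ[algebraMap k R] Coef R (P.tensor X) X'}
    {g : N →ₛₗ[algebraMap k R] Coef R (P.tensor Y) Y'} {p : Coef R X X} {q : Coef R Y Y}
    (hf : ∀ m, Coef.comp t (Coef.tensor (Coef.id R P) p) (f m) = f m)
    (hg : ∀ n, Coef.comp t (Coef.tensor (Coef.id R P) q) (g n) = g n) (u : M ⊗[k] N) :
    Coef.comp t (Coef.tensor (Coef.id R P) (Coef.tensor p q)) (Coef.tensorSL f g u) =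
      Coef.tensorSL f g u := by
  have h := Coef.comp_tensorSL t (c' := Coef.id R X') (d' := Coef.id R Y')
    (fun m => (hf m).trans (Coef.comp_id t (f m)).symm)
    (fun m => (hg m).trans (Coef.comp_id t (g m)).symm) u
  refine h.trans ?_
  rw [Coef.id_tensor_id t]
  exact Coef.comp_id t _

theorem Coef.comp_tensorSL_right (t : R) {M N : Type*} [AddCommGroup M] [AddCommGroup N]
    [Module k M] [Module k N] {f : M →ₛₗ[algebraMap k R] Coef R (P.tensor X) X'}
    {g : N →ₛₗ[algebraMap k R] Coef R (P.tensor Y) Y'} {p : Coef R X' X'} {q : Coef R Y' Y'}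
    (hf : ∀ m, Coef.comp t (f m) p = f m) (hg : ∀ n, Coef.comp t (g n) q = g n) (u : M ⊗[k] N) :
    Coef.comp t (Coef.tensorSL f g u) (Coef.tensor p q) = Coef.tensorSL f g u := by
  have h := Coef.comp_tensorSL t (c := Coef.id R X) (d := Coef.id R Y) (f := f) (f' := f)
    (g := g) (g' := g) (c' := p) (d' := q)
    (fun m => by rw [Coef.id_tensor_id t, Coef.id_comp, hf])
    (fun m => by rw [Coef.id_tensor_id t, Coef.id_comp, hg]) u
  refine h.symm.trans ?_
  rw [Coef.id_tensor_id t, Coef.id_tensor_id t]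
  exact Coef.id_comp t _

end algebra

variable [Bialgebra k A]
variable {p : Coef R X X} {q : Coef R Y Y}

/-- The action of `A ⊗ A` is restricted along the comultiplication, a unital homomorphism of
algebras. The commutation relation holds for all elements of `A ⊗ A`, in particular for coproducts.
-/
theorem CoefAction.tensor {y : A → Coef R (Shape.point.tensor X) X}
    {y' : A → Coef R (Shape.point.tensor Y) Y} (h : CoefAction t p k y)
    (h' : CoefAction t q k y') :
    CoefAction t (Coef.tensor p q) k
      fun a => Coef.tensorSL h.toSL h'.toSL (Coalgebra.comul (R := k) a) where
  left a := Coef.comp_tensorSL_left t (f := h.toSL) (g := h'.toSL) h.left h'.left _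
  right a := Coef.comp_tensorSL_right t (f := h.toSL) (g := h'.toSL) h.right h'.right _
  add a b := by rw [_root_.map_add, _root_.map_add]
  smul c a := by rw [_root_.map_smul, LinearMap.map_smulₛₗ]
  one := by
    rw [Bialgebra.comul_one, Algebra.TensorProduct.one_def, Coef.tensorSL_tmul,
      ← Coef.tensorFam_const]
    exact congrArg₂ Coef.tensorFam h.one h'.one
  mul a b := by
    rw [Bialgebra.comul_mul]
    exact h.tensorSL_mul h' (Coalgebra.comul a) (Coalgebra.comul b)
  comm a b := h.tensorSL_comm h' (Coalgebra.comul a) (Coalgebra.comul b)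

/-- The counit is a unital homomorphism to `k`, and the operators are multiples of one constant
family, so they commute. -/
theorem CoefAction.unit (t : R) : CoefAction (A := A) t (Coef.id R Shape.unit) k
    fun a => algebraMap k R (Coalgebra.counit a) • Coef.const t (Coef.id R Shape.unit) where
  left a := by rw [Coef.id_tensor_id t, Coef.id_comp]
  right a := by rw [Coef.comp_id]
  add a b := by rw [_root_.map_add, _root_.map_add, add_smul]
  smul c a := by rw [_root_.map_smul, smul_eq_mul, map_mul, mul_smul]
  one := by rw [Bialgebra.counit_one, map_one, one_smul]
  mul a b := by
    have := Coef.conv_const t (Coef.id R Shape.unit) (Coef.id R Shape.unit)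
    rw [Coef.comp_id] at this
    rw [← Coef.convₗ_apply, _root_.map_smul, _root_.map_smul, LinearMap.smul_apply, smul_smul,
      Coef.convₗ_apply, this, Bialgebra.counit_mul, map_mul, mul_comm]
  comm a b := by
    simp only [← Coef.offₗ_apply, ← Coef.pullₗ_apply, ← Coef.yy₂ₗ_apply]
    simp only [_root_.map_smul, LinearMap.smul_apply]
    rw [smul_comm]
    simp only [Coef.offₗ_apply, Coef.pullₗ_apply, Coef.yy₂ₗ_apply, Coef.pull_braid_yy₂_const]

end tensorAction

end

/-! ### Coherence of the tensor action -/

section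

open Idempotents TensorProduct

variable {X Y Z W X' Y' Z' P Q : Shape}

section lift
variable {R : Type u} [CommRing R] {t : R}
variable {k A : Type*} [CommRing k] [Algebra k R] [Ring A] [Bialgebra k A]
variable {p : Coef R X X} {q : Coef R Y Y} {r : Coef R Z Z}
variable {y : A → Coef R (Shape.point.tensor X) X} {y' : A → Coef R (Shape.point.tensor Y) Y}
  {y'' : A → Coef R (Shape.point.tensor Z) Z}

/-- The action on the second factor already contains a coproduct; pulling it out leaves an element
of `A ⊗ (A ⊗ A)`, to which coassociativity can be applied. -/
theorem CoefAction.tensorSL_tensor_right (f : A →ₛₗ[algebraMap k R] Coef R (Shape.point.tensor X) X)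
    (h' : CoefAction t q k y') (h'' : CoefAction t r k y'') (u : A ⊗[k] A) :
    Coef.tensorSL f (h'.tensor h'').toSL u =
      Coef.tensorSL f (Coef.tensorSL h'.toSL h''.toSL) (Coalgebra.comul.lTensor A u) := by
  induction u with
  | zero => simp
  | add u v hu hv => simp only [_root_.map_add, hu, hv]
  | tmul a b => rfl

theorem CoefAction.tensorSL_tensor_left (h : CoefAction t p k y) (h' : CoefAction t q k y')
    (f : A →ₛₗ[algebraMap k R] Coef R (Shape.point.tensor Z) Z) (u : A ⊗[k] A) :
    Coef.tensorSL (h.tensor h').toSL f u =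
      Coef.tensorSL (Coef.tensorSL h.toSL h'.toSL) f (Coalgebra.comul.rTensor A u) := by
  induction u with
  | zero => simp
  | add u v hu hv => simp only [_root_.map_add, hu, hv]
  | tmul a b => rfl

/-- Coassociativity identifies the two iterated coproducts, and the associator then matches the two
triple tensor products. -/
theorem CoefAction.comp_assoc (h : CoefAction t p k y) (h' : CoefAction t q k y')
    (h'' : CoefAction t r k y'') (a : A) :
    Coef.comp t (Coef.tensor (Coef.id R Shape.point) (Coef.assoc' R X Y Z))
        (Coef.tensorSL h.toSL (h'.tensor h'').toSL (Coalgebra.comul (R := k) a)) =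
      Coef.comp t (Coef.tensorSL (h.tensor h').toSL h''.toSL (Coalgebra.comul (R := k) a))
        (Coef.assoc' R X Y Z) := by
  rw [CoefAction.tensorSL_tensor_right, CoefAction.tensorSL_tensor_left,
    ← Coalgebra.coassoc_apply, Coef.tensorSL_assoc]

theorem Coef.smul_tensorFam_lunit (c : R) (f : Coef R (Shape.point.tensor X) Y) :
    Coef.comp t (Coef.tensorFam (c • Coef.const t (Coef.id R Shape.unit)) f) (Coef.lunit R Y) =
      Coef.comp t (Coef.tensor (Coef.id R Shape.point) (Coef.lunit R X)) (c • f) := by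
  rw [Coef.smul_tensorFam, Coef.smul_comp, Coef.comp_smul, Coef.tensorFam_lunit]

theorem Coef.smul_tensorFam_runit (c : R) (f : Coef R (Shape.point.tensor X) Y) :
    Coef.comp t (Coef.tensorFam f (c • Coef.const t (Coef.id R Shape.unit))) (Coef.runit R Y) =
      Coef.comp t (Coef.tensor (Coef.id R Shape.point) (Coef.runit R X)) (c • f) := by
  rw [Coef.tensorFam_smul, Coef.smul_comp, Coef.comp_smul, Coef.tensorFam_runit]

/-- For an arbitrary `u` the identity can be checked on `a ⊗ b`, where the unit object contributes
the scalar `ε(a)`. At `u = Δ(a)` the counit axiom then leaves `y a`. -/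
theorem CoefAction.comp_lunit_aux (h : CoefAction t p k y) (u : A ⊗[k] A) :
    Coef.comp t (Coef.tensorSL (CoefAction.unit (A := A) (k := k) t).toSL h.toSL u)
      (Coef.lunit R X) =
    Coef.comp t (Coef.tensor (Coef.id R Shape.point) (Coef.lunit R X))
      (h.toSL (TensorProduct.lid k A (Coalgebra.counit.rTensor A u))) := by
  rw [← Coef.compₗ_flip_apply, ← Coef.compₗ_apply]
  induction u with
  | zero => simp
  | add u v hu hv => simp only [_root_.map_add, hu, hv]
  | tmul a b =>
    have e : h.toSL (TensorProduct.lid k A (Coalgebra.counit.rTensor A (a ⊗ₜ[k] b))) =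
        algebraMap k R (Coalgebra.counit a) • y b := h.smul (Coalgebra.counit a) b
    rw [e]
    exact Coef.smul_tensorFam_lunit (t := t) (algebraMap k R (Coalgebra.counit a)) (y b)

theorem CoefAction.comp_runit_aux (h : CoefAction t p k y) (u : A ⊗[k] A) :
    Coef.comp t (Coef.tensorSL h.toSL (CoefAction.unit (A := A) (k := k) t).toSL u)
      (Coef.runit R X) =
    Coef.comp t (Coef.tensor (Coef.id R Shape.point) (Coef.runit R X))
      (h.toSL (TensorProduct.rid k A (Coalgebra.counit.lTensor A u))) := by
  rw [← Coef.compₗ_flip_apply, ← Coef.compₗ_apply]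
  induction u with
  | zero => simp
  | add u v hu hv => simp only [_root_.map_add, hu, hv]
  | tmul a b =>
    have e : h.toSL (TensorProduct.rid k A (Coalgebra.counit.lTensor A (a ⊗ₜ[k] b))) =
        algebraMap k R (Coalgebra.counit b) • y a := h.smul (Coalgebra.counit b) a
    rw [e]
    exact Coef.smul_tensorFam_runit (t := t) (algebraMap k R (Coalgebra.counit b)) (y a)

theorem CoefAction.comp_lunit (h : CoefAction t p k y) (a : A) :
    Coef.comp t (Coef.tensor (Coef.id R Shape.point) (Coef.lunit R X)) (y a) =
    Coef.comp t (Coef.tensorSL (CoefAction.unit (A := A) (k := k) t).toSL h.toSL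
      (Coalgebra.comul (R := k) a)) (Coef.lunit R X) := by
  rw [h.comp_lunit_aux, Coalgebra.rTensor_counit_comul, TensorProduct.lid_tmul, one_smul]
  rfl

theorem CoefAction.comp_runit (h : CoefAction t p k y) (a : A) :
    Coef.comp t (Coef.tensor (Coef.id R Shape.point) (Coef.runit R X)) (y a) =
    Coef.comp t (Coef.tensorSL h.toSL (CoefAction.unit (A := A) (k := k) t).toSL
      (Coalgebra.comul (R := k) a)) (Coef.runit R X) := by
  rw [h.comp_runit_aux, Coalgebra.lTensor_counit_comul, TensorProduct.rid_tmul, one_smul]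
  rfl

/-- If a map commutes with families which absorb an idempotent, so does its restriction. -/
theorem Coef.comp_restrict {p : Coef R X X} {e : Coef R X Y} {f : Coef R (P.tensor X) X}
    {g : Coef R (P.tensor Y) Y} (hl : Coef.comp t (Coef.tensor (Coef.id R P) p) f = f)
    (hr : Coef.comp t f p = f)
    (h : Coef.comp t (Coef.tensor (Coef.id R P) e) g = Coef.comp t f e) :
    Coef.comp t (Coef.tensor (Coef.id R P) (Coef.comp t p e)) g =
      Coef.comp t f (Coef.comp t p e) := by
  rw [← Coef.id_comp t (Coef.id R P), ← Coef.tensor_comp, Coef.assoc, h, ← Coef.assoc, hl,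
    ← Coef.assoc, hr]

/-! ### The lift of the monoidal structure -/

/-- The `y`-maps on a tensor product. -/
def tensorAction (M N : WreathRep k R A (permData R t)) :
    WreathAction k R A (permData R t) (M.V ⊗ N.V) :=
  CoefAction.act (V := M.V ⊗ N.V)
    (CoefAction.tensor (X := M.V.X) (Y := N.V.X) M.act.coefAction N.act.coefAction)

/-- The `y`-maps on the unit object. -/
def unitAction : WreathAction k R A (permData R t) (𝟙_ (RepS R t)) :=
  CoefAction.act (V := 𝟙_ (RepS R t)) (CoefAction.unit (A := A) t)

variable (k R A t) in
/-- The lift of the monoidal structure of `Rep(S_t, R)` to `Rep(A_t)`. -/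
def monoidalLift : MonoidalLift k R A (permData R t) where
  tensor := tensorAction
  unit := unitAction (k := k) (R := R) (A := A) (t := t)
  tensorHom_mem {M M' N N'} f g := mem_equivariant_iff.2 fun a =>
    Coef.comp_tensorSL (X := M.V.X) (Y := N.V.X) (Z := M'.V.X) (W := N'.V.X)
      (f := M.act.coefAction.toSL (X := M.V.X)) (g := N.act.coefAction.toSL (X := N.V.X))
      (f' := M'.act.coefAction.toSL (X := M'.V.X)) (g' := N'.act.coefAction.toSL (X := N'.V.X))
      t (mem_equivariant_iff.1 f.2) (mem_equivariant_iff.1 g.2) (Coalgebra.comul a)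
  associator_mem L M N := mem_equivariant_iff.2 fun a =>
    have hL := L.act.coefAction
    have hM := M.act.coefAction
    have hN := N.act.coefAction
    -- The associator of the Karoubi envelope is the idempotent of the source followed by the
    -- associator of coefficients. Equivariance of the latter restricts to the image because the
    -- action absorbs the idempotent.
    Coef.comp_restrict (t := t) (p := Coef.tensor (X := L.V.X.tensor M.V.X) (Y := N.V.X)
        (Coef.tensor (X := L.V.X) (Y := M.V.X) L.V.p M.V.p) N.V.p)
      (((hL.tensor hM).tensor hN).left a) (((hL.tensor hM).tensor hN).right a)
      (CoefAction.comp_assoc (X := L.V.X) (Y := M.V.X) (Z := N.V.X) hL hM hN a)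
  leftUnitor_mem M := mem_equivariant_iff.2 fun a =>
    have hM := M.act.coefAction
    Coef.comp_restrict (t := t)
      (p := Coef.tensor (X := Shape.unit) (Y := M.V.X) (Coef.id R Shape.unit) M.V.p)
      (((CoefAction.unit t).tensor hM).left a) (((CoefAction.unit t).tensor hM).right a)
      (CoefAction.comp_lunit (X := M.V.X) hM a)
  rightUnitor_mem M := mem_equivariant_iff.2 fun a =>
    have hM := M.act.coefAction
    Coef.comp_restrict (t := t)
      (p := Coef.tensor (X := M.V.X) (Y := Shape.unit) M.V.p (Coef.id R Shape.unit))
      ((hM.tensor (CoefAction.unit t)).left a) ((hM.tensor (CoefAction.unit t)).right a)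
      (CoefAction.comp_runit (X := M.V.X) hM a)

end lift

end

section

open Idempotents TensorProduct

variable {X Y Z W X' Y' Z' P Q : Shape}

/-! ### The tensor product of families of maps -/

section karoubi
universe v₁ u₁
variable {C : Type u₁} [Category.{v₁} C] [MonoidalCategory C] [BraidedCategory C]

theorem Kar.toKaroubi_tensorμ_f (P Q S T : C) :
    (tensorμ ((toKaroubi C).obj P) ((toKaroubi C).obj Q) ((toKaroubi C).obj S)
      ((toKaroubi C).obj T)).f = tensorμ P Q S T := by
  simp [tensorμ, Karoubi.comp_f, Kar.associator_hom_f, Kar.associator_inv_f, Kar.whiskerLeft_f,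
    Kar.whiskerRight_f, Kar.braiding_hom_f, Kar.tensorObj_X, Kar.tensorObj_p]

/-- Every object of the Karoubi envelope is a retract of an object with identity idempotent.
Naturality of the exchange along the inclusions reduces to that case, where all the idempotents
disappear. -/
theorem Kar.tensorμ_f (P Q S T : Karoubi C) :
    (tensorμ P Q S T).f =
      ((P.p ⊗ₘ Q.p) ⊗ₘ (S.p ⊗ₘ T.p)) ≫ tensorμ P.X Q.X S.X T.X := by
  have h := congrArg Karoubi.Hom.f (tensorμ_natural (Karoubi.decompId_i P) (Karoubi.decompId_i Q)
    (Karoubi.decompId_i S) (Karoubi.decompId_i T))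
  rw [Karoubi.comp_f, Karoubi.comp_f] at h
  refine (Karoubi.comp_p (tensorμ P Q S T)).symm.trans (h.symm.trans ?_)
  exact congrArg (_ ≫ ·) (Kar.toKaroubi_tensorμ_f P.X Q.X S.X T.X)

end karoubi

/-! ### The tensor action as a composite through `r` -/

section tensorY
variable {R : Type u} [CommRing R] {t : R}

/-- The exchange of the two inner factors. -/
def Coef.mu (R : Type*) [CommRing R] (t : R) (X Y Z W : Shape) :
    Coef R ((X.tensor Y).tensor (Z.tensor W)) ((X.tensor Z).tensor (Y.tensor W)) :=
  tensorμ (C := Del R t) X Y Z W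

theorem Coef.mu_eq (t : R) (X Y Z W : Shape) : Coef.mu R t X Y Z W =
    Coef.comp t (Coef.assoc' R X Y (Z.tensor W)) (Coef.comp t (Coef.tensor (Coef.id R X)
      (Coef.assoc' R Y Z W).transpose) (Coef.comp t (Coef.tensor (Coef.id R X)
        (Coef.tensor (Coef.braid R Y Z) (Coef.id R W))) (Coef.comp t (Coef.tensor (Coef.id R X)
          (Coef.assoc' R Z Y W)) (Coef.assoc' R X Z (Y.tensor W)).transpose))) := rfl

@[simp] theorem Coef.map_mu {S : Type u} [CommRing S] (φ : R →+* S) :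
    (Coef.mu R t X Y Z W).map φ = Coef.mu S (φ t) X Y Z W := by
  rw [Coef.mu_eq, Coef.mu_eq]
  simp

theorem ev_mu_comp {n : ℕ} (g : Coef R ((X.tensor Z).tensor (Y.tensor W)) X') (a : X.Pt n)
    (b : Y.Pt n) (c : Z.Pt n) (d : W.Pt n) (w : X'.Pt n) :
    ev n (Coef.comp (n : R) (Coef.mu R (n : R) X Y Z W) g) (pair (pair a b) (pair c d)) w =
      ev n g (pair (pair a c) (pair b d)) w := by
  rw [Coef.mu_eq]
  rw [((isPtMap_assoc (R := R)).comp ((isPtMap_id.tensor isPtMap_assoc_transpose).comp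
    ((isPtMap_id.tensor (isPtMap_braid.tensor isPtMap_id)).comp
    ((isPtMap_id.tensor isPtMap_assoc).comp isPtMap_assoc_transpose)))).comp_apply]
  simp

/-- At points, `r` doubles the parameter and the exchange hands one copy to each factor. -/
theorem Coef.hmul_transpose_mu_tensor (t : R) (f : Coef R (Shape.point.tensor X) X')
    (g : Coef R (Shape.point.tensor Y) Y') :
    Coef.comp t (Coef.tensor (Coef.hmul R).transpose (Coef.id R (X.tensor Y)))
      (Coef.comp t (Coef.mu R t Shape.point Shape.point X Y) (Coef.tensor f g)) =
    Coef.tensorFam f g := by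
  refine Coef.natural_eq₂
    (F := fun R _ t f g => Coef.comp t (Coef.tensor (Coef.hmul R).transpose
      (Coef.id R (X.tensor Y)))
      (Coef.comp t (Coef.mu R t Shape.point Shape.point X Y) (Coef.tensor f g)))
    (G := fun R _ t f g => Coef.tensorFam f g) ?_ ?_ ?_ t f g
  · intro _ _ _ _ φ t f g; simp
  · intro _ _ _ _ φ t f g; simp
  · simp only [forall_pair]
    intros
    rw [((isPtMap_hmul_transpose).tensor isPtMap_id).comp_apply]
    simp [ev_mu_comp, ev_tensor_pair]

theorem Coef.tensor_mu (t : R) (f : Coef R X X') (g : Coef R Y Y') (f' : Coef R Z Z')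
    (g' : Coef R W Q) :
    Coef.comp t (Coef.tensor (Coef.tensor f g) (Coef.tensor f' g')) (Coef.mu R t _ _ _ _) =
      Coef.comp t (Coef.mu R t _ _ _ _) (Coef.tensor (Coef.tensor f f') (Coef.tensor g g')) :=
  tensorμ_natural (C := Del R t) (X₁ := X) (Y₁ := X') (X₂ := Y) (Y₂ := Y') (U₁ := Z) (V₁ := Z')
    (U₂ := W) (V₂ := Q) f g f' g'

/-- The version with the idempotents of the Karoubi envelope: they slide through the exchange by
naturality and are absorbed by `f` and `g`. -/
theorem Coef.tensorY_eq {p : Coef R X X} {q : Coef R Y Y} {f : Coef R (Shape.point.tensor X) X'}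
    {g : Coef R (Shape.point.tensor Y) Y'}
    (hf : Coef.comp t (Coef.tensor (Coef.id R Shape.point) p) f = f)
    (hg : Coef.comp t (Coef.tensor (Coef.id R Shape.point) q) g = g) :
    Coef.comp t (Coef.tensor (Coef.hmul R).transpose (Coef.tensor p q))
      (Coef.comp t (Coef.comp t (Coef.tensor (Coef.tensor (Coef.id R Shape.point)
        (Coef.id R Shape.point)) (Coef.tensor p q)) (Coef.mu R t _ _ _ _)) (Coef.tensor f g)) =
      Coef.tensorFam f g := by
  have h : Coef.comp t (Coef.tensor (Coef.tensor (Coef.id R Shape.point)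
      (Coef.id R Shape.point)) (Coef.tensor p q))
        (Coef.comp t (Coef.mu R t _ _ _ _) (Coef.tensor f g)) =
      Coef.comp t (Coef.mu R t _ _ _ _) (Coef.tensor f g) := by
    rw [← Coef.assoc, Coef.tensor_mu, Coef.assoc, Coef.tensor_comp, hf, hg]
  rw [Coef.id_tensor_id t] at h ⊢
  rw [Coef.assoc, h, Coef.tensor_eq_comp t, Coef.assoc, h,
    Coef.hmul_transpose_mu_tensor]

theorem tensorY_f {V W : RepS R t} (f : (permData R t).h ⊗ V ⟶ V)
    (g : (permData R t).h ⊗ W ⟶ W) :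
    ((permData R t).tensorY f g).f =
      Coef.tensorFam (P := Shape.point) (X := V.X) (Y := W.X) (X' := V.X) (Y' := W.X) f.f g.f := by
  refine Eq.trans ?_ (Coef.tensorY_eq (t := t) (X := V.X) (Y := W.X) (X' := V.X) (Y' := W.X)
    (p := V.p) (q := W.p) (f := f.f) (g := g.f) (Karoubi.p_comp f) (Karoubi.p_comp g))
  exact congrArg (fun x => ((permData R t).comul ▷ (V ⊗ W)).f ≫ x ≫ (f.f ⊗ₘ g.f))
    (Kar.tensorμ_f (permData R t).h (permData R t).h V W)

variable {k A : Type u} [CommRing k] [Algebra k R] [Ring A] [Bialgebra k A]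

/-- The action was defined from `Δ(a)` as an element of `A ⊗ A`, so additivity expands it along any
decomposition into pure tensors. -/
theorem tensorAction_y (M N : WreathRep k R A (permData R t)) (a : A) (m : ℕ) (x z : Fin m → A)
    (h : Coalgebra.comul (R := k) a = ∑ i, x i ⊗ₜ[k] z i) :
    (tensorAction M N).y a = ∑ i, (permData R t).tensorY (M.act.y (x i)) (N.act.y (z i)) := by
  refine Karoubi.hom_ext _ _ ?_
  -- Passing from morphisms of the Karoubi envelope to their coefficients is additive.
  have h1 : (∑ i, (permData R t).tensorY (M.act.y (x i)) (N.act.y (z i))).f =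
      ∑ i, ((permData R t).tensorY (M.act.y (x i)) (N.act.y (z i))).f :=
    _root_.map_sum (Karoubi.inclusionHom _ _) _ _
  rw [h1]
  simp only [tensorY_f]
  change Coef.tensorSL _ _ (Coalgebra.comul (R := k) a) = _
  rw [h]
  exact _root_.map_sum (Coef.tensorSL (X := M.V.X) (Y := N.V.X)
    (M.act.coefAction.toSL (X := M.V.X)) (N.act.coefAction.toSL (X := N.V.X))) _ _

theorem unitAction_y (a : A) : (unitAction (k := k) (R := R) (A := A) (t := t)).y a =
    algebraMap k R (Coalgebra.counit a) •
      ((permData R t).aug ▷ 𝟙_ (RepS R t) ≫ (λ_ (𝟙_ (RepS R t))).hom) :=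
  Karoubi.hom_ext _ _ (congrArg (algebraMap k R (Coalgebra.counit a) • ·)
    (Coef.one_eq (p := Coef.id R Shape.unit) (Coef.id_comp t _)).symm)

section
variable (L : MonoidalLift k R A (permData R t))

/-- The tensor product and the sum of equivariant morphisms are those of the underlying morphisms,
so bilinearity is inherited from `Rep(S_t, R)`. -/
theorem MonoidalLift.monoidalPreadditive : letI := L.monoidal
    MonoidalPreadditive (WreathRep k R A (permData R t)) :=
  letI := L.monoidal
  { whiskerLeft_zero := Subtype.ext (MonoidalPreadditive.whiskerLeft_zero (C := RepS R t))
    zero_whiskerRight := Subtype.ext (MonoidalPreadditive.zero_whiskerRight (C := RepS R t))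
    whiskerLeft_add f g := Subtype.ext (MonoidalPreadditive.whiskerLeft_add f.1 g.1)
    add_whiskerRight f g := Subtype.ext (MonoidalPreadditive.add_whiskerRight f.1 g.1) }

theorem MonoidalLift.monoidalLinear : letI := L.monoidal
    letI := L.monoidalPreadditive
    MonoidalLinear R (WreathRep k R A (permData R t)) :=
  letI := L.monoidal
  letI := L.monoidalPreadditive
  { whiskerLeft_smul M _ _ c f := Subtype.ext (MonoidalLinear.whiskerLeft_smul M.V c f.1)
    smul_whiskerRight c _ _ f M := Subtype.ext (MonoidalLinear.smul_whiskerRight c f.1 M.V) }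

end

end tensorY

end

section

open Idempotents TensorProduct

variable {X Y Z W X' Y' Z' P Q : Shape}

/-! ### Duals -/

section dual
variable {R : Type u} [CommRing R] {t : R}

/-- In a zigzag the sums over intermediate points are matrix multiplications. The arbitrary
endomorphisms leave room for the idempotents of the Karoubi envelope. -/
theorem Coef.cup_assoc_cap (t : R) (f : Coef R X X) (g : Coef R X X) (h : Coef R X X)
    (l : Coef R X X) :
    Coef.comp t (Coef.tensor (Coef.cup g) f) (Coef.comp t (Coef.assoc' R X X X)
      (Coef.tensor l (Coef.cap h))) =
    Coef.comp t (Coef.lunit R X) (Coef.comp t (Coef.comp t f (Coef.comp t h (Coef.comp t g l)))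
      (Coef.runit R X).transpose) := by
  refine Coef.natural_eq₄
    (F := fun R _ t f g h l => Coef.comp t (Coef.tensor (Coef.cup g) f)
      (Coef.comp t (Coef.assoc' R X X X) (Coef.tensor l (Coef.cap h))))
    (G := fun R _ t f g h l => Coef.comp t (Coef.lunit R X)
      (Coef.comp t (Coef.comp t f (Coef.comp t h (Coef.comp t g l))) (Coef.runit R X).transpose))
    ?_ ?_ ?_ t f g h l
  · intro _ _ _ _ φ t f g h l; simp
  · intro _ _ _ _ φ t f g h l; simp
  · simp only [forall_pair]
    intro R _ n f g h l z v v' z'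
    rw [isPtMap_lunit.comp_apply, ev_comp_apply, ev_comp_apply]
    simp only [sum_pair, ev_assoc_comp, ev_tensor_pair, ev_cup, ev_cap, lunitPt_pair, ev_transpose,
      isPtMap_runit _ _, runitPt_pair, mul_ite, mul_one, mul_zero, Finset.sum_ite_eq,
      Finset.mem_univ, if_true]
    simp only [ev_comp_apply, Finset.mul_sum]
    rw [Finset.sum_comm]
    conv_rhs => rw [Finset.sum_comm]
    refine Finset.sum_congr rfl fun _ _ => ?_
    rw [Finset.sum_comm]
    exact Finset.sum_congr rfl fun _ _ => Finset.sum_congr rfl fun _ _ => by ring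

/-- In the mirror zigzag the matrices of the cap and the cup are traversed in the opposite
direction, hence the transposes. -/
theorem Coef.cup_assoc_transpose_cap (t : R) (f : Coef R X X) (g : Coef R X X) (h : Coef R X X)
    (l : Coef R X X) :
    Coef.comp t (Coef.tensor f (Coef.cup g)) (Coef.comp t (Coef.assoc' R X X X).transpose
      (Coef.tensor (Coef.cap h) l)) =
    Coef.comp t (Coef.runit R X) (Coef.comp t (Coef.comp t f (Coef.comp t h.transpose
      (Coef.comp t g.transpose l))) (Coef.lunit R X).transpose) := by
  refine Coef.natural_eq₄
    (F := fun R _ t f g h l => Coef.comp t (Coef.tensor f (Coef.cup g))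
      (Coef.comp t (Coef.assoc' R X X X).transpose (Coef.tensor (Coef.cap h) l)))
    (G := fun R _ t f g h l => Coef.comp t (Coef.runit R X)
      (Coef.comp t (Coef.comp t f (Coef.comp t h.transpose (Coef.comp t g.transpose l)))
        (Coef.lunit R X).transpose))
    ?_ ?_ ?_ t f g h l
  · intro _ _ _ _ φ t f g h l; simp
  · intro _ _ _ _ φ t f g h l; simp
  · simp only [forall_pair]
    intro R _ n f g h l v z z' v'
    rw [isPtMap_runit.comp_apply, ev_comp_apply, ev_comp_apply]
    simp only [sum_pair, isPtMap_assoc_transpose.comp_apply, assocPt_symm_pair, ev_tensor_pair,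
      ev_cup, ev_cap, runitPt_pair, ev_transpose, isPtMap_lunit _ _, lunitPt_pair, mul_ite,
      mul_one, mul_zero, Finset.sum_ite_eq, Finset.mem_univ, if_true]
    simp only [ev_comp_apply, ev_transpose, Finset.mul_sum]
    exact Finset.sum_congr rfl fun _ _ => Finset.sum_congr rfl fun _ _ =>
      Finset.sum_congr rfl fun _ _ => by ring

variable {k A : Type u} [CommRing k] [Algebra k R] [Ring A]
variable {p p' : Coef R X X} {y y' : A → Coef R (Shape.point.tensor X) X}

section
variable [Algebra k A]

/-- The object with given coefficients. -/
def CoefAction.rep (h : CoefAction t p k y) (hp : Coef.comp t p p = p) :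
    WreathRep k R A (permData R t) :=
  ⟨⟨X, p, hp⟩, CoefAction.act (V := ⟨X, p, hp⟩) h⟩

/-- Transposition reverses products and `σ` reverses them back. Off-diagonal commutation is
symmetric in the two operators and survives transposition. The map `σ` will be the antipode for
right duals and its inverse for left duals. -/
theorem CoefAction.dual (h : CoefAction t p k y) (σ : A →ₗ[k] A) (h1 : σ 1 = 1)
    (hm : ∀ a b, σ (a * b) = σ b * σ a) :
    CoefAction t p.transpose k fun a => Coef.adj (y (σ a)) where
  left a := by rw [Coef.transpose_comp_adj, h.right]
  right a := by rw [Coef.adj_comp_transpose, h.left]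
  add a b := by
    rw [_root_.map_add, h.add]
    exact _root_.map_add (Coef.adjₗ R _ _ _) _ _
  smul c a := by
    rw [_root_.map_smul, h.smul]
    exact _root_.map_smul (Coef.adjₗ R _ _ _) _ _
  one := by rw [h1, h.one, Coef.adj_const]
  mul a b := by rw [Coef.conv_adj, h.mul, hm]
  comm a b := by
    rw [Coef.yy₂_adj, Coef.yy₂_adj, Coef.pull_braid_adj, Coef.pull_braid_pull_braid,
      Coef.off_adj, Coef.off_adj, h.comm]

end

variable [HopfAlgebra k A]

/-- Moving the transposed action across the pairing turns `a ⊗ b` into the action of `S(a) b`. -/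
theorem CoefAction.tensorSL_cap (h : CoefAction t p k y) (h' : CoefAction t p' k y')
    (H : ∀ a, y' a = Coef.adj (y (HopfAlgebra.antipode k a))) (u : A ⊗[k] A) :
    Coef.comp t (Coef.tensorSL h'.toSL h.toSL u) (Coef.cap p) =
      Coef.capFam (h.toSL (LinearMap.mul' k A ((HopfAlgebra.antipode k).rTensor A u))) := by
  rw [← Coef.compₗ_flip_apply]
  induction u with
  | zero => simp only [_root_.map_zero]; exact (_root_.map_zero (Coef.capFamₗ R _ _ _)).symm
  | add u v hu hv =>
    simp only [_root_.map_add, hu, hv]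
    exact (_root_.map_add (Coef.capFamₗ R _ _ _) _ _).symm
  | tmul a b =>
    refine (congrArg (fun x => Coef.comp t (Coef.tensorFam x (y b)) (Coef.cap p)) (H a)).trans ?_
    rw [Coef.tensorFam_adj_cap, h.right, h.mul]
    rfl

/-- For the copairing, `a ⊗ b` becomes the action of `a S(b)`. -/
theorem CoefAction.cup_tensorSL (h : CoefAction t p k y) (h' : CoefAction t p' k y')
    (H : ∀ a, y' a = Coef.adj (y (HopfAlgebra.antipode k a))) (u : A ⊗[k] A) :
    Coef.comp t (Coef.tensor (Coef.id R Shape.point) (Coef.cup p))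
        (Coef.tensorSL h.toSL h'.toSL u) =
      Coef.cupFam (h.toSL (LinearMap.mul' k A ((HopfAlgebra.antipode k).lTensor A u))) := by
  rw [← Coef.compₗ_apply]
  induction u with
  | zero => simp only [_root_.map_zero]; exact (_root_.map_zero (Coef.cupFamₗ R _ _ _)).symm
  | add u v hu hv =>
    simp only [_root_.map_add, hu, hv]
    exact (_root_.map_add (Coef.cupFamₗ R _ _ _) _ _).symm
  | tmul a b =>
    refine (congrArg (fun x => Coef.comp t _ (Coef.tensorFam (y a) x)) (H b)).trans ?_
    rw [Coef.cup_tensorFam_adj, h.right, h.mul]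
    rfl

theorem CoefAction.toSL_algebraMap (h : CoefAction t p k y) (c : k) :
    h.toSL (algebraMap k A c) = algebraMap k R c • Coef.const t p := by
  rw [Algebra.algebraMap_eq_smul_one, LinearMap.map_smulₛₗ, ← h.one]
  rfl

/-- Invariance of the evaluation is the antipode axiom for `S(a₁) a₂`. -/
theorem CoefAction.comp_cap (h : CoefAction t p k y) (h' : CoefAction t p' k y')
    (H : ∀ a, y' a = Coef.adj (y (HopfAlgebra.antipode k a))) (a : A) :
    Coef.comp t (Coef.tensor (Coef.id R Shape.point) (Coef.cap p))
        (algebraMap k R (Coalgebra.counit a) • Coef.const t (Coef.id R Shape.unit)) =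
      Coef.comp t (Coef.tensorSL h'.toSL h.toSL (Coalgebra.comul (R := k) a)) (Coef.cap p) := by
  rw [CoefAction.tensorSL_cap h h' H, HopfAlgebra.mul_antipode_rTensor_comul_apply,
    h.toSL_algebraMap, Coef.comp_smul, Coef.cap_comp_const]
  exact (_root_.map_smul (Coef.capFamₗ R _ _ _) _ _).symm

/-- Invariance of the coevaluation is the antipode axiom for `a₁ S(a₂)`. -/
theorem CoefAction.comp_cup (h : CoefAction t p k y) (h' : CoefAction t p' k y')
    (H : ∀ a, y' a = Coef.adj (y (HopfAlgebra.antipode k a))) (a : A) :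
    Coef.comp t (Coef.tensor (Coef.id R Shape.point) (Coef.cup p))
        (Coef.tensorSL h.toSL h'.toSL (Coalgebra.comul (R := k) a)) =
      Coef.comp t (algebraMap k R (Coalgebra.counit a) • Coef.const t (Coef.id R Shape.unit))
        (Coef.cup p) := by
  rw [CoefAction.cup_tensorSL h h' H, HopfAlgebra.mul_antipode_lTensor_comul_apply,
    h.toSL_algebraMap, Coef.smul_comp, Coef.const_comp_cup]
  exact _root_.map_smul (Coef.cupFamₗ R _ _ _) _ _

theorem Coef.comp_transpose_self (hp : Coef.comp t p p = p) :
    Coef.comp t p.transpose p.transpose = p.transpose := by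
  rw [← Coef.comp_transpose, hp]

/-- An endomorphism slides around the cup and becomes its transpose on the other leg. -/
theorem Coef.cup_comp_tensor (t : R) (f : Coef R X X) (g : Coef R X X) (h : Coef R X X) :
    Coef.comp t (Coef.cup f) (Coef.tensor g h) =
      Coef.cup (Coef.comp t h.transpose (Coef.comp t f g)) := by
  refine Coef.natural_eq₃
    (F := fun R _ t f g h => Coef.comp t (Coef.cup f) (Coef.tensor g h))
    (G := fun R _ t f g h => Coef.cup (Coef.comp t h.transpose (Coef.comp t f g)))
    ?_ ?_ ?_ t f g h
  · intro _ _ _ _ φ t f g h; simp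
  · intro _ _ _ _ φ t f g h; simp
  · simp only [forall_pair]
    intro R _ n f g h z v w
    rw [ev_cup, ev_comp_apply, ev_comp_apply]
    simp only [sum_pair, ev_tensor_pair, ev_cup, ev_transpose, ev_comp_apply, Finset.mul_sum]
    rw [Finset.sum_comm]
    exact Finset.sum_congr rfl fun _ _ => Finset.sum_congr rfl fun _ _ => by ring

theorem Coef.tensor_comp_cap (t : R) (f : Coef R X X) (g : Coef R X X) (h : Coef R X X) :
    Coef.comp t (Coef.tensor g h) (Coef.cap f) =
      Coef.cap (Coef.comp t h (Coef.comp t f g.transpose)) := by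
  refine Coef.natural_eq₃
    (F := fun R _ t f g h => Coef.comp t (Coef.tensor g h) (Coef.cap f))
    (G := fun R _ t f g h => Coef.cap (Coef.comp t h (Coef.comp t f g.transpose)))
    ?_ ?_ ?_ t f g h
  · intro _ _ _ _ φ t f g h; simp
  · intro _ _ _ _ φ t f g h; simp
  · simp only [forall_pair]
    intro R _ n f g h v w z
    rw [ev_cap, ev_comp_apply, ev_comp_apply]
    simp only [sum_pair, ev_tensor_pair, ev_cap, ev_transpose, ev_comp_apply, Finset.mul_sum]
    rw [Finset.sum_comm]
    exact Finset.sum_congr rfl fun _ _ => Finset.sum_congr rfl fun _ _ => by ring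

/-- The pairing of an object with its dual. -/
abbrev CoefAction.exactPairing (h : CoefAction t p k y) (h' : CoefAction t p' k y')
    (hp : Coef.comp t p p = p) (hp' : Coef.comp t p' p' = p') (e : p' = p.transpose)
    (H : ∀ a, y' a = Coef.adj (y (HopfAlgebra.antipode k a))) :
    letI := (monoidalLift (k := k) (R := R) (A := A) (t := t)).monoidal
    ExactPairing (h.rep hp) (h'.rep hp') :=
  have et : p'.transpose = p := by rw [e, Coef.transpose_transpose]
  -- The two legs carry `p` and its transpose. Sliding the second one around the cup makes it `p`
  -- again, so both idempotents are absorbed.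
  have h1 : Coef.comp t (Coef.cup p) (Coef.tensor p p') = Coef.cup p := by
    rw [Coef.cup_comp_tensor, et, hp, hp]
  have h2 : Coef.comp t (Coef.tensor p' p) (Coef.cap p) = Coef.cap p := by
    rw [Coef.tensor_comp_cap, et, hp, hp]
  letI := (monoidalLift (k := k) (R := R) (A := A) (t := t)).monoidal
  { coevaluation' := ⟨⟨Coef.cup p, by
      change Coef.comp t (Coef.id R _) (Coef.comp t (Coef.cup p) (Coef.tensor p p')) = Coef.cup p
      rw [Coef.id_comp, h1]⟩, mem_equivariant_iff.2 fun a => CoefAction.comp_cup h h' H a⟩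
    evaluation' := ⟨⟨Coef.cap p, by
      change Coef.comp t (Coef.tensor p' p) (Coef.comp t (Coef.cap p) (Coef.id R _)) = Coef.cap p
      rw [Coef.comp_id, h2]⟩, mem_equivariant_iff.2 fun a => CoefAction.comp_cap h h' H a⟩
    coevaluation_evaluation' := Subtype.ext <| Karoubi.hom_ext _ _ <| by
      -- In coefficients, both sides reduce to the idempotent `p'` framed by the unit constraints.
      change Coef.comp t (Coef.tensor p' (Coef.cup p)) (Coef.comp t (Coef.comp t
        (Coef.tensor p' (Coef.tensor p p')) (Coef.assoc' R X X X).transpose)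
        (Coef.tensor (Coef.cap p) p')) = Coef.comp t (Coef.comp t
          (Coef.tensor p' (Coef.id R Shape.unit)) (Coef.runit R X))
          (Coef.comp t p' (Coef.lunit R X).transpose)
      rw [Coef.runit_naturality, Coef.assoc, ← Coef.assoc, Coef.tensor_comp, h1, hp',
        Coef.cup_assoc_transpose_cap, ← e, hp', hp', hp', Coef.assoc t (Coef.runit R X),
        ← Coef.assoc t p' p', hp']
    evaluation_coevaluation' := Subtype.ext <| Karoubi.hom_ext _ _ <| by
      change Coef.comp t (Coef.tensor (Coef.cup p) p) (Coef.comp t (Coef.comp t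
        (Coef.tensor (Coef.tensor p p') p) (Coef.assoc' R X X X))
        (Coef.tensor p (Coef.cap p))) = Coef.comp t (Coef.comp t
          (Coef.tensor (Coef.id R Shape.unit) p) (Coef.lunit R X))
          (Coef.comp t p (Coef.runit R X).transpose)
      rw [Coef.lunit_naturality, Coef.assoc, ← Coef.assoc, Coef.tensor_comp, h1, hp,
        Coef.cup_assoc_cap, hp, hp, hp, Coef.assoc t (Coef.lunit R X), ← Coef.assoc t p p, hp] }

variable (k R A t) in
-- The dual of the image of `p` is the image of the transpose of `p`, with the transposed action
-- twisted by the antipode.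
theorem nonempty_rightRigidCategory :
    letI := (monoidalLift (k := k) (R := R) (A := A) (t := t)).monoidal
    Nonempty (RightRigidCategory (WreathRep k R A (permData R t))) :=
  letI := (monoidalLift (k := k) (R := R) (A := A) (t := t)).monoidal
  ⟨{ rightDual := fun M =>
      have hM := M.act.coefAction
      have hp : Coef.comp (X := M.V.X) (Y := M.V.X) (Z := M.V.X) t M.V.p M.V.p = M.V.p := M.V.idem
      have hp' : Coef.comp t (Coef.transpose (X := M.V.X) (Y := M.V.X) M.V.p)
          (Coef.transpose (X := M.V.X) (Y := M.V.X) M.V.p) = _ := Coef.comp_transpose_self hp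
      have hd := hM.dual (HopfAlgebra.antipode k) HopfAlgebra.antipode_one
        HopfAlgebra.antipode_mul_antidistrib
      letI : ExactPairing M (hd.rep hp') :=
        CoefAction.exactPairing hM hd hp hp' rfl fun _ => rfl
      ⟨hd.rep hp'⟩ }⟩

variable (k R A t) in
theorem nonempty_rigidCategory (hA : Function.Bijective (HopfAlgebra.antipode k (A := A))) :
    letI := (monoidalLift (k := k) (R := R) (A := A) (t := t)).monoidal
    Nonempty (RigidCategory (WreathRep k R A (permData R t))) :=
  letI := (monoidalLift (k := k) (R := R) (A := A) (t := t)).monoidal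
  let S := LinearEquiv.ofBijective (HopfAlgebra.antipode k (A := A)) hA
  have hS : ∀ a, HopfAlgebra.antipode k (S.symm a) = a := S.apply_symm_apply
  have h1 : S.symm 1 = 1 := by
    rw [LinearEquiv.symm_apply_eq]
    exact HopfAlgebra.antipode_one.symm
  have hm : ∀ a b, S.symm (a * b) = S.symm b * S.symm a := fun a b => by
    rw [LinearEquiv.symm_apply_eq]
    refine Eq.trans ?_ (HopfAlgebra.antipode_mul_antidistrib _ _).symm
    rw [hS, hS]
  have ⟨hr⟩ := nonempty_rightRigidCategory R t k A
  ⟨{ toRightRigidCategory := hr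
     toLeftRigidCategory :=
      { leftDual := fun M =>
          have hM := M.act.coefAction
          have hp : Coef.comp (X := M.V.X) (Y := M.V.X) (Z := M.V.X) t M.V.p M.V.p = M.V.p := M.V.idem
          have hp' : Coef.comp t (Coef.transpose (X := M.V.X) (Y := M.V.X) M.V.p)
              (Coef.transpose (X := M.V.X) (Y := M.V.X) M.V.p) = _ :=
            Coef.comp_transpose_self hp
          have hd := hM.dual S.symm.toLinearMap h1 hm
          -- Now the dual is the first member of the pairing, so the action on `M` has to be the
          -- transpose of the action of `S(a)` on the dual. It is, because `S⁻¹(S(a)) = a` and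
          -- transposing twice gives back the family.
          letI : ExactPairing (hd.rep hp') M :=
            CoefAction.exactPairing hd hM hp' hp (Coef.transpose_transpose _).symm fun a =>
              (congrArg (fun a => (M.act.y a).f) (S.symm_apply_apply a).symm).trans
                (Coef.adj_adj (X := M.V.X) (Y := M.V.X) _).symm
          ⟨hd.rep hp'⟩ } }⟩

end dual

end

section

open Idempotents TensorProduct

variable {X Y Z W X' Y' Z' P Q : Shape}

/-! ### Families of maps of permutation modules -/

section values
variable {k : Type u} [CommRing k] {n : ℕ}

theorem evLin_apply (f : Coef k X Y) (v : X.Pt n → k) (w : Y.Pt n) :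
    evLin n f v w = ∑ z, v z * ev n f z w := rfl

theorem evLin_id (v : X.Pt n → k) : evLin n (Coef.id k X) v = v := by
  ext w
  simp [evLin_apply, ev_id_apply]

/-- The basis vector `e_i` of the permutation representation. -/
def pointPt (i : Fin n) : Shape.point.Pt n :=
  ⟨(0 : Fin 1), ⟨fun _ => i, fun x y _ => Subsingleton.elim (α := Fin 1) x y⟩⟩

theorem eq_pointPt_iff (z : Shape.point.Pt n) (i : Fin n) :
    z = pointPt i ↔ z.2 (0 : Fin 1) = i := by
  constructor
  · rintro rfl
    rfl
  · obtain ⟨j, u⟩ := z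
    rintro rfl
    obtain rfl : j = (0 : Fin 1) := Subsingleton.elim (α := Fin 1) _ _
    refine congrArg (Sigma.mk _) (Function.Embedding.ext fun x => ?_)
    exact congrArg u (Subsingleton.elim (α := Fin 1) _ _)

theorem pointPt_injective : Function.Injective (pointPt (n := n)) := fun i j h =>
  (eq_pointPt_iff (pointPt i) j).1 h

theorem insertPt_pair (i : Fin n) (v : X.Pt n → k) (z : Shape.point.Pt n) (u : X.Pt n) :
    insertPt i v (pair z u) = if z = pointPt i then v u else 0 := by
  rw [insertPt, ptEquiv_pair]
  exact if_congr (eq_pointPt_iff z i).symm rfl rfl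

/-- The member at `e_i` of a family of maps. -/
def famLin (f : Coef k (Shape.point.tensor X) Y) (i : Fin n) : (X.Pt n → k) →ₗ[k] (Y.Pt n → k) :=
  (Matrix.of fun v w => ev n f (pair (pointPt i) v) w).vecMulLinear

theorem famLin_apply (f : Coef k (Shape.point.tensor X) Y) (i : Fin n) (v : X.Pt n → k)
    (w : Y.Pt n) : famLin f i v w = ∑ u, v u * ev n f (pair (pointPt i) u) w := rfl

/-- The action `v ↦ y_a(e_i ⊗ v)` prescribed by the interpolation is the member at `e_i` of the
family `y_a`. -/
theorem evLin_insertPt (f : Coef k (Shape.point.tensor X) Y) (i : Fin n) (v : X.Pt n → k) :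
    evLin n f (insertPt i v) = famLin f i v := by
  ext w
  simp [evLin_apply, famLin_apply, sum_pair, insertPt_pair]

theorem famLin_add (f g : Coef k (Shape.point.tensor X) Y) (i : Fin n) :
    famLin (f + g) i = famLin f i + famLin g i := by
  ext v w
  simp [famLin_apply, ev_add, mul_add, Finset.sum_add_distrib]

theorem famLin_smul (c : k) (f : Coef k (Shape.point.tensor X) Y) (i : Fin n) :
    famLin (c • f) i = c • famLin f i := by
  ext v w
  simp [famLin_apply, ev_smul, Finset.mul_sum, mul_left_comm]

theorem famLin_const (f : Coef k X Y) (i : Fin n) :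
    famLin (Coef.const (n : k) f) i = evLin n f := by
  ext v w
  simp [famLin_apply, evLin_apply]

theorem famLin_comp (f : Coef k (Shape.point.tensor X) Y) (g : Coef k Y Z) (i : Fin n)
    (v : X.Pt n → k) : famLin (Coef.comp (n : k) f g) i v = evLin n g (famLin f i v) := by
  rw [← evLin_insertPt, evLin_comp, evLin_insertPt]

theorem famLin_tensor_comp (f : Coef k X Y) (g : Coef k (Shape.point.tensor Y) Z) (i : Fin n)
    (v : X.Pt n → k) :
    famLin (Coef.comp (n : k) (Coef.tensor (Coef.id k Shape.point) f) g) i v =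
      famLin g i (evLin n f v) := by
  ext w
  simp only [famLin_apply, ev_tensor_id_comp, evLin_apply, Finset.mul_sum, Finset.sum_mul]
  rw [Finset.sum_comm]
  exact Finset.sum_congr rfl fun _ _ => Finset.sum_congr rfl fun _ _ => by ring

theorem famLin_conv (f g : Coef k (Shape.point.tensor X) X) (i : Fin n) (v : X.Pt n → k) :
    famLin (Coef.conv (n : k) f g) i v = famLin f i (famLin g i v) := by
  ext w
  simp only [famLin_apply, ev_conv, Finset.mul_sum, Finset.sum_mul]
  rw [Finset.sum_comm]
  exact Finset.sum_congr rfl fun _ _ => Finset.sum_congr rfl fun _ _ => by ring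

theorem famLin_famLin (f g : Coef k (Shape.point.tensor X) X) (i j : Fin n) (v : X.Pt n → k)
    (w : X.Pt n) : famLin f i (famLin g j v) w =
      ∑ u, v u * ev n (Coef.yy₂ (n : k) f g) (pair (pair (pointPt i) (pointPt j)) u) w := by
  simp only [famLin_apply, ev_yy₂, Finset.mul_sum, Finset.sum_mul]
  rw [Finset.sum_comm]
  exact Finset.sum_congr rfl fun _ _ => Finset.sum_congr rfl fun _ _ => by ring

/-- Off-diagonal commutation, read at the point `(e_i, e_j)` with `i ≠ j`, is the commutation of the
`i`-th and `j`-th tensor factors `A`. -/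
theorem famLin_comm {f g : Coef k (Shape.point.tensor X) X}
    (h : Coef.off (Coef.yy₂ (n : k) f g) =
      Coef.off (Coef.pull (n : k) (Coef.braid k _ _) (Coef.yy₂ (n : k) g f))) {i j : Fin n}
    (hij : i ≠ j) (v : X.Pt n → k) : famLin f i (famLin g j v) = famLin g j (famLin f i v) := by
  ext w
  rw [famLin_famLin, famLin_famLin]
  refine Finset.sum_congr rfl fun u _ => congrArg (v u * ·) ?_
  have := congrArg (fun F => ev n F (pair (pair (pointPt i) (pointPt j)) u) w) h
  simpa [pointPt_injective.eq_iff, hij] using this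

/-! ### The action of the symmetric group -/

/-- The action of the symmetric group on a permutation module. -/
def permLin (k : Type u) [CommRing k] (X : Shape) (n : ℕ) :
    Equiv.Perm (Fin n) →* Module.End k (X.Pt n → k) where
  toFun σ := LinearMap.funLeft k k (permPt σ⁻¹)
  map_one' := rfl
  map_mul' σ τ := by rw [mul_inv_rev]; rfl

theorem permLin_apply (σ : Equiv.Perm (Fin n)) (v : X.Pt n → k) (z : X.Pt n) :
    permLin k X n σ v z = v (permPt σ⁻¹ z) := rfl

theorem ev_permPt {R : Type*} (σ : Equiv.Perm (Fin n)) (f : Coef R X Y) (z : X.Pt n) (w : Y.Pt n) :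
    ev n f (permPt σ z) (permPt σ w) = ev n f z w := ev_mapPt σ.toEmbedding f z w

/-- The action of a permutation on points. -/
def permPtEquiv (X : Shape) (σ : Equiv.Perm (Fin n)) : X.Pt n ≃ X.Pt n where
  toFun := permPt σ
  invFun := permPt σ⁻¹
  left_inv z := congrArg (Sigma.mk z.1) (Function.Embedding.ext fun _ => σ.symm_apply_apply _)
  right_inv z := congrArg (Sigma.mk z.1) (Function.Embedding.ext fun _ => σ.apply_symm_apply _)

theorem permPt_pair (σ : Equiv.Perm (Fin n)) (a : X.Pt n) (b : Y.Pt n) :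
    permPt σ (pair a b) = pair (permPt σ a) (permPt σ b) := mapPt_pair σ.toEmbedding a b

theorem permLin_evLin (σ : Equiv.Perm (Fin n)) (f : Coef k X Y) (v : X.Pt n → k) :
    permLin k Y n σ (evLin n f v) = evLin n f (permLin k X n σ v) := by
  ext w
  rw [permLin_apply, evLin_apply, evLin_apply, ← (permPtEquiv X σ⁻¹).sum_comp]
  exact Finset.sum_congr rfl fun z _ => congrArg (_ * ·) (ev_permPt σ⁻¹ f z w)

/-- The matrix of the family is invariant when the parameter `e_i` is permuted together with the
other arguments. This gives the relation between the action of `S_n` and the tensor factors. -/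
theorem permLin_famLin (σ : Equiv.Perm (Fin n)) (f : Coef k (Shape.point.tensor X) Y) (i : Fin n)
    (v : X.Pt n → k) :
    permLin k Y n σ (famLin f i v) = famLin f (σ i) (permLin k X n σ v) := by
  ext w
  rw [permLin_apply, famLin_apply, famLin_apply, ← (permPtEquiv X σ⁻¹).sum_comp]
  refine Finset.sum_congr rfl fun z _ => congrArg (_ * ·) ?_
  have h : permPt σ⁻¹ (pointPt (σ i)) = pointPt i :=
    (eq_pointPt_iff _ _).2 (σ.symm_apply_apply i)
  rw [← ev_permPt σ⁻¹ f _ w, permPt_pair, h]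
  rfl

/-! ### Tensor products of permutation modules -/

/-- The pure tensors in the permutation module of a tensor product. -/
def tprod (X Y : Shape) (n : ℕ) :
    (X.Pt n → k) →ₗ[k] (Y.Pt n → k) →ₗ[k] ((X.tensor Y).Pt n → k) :=
  LinearMap.mk₂ k (fun v w z => v (ptEquiv X Y n z).1 * w (ptEquiv X Y n z).2)
    (fun _ _ _ => funext fun _ => add_mul _ _ _) (fun _ _ _ => funext fun _ => mul_assoc _ _ _)
    (fun _ _ _ => funext fun _ => mul_add _ _ _) (fun _ _ _ => funext fun _ => mul_left_comm _ _ _)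

theorem tprod_apply (v : X.Pt n → k) (w : Y.Pt n → k) (z : (X.tensor Y).Pt n) :
    tprod X Y n v w z = v (ptEquiv X Y n z).1 * w (ptEquiv X Y n z).2 := rfl

@[simp] theorem tprod_pair (v : X.Pt n → k) (w : Y.Pt n → k) (a : X.Pt n) (b : Y.Pt n) :
    tprod X Y n v w (pair a b) = v a * w b := by
  rw [tprod_apply, ptEquiv_pair]

theorem funext_pair {α : Type*} {f g : (X.tensor Y).Pt n → α}
    (h : ∀ a b, f (pair a b) = g (pair a b)) : f = g :=
  funext (forall_pair.2 h)

theorem evLin_tensor_tprod (f : Coef k X X') (g : Coef k Y Y') (v : X.Pt n → k)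
    (w : Y.Pt n → k) : evLin n (Coef.tensor f g) (tprod X Y n v w) =
      tprod X' Y' n (evLin n f v) (evLin n g w) := by
  refine funext_pair fun a b => ?_
  simp only [evLin_apply, sum_pair, tprod_pair, ev_tensor_pair, Finset.sum_mul_sum]
  exact Finset.sum_congr rfl fun _ _ => Finset.sum_congr rfl fun _ _ => by ring

theorem famLin_tensorFam_tprod (f : Coef k (Shape.point.tensor X) X')
    (g : Coef k (Shape.point.tensor Y) Y') (i : Fin n) (v : X.Pt n → k) (w : Y.Pt n → k) :
    famLin (Coef.tensorFam f g) i (tprod X Y n v w) =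
      tprod X' Y' n (famLin f i v) (famLin g i w) := by
  refine funext_pair fun a b => ?_
  simp only [famLin_apply, sum_pair, tprod_pair, ev_tensorFam, Finset.sum_mul_sum]
  exact Finset.sum_congr rfl fun _ _ => Finset.sum_congr rfl fun _ _ => by ring

theorem IsPtMap.evLin_comp_equiv {f : Coef k X Y} {e : X.Pt n ≃ Y.Pt n} (h : IsPtMap f e)
    (v : X.Pt n → k) (z : X.Pt n) : evLin n f v (e z) = v z := by
  simp [evLin_apply, h _ _]

theorem evLin_assoc_tprod (u : X.Pt n → k) (v : Y.Pt n → k) (w : Z.Pt n → k) :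
    evLin n (Coef.assoc' k X Y Z) (tprod _ Z n (tprod X Y n u v) w) =
      tprod X _ n u (tprod Y Z n v w) := by
  refine funext_pair fun a => forall_pair.2 fun b c => ?_
  rw [← assocPt_pair, isPtMap_assoc.evLin_comp_equiv]
  simp [mul_assoc]

theorem evLin_lunit_tprod (u : Shape.unit.Pt n → k) (v : X.Pt n → k) :
    evLin n (Coef.lunit k X) (tprod _ X n u v) = u default • v := by
  ext z
  rw [← lunitPt_pair default z, isPtMap_lunit.evLin_comp_equiv]
  simp

theorem evLin_runit_tprod (u : Shape.unit.Pt n → k) (v : X.Pt n → k) :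
    evLin n (Coef.runit k X) (tprod X _ n v u) = u default • v := by
  ext z
  rw [← runitPt_pair default z, isPtMap_runit.evLin_comp_equiv]
  simp [mul_comm]

/-! ### Images of idempotents -/

variable {p : Coef k X X} {q : Coef k Y Y}

/-- The image of an endomorphism of a permutation module. -/
abbrev Coef.image (n : ℕ) (p : Coef k X X) : Submodule k (X.Pt n → k) :=
  LinearMap.range (evLin n p)

/-- The image of an idempotent is its set of fixed vectors, which is how membership is used and
proved from here on. -/
theorem Coef.evLin_of_mem_image (hp : Coef.comp (n : k) p p = p) {v : X.Pt n → k}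
    (hv : v ∈ p.image n) : evLin n p v = v := by
  obtain ⟨w, rfl⟩ := hv
  rw [← evLin_comp, hp]

theorem Coef.mem_image_of_eq {v : X.Pt n → k} (hv : evLin n p v = v) : v ∈ p.image n := ⟨v, hv⟩

/-- Pure tensors in the image of an idempotent. -/
def imageTprod (hp : Coef.comp (n : k) p p = p) (hq : Coef.comp (n : k) q q = q) :
    p.image n ⊗[k] q.image n →ₗ[k] (Coef.tensor p q).image n :=
  LinearMap.codRestrict _ (TensorProduct.lift ((tprod X Y n).domRestrict₁₂ _ _)) fun x => by
    induction x with
    | zero => rw [_root_.map_zero]; exact zero_mem _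
    | add x y hx hy => rw [_root_.map_add]; exact add_mem hx hy
    | tmul v w =>
      refine Coef.mem_image_of_eq ?_
      change evLin n _ (tprod X Y n v.1 w.1) = tprod X Y n v.1 w.1
      rw [evLin_tensor_tprod, Coef.evLin_of_mem_image hp v.2, Coef.evLin_of_mem_image hq w.2]

theorem imageTprod_tmul (hp : Coef.comp (n : k) p p = p) (hq : Coef.comp (n : k) q q = q)
    (v : p.image n) (w : q.image n) : (imageTprod hp hq (v ⊗ₜ w)).1 = tprod X Y n v.1 w.1 := rfl

theorem sum_smul_single {X : Shape} (v : X.Pt n → k) : ∑ a, v a • Pi.single a (1 : k) = v := by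
  ext b
  simp [Pi.single_apply]

/-- The image of a tensor product of idempotents is the tensor product of the images. -/
def imageTensorEquiv (hp : Coef.comp (n : k) p p = p) (hq : Coef.comp (n : k) q q = q) :
    p.image n ⊗[k] q.image n ≃ₗ[k] (Coef.tensor p q).image n :=
  LinearEquiv.ofLinearMap (imageTprod hp hq)
    -- The inverse sends the basis vector at the pair `(a, b)` to `p(e_a) ⊗ q(e_b)`.
    (Fintype.linearCombination k (fun z : (X.tensor Y).Pt n =>
        (evLin n p).rangeRestrict (Pi.single (ptEquiv X Y n z).1 1) ⊗ₜ[k]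
          (evLin n q).rangeRestrict (Pi.single (ptEquiv X Y n z).2 1)) ∘ₗ
      ((Coef.tensor p q).image n).subtype)
    (by
      refine LinearMap.ext fun F => Subtype.ext ?_
      -- `F` is fixed by the idempotent `p ⊗ q`, so it is enough to compare with `p ⊗ q` applied to
      -- the expansion of `F` in basis vectors.
      have h : (evLin n (Coef.tensor p q)) F.1 = F.1 :=
        Coef.evLin_of_mem_image (by rw [Coef.tensor_comp, hp, hq]) F.2
      refine Eq.trans ?_ h
      conv_rhs => rw [← sum_smul_single F.1]
      change (Submodule.subtype _ ∘ₗ imageTprod hp hq) (∑ z, _) = _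
      rw [_root_.map_sum, _root_.map_sum]
      refine Finset.sum_congr rfl fun z _ => ?_
      rw [_root_.map_smul, _root_.map_smul]
      refine congrArg (F.1 z • ·) ?_
      change tprod X Y n (evLin n p _) (evLin n q _) = _
      rw [← evLin_tensor_tprod]
      refine congrArg _ ?_
      obtain ⟨a, b, rfl⟩ := exists_pair z
      refine funext_pair fun a' b' => ?_
      rw [tprod_pair, ptEquiv_pair]
      simp only [Pi.single_apply, pair_inj, ite_and]
      split_ifs <;> simp)
    (by
      refine TensorProduct.ext' fun v w => ?_
      change ∑ z, tprod X Y n v.1 w.1 z • _ = _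
      -- Elements of the images are the projections of themselves, so they can be expanded in the
      -- bases of the ambient permutation modules.
      have hv : v = (evLin n p).rangeRestrict v.1 :=
        Subtype.ext (Coef.evLin_of_mem_image hp v.2).symm
      have hw : w = (evLin n q).rangeRestrict w.1 :=
        Subtype.ext (Coef.evLin_of_mem_image hq w.2).symm
      refine Eq.trans ?_ (congrArg₂ (· ⊗ₜ[k] ·) hv hw).symm
      conv_rhs => rw [← sum_smul_single v.1, ← sum_smul_single w.1]
      simp only [_root_.map_sum, _root_.map_smul, TensorProduct.sum_tmul, TensorProduct.tmul_sum,
        sum_pair, tprod_pair, ptEquiv_pair, TensorProduct.smul_tmul', TensorProduct.tmul_smul]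
      rw [Finset.sum_comm]
      refine Finset.sum_congr rfl fun b _ => ?_
      rw [Finset.smul_sum]
      refine Finset.sum_congr rfl fun a _ => ?_
      rw [mul_comm, mul_smul, TensorProduct.smul_tmul'])

end values

end

section

open Idempotents TensorProduct

variable {X Y Z W X' Y' Z' P Q : Shape}

/-! ### The interpolation functor -/

section functor
variable {k A : Type u} [CommRing k] [Ring A] {n : ℕ}
variable {p : Coef k X X} {q : Coef k Y Y}
  {y : A → Coef k (Shape.point.tensor X) X} {y' : A → Coef k (Shape.point.tensor Y) Y}

section algebra
variable [Algebra k A]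

/-- The action of the symmetric group on the image of an endomorphism. -/
def imagePerm (n : ℕ) (p : Coef k X X) :
    Equiv.Perm (Fin n) →* Module.End k (p.image n) where
  toFun σ := (permLin k X n σ).restrict (by
    rintro _ ⟨v, rfl⟩
    exact ⟨permLin k X n σ v, (permLin_evLin σ p v).symm⟩)
  map_one' := rfl
  map_mul' σ τ := LinearMap.ext fun v => Subtype.ext (by
    change permLin k X n (σ * τ) v.1 = permLin k X n σ (permLin k X n τ v.1)
    rw [_root_.map_mul]
    rfl)

theorem CoefAction.famLin_mem (h : CoefAction (n : k) p k y) (i : Fin n) (a : A)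
    (v : X.Pt n → k) : famLin (y a) i v ∈ p.image n :=
  Coef.mem_image_of_eq (by rw [← famLin_comp, h.right])

/-- The action of the `i`-th tensor factor. -/
def CoefAction.imageY (h : CoefAction (n : k) p k y) (hp : Coef.comp (n : k) p p = p)
    (i : Fin n) : A →ₐ[k] Module.End k (p.image n) :=
  AlgHom.ofLinearMap
    { toFun := fun a => (famLin (y a) i).restrict fun v _ => h.famLin_mem i a v
      map_add' := fun a b => LinearMap.ext fun v => Subtype.ext (by
        change famLin (y (a + b)) i v.1 = famLin (y a) i v.1 + famLin (y b) i v.1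
        rw [h.add, famLin_add]
        rfl)
      map_smul' := fun c a => LinearMap.ext fun v => Subtype.ext (by
        change famLin (y (c • a)) i v.1 = c • famLin (y a) i v.1
        rw [h.smul, famLin_smul]
        rfl) }
    (LinearMap.ext fun v => Subtype.ext (by
      change famLin (y 1) i v.1 = v.1
      rw [h.one, famLin_const, Coef.evLin_of_mem_image hp v.2]))
    (fun a b => LinearMap.ext fun v => Subtype.ext (by
      change famLin (y (a * b)) i v.1 = famLin (y a) i (famLin (y b) i v.1)
      rw [← h.mul, famLin_conv]))

/-- The module over `S_n ⋉ A^{⊗ n}` with given coefficients. -/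
def CoefAction.wreathMod (h : CoefAction (n : k) p k y) (hp : Coef.comp (n : k) p p = p) :
    WreathMod k A n where
  V := ModuleCat.of k (p.image n)
  perm := imagePerm n p
  y := h.imageY hp
  y_comm _ _ hij a b := LinearMap.ext fun v => Subtype.ext (famLin_comm (h.comm a b) hij v.1)
  perm_y σ i a := LinearMap.ext fun v => Subtype.ext (permLin_famLin σ (y a) i v.1)

variable (k A n) in
/-- The interpolation functor. -/
def interpolate : WreathRep k k A (permData k (n : k)) ⥤ WreathMod k A n where
  obj M := CoefAction.wreathMod (X := M.V.X) (p := M.V.p) M.act.coefAction M.V.idem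
  map {M N} f := ⟨(specialize k n).map f.1, by
    constructor
    · intro σ v
      exact Subtype.ext (permLin_evLin (X := M.V.X) (Y := N.V.X) σ f.1.f v.1).symm
    · intro i a v
      refine Subtype.ext ?_
      change evLin n (X := M.V.X) (Y := N.V.X) f.1.f
          (famLin (X := M.V.X) (Y := M.V.X) (M.act.y a).f i v.1) =
        famLin (X := N.V.X) (Y := N.V.X) (N.act.y a).f i
          (evLin n (X := M.V.X) (Y := N.V.X) f.1.f v.1)
      refine (famLin_comp (X := M.V.X) (Y := M.V.X) (Z := N.V.X) _ _ i v.1).symm.trans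
        (Eq.trans ?_ (famLin_tensor_comp (X := M.V.X) (Y := N.V.X) (Z := N.V.X) _ _ i v.1))
      exact congrArg (fun F => famLin (X := M.V.X) (Y := N.V.X) F i v.1)
        (mem_equivariant_iff.1 f.2 a).symm⟩
  map_id M := Subtype.ext ((specialize k n).map_id M.V)
  map_comp f g := Subtype.ext ((specialize k n).map_comp f.1 g.1)

end algebra

variable [Bialgebra k A]

/-- The passage to permutation modules intertwines the two actions of `A ⊗ A`. The statement for all
`u` reduces to pure tensors, and `u = Δ(a)` gives compatibility with the tensor product of modules.
-/
theorem famLin_tensorSL_tprod (h : CoefAction (n : k) p k y)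
    (h' : CoefAction (n : k) q k y') (hp : Coef.comp (n : k) p p = p)
    (hq : Coef.comp (n : k) q q = q) (i : Fin n) (u : A ⊗[k] A) (x : p.image n ⊗[k] q.image n) :
    famLin (Coef.tensorSL h.toSL h'.toSL u) i (imageTprod hp hq x).1 =
      (imageTprod hp hq (tens (h.imageY hp i) (h'.imageY hq i) u x)).1 := by
  induction u with
  | zero =>
    rw [_root_.map_zero, _root_.map_zero, LinearMap.zero_apply, _root_.map_zero]
    have := famLin_smul (0 : k) (0 : Coef k (Shape.point.tensor (X.tensor Y)) (X.tensor Y)) i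
    rw [zero_smul, zero_smul] at this
    rw [this]
    rfl
  | add u v hu hv =>
    rw [_root_.map_add, _root_.map_add, LinearMap.add_apply, _root_.map_add, famLin_add,
      LinearMap.add_apply, hu, hv]
    rfl
  | tmul a b =>
    rw [tens_tmul]
    change famLin (Coef.tensorFam (y a) (y' b)) i _ = _
    induction x with
    | zero => simp
    | add x x' hx hx' =>
      rw [_root_.map_add, _root_.map_add, _root_.map_add]
      exact (_root_.map_add _ _ _).trans (congrArg₂ (· + ·) hx hx')
    | tmul v w =>
      rw [imageTprod_tmul, famLin_tensorFam_tprod]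
      rfl

theorem permLin_imageTprod (hp : Coef.comp (n : k) p p = p) (hq : Coef.comp (n : k) q q = q)
    (σ : Equiv.Perm (Fin n)) (x : p.image n ⊗[k] q.image n) :
    permLin k _ n σ (imageTprod hp hq x).1 =
      (imageTprod hp hq (TensorProduct.map (imagePerm n p σ) (imagePerm n q σ) x)).1 := by
  induction x with
  | zero => simp
  | add x x' hx hx' =>
    rw [_root_.map_add, _root_.map_add, _root_.map_add]
    exact (_root_.map_add _ _ _).trans (congrArg₂ (· + ·) hx hx')
  | tmul v w => rfl

/-- The tensor product of the images of idempotents, as modules. -/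
def wreathTensorIso (h : CoefAction (n : k) p k y) (h' : CoefAction (n : k) q k y')
    (hp : Coef.comp (n : k) p p = p) (hq : Coef.comp (n : k) q q = q)
    (hpq : Coef.comp (n : k) (Coef.tensor p q) (Coef.tensor p q) = Coef.tensor p q) :
    h.wreathMod hp ⊗ h'.wreathMod hq ≅ (h.tensor h').wreathMod hpq :=
  let e : (h.wreathMod hp ⊗ h'.wreathMod hq).V ≅ ((h.tensor h').wreathMod hpq).V :=
    (imageTensorEquiv hp hq).toModuleIso
  WreathMod.mkIso e
    ⟨fun σ x => Subtype.ext (by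
        change (imageTprod hp hq (TensorProduct.map (imagePerm n p σ) (imagePerm n q σ) x)).1 =
          permLin k _ n σ (imageTprod hp hq x).1
        exact (permLin_imageTprod hp hq σ x).symm),
      fun i a x => Subtype.ext (famLin_tensorSL_tprod h h' hp hq i (Coalgebra.comul a) x).symm⟩

variable (k n) in
/-- The functions on a point. -/
def unitImageEquiv : k ≃ₗ[k] (Coef.id k Shape.unit).image n where
  toFun c := ⟨fun _ => c, Coef.mem_image_of_eq (evLin_id _)⟩
  map_add' _ _ := rfl
  map_smul' _ _ := rfl
  invFun v := v.1 default
  left_inv _ := rfl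
  right_inv v := Subtype.ext (funext fun _ => congrArg v.1 (Subsingleton.elim _ _))

variable (k A n) in
/-- The unit module. -/
def wreathUnitIso (hp : Coef.comp (n : k) (Coef.id k Shape.unit) (Coef.id k Shape.unit) =
      Coef.id k Shape.unit) :
    𝟙_ (WreathMod k A n) ≅ (CoefAction.unit (k := k) (A := A) (n : k)).wreathMod hp :=
  WreathMod.mkIso (unitImageEquiv k n).toModuleIso
    ⟨fun _ _ => rfl, fun i a (c : k) => Subtype.ext (by
      change (fun _ => Coalgebra.counit (R := k) a * c) =
        famLin (algebraMap k k (Coalgebra.counit a) • Coef.const (n : k) (Coef.id k Shape.unit)) i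
          (fun _ => c)
      rw [famLin_smul, famLin_const, LinearMap.smul_apply, evLin_id]
      rfl)⟩

/-- The associator of the Karoubi envelope applies the idempotents first, and these fix vectors of
the images. -/
theorem evLin_comp_assoc_tprod {r : Coef k Z Z} {u : X.Pt n → k} {v : Y.Pt n → k} {w : Z.Pt n → k}
    (hu : evLin n p u = u) (hv : evLin n q v = v) (hw : evLin n r w = w) :
    evLin n (Coef.comp (n : k) (Coef.tensor (Coef.tensor p q) r) (Coef.assoc' k X Y Z))
      (tprod _ Z n (tprod X Y n u v) w) = tprod X _ n u (tprod Y Z n v w) := by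
  rw [evLin_comp, evLin_tensor_tprod, evLin_tensor_tprod, evLin_assoc_tprod, hu, hv, hw]

theorem evLin_comp_lunit_tprod {v : X.Pt n → k} (hv : evLin n p v = v) (c : k) :
    evLin n (Coef.comp (n : k) (Coef.tensor (Coef.id k Shape.unit) p) (Coef.lunit k X))
      (tprod _ X n (fun _ => c) v) = c • v := by
  rw [evLin_comp, evLin_tensor_tprod, evLin_lunit_tprod, evLin_id, hv]

theorem evLin_comp_runit_tprod {v : X.Pt n → k} (hv : evLin n p v = v) (c : k) :
    evLin n (Coef.comp (n : k) (Coef.tensor p (Coef.id k Shape.unit)) (Coef.runit k X))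
      (tprod X _ n v (fun _ => c)) = c • v := by
  rw [evLin_comp, evLin_tensor_tprod, evLin_runit_tprod, evLin_id, hv]

variable (k A n) in
/-- The monoidal structure of the interpolation functor. -/
def interpolateMonoidal :
    letI := (monoidalLift k (n : k) k A).monoidal
    (interpolate k A n).CoreMonoidal :=
  letI := (monoidalLift k (n : k) k A).monoidal
  { εIso := wreathUnitIso k A n (Coef.id_comp _ _)
    μIso := fun M N => wreathTensorIso (X := M.V.X) (Y := N.V.X) M.act.coefAction N.act.coefAction
      M.V.idem N.V.idem (M.V ⊗ N.V).idem
    -- Whiskering by `N` applies the idempotent of `N`, which fixes `w`; pure tensors suffice.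
    μIso_hom_natural_left := fun {M M'} f N => Subtype.ext <| ModuleCat.hom_ext <|
      TensorProduct.ext' fun v w => Subtype.ext (by
        refine Eq.trans ?_ (evLin_tensor_tprod (X := M.V.X) (Y := N.V.X) (X' := M'.V.X)
          (Y' := N.V.X) f.1.f N.V.p v.1 w.1).symm
        exact congrArg (tprod M'.V.X N.V.X n _)
          (Coef.evLin_of_mem_image (X := N.V.X) N.V.idem w.2).symm)
    μIso_hom_natural_right := fun {M M'} N f => Subtype.ext <| ModuleCat.hom_ext <|
      TensorProduct.ext' fun v w => Subtype.ext (by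
        refine Eq.trans ?_ (evLin_tensor_tprod (X := N.V.X) (Y := M.V.X) (X' := N.V.X)
          (Y' := M'.V.X) N.V.p f.1.f v.1 w.1).symm
        exact congrArg (fun x => tprod N.V.X M'.V.X n x _)
          (Coef.evLin_of_mem_image (X := N.V.X) N.V.idem v.2).symm)
    associativity := fun L M N => Subtype.ext <| ModuleCat.hom_ext <|
      TensorProduct.ext_threefold fun u v w => Subtype.ext <|
        evLin_comp_assoc_tprod (X := L.V.X) (Y := M.V.X) (Z := N.V.X)
          (Coef.evLin_of_mem_image (X := L.V.X) L.V.idem u.2)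
          (Coef.evLin_of_mem_image (X := M.V.X) M.V.idem v.2)
          (Coef.evLin_of_mem_image (X := N.V.X) N.V.idem w.2)
    left_unitality := fun M => Subtype.ext <| ModuleCat.hom_ext <|
      TensorProduct.ext' fun (c : k) v => Subtype.ext
        (evLin_comp_lunit_tprod (X := M.V.X)
          (Coef.evLin_of_mem_image (X := M.V.X) M.V.idem v.2) c).symm
    right_unitality := fun M => Subtype.ext <| ModuleCat.hom_ext <|
      TensorProduct.ext' fun v (c : k) => Subtype.ext
        (evLin_comp_runit_tprod (X := M.V.X)
          (Coef.evLin_of_mem_image (X := M.V.X) M.V.idem v.2) c).symm }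

variable (k A n) in
/-- The interpolation functor is compatible with the monoidal structure. -/
def interpolation : Interpolation (monoidalLift k (n : k) k A) where
  Φ := interpolate k A n
  -- The modules are built on the very images used by `specialize`, so the comparison is the
  -- identity.
  e := NatIso.ofComponents (fun _ => Iso.refl _) fun _ => rfl
  perm _ _ _ _ := rfl
  y M i _ v := (evLin_insertPt (X := M.V.X) (Y := M.V.X) _ i v.1).symm
  monoidal :=
    letI := (monoidalLift k (n : k) k A).monoidal
    (interpolateMonoidal k A n).toMonoidal
  unit _ := rfl
  tensor _ _ _ _ _ := rfl

end functor

end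

section

open Idempotents TensorProduct

variable {X Y Z W X' Y' Z' P Q : Shape}

/-! ### Representability of algebraic conditions -/

section algebraic
variable {k : Type u} [CommRing k] {σ : Type u}

/-- Composition of morphisms of `k`-algebras with an element. -/
def Base.Hom.comp {B B' B'' : Base k} (φ : B.Hom B') (ψ : B'.Hom B'') : B.Hom B'' :=
  ⟨ψ.1.comp φ.1, by rw [AlgHom.comp_apply, φ.2, ψ.2]⟩

/-- A condition on families of elements which is given by polynomial equations, with coefficients
which may depend on the distinguished element. -/
def Algebraic (C : ∀ B : Base k, (σ → B.R) → Prop) : Prop :=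
  ∃ S : Set (MvPolynomial (Option σ) k), ∀ B v,
    C B v ↔ ∀ f ∈ S, MvPolynomial.aeval (fun o : Option σ => o.elim B.t v) f = 0

theorem Algebraic.and {C D : ∀ B : Base k, (σ → B.R) → Prop} (hC : Algebraic C)
    (hD : Algebraic D) : Algebraic fun B v => C B v ∧ D B v := by
  obtain ⟨S, hS⟩ := hC
  obtain ⟨S', hS'⟩ := hD
  exact ⟨S ∪ S', fun B v => by
    beta_reduce
    simp only [hS, hS', Set.mem_union, or_imp, forall_and]⟩

theorem Algebraic.congr {C D : ∀ B : Base k, (σ → B.R) → Prop} (hC : Algebraic C)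
    (h : ∀ B v, C B v ↔ D B v) : Algebraic D := by
  obtain ⟨S, hS⟩ := hC
  exact ⟨S, fun B v => (h B v).symm.trans (hS B v)⟩

/-- Any number of equations is allowed, so conditions quantified over all elements of `A` or `k` are
still algebraic. -/
theorem Algebraic.forall {ι : Type*} {C : ι → ∀ B : Base k, (σ → B.R) → Prop}
    (hC : ∀ i, Algebraic (C i)) : Algebraic fun B v => ∀ i, C i B v := by
  choose S hS using hC
  refine ⟨⋃ i, S i, fun B v => ?_⟩
  simp only [hS, Set.mem_iUnion]
  exact ⟨fun h f ⟨i, hf⟩ => h i f hf, fun h i f hf => h f ⟨i, hf⟩⟩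

theorem Algebraic.comp {τ : Type u} {C : ∀ B : Base k, (σ → B.R) → Prop} (hC : Algebraic C)
    (e : σ → τ) : Algebraic fun (B : Base k) (v : τ → B.R) => C B (v ∘ e) := by
  obtain ⟨S, hS⟩ := hC
  refine ⟨MvPolynomial.rename (Option.map e) '' S, fun B v => ?_⟩
  beta_reduce
  rw [hS, Set.forall_mem_image]
  refine forall₂_congr fun f _ => ?_
  rw [MvPolynomial.aeval_rename]
  exact Eq.congr_left (congrArg (fun g => MvPolynomial.aeval g f)
    (funext fun o => by cases o <;> rfl))

/-- The universal family of elements. -/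
def freeBase (k : Type u) [CommRing k] (σ : Type u) : Base k where
  R := MvPolynomial (Option σ) k
  t := MvPolynomial.X none

/-- The map given by a family of elements. -/
def freeHom {B : Base k} (v : σ → B.R) : (freeBase k σ).Hom B :=
  ⟨MvPolynomial.aeval fun o : Option σ => o.elim B.t v, MvPolynomial.aeval_X _ _⟩

/-- A Yoneda argument: a natural function of families of elements is determined by its value at the
universal family, and this value is a polynomial. The condition is the vanishing of one difference
of polynomials. -/
theorem algebraic_eq {F G : ∀ B : Base k, (σ → B.R) → B.R}
    (hF : ∀ {B B' : Base k} (φ : B.Hom B') v, φ.1 (F B v) = F B' (φ.1 ∘ v))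
    (hG : ∀ {B B' : Base k} (φ : B.Hom B') v, φ.1 (G B v) = G B' (φ.1 ∘ v)) :
    Algebraic fun B v => F B v = G B v := by
  let x : σ → (freeBase k σ).R := fun i => MvPolynomial.X (some i)
  refine ⟨({F _ x - G _ x} : Set (freeBase k σ).R), fun B v => ?_⟩
  have h : (freeHom v).1 ∘ x = v := funext fun i => MvPolynomial.aeval_X _ _
  have h1 := hF (freeHom v) x
  have h2 := hG (freeHom v) x
  rw [h] at h1 h2
  beta_reduce
  rw [← h1, ← h2, ← sub_eq_zero, ← map_sub]
  exact ⟨fun h f hf => hf ▸ h, fun h => h _ rfl⟩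

/-- Families of coefficients which depend naturally on families of elements. -/
def NatCoef (F : ∀ B : Base k, (σ → B.R) → Coef B.R X Y) : Prop :=
  ∀ {B B' : Base k} (φ : B.Hom B') v, (F B v).map (φ.1 : B.R →+* B'.R) = F B' (φ.1 ∘ v)

theorem algebraic_coef_eq {F G : ∀ B : Base k, (σ → B.R) → Coef B.R X Y} (hF : NatCoef F)
    (hG : NatCoef G) : Algebraic fun B v => F B v = G B v := by
  have : Algebraic fun (B : Base k) (v : σ → B.R) => ∀ i j E, F B v i j E = G B v i j E :=
    .forall fun i => .forall fun j => .forall fun E => algebraic_eq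
      (fun φ v => congrArg (fun f : Coef _ X Y => f i j E) (hF φ v))
      (fun φ v => congrArg (fun f : Coef _ X Y => f i j E) (hG φ v))
  simpa only [← Coef.ext_iff] using this

namespace Algebraic
variable {C : ∀ B : Base k, (σ → B.R) → Prop} (hC : Algebraic C)

/-- The base which represents an algebraic condition. -/
def base : Base k where
  R := MvPolynomial (Option σ) k ⧸ Ideal.span hC.choose
  t := Ideal.Quotient.mk _ (MvPolynomial.X none)

/-- The universal family which satisfies an algebraic condition. -/
def vec : σ → hC.base.R := fun i => Ideal.Quotient.mk _ (MvPolynomial.X (some i))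

/-- In the quotient ring, evaluating an equation at the universal family gives its residue class,
which is zero. -/
theorem holds : C hC.base hC.vec := by
  rw [hC.choose_spec]
  intro f hf
  have h : MvPolynomial.aeval (fun o : Option σ => o.elim hC.base.t hC.vec) =
      Ideal.Quotient.mkₐ k (Ideal.span hC.choose) :=
    MvPolynomial.algHom_ext fun o => by
      refine (MvPolynomial.aeval_X _ _).trans ?_
      cases o <;> rfl
  refine (AlgHom.congr_fun h f).trans ?_
  exact Ideal.Quotient.eq_zero_iff_mem.2 (Ideal.subset_span hf)

variable {hC} in
theorem hom_ext {B : Base k} {φ ψ : hC.base.Hom B} (h : φ.1 ∘ hC.vec = ψ.1 ∘ hC.vec) : φ = ψ := by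
  refine Subtype.ext (Ideal.Quotient.algHom_ext k (MvPolynomial.algHom_ext fun o => ?_))
  cases o with
  | none => exact φ.2.trans ψ.2.symm
  | some i => exact congrFun h i

/-- The map which classifies a family which satisfies an algebraic condition. -/
def classify {B : Base k} {v : σ → B.R} (h : C B v) : hC.base.Hom B :=
  ⟨Ideal.Quotient.liftₐ _ (freeHom v).1 fun f hf => by
    -- The family satisfies the defining equations, so the evaluation kills the ideal they generate.
    have : Ideal.span hC.choose ≤ RingHom.ker (freeHom v).1 :=
      Ideal.span_le.2 ((hC.choose_spec B v).1 h)
    exact this hf, MvPolynomial.aeval_X _ _⟩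

theorem classify_vec {B : Base k} {v : σ → B.R} (h : C B v) : (hC.classify h).1 ∘ hC.vec = v :=
  funext fun _ => MvPolynomial.aeval_X _ _

end Algebraic

end algebraic

/-! ### Objects and morphisms as families of elements -/

section raw
variable {k : Type u} [CommRing k] {A : Type u} [Ring A] [Algebra k A]

/-- The index set of the coefficients of a morphism. -/
def CoefIdx (X Y : Shape) : Type := Σ (i : Fin X.len) (j : Fin Y.len), Rec (X.deg i) (Y.deg j)

/-- The morphism with given coefficients. -/
def coefOf {R : Type*} (v : CoefIdx X Y → R) : Coef R X Y := fun i j E => v ⟨i, j, E⟩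

/-- The family of coefficients of a morphism. -/
def Coef.vec {R : Type*} (f : Coef R X Y) : CoefIdx X Y → R := fun z => f z.1 z.2.1 z.2.2

variable (A) in
/-- The index set of the coefficients of an object. -/
abbrev ObIdx (X : Shape) : Type u := CoefIdx X X ⊕ A × CoefIdx (Shape.point.tensor X) X

variable {R : Type*}

/-- The idempotent given by a family of coefficients. -/
def ObIdx.p (v : ObIdx A X → R) : Coef R X X := coefOf fun z => v (.inl z)

/-- The `y`-maps given by a family of coefficients. -/
def ObIdx.y (v : ObIdx A X → R) (a : A) : Coef R (Shape.point.tensor X) X :=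
  coefOf fun z => v (.inr (a, z))

/-- The family of coefficients given by an idempotent and `y`-maps. -/
def ObIdx.vec (p : Coef R X X) (y : A → Coef R (Shape.point.tensor X) X) : ObIdx A X → R :=
  Sum.elim p.vec fun z => (y z.1).vec z.2

variable (A) in
/-- The index set of the coefficients of a morphism between objects. -/
abbrev MorIdx (X Y : Shape) : Type u := ObIdx A X ⊕ ObIdx A Y ⊕ CoefIdx X Y

/-- The condition on the coefficients of an object. -/
def ObCond (X : Shape) (B : Base k) (v : ObIdx A X → B.R) : Prop :=
  CoefAction B.t (ObIdx.p v) k (ObIdx.y v) ∧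
    Coef.comp B.t (ObIdx.p v) (ObIdx.p v) = ObIdx.p v

/-- The condition on the coefficients of a morphism between objects. -/
def MorCond (X Y : Shape) (B : Base k) (v : MorIdx A X Y → B.R) : Prop :=
  (ObCond X B (v ∘ .inl) ∧ ObCond Y B (v ∘ .inr ∘ .inl)) ∧
    (Coef.comp B.t (ObIdx.p (v ∘ .inl)) (Coef.comp B.t (coefOf (v ∘ .inr ∘ .inr))
      (ObIdx.p (v ∘ .inr ∘ .inl))) = coefOf (v ∘ .inr ∘ .inr)) ∧
    ∀ a, Coef.comp B.t (Coef.tensor (Coef.id B.R Shape.point) (coefOf (v ∘ .inr ∘ .inr)))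
      (ObIdx.y (v ∘ .inr ∘ .inl) a) =
        Coef.comp B.t (ObIdx.y (v ∘ .inl) a) (coefOf (v ∘ .inr ∘ .inr))

/-- Both sides of each axiom are built from operations compatible with change of rings, so they are
natural in the coefficients and `algebraic_coef_eq` applies. -/
theorem algebraic_obCond (X : Shape) : Algebraic (ObCond (k := k) (A := A) X) := by
  have hp : ∀ {B B' : Base k} (φ : B.Hom B') (v : ObIdx A X → B.R),
      (ObIdx.p v).map (φ.1 : B.R →+* B'.R) = ObIdx.p (φ.1 ∘ v) := fun _ _ => rfl
  have hy : ∀ {B B' : Base k} (φ : B.Hom B') (v : ObIdx A X → B.R) a,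
      (ObIdx.y v a).map (φ.1 : B.R →+* B'.R) = ObIdx.y (φ.1 ∘ v) a := fun _ _ _ => rfl
  have ht : ∀ {B B' : Base k} (φ : B.Hom B'), (φ.1 : B.R →+* B'.R) B.t = B'.t := fun φ => φ.2
  have hc : ∀ {B B' : Base k} (φ : B.Hom B') (c : k),
    (φ.1 : B.R →+* B'.R) (algebraMap k B.R c) = algebraMap k B'.R c := fun φ c => φ.1.commutes c
  -- The axioms are unfolded into conjunctions and universal quantifiers, under which algebraic
  -- conditions are closed.
  have h : Algebraic fun (B : Base k) (v : ObIdx A X → B.R) =>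
      ((∀ a, Coef.comp B.t (Coef.tensor (Coef.id B.R Shape.point) (ObIdx.p v)) (ObIdx.y v a) =
        ObIdx.y v a) ∧
      (∀ a, Coef.comp B.t (ObIdx.y v a) (ObIdx.p v) = ObIdx.y v a) ∧
      (∀ a b, ObIdx.y v (a + b) = ObIdx.y v a + ObIdx.y v b) ∧
      (∀ (c : k) a, ObIdx.y v (c • a) = algebraMap k B.R c • ObIdx.y v a) ∧
      ObIdx.y v 1 = Coef.const B.t (ObIdx.p v) ∧
      (∀ a b, Coef.conv B.t (ObIdx.y v a) (ObIdx.y v b) = ObIdx.y v (a * b)) ∧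
      (∀ a b, Coef.off (Coef.yy₂ B.t (ObIdx.y v a) (ObIdx.y v b)) =
        Coef.off (Coef.pull B.t (Coef.braid B.R _ _)
          (Coef.yy₂ B.t (ObIdx.y v b) (ObIdx.y v a))))) ∧
      Coef.comp B.t (ObIdx.p v) (ObIdx.p v) = ObIdx.p v := by
    refine .and (.and (.forall fun a => algebraic_coef_eq ?_ ?_) <|
      .and (.forall fun a => algebraic_coef_eq ?_ ?_) <|
      .and (.forall fun a => .forall fun b => algebraic_coef_eq ?_ ?_) <|
      .and (.forall fun c => .forall fun a => algebraic_coef_eq ?_ ?_) <|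
      .and (algebraic_coef_eq ?_ ?_) <|
      .and (.forall fun a => .forall fun b => algebraic_coef_eq ?_ ?_) <|
      .forall fun a => .forall fun b => algebraic_coef_eq ?_ ?_) (algebraic_coef_eq ?_ ?_) <;>
    · intro B B' φ v
      simp [Coef.map_add, Coef.map_smul, hp, hy, ht, hc]
  refine h.congr fun B v => and_congr_left fun _ =>
    ⟨fun ⟨h1, h2, h3, h4, h5, h6, h7⟩ => ⟨h1, h2, h3, h4, h5, h6, h7⟩,
    fun ⟨h1, h2, h3, h4, h5, h6, h7⟩ => ⟨h1, h2, h3, h4, h5, h6, h7⟩⟩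

theorem algebraic_morCond (X Y : Shape) : Algebraic (MorCond (k := k) (A := A) X Y) := by
  have hp : ∀ {X : Shape} {B B' : Base k} (φ : B.Hom B') (v : ObIdx A X → B.R),
      (ObIdx.p v).map (φ.1 : B.R →+* B'.R) = ObIdx.p (φ.1 ∘ v) := fun _ _ => rfl
  have hy : ∀ {X : Shape} {B B' : Base k} (φ : B.Hom B') (v : ObIdx A X → B.R) a,
      (ObIdx.y v a).map (φ.1 : B.R →+* B'.R) = ObIdx.y (φ.1 ∘ v) a := fun _ _ _ => rfl
  have hf : ∀ {B B' : Base k} (φ : B.Hom B') (v : CoefIdx X Y → B.R),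
      (coefOf v).map (φ.1 : B.R →+* B'.R) = coefOf (φ.1 ∘ v) := fun _ _ => rfl
  have ht : ∀ {B B' : Base k} (φ : B.Hom B'), (φ.1 : B.R →+* B'.R) B.t = B'.t := fun φ => φ.2
  refine .and (.and (.comp (algebraic_obCond X) Sum.inl)
      (.comp (algebraic_obCond Y) (Sum.inr ∘ Sum.inl))) <|
    .and (algebraic_coef_eq
      (F := fun (B : Base k) (v : MorIdx A X Y → B.R) => Coef.comp B.t (ObIdx.p (v ∘ .inl))
        (Coef.comp B.t (coefOf (v ∘ .inr ∘ .inr)) (ObIdx.p (v ∘ .inr ∘ .inl))))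
      (G := fun (B : Base k) (v : MorIdx A X Y → B.R) => coefOf (v ∘ .inr ∘ .inr)) ?_ ?_)
    (.forall fun a => algebraic_coef_eq
      (F := fun (B : Base k) (v : MorIdx A X Y → B.R) => Coef.comp B.t
        (Coef.tensor (Coef.id B.R Shape.point) (coefOf (v ∘ .inr ∘ .inr)))
          (ObIdx.y (v ∘ .inr ∘ .inl) a))
      (G := fun (B : Base k) (v : MorIdx A X Y → B.R) =>
        Coef.comp B.t (ObIdx.y (v ∘ .inl) a) (coefOf (v ∘ .inr ∘ .inr))) ?_ ?_) <;>
  · intro B B' φ v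
    simp [hp, hy, ht, hf, Function.comp_assoc]

end raw

end

section

open Idempotents TensorProduct

variable {X Y Z W X' Y' Z' P Q : Shape}

/-! ### Classifying maps of objects and morphisms -/

section classify
variable {k : Type u} [CommRing k] {A : Type u} [Ring A] [Algebra k A] {B B' : Base k}

/-- The coefficients of an object. -/
def repVec (M : B.Rep A) : ObIdx A M.V.X → B.R :=
  ObIdx.vec (X := M.V.X) M.V.p fun a => (M.act.y a).f

theorem obCond_repVec (M : B.Rep A) : ObCond M.V.X B (repVec M) :=
  ⟨M.act.coefAction, M.V.idem⟩

/-- The object with given coefficients. -/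
def ObCond.rep {v : ObIdx A X → B.R} (h : ObCond X B v) : B.Rep A := h.1.rep h.2

theorem repVec_rep {v : ObIdx A X → B.R} (h : ObCond X B v) : repVec h.rep = v := by
  funext i
  rcases i with i | i <;> rfl

/-- The new coefficients are those of the object obtained by extension of scalars. -/
theorem ObCond.map {v : ObIdx A X → B.R} (h : ObCond X B v) (φ : B.Hom B') :
    ObCond X B' (φ.1 ∘ v) := obCond_repVec (φ.map.obj h.rep)

theorem ObCond.rep_congr {v v' : ObIdx A X → B.R} (h : ObCond X B v) (h' : ObCond X B v')
    (e : v = v') : h.rep = h'.rep := by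
  subst e
  rfl

theorem ObCond.rep_inj {v v' : ObIdx A X → B.R} {h : ObCond X B v} {h' : ObCond X B v'} :
    h.rep = h'.rep ↔ v = v' := by
  refine ⟨fun e => ?_, h.rep_congr h'⟩
  -- The type of the coefficient family depends on the formal direct sum, so the two are extracted
  -- together.
  have := congrArg (fun M : B.Rep A => (⟨M.V.X, repVec M⟩ : Σ X : Shape, (ObIdx A X → B.R))) e
  have := eq_of_heq (Sigma.mk.inj this).2
  rwa [repVec_rep, repVec_rep] at this

/-- The coefficients of a morphism. -/
def arrVec {M N : B.Rep A} (f : M ⟶ N) : MorIdx A M.V.X N.V.X → B.R :=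
  Sum.elim (repVec M) (Sum.elim (repVec N) (Coef.vec (X := M.V.X) (Y := N.V.X) f.1.f))

theorem morCond_arrVec {M N : B.Rep A} (f : M ⟶ N) : MorCond M.V.X N.V.X B (arrVec f) :=
  ⟨⟨obCond_repVec M, obCond_repVec N⟩, f.1.comm, mem_equivariant_iff.1 f.2⟩

/-- The morphism with given coefficients. -/
def MorCond.hom {v : MorIdx A X Y → B.R} (h : MorCond X Y B v) : h.1.1.rep ⟶ h.1.2.rep :=
  ⟨⟨coefOf (v ∘ .inr ∘ .inr), h.2.1⟩, mem_equivariant_iff.2 h.2.2⟩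

theorem arrVec_hom {v : MorIdx A X Y → B.R} (h : MorCond X Y B v) : arrVec h.hom = v := by
  funext i
  rcases i with (i | i) | (i | i) | i <;> rfl

theorem arrVec_map (φ : B.Hom B') {M N : B.Rep A} (f : M ⟶ N) :
    arrVec (φ.map.map f) = φ.1 ∘ arrVec f := by
  funext i
  rcases i with (i | i) | (i | i) | i <;> rfl

theorem MorCond.map {v : MorIdx A X Y → B.R} (h : MorCond X Y B v) (φ : B.Hom B') :
    MorCond X Y B' (φ.1 ∘ v) := by
  have := morCond_arrVec (φ.map.map h.hom)
  rwa [arrVec_map, arrVec_hom] at this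

theorem MorCond.hom_congr {v v' : MorIdx A X Y → B.R} (h : MorCond X Y B v)
    (h' : MorCond X Y B v') (e : v = v') : Arrow.mk h.hom = Arrow.mk h'.hom := by
  subst e
  rfl

theorem MorCond.hom_inj {v v' : MorIdx A X Y → B.R} {h : MorCond X Y B v}
    {h' : MorCond X Y B v'} : Arrow.mk h.hom = Arrow.mk h'.hom ↔ v = v' := by
  refine ⟨fun e => ?_, h.hom_congr h'⟩
  have := congrArg (fun f : Arrow (B.Rep A) => (⟨(f.left.V.X, f.right.V.X), arrVec f.hom⟩ :
    Σ X : Shape × Shape, (MorIdx A X.1 X.2 → B.R))) e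
  have := eq_of_heq (Sigma.mk.inj this).2
  change arrVec h.hom = arrVec h'.hom at this
  rwa [arrVec_hom, arrVec_hom] at this

variable (k A) in
/-- The base which parametrizes the objects with a given underlying formal direct sum. -/
def obBase (X : Shape) : Base k := (algebraic_obCond (k := k) (A := A) X).base

variable (k A) in
/-- The universal object. -/
def univOb (X : Shape) : (obBase k A X).Rep A := (algebraic_obCond X).holds.rep

/-- The classifying map of an object. -/
def obClassify (M : B.Rep A) : (obBase k A M.V.X).Hom B :=
  (algebraic_obCond M.V.X).classify (obCond_repVec M)

/-- With the formal direct sum fixed, an object amounts to its coefficients, and a homomorphism from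
the parametrizing ring amounts to the images of the generators. -/
theorem map_univOb_eq_iff (M : B.Rep A) (φ : (obBase k A M.V.X).Hom B) :
    φ.map.obj (univOb k A M.V.X) = M ↔ φ = obClassify M := by
  have h := (algebraic_obCond (k := k) (A := A) M.V.X).classify_vec (obCond_repVec M)
  refine (ObCond.rep_inj (h := (algebraic_obCond (k := k) (A := A) M.V.X).holds.map φ)
    (h' := obCond_repVec M)).trans ⟨fun e => Algebraic.hom_ext (e.trans h.symm), ?_⟩
  rintro rfl
  exact h

theorem map_obClassify (M : B.Rep A) : (obClassify M).map.obj (univOb k A M.V.X) = M :=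
  (map_univOb_eq_iff M _).2 rfl

variable (k A) in
/-- The base which parametrizes the morphisms between objects with given underlying formal direct
sums. -/
def morBase (X Y : Shape) : Base k := (algebraic_morCond (k := k) (A := A) X Y).base

variable (k A) in
/-- The universal morphism. -/
def univMor (X Y : Shape) : Arrow ((morBase k A X Y).Rep A) :=
  Arrow.mk (algebraic_morCond X Y).holds.hom

/-- The classifying map of a morphism. -/
def morClassify {M N : B.Rep A} (f : M ⟶ N) : (morBase k A M.V.X N.V.X).Hom B :=
  (algebraic_morCond M.V.X N.V.X).classify (morCond_arrVec f)

theorem map_univMor_eq_iff {M N : B.Rep A} (f : M ⟶ N) (φ : (morBase k A M.V.X N.V.X).Hom B) :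
    φ.map.mapArrow.obj (univMor k A M.V.X N.V.X) = Arrow.mk f ↔ φ = morClassify f := by
  have h := (algebraic_morCond (k := k) (A := A) M.V.X N.V.X).classify_vec (morCond_arrVec f)
  refine (MorCond.hom_inj (h := (algebraic_morCond (k := k) (A := A) M.V.X N.V.X).holds.map φ)
    (h' := morCond_arrVec f)).trans ⟨fun e => Algebraic.hom_ext (e.trans h.symm), ?_⟩
  rintro rfl
  exact h

theorem map_morClassify {M N : B.Rep A} (f : M ⟶ N) :
    (morClassify f).map.mapArrow.obj (univMor k A M.V.X N.V.X) = Arrow.mk f :=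
  (map_univMor_eq_iff f _).2 rfl

/-- Both maps carry the universal object to the same object, and the classifying map is unique. -/
theorem obClassify_map (φ : B.Hom B') (M : B.Rep A) :
    obClassify (φ.map.obj M) = (obClassify M).comp φ := by
  refine ((map_univOb_eq_iff (φ.map.obj M) ((obClassify M).comp φ)).1 ?_).symm
  exact congrArg φ.map.obj (map_obClassify M)

theorem morClassify_map (φ : B.Hom B') {M N : B.Rep A} (f : M ⟶ N) :
    morClassify (φ.map.map f) = (morClassify f).comp φ := by
  refine ((map_univMor_eq_iff (φ.map.map f) ((morClassify f).comp φ)).1 ?_).symm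
  exact congrArg φ.map.mapArrow.obj (map_morClassify f)

end classify

end

section

open Idempotents TensorProduct

variable {X Y Z W X' Y' Z' P Q : Shape}

/-! ### Affine schemes over the affine line -/

section affine
open AlgebraicGeometry Limits
variable {k : Type u} [CommRing k] {B B' B'' : Base k}

theorem Base.Hom.spec_comp (φ : B.Hom B') (ψ : B'.Hom B'') :
    (φ.comp ψ).spec = ψ.spec ≫ φ.spec := by
  apply Over.OverMorphism.ext
  change Spec.map _ = Spec.map _ ≫ Spec.map _
  rw [← Spec.map_comp]
  rfl

/-- The identity. -/
def Base.Hom.id (B : Base k) : B.Hom B := ⟨AlgHom.id k B.R, rfl⟩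

theorem Base.Hom.spec_id : (Base.Hom.id B).spec = 𝟙 B.spec := by
  apply Over.OverMorphism.ext
  exact Spec.map_id (CommRingCat.of B.R)

theorem Base.Hom.spec_injective : Function.Injective (Base.Hom.spec : B.Hom B' → _) := by
  intro φ ψ h
  have h := Spec.map_injective (congrArg (fun f : B'.spec ⟶ B.spec => f.left) h)
  refine Subtype.ext (AlgHom.ext fun r => ?_)
  exact congrArg (fun f : CommRingCat.of B.R ⟶ CommRingCat.of B'.R => f.hom r) h

/-- A morphism over the affine line is a homomorphism of `k[T]`-algebras. Its compatibility with
constants is `k`-linearity, and its compatibility with `T` says that `t` goes to `t`. -/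
theorem Base.Hom.spec_surjective : Function.Surjective (Base.Hom.spec : B.Hom B' → _) := by
  intro g
  obtain ⟨p, hp⟩ := Spec.map_surjective (R := CommRingCat.of B.R) (S := CommRingCat.of B'.R) g.left
  have hw : Spec.map p ≫ Spec.map (CommRingCat.ofHom (Polynomial.aeval (R := k) B.t).toRingHom) =
      Spec.map (CommRingCat.ofHom (Polynomial.aeval (R := k) B'.t).toRingHom) := by
    rw [hp]
    exact Over.w g
  rw [← Spec.map_comp] at hw
  have hw := Spec.map_injective hw
  have hw' (f : Polynomial k) : p.hom (Polynomial.aeval B.t f) = Polynomial.aeval B'.t f :=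
    congrArg (fun f' : CommRingCat.of (Polynomial k) ⟶ CommRingCat.of B'.R => f'.hom f) hw
  refine ⟨⟨{ p.hom with commutes' := fun c => ?_ }, ?_⟩, ?_⟩
  · simpa using hw' (Polynomial.C c)
  · simpa using hw' Polynomial.X
  · apply Over.OverMorphism.ext
    exact hp

/-- A scheme over the affine line has enough affine charts. -/
theorem exists_chart (Y : Over (A1 k)) (U : Y.left.Opens) (y : Y.left) (hy : y ∈ U) :
    ∃ (B : Base k) (x : B.spec ⟶ Y), IsOpenImmersion x.left ∧ y ∈ Set.range x.left ∧
      Set.range x.left ⊆ U := by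
  obtain ⟨V, hV, hyV, hVU⟩ := Y.left.isBasis_affineOpens.exists_subset_of_mem_open hy U.isOpen
  obtain ⟨V, hV, rfl⟩ := hV
  have hV : IsAffineOpen V := hV
  obtain ⟨q, hq⟩ := Spec.map_surjective (hV.fromSpec ≫ Y.hom)
  -- The map from `k[T]` to the sections supplies both the `k`-algebra structure, through constants,
  -- and the element `t`, the image of `T`.
  let _ : Algebra k Γ(Y.left, V) := (q.hom.comp Polynomial.C).toAlgebra
  let B : Base k := { R := Γ(Y.left, V), t := q.hom Polynomial.X }
  have hB : B.spec.hom = hV.fromSpec ≫ Y.hom := by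
    rw [← hq]
    refine congrArg Spec.map (CommRingCat.hom_ext (Polynomial.ringHom_ext (fun c => ?_) ?_))
    · exact Polynomial.aeval_C (A := Γ(Y.left, V)) _ c
    · exact Polynomial.aeval_X (A := Γ(Y.left, V)) _
  refine ⟨B, Over.homMk hV.fromSpec hB.symm, inferInstanceAs (IsOpenImmersion hV.fromSpec), ?_, ?_⟩
  · change y ∈ Set.range hV.fromSpec
    rwa [hV.range_fromSpec]
  · change Set.range hV.fromSpec ⊆ U
    rwa [hV.range_fromSpec]

/-- Over the zero ring all points coincide and say nothing about objects. Charts around an existing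
point avoid this case. -/
theorem Base.nontrivial_of_mem (y : B.spec.left) : Nontrivial B.R :=
  PrimeSpectrum.nontrivial (R := B.R) y

/-- A property of affine charts of `Y` which holds for all nonempty charts which are small enough
around any given point. -/
def Locally (Y : Over (A1 k)) (p : ∀ {B : Base k}, (B.spec ⟶ Y) → Prop) : Prop :=
  ∀ y : Y.left, ∃ U : Y.left.Opens, y ∈ U ∧ ∀ {B : Base k} [Nontrivial B.R] (x : B.spec ⟶ Y),
    Set.range x.left ⊆ U → p x

variable {S S' : Over (A1 k)}

theorem Locally.mono {p q : ∀ {B : Base k}, (B.spec ⟶ S) → Prop} (hp : Locally S p)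
    (h : ∀ {B : Base k} [Nontrivial B.R] (x : B.spec ⟶ S), p x → q x) : Locally S q := by
  intro y
  obtain ⟨U, hy, hU⟩ := hp y
  exact ⟨U, hy, fun x hx => h x (hU x hx)⟩

theorem Locally.and {p q : ∀ {B : Base k}, (B.spec ⟶ S) → Prop} (hp : Locally S p)
    (hq : Locally S q) : Locally S fun x => p x ∧ q x := by
  intro y
  obtain ⟨U, hy, hU⟩ := hp y
  obtain ⟨V, hy', hV⟩ := hq y
  exact ⟨U ⊓ V, ⟨hy, hy'⟩, fun x hx =>
    ⟨hU x (hx.trans inf_le_left), hV x (hx.trans inf_le_right)⟩⟩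

theorem Locally.exists_chart {p : ∀ {B : Base k}, (B.spec ⟶ S) → Prop} (hp : Locally S p)
    (y : S.left) : ∃ (B : Base k) (x : B.spec ⟶ S), IsOpenImmersion x.left ∧
      y ∈ Set.range x.left ∧ Nontrivial B.R ∧ p x := by
  obtain ⟨U, hy, hU⟩ := hp y
  obtain ⟨B, x, hx, ⟨y', hy'⟩, hxU⟩ := DeligneCat.exists_chart S U y hy
  have := Base.nontrivial_of_mem y'
  exact ⟨B, x, hx, ⟨y', hy'⟩, this, hU x hxU⟩

/-- The small charts around all points form an open cover, on which morphisms can be compared. -/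
theorem Locally.hom_ext {f g : S ⟶ S'} (h : Locally S fun x => x ≫ f = x ≫ g) : f = g := by
  apply Over.OverMorphism.ext
  choose B x hx hy _ hfg using h.exists_chart
  let 𝒰 : S.left.OpenCover :=
    { I₀ := S.left, X := fun y => (B y).spec.left, f := fun y => (x y).left,
      mem₀ := by
        rw [Scheme.ofArrows_mem_precoverage_iff]
        exact ⟨fun y => ⟨y, hy y⟩, hx⟩ }
  exact Scheme.Cover.hom_ext 𝒰 _ _ fun y => congrArg (fun f => f.left) (hfg y)

theorem hom_ext_of_spec {f g : S ⟶ S'}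
    (h : ∀ {B : Base k} [Nontrivial B.R] (x : B.spec ⟶ S), x ≫ f = x ≫ g) : f = g :=
  Locally.hom_ext fun _ => ⟨⊤, trivial, fun x _ => h x⟩

/-- A functorial rule on sufficiently small affine charts glues to a morphism. -/
theorem exists_glue (G : ∀ {B : Base k}, (B.spec ⟶ S) → (B.spec ⟶ S') → Prop)
    (hG : Locally S fun x => ∃ z, G x z)
    (map : ∀ {B B' : Base k} (φ : B.Hom B') (x : B.spec ⟶ S) (z : B.spec ⟶ S'), G x z →
      G (φ.spec ≫ x) (φ.spec ≫ z))
    (uniq : ∀ {B : Base k} [Nontrivial B.R] (x : B.spec ⟶ S) (z z' : B.spec ⟶ S'), G x z →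
      G x z' → z = z') :
    ∃ m : S ⟶ S', ∀ {B : Base k} (x : B.spec ⟶ S) (z : B.spec ⟶ S'), G x z → x ≫ m = z := by
  have map' {B B' : Base k} (w : B'.spec ⟶ B.spec) (x : B.spec ⟶ S) (z : B.spec ⟶ S')
      (h : G x z) : G (w ≫ x) (w ≫ z) := by
    obtain ⟨φ, rfl⟩ := Base.Hom.spec_surjective w
    exact map φ x z h
  choose B x hx hy _ z hz using hG.exists_chart
  let 𝒰 : S.left.OpenCover :=
    { I₀ := S.left, X := fun y => (B y).spec.left, f := fun y => (x y).left,
      mem₀ := by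
        rw [Scheme.ofArrows_mem_precoverage_iff]
        exact ⟨fun y => ⟨y, hy y⟩, hx⟩ }
  have glue (y y' : S.left) : pullback.fst (x y).left (x y').left ≫ (z y).left =
      pullback.snd (x y).left (x y').left ≫ (z y').left := by
    -- The overlap of two charts need not be affine. Agreement is tested on its affine points, where
    -- both sides are values of the rule at the same point of `S`.
    let T : Over (A1 k) := Over.mk (pullback.fst (x y).left (x y').left ≫ (B y).spec.hom)
    let p : T ⟶ (B y).spec := Over.homMk (pullback.fst _ _) rfl
    let q : T ⟶ (B y').spec := Over.homMk (pullback.snd _ _) (by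
      change _ = pullback.fst (x y).left (x y').left ≫ (B y).spec.hom
      rw [← Over.w (x y), ← Over.w (x y'), pullback.condition_assoc])
    have hpq : p ≫ x y = q ≫ x y' := Over.OverMorphism.ext pullback.condition
    suffices p ≫ z y = q ≫ z y' from congrArg (fun f => f.left) this
    refine hom_ext_of_spec fun w => uniq (w ≫ p ≫ x y) _ _ ?_ ?_
    · simpa using map' (w ≫ p) _ _ (hz y)
    · rw [hpq]
      simpa using map' (w ≫ q) _ _ (hz y')
  let m : S ⟶ S' := Over.homMk (Scheme.Cover.glueMorphisms 𝒰 (fun y => (z y).left) glue) (by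
    refine Scheme.Cover.hom_ext 𝒰 _ _ fun y => ?_
    rw [Scheme.Cover.ι_glueMorphisms_assoc]
    exact (Over.w (z y)).trans (Over.w (x y)).symm)
  have hm (y : S.left) : x y ≫ m = z y :=
    Over.OverMorphism.ext (Scheme.Cover.ι_glueMorphisms 𝒰 _ glue y)
  -- For a point factoring through one of the chosen charts, the glued morphism gives a value of the
  -- rule, and uniqueness identifies it with `w`.
  have hm' {B' : Base k} [Nontrivial B'.R] (y : S.left) (v : B'.spec ⟶ S) (w : B'.spec ⟶ S') 
      (h : G v w) (g : B'.spec ⟶ (B y).spec) (hg : g ≫ x y = v) : v ≫ m = w := by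
    subst hg
    rw [Category.assoc, hm]
    exact uniq _ _ _ (map' g _ _ (hz y)) h
  -- An arbitrary point factors through a chosen chart only near each `b`, which suffices for
  -- comparing morphisms.
  refine ⟨m, fun {B'} v w h => Locally.hom_ext fun b => ?_⟩
  let y := v.left b
  refine ⟨v.left ⁻¹ᵁ (x y).left.opensRange, hy y, fun {B''} _ g hgr => ?_⟩
  change g ≫ v ≫ m = g ≫ w
  rw [← Category.assoc]
  have : IsOpenImmersion (x y).left := hx y
  have hr : Set.range (g ≫ v).left ⊆ Set.range (x y).left := by
    rintro _ ⟨c, rfl⟩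
    exact hgr ⟨c, rfl⟩
  refine hm' y _ _ (map' g _ _ h) (Over.homMk (IsOpenImmersion.lift (x y).left (g ≫ v).left hr) ?_)
    (Over.OverMorphism.ext (IsOpenImmersion.lift_fac _ _ _))
  rw [← Over.w (x y), IsOpenImmersion.lift_fac_assoc, Over.w]

end affine

end

section

open Idempotents TensorProduct

variable {X Y Z W X' Y' Z' P Q : Shape}

/-! ### Coproducts of affine schemes over the affine line -/

section sigma
open AlgebraicGeometry Limits
variable {k : Type u} [CommRing k] {B B' : Base k} {S : Over (A1 k)}
variable {σ : Type} (b : σ → Base k)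

/-- A coproduct of affine schemes over the affine line. -/
def sigmaSpec : Over (A1 k) :=
  Over.mk (Sigma.desc fun i => (b i).spec.hom)

/-- The inclusion of a component. -/
def sigmaSpecι (i : σ) : (b i).spec ⟶ sigmaSpec b :=
  Over.homMk (Sigma.ι (fun i => (b i).spec.left) i) (Sigma.ι_desc _ _)

instance (i : σ) : IsOpenImmersion (sigmaSpecι b i).left :=
  (sigmaOpenCover fun i => (b i).spec.left).map_prop i

/-- The coproduct property. -/
def sigmaSpecIsColimit : IsColimit (Cofan.mk (sigmaSpec b) (sigmaSpecι b)) :=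
  Cofan.IsColimit.mk _
    (fun s => Over.homMk (Sigma.desc fun i => (s.inj i).left) (by
      refine Sigma.hom_ext _ _ fun i => ?_
      exact (Sigma.ι_desc_assoc _ _ _).trans
        ((Over.w (s.inj i)).trans (Over.w (sigmaSpecι b i)).symm)))
    (fun s i => Over.OverMorphism.ext (Sigma.ι_desc _ _))
    (fun s m hm => Over.OverMorphism.ext (Sigma.hom_ext _ _ fun i =>
      (congrArg (fun f => f.left) (hm i)).trans
        (Sigma.ι_desc (fun i => (s.inj i).left) i).symm))

/-- A point of a coproduct which factors through a component. -/
def point (p : Σ i, (b i).Hom B) : B.spec ⟶ sigmaSpec b := p.2.spec ≫ sigmaSpecι b p.1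

/-- A nonempty scheme cannot map into two distinct components at once, since these are disjoint, and
the inclusion of a component is a monomorphism. -/
theorem point_injective [Nontrivial B.R] :
    Function.Injective (point b : (Σ i, (b i).Hom B) → _) := by
  rintro ⟨i, φ⟩ ⟨j, ψ⟩ h
  have hl : φ.spec.left ≫ Sigma.ι (fun i => (b i).spec.left) i =
      ψ.spec.left ≫ Sigma.ι (fun i => (b i).spec.left) j :=
    congrArg (fun f => f.left) h
  obtain rfl : i = j := by
    by_contra hij
    exact (isEmpty_of_commSq_sigmaι_of_ne ⟨hl⟩ hij).false
      (inferInstance : Nonempty (PrimeSpectrum B.R)).some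
  have hm : Mono (sigmaSpecι b i).left := inferInstance
  obtain rfl : φ = ψ := Base.Hom.spec_injective (Over.OverMorphism.ext ((cancel_mono _).1 hl))
  rfl

theorem point_comp (φ : B.Hom B') (p : Σ i, (b i).Hom B) :
    point b ⟨p.1, p.2.comp φ⟩ = φ.spec ≫ point b p := by
  rw [point, point, Base.Hom.spec_comp, Category.assoc]

/-- The components are open, so a chart inside the preimage of one of them factors through it. -/
theorem locally_point (h : S ⟶ sigmaSpec b) :
    Locally S fun {B} x => ∃ p : Σ i, (b i).Hom B, x ≫ h = point b p := by
  intro y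
  obtain ⟨i, c, hc⟩ : ∃ i c, (sigmaSpecι b i).left c = h.left y :=
    (sigmaOpenCover fun i => (b i).spec.left).exists_eq (h.left y)
  refine ⟨h.left ⁻¹ᵁ (sigmaSpecι b i).left.opensRange, ⟨c, hc⟩, fun {B} _ x hx => ?_⟩
  have hr : Set.range (x ≫ h).left ⊆ Set.range (sigmaSpecι b i).left := by
    rintro _ ⟨d, rfl⟩
    exact hx ⟨d, rfl⟩
  let g : B.spec ⟶ (b i).spec :=
    Over.homMk (IsOpenImmersion.lift (sigmaSpecι b i).left (x ≫ h).left hr) (by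
      rw [← Over.w (sigmaSpecι b i), IsOpenImmersion.lift_fac_assoc, Over.w])
  have hg : g ≫ sigmaSpecι b i = x ≫ h := Over.OverMorphism.ext (IsOpenImmersion.lift_fac _ _ _)
  obtain ⟨φ, hφ⟩ := Base.Hom.spec_surjective g
  exact ⟨⟨i, φ⟩, by rw [point, hφ, hg]⟩

end sigma

/-! ### The schemes of objects and morphisms -/

section points
open AlgebraicGeometry Limits
variable {k : Type u} [CommRing k] {A : Type u} [Ring A] [Algebra k A] {B B' : Base k}
variable {S : Over (A1 k)}

variable (k A) in
/-- The scheme of objects. -/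
def obScheme : Over (A1 k) := sigmaSpec (obBase k A)

variable (k A) in
/-- The scheme of morphisms. -/
def morScheme : Over (A1 k) := sigmaSpec fun p : Shape × Shape => morBase k A p.1 p.2

/-- The point given by an object. -/
def obPt (M : B.Rep A) : B.spec ⟶ obScheme k A := point (obBase k A) ⟨M.V.X, obClassify M⟩

/-- The point given by a morphism. -/
def morPt (f : Arrow (B.Rep A)) : B.spec ⟶ morScheme k A :=
  point (fun p : Shape × Shape => morBase k A p.1 p.2) ⟨(f.left.V.X, f.right.V.X), morClassify f.hom⟩

theorem obPt_map (φ : B.Hom B') (M : B.Rep A) : obPt (φ.map.obj M) = φ.spec ≫ obPt M := by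
  refine Eq.trans ?_ (point_comp _ φ _)
  exact congrArg (fun ψ => point (obBase k A) ⟨M.V.X, ψ⟩) (obClassify_map φ M)

theorem morPt_map (φ : B.Hom B') (f : Arrow (B.Rep A)) :
    morPt (φ.map.mapArrow.obj f) = φ.spec ≫ morPt f := by
  refine Eq.trans ?_ (point_comp _ φ _)
  exact congrArg (fun ψ => point (fun p : Shape × Shape => morBase k A p.1 p.2)
    ⟨(f.left.V.X, f.right.V.X), ψ⟩) (morClassify_map φ f.hom)

/-- The universal object is classified by the identity. -/
theorem obPt_univOb (X : Shape) : obPt (univOb k A X) = sigmaSpecι (obBase k A) X := by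
  have : Base.Hom.id _ = obClassify (univOb k A X) :=
    (map_univOb_eq_iff (univOb k A X) (Base.Hom.id _)).1 rfl
  change (obClassify (univOb k A X)).spec ≫ sigmaSpecι (obBase k A) X = _
  rw [← this]
  exact (congrArg (· ≫ sigmaSpecι (obBase k A) X) Base.Hom.spec_id).trans (Category.id_comp _)

theorem morPt_univMor (X Y : Shape) : morPt (univMor k A X Y) =
    sigmaSpecι (fun p : Shape × Shape => morBase k A p.1 p.2) (X, Y) := by
  have : Base.Hom.id _ = morClassify (univMor k A X Y).hom :=
    (map_univMor_eq_iff (univMor k A X Y).hom (Base.Hom.id _)).1 rfl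
  change (morClassify (univMor k A X Y).hom).spec ≫
    sigmaSpecι (fun p : Shape × Shape => morBase k A p.1 p.2) (X, Y) = _
  rw [← this]
  exact (congrArg (· ≫ sigmaSpecι (fun p : Shape × Shape => morBase k A p.1 p.2) (X, Y))
    Base.Hom.spec_id).trans (Category.id_comp _)

/-- The point determines its component and the classifying map, and the object is the extension of
scalars of the universal object along that map. -/
theorem obPt_injective [Nontrivial B.R] :
    Function.Injective (obPt : B.Rep A → (B.spec ⟶ obScheme k A)) := by
  intro M N h
  have := congrArg (fun p : Σ X, (obBase k A X).Hom B => p.2.map.obj (univOb k A p.1))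
    (point_injective (obBase k A) h)
  rwa [map_obClassify, map_obClassify] at this

theorem morPt_injective [Nontrivial B.R] :
    Function.Injective (morPt : Arrow (B.Rep A) → (B.spec ⟶ morScheme k A)) := by
  intro f g h
  have := congrArg (fun p : Σ X : Shape × Shape, (morBase k A X.1 X.2).Hom B =>
    p.2.map.mapArrow.obj (univMor k A p.1.1 p.1.2)) (point_injective _ h)
  exact (map_morClassify f.hom).symm.trans (this.trans (map_morClassify g.hom))

theorem point_obBase (p : Σ X, (obBase k A X).Hom B) :
    point _ p = obPt (p.2.map.obj (univOb k A p.1)) := by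
  rw [obPt_map, obPt_univOb]
  rfl

theorem point_morBase (p : Σ X : Shape × Shape, (morBase k A X.1 X.2).Hom B) :
    point (fun p : Shape × Shape => morBase k A p.1 p.2) p =
      morPt (p.2.map.mapArrow.obj (univMor k A p.1.1 p.1.2)) := by
  rw [morPt_map, morPt_univMor]
  rfl

/-- A morphism to the scheme of objects need not come from one object, because different parts of
`S` may land in components of different shapes. On small charts it does. -/
theorem locally_obPt (h : S ⟶ obScheme k A) :
    Locally S fun {B} x => ∃ M : B.Rep A, x ≫ h = obPt M :=
  (locally_point _ h).mono fun _ ⟨p, hp⟩ => ⟨_, hp.trans (point_obBase p)⟩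

theorem locally_morPt (h : S ⟶ morScheme k A) :
    Locally S fun {B} x => ∃ f : Arrow (B.Rep A), x ≫ h = morPt f :=
  (locally_point _ h).mono fun _ ⟨p, hp⟩ => ⟨_, hp.trans (point_morBase p)⟩

end points

end

section

open Idempotents TensorProduct

variable {X Y Z W X' Y' Z' P Q : Shape}

/-! ### Extension of scalars and tensor products -/

theorem ObIdx.vec_congr {R A : Type u} {p p' : Coef R X X}
    {y y' : A → Coef R (Shape.point.tensor X) X} (h : p = p') (h' : ∀ a, y a = y' a) :
    ObIdx.vec p y = ObIdx.vec p' y' := by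
  obtain rfl : y = y' := funext h'
  rw [h]

section tensorMap
variable {k : Type u} [CommRing k] {A : Type u} [Ring A] [Bialgebra k A] {B B' : Base k}

/-- The monoidal structure of `Rep(A_t)`. -/
abbrev repMonoidal (B : Base k) : MonoidalCategory (B.Rep A) := (monoidalLift B.R B.t k A).monoidal

attribute [local instance] repMonoidal

theorem map_tensorObj_y (φ : B.Hom B') (M N : B.Rep A) (a : A) :
    Coef.map (φ.1 : B.R →+* B'.R) ((tensorAction M N).y a).f =
      ((tensorAction (φ.map.obj M) (φ.map.obj N)).y a).f := by
  -- The coproduct is replaced by an arbitrary `u`, so that additivity reduces the claim to pure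
  -- tensors.
  have h (u : A ⊗[k] A) : Coef.map (φ.1 : B.R →+* B'.R)
      (Coef.tensorSL (X := M.V.X) (Y := N.V.X) M.act.coefAction.toSL N.act.coefAction.toSL u) =
      Coef.tensorSL (X := M.V.X) (Y := N.V.X) (φ.map.obj M).act.coefAction.toSL
        (φ.map.obj N).act.coefAction.toSL u := by
    induction u with
    | zero =>
      ext i j E
      exact map_zero φ.1
    | add u v hu hv =>
      exact (congrArg _ (_root_.map_add _ u v)).trans ((Coef.map_add _ _ _).trans
        ((congrArg₂ (· + ·) hu hv).trans (_root_.map_add _ u v).symm))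
    | tmul a b => exact Coef.map_tensorFam _ _ _
  exact h _

theorem map_tensorObj_p (φ : B.Hom B') (M N : B.Rep A) :
    (φ.map.obj (M ⊗ N)).V.p = (φ.map.obj M ⊗ φ.map.obj N).V.p :=
  Coef.map_tensor (φ.1 : B.R →+* B'.R) _ _

theorem repVec_map_tensorObj (φ : B.Hom B') (M N : B.Rep A) :
    (repVec (φ.map.obj (M ⊗ N)) : ObIdx A (M ⊗ N).V.X → B'.R) =
      repVec (φ.map.obj M ⊗ φ.map.obj N) :=
  ObIdx.vec_congr (map_tensorObj_p φ M N) (map_tensorObj_y φ M N)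

/-- An equality rather than an isomorphism, as needed for comparing points of the scheme of objects.
It holds because the formal direct sum underlying a tensor product does not depend on the ring, and
the coefficients match. -/
theorem map_tensorObj (φ : B.Hom B') (M N : B.Rep A) :
    φ.map.obj (M ⊗ N) = φ.map.obj M ⊗ φ.map.obj N :=
  ObCond.rep_congr (X := (M ⊗ N).V.X) (obCond_repVec (φ.map.obj (M ⊗ N)))
    (obCond_repVec (φ.map.obj M ⊗ φ.map.obj N)) (repVec_map_tensorObj φ M N)

theorem map_tensorHom (φ : B.Hom B') {M M' N N' : B.Rep A} (f : M ⟶ M') (g : N ⟶ N') :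
    φ.map.mapArrow.obj (Arrow.mk (f ⊗ₘ g)) = Arrow.mk (φ.map.map f ⊗ₘ φ.map.map g) := by
  refine MorCond.hom_congr (X := (M ⊗ N).V.X) (Y := (M' ⊗ N').V.X)
    (morCond_arrVec (φ.map.map (f ⊗ₘ g))) (morCond_arrVec (φ.map.map f ⊗ₘ φ.map.map g)) ?_
  refine congrArg₂ Sum.elim (repVec_map_tensorObj φ M N)
    (congrArg₂ Sum.elim (repVec_map_tensorObj φ M' N') ?_)
  exact congrArg Coef.vec (Coef.map_tensor (φ.1 : B.R →+* B'.R) _ _)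

end tensorMap

end

section

open Idempotents TensorProduct

variable {X Y Z W X' Y' Z' P Q : Shape}

/-! ### The internal category -/

section internalCat
open AlgebraicGeometry Limits
variable {k : Type u} [CommRing k] {A : Type u} [Ring A] [Algebra k A] {B B' : Base k}
variable {S S' : Over (A1 k)}

/-- A rule on objects which is compatible with extension of scalars gives a morphism. -/
theorem exists_obScheme_desc (F : ∀ {B : Base k}, B.Rep A → (B.spec ⟶ S))
    (hF : ∀ {B B' : Base k} (φ : B.Hom B') (M : B.Rep A), F (φ.map.obj M) = φ.spec ≫ F M) :
    ∃ m : obScheme k A ⟶ S, ∀ {B : Base k} (M : B.Rep A), obPt M ≫ m = F M := by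
  refine ⟨(sigmaSpecIsColimit _).desc (Cofan.mk S fun X => F (univOb k A X)), fun M => ?_⟩
  -- Every object is an extension of scalars of a universal one, so the rule is determined by its
  -- values at the universal objects.
  conv_rhs => rw [← map_obClassify M, hF]
  refine (Category.assoc _ _ _).trans (congrArg _ ?_)
  exact (sigmaSpecIsColimit (obBase k A)).fac (Cofan.mk S fun X => F (univOb k A X)) ⟨M.V.X⟩

/-- A rule on morphisms which is compatible with extension of scalars gives a morphism. -/
theorem exists_morScheme_desc (F : ∀ {B : Base k}, Arrow (B.Rep A) → (B.spec ⟶ S))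
    (hF : ∀ {B B' : Base k} (φ : B.Hom B') (f : Arrow (B.Rep A)),
      F (φ.map.mapArrow.obj f) = φ.spec ≫ F f) :
    ∃ m : morScheme k A ⟶ S, ∀ {B : Base k} (f : Arrow (B.Rep A)), morPt f ≫ m = F f := by
  refine ⟨(sigmaSpecIsColimit _).desc (Cofan.mk S fun X => F (univMor k A X.1 X.2)),
    fun f => ?_⟩
  have : F f = (morClassify f.hom).spec ≫ F (univMor k A f.left.V.X f.right.V.X) :=
    (congrArg F (map_morClassify f.hom)).symm.trans (hF _ _)
  rw [this]
  refine (Category.assoc _ _ _).trans (congrArg _ ?_)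
  exact (sigmaSpecIsColimit fun X : Shape × Shape => morBase k A X.1 X.2).fac
    (Cofan.mk S fun X => F (univMor k A X.1 X.2)) ⟨(f.left.V.X, f.right.V.X)⟩

theorem exists_dom : ∃ m : morScheme k A ⟶ obScheme k A,
    ∀ {B : Base k} (f : Arrow (B.Rep A)), morPt f ≫ m = obPt f.left :=
  exists_morScheme_desc (fun f => obPt f.left) fun φ f => obPt_map φ f.left

theorem exists_cod : ∃ m : morScheme k A ⟶ obScheme k A,
    ∀ {B : Base k} (f : Arrow (B.Rep A)), morPt f ≫ m = obPt f.right :=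
  exists_morScheme_desc (fun f => obPt f.right) fun φ f => obPt_map φ f.right

theorem exists_one : ∃ m : obScheme k A ⟶ morScheme k A,
    ∀ {B : Base k} (M : B.Rep A), obPt M ≫ m = morPt (Arrow.mk (𝟙 M)) :=
  exists_obScheme_desc (fun M => morPt (Arrow.mk (𝟙 M))) fun φ M => morPt_map φ (Arrow.mk (𝟙 M))

variable (k A) in
/-- The source. -/
def domHom : morScheme k A ⟶ obScheme k A := exists_dom.choose

variable (k A) in
/-- The target. -/
def codHom : morScheme k A ⟶ obScheme k A := exists_cod.choose

variable (k A) in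
/-- The identities. -/
def oneHom : obScheme k A ⟶ morScheme k A := exists_one.choose

@[simp] theorem morPt_domHom {M N : B.Rep A} (f : M ⟶ N) :
    morPt (Arrow.mk f) ≫ domHom k A = obPt M := exists_dom.choose_spec (Arrow.mk f)

@[simp] theorem morPt_codHom {M N : B.Rep A} (f : M ⟶ N) :
    morPt (Arrow.mk f) ≫ codHom k A = obPt N := exists_cod.choose_spec (Arrow.mk f)

@[simp] theorem obPt_oneHom (M : B.Rep A) : obPt M ≫ oneHom k A = morPt (Arrow.mk (𝟙 M)) :=
  exists_one.choose_spec M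

theorem locally_morPt_mk (h : S ⟶ morScheme k A) :
    Locally S fun {B} x => ∃ (M N : B.Rep A) (f : M ⟶ N), x ≫ h = morPt (Arrow.mk f) :=
  (locally_morPt h).mono fun _ ⟨f, hf⟩ => ⟨f.left, f.right, f.hom, hf⟩

/-- On small charts the two points come from morphisms, and equality of the target point with the
source point is equality of objects because the ring is nonzero. Hence the morphisms are composable.
-/
theorem locally_pair (f g : S ⟶ morScheme k A) (h : f ≫ codHom k A = g ≫ domHom k A) :
    Locally S fun {B} x => ∃ (L M N : B.Rep A) (u : L ⟶ M) (v : M ⟶ N),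
      x ≫ f = morPt (Arrow.mk u) ∧ x ≫ g = morPt (Arrow.mk v) := by
  refine ((locally_morPt f).and (locally_morPt g)).mono ?_
  rintro B _ x ⟨⟨⟨L, M, u⟩, hu⟩, ⟨M', N, v⟩, hv⟩
  obtain rfl : M = M' := by
    apply obPt_injective
    have := congrArg (x ≫ ·) h
    simp only [← Category.assoc] at this
    rw [hu, hv] at this
    exact (morPt_codHom u).symm.trans (this.trans (morPt_domHom v))
  exact ⟨L, M, N, u, v, hu, hv⟩

theorem locally_triple (f g h : S ⟶ morScheme k A) (hfg : f ≫ codHom k A = g ≫ domHom k A)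
    (hgh : g ≫ codHom k A = h ≫ domHom k A) :
    Locally S fun {B} x => ∃ (L M N P : B.Rep A) (u : L ⟶ M) (v : M ⟶ N) (w : N ⟶ P),
      x ≫ f = morPt (Arrow.mk u) ∧ x ≫ g = morPt (Arrow.mk v) ∧ x ≫ h = morPt (Arrow.mk w) := by
  refine ((locally_pair f g hfg).and (locally_morPt h)).mono ?_
  rintro B _ x ⟨⟨L, M, N, u, v, hu, hv⟩, ⟨N', P, w⟩, hw⟩
  obtain rfl : N = N' := by
    apply obPt_injective
    have := congrArg (x ≫ ·) hgh
    simp only [← Category.assoc] at this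
    rw [hv, hw] at this
    exact (morPt_codHom v).symm.trans (this.trans (morPt_domHom w))
  exact ⟨L, M, N, P, u, v, w, hu, hv, hw⟩

/-- Over a nonzero ring the points determine the arrows together with their sources and targets,
hence the composite. -/
theorem comp_congr [Nontrivial B.R] {L M N L' M' N' : B.Rep A} {u : L ⟶ M} {v : M ⟶ N}
    {u' : L' ⟶ M'} {v' : M' ⟶ N'} (hu : morPt (Arrow.mk u) = morPt (Arrow.mk u'))
    (hv : morPt (Arrow.mk v) = morPt (Arrow.mk v')) :
    Arrow.mk (u ≫ v) = Arrow.mk (u' ≫ v') := by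
  cases morPt_injective hu
  cases morPt_injective hv
  rfl

/-- Points of the fibre product are composable pairs only locally. Composition in `Rep(A_t)` is a
functorial rule on these local pairs, and it is glued. -/
theorem exists_comp : ∃ m : pullback (codHom k A) (domHom k A) ⟶ morScheme k A,
    ∀ {B : Base k} (x : B.spec ⟶ pullback (codHom k A) (domHom k A)) {L M N : B.Rep A}
      (u : L ⟶ M) (v : M ⟶ N), x ≫ pullback.fst _ _ = morPt (Arrow.mk u) →
      x ≫ pullback.snd _ _ = morPt (Arrow.mk v) → x ≫ m = morPt (Arrow.mk (u ≫ v)) := by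
  obtain ⟨m, hm⟩ := exists_glue (S := pullback (codHom k A) (domHom k A)) (S' := morScheme k A)
    (fun {B} x z => ∃ (L M N : B.Rep A) (u : L ⟶ M) (v : M ⟶ N),
      x ≫ pullback.fst _ _ = morPt (Arrow.mk u) ∧ x ≫ pullback.snd _ _ = morPt (Arrow.mk v) ∧
      z = morPt (Arrow.mk (u ≫ v)))
    ((locally_pair _ _ pullback.condition).mono fun _ ⟨L, M, N, u, v, hu, hv⟩ =>
      ⟨_, L, M, N, u, v, hu, hv, rfl⟩)
    (by
      rintro B B' φ x _ ⟨L, M, N, u, v, hu, hv, rfl⟩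
      refine ⟨_, _, _, φ.map.map u, φ.map.map v, ?_, ?_, ?_⟩
      · rw [Category.assoc, hu]
        exact (morPt_map φ (Arrow.mk u)).symm
      · rw [Category.assoc, hv]
        exact (morPt_map φ (Arrow.mk v)).symm
      · rw [← φ.map.map_comp]
        exact (morPt_map φ (Arrow.mk (u ≫ v))).symm)
    (by
      rintro B _ x _ _ ⟨L, M, N, u, v, hu, hv, rfl⟩ ⟨L', M', N', u', v', hu', hv', rfl⟩
      exact congrArg morPt (comp_congr (hu.symm.trans hu') (hv.symm.trans hv')))
  exact ⟨m, fun x _ _ _ u v hu hv => hm x _ ⟨_, _, _, u, v, hu, hv, rfl⟩⟩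

variable (k A) in
/-- The composition. -/
def compHom : pullback (codHom k A) (domHom k A) ⟶ morScheme k A := exists_comp.choose

theorem comp_compHom (x : B.spec ⟶ pullback (codHom k A) (domHom k A)) {L M N : B.Rep A}
    (u : L ⟶ M) (v : M ⟶ N) (hu : x ≫ pullback.fst _ _ = morPt (Arrow.mk u))
    (hv : x ≫ pullback.snd _ _ = morPt (Arrow.mk v)) :
    x ≫ compHom k A = morPt (Arrow.mk (u ≫ v)) := exists_comp.choose_spec x u v hu hv

theorem lift_compHom (x : B.spec ⟶ S) {f g : S ⟶ morScheme k A}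
    (h : f ≫ codHom k A = g ≫ domHom k A) {L M N : B.Rep A} {u : L ⟶ M} {v : M ⟶ N}
    (hu : x ≫ f = morPt (Arrow.mk u)) (hv : x ≫ g = morPt (Arrow.mk v)) :
    x ≫ pullback.lift f g h ≫ compHom k A = morPt (Arrow.mk (u ≫ v)) := by
  rw [← Category.assoc]
  exact comp_compHom _ u v (by rwa [Category.assoc, pullback.lift_fst])
    (by rwa [Category.assoc, pullback.lift_snd])

variable (k A) in
/-- The category of the `Rep(A_t)`, internal to schemes over the affine line. -/
def repCat : InternalCat (Over (A1 k)) where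
  ob := obScheme k A
  mor := morScheme k A
  dom := domHom k A
  cod := codHom k A
  one := oneHom k A
  comp := compHom k A
  -- Equalities of morphisms of schemes are tested on small charts. Applied to the identity
  -- morphism, `locally_obPt` says that such charts of the scheme itself come from objects, which
  -- reduces the axiom to one in `Rep(A_t)`.
  one_dom := ((locally_obPt (𝟙 (obScheme k A))).mono fun x ⟨M, hM⟩ => by
    rw [Category.comp_id] at hM ⊢
    rw [hM, ← Category.assoc, obPt_oneHom, morPt_domHom]).hom_ext
  one_cod := ((locally_obPt (𝟙 (obScheme k A))).mono fun x ⟨M, hM⟩ => by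
    rw [Category.comp_id] at hM ⊢
    rw [hM, ← Category.assoc, obPt_oneHom, morPt_codHom]).hom_ext
  comp_dom := ((locally_pair _ _ pullback.condition).mono fun x ⟨L, M, N, u, v, hu, hv⟩ => by
    rw [← Category.assoc, ← Category.assoc, comp_compHom x u v hu hv, hu, morPt_domHom,
      morPt_domHom]).hom_ext
  comp_cod := ((locally_pair _ _ pullback.condition).mono fun x ⟨L, M, N, u, v, hu, hv⟩ => by
    rw [← Category.assoc, ← Category.assoc, comp_compHom x u v hu hv, hv, morPt_codHom,
      morPt_codHom]).hom_ext
  one_comp := ((locally_morPt_mk (𝟙 (morScheme k A))).mono fun x ⟨M, N, f, hf⟩ => by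
    rw [Category.comp_id] at hf
    subst hf
    refine (lift_compHom _ _ (u := 𝟙 M) (v := f) ?_ (Category.comp_id _)).trans ?_
    · rw [← Category.assoc]
      exact (congrArg (· ≫ _) (morPt_domHom f)).trans (obPt_oneHom M)
    · rw [Category.id_comp f, Category.comp_id]).hom_ext
  comp_one := ((locally_morPt_mk (𝟙 (morScheme k A))).mono fun x ⟨M, N, f, hf⟩ => by
    rw [Category.comp_id] at hf
    subst hf
    refine (lift_compHom _ _ (u := f) (v := 𝟙 N) (Category.comp_id _) ?_).trans ?_
    · rw [← Category.assoc]
      exact (congrArg (· ≫ _) (morPt_codHom f)).trans (obPt_oneHom N)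
    · rw [Category.comp_id f, Category.comp_id]).hom_ext
  assoc f g h hfg hgh := ((locally_triple f g h hfg hgh).mono
    fun x ⟨L, M, N, P, u, v, w, hu, hv, hw⟩ => by
      rw [lift_compHom x _ (lift_compHom x _ hu hv) hw, lift_compHom x _ hu (lift_compHom x _ hv hw),
        Category.assoc]).hom_ext

variable (k A) in
/-- The internal category is the category of the `Rep(A_t)`. -/
def repCatIsRep : IsRep A (repCat k A) where
  pt := obPt
  arr f := morPt (Arrow.mk f)
  arr_dom := morPt_domHom
  arr_cod := morPt_codHom
  arr_id M := (obPt_oneHom M).symm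
  arr_comp f g := (comp_compHom _ f g (pullback.lift_fst _ _ _) (pullback.lift_snd _ _ _)).symm
  pt_map := obPt_map
  arr_map φ _ _ f := morPt_map φ (Arrow.mk f)
  obBase := obBase k A
  univOb := univOb k A
  shape_univOb _ := rfl
  existsUnique_ob _ M := ⟨obClassify M, map_obClassify M, fun φ h => (map_univOb_eq_iff M φ).1 h⟩
  ob_coproduct := (sigmaSpecIsColimit (obBase k A)).ofIsoColimit
    (Cofan.ext (Iso.refl _) fun X => (Category.comp_id _).trans (obPt_univOb X).symm)
  morBase := morBase k A
  univMor := univMor k A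
  shape_left _ _ := rfl
  shape_right _ _ := rfl
  existsUnique_mor _ f := ⟨morClassify f.hom, map_morClassify f.hom,
    fun φ h => (map_univMor_eq_iff f.hom φ).1 h⟩
  mor_coproduct := (sigmaSpecIsColimit fun X : Shape × Shape => morBase k A X.1 X.2).ofIsoColimit
    (Cofan.ext (Iso.refl _) fun X => (Category.comp_id _).trans (morPt_univMor X.1 X.2).symm)

end internalCat

/-! ### The internal tensor product -/

section internalTensor
open AlgebraicGeometry Limits
variable {k : Type u} [CommRing k] {A : Type u} [Ring A] [Bialgebra k A] {B B' : Base k}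
variable {S S' : Over (A1 k)}

attribute [local instance] repMonoidal

theorem eq_prod_lift {S T T' : Over (A1 k)} (x : S ⟶ T ⨯ T') :
    x = prod.lift (x ≫ prod.fst) (x ≫ prod.snd) :=
  Limits.prod.hom_ext (Limits.prod.lift_fst _ _).symm (Limits.prod.lift_snd _ _).symm

theorem prod_lift_inj {S T T' : Over (A1 k)} {x x' : S ⟶ T} {y y' : S ⟶ T'}
    (h : prod.lift x y = prod.lift x' y') : x = x' ∧ y = y' :=
  ⟨by simpa only [prod.lift_fst] using congrArg (· ≫ prod.fst) h,
    by simpa only [prod.lift_snd] using congrArg (· ≫ prod.snd) h⟩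

theorem locally_prod_morPt : Locally (morScheme k A ⨯ morScheme k A) fun {B} x =>
    ∃ (M M' N N' : B.Rep A) (f : M ⟶ M') (g : N ⟶ N'),
      x = prod.lift (morPt (Arrow.mk f)) (morPt (Arrow.mk g)) :=
  ((locally_morPt_mk prod.fst).and (locally_morPt_mk prod.snd)).mono
    fun x ⟨⟨M, M', f, hf⟩, N, N', g, hg⟩ =>
      ⟨M, M', N, N', f, g, by rw [eq_prod_lift x, hf, hg]⟩

theorem locally_prod_obPt : Locally (obScheme k A ⨯ obScheme k A) fun {B} x =>
    ∃ M N : B.Rep A, x = prod.lift (obPt M) (obPt N) :=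
  ((locally_obPt prod.fst).and (locally_obPt prod.snd)).mono fun x ⟨⟨M, hM⟩, N, hN⟩ =>
    ⟨M, N, by rw [eq_prod_lift x, hM, hN]⟩

/-- A point of the product is locally a pair of objects. The rule `(M, N) ↦ M ⊗ N` is functorial by
`map_tensorObj` and well defined because points determine objects. -/
theorem exists_tensorOb : ∃ m : obScheme k A ⨯ obScheme k A ⟶ obScheme k A,
    ∀ {B : Base k} (M N : B.Rep A), prod.lift (obPt M) (obPt N) ≫ m = obPt (M ⊗ N) := by
  obtain ⟨m, hm⟩ := exists_glue (S := obScheme k A ⨯ obScheme k A) (S' := obScheme k A)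
    (fun {B} x z => ∃ M N : B.Rep A, x = prod.lift (obPt M) (obPt N) ∧ z = obPt (M ⊗ N))
    (locally_prod_obPt.mono fun _ ⟨M, N, h⟩ => ⟨_, M, N, h, rfl⟩)
    (by
      rintro B B' φ _ _ ⟨M, N, rfl, rfl⟩
      refine ⟨φ.map.obj M, φ.map.obj N, ?_, ?_⟩
      · rw [prod.comp_lift, obPt_map, obPt_map]
      · rw [← obPt_map, map_tensorObj])
    (by
      rintro B _ _ _ _ ⟨M, N, rfl, rfl⟩ ⟨M', N', h, rfl⟩
      obtain rfl := obPt_injective (prod_lift_inj h).1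
      obtain rfl := obPt_injective (prod_lift_inj h).2
      rfl)
  exact ⟨m, fun M N => hm _ _ ⟨M, N, rfl, rfl⟩⟩

theorem exists_tensorMor : ∃ m : morScheme k A ⨯ morScheme k A ⟶ morScheme k A,
    ∀ {B : Base k} {M M' N N' : B.Rep A} (f : M ⟶ M') (g : N ⟶ N'),
      prod.lift (morPt (Arrow.mk f)) (morPt (Arrow.mk g)) ≫ m = morPt (Arrow.mk (f ⊗ₘ g)) := by
  obtain ⟨m, hm⟩ := exists_glue (S := morScheme k A ⨯ morScheme k A) (S' := morScheme k A)
    (fun {B} x z => ∃ f g : Arrow (B.Rep A), x = prod.lift (morPt f) (morPt g) ∧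
      z = morPt (Arrow.mk (f.hom ⊗ₘ g.hom)))
    (locally_prod_morPt.mono fun _ ⟨_, _, _, _, f, g, h⟩ =>
      ⟨_, Arrow.mk f, Arrow.mk g, h, rfl⟩)
    (by
      rintro B B' φ _ _ ⟨f, g, rfl, rfl⟩
      refine ⟨φ.map.mapArrow.obj f, φ.map.mapArrow.obj g, ?_, ?_⟩
      · rw [prod.comp_lift, morPt_map, morPt_map]
      · rw [← morPt_map]
        exact congrArg morPt (map_tensorHom φ f.hom g.hom))
    (by
      rintro B _ _ _ _ ⟨f, g, rfl, rfl⟩ ⟨f', g', h, rfl⟩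
      obtain rfl := morPt_injective (prod_lift_inj h).1
      obtain rfl := morPt_injective (prod_lift_inj h).2
      rfl)
  exact ⟨m, fun f g => hm _ _ ⟨Arrow.mk f, Arrow.mk g, rfl, rfl⟩⟩

variable (k A) in
/-- The tensor product of objects. -/
def tensorObHom : obScheme k A ⨯ obScheme k A ⟶ obScheme k A := exists_tensorOb.choose

variable (k A) in
/-- The tensor product of morphisms. -/
def tensorMorHom : morScheme k A ⨯ morScheme k A ⟶ morScheme k A := exists_tensorMor.choose

theorem lift_tensorObHom (M N : B.Rep A) :
    prod.lift (obPt M) (obPt N) ≫ tensorObHom k A = obPt (M ⊗ N) := exists_tensorOb.choose_spec M N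

theorem lift_tensorMorHom {M M' N N' : B.Rep A} (f : M ⟶ M') (g : N ⟶ N') :
    prod.lift (morPt (Arrow.mk f)) (morPt (Arrow.mk g)) ≫ tensorMorHom k A =
      morPt (Arrow.mk (f ⊗ₘ g)) := exists_tensorMor.choose_spec f g

theorem comp_lift_tensorMorHom (x : B.spec ⟶ S) {f g : S ⟶ morScheme k A} {M M' N N' : B.Rep A}
    {u : M ⟶ M'} {v : N ⟶ N'} (hu : x ≫ f = morPt (Arrow.mk u)) (hv : x ≫ g = morPt (Arrow.mk v)) :
    x ≫ prod.lift f g ≫ tensorMorHom k A = morPt (Arrow.mk (u ⊗ₘ v)) := by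
  rw [← Category.assoc, prod.comp_lift, hu, hv, lift_tensorMorHom]

variable (k A) in
/-- The tensor product of the `Rep(A_t)` as an internal bifunctor. -/
def repTensor : InternalBifunctor (repCat k A) where
  ob := tensorObHom k A
  mor := tensorMorHom k A
  dom := (locally_prod_morPt.mono fun x ⟨M, M', N, N', f, g, hx⟩ => by
    subst hx
    change _ ≫ _ ≫ domHom k A = _ ≫ prod.map (domHom k A) (domHom k A) ≫ _
    rw [← Category.assoc, lift_tensorMorHom, prod.lift_map_assoc, morPt_domHom, morPt_domHom,
      morPt_domHom, lift_tensorObHom]).hom_ext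
  cod := (locally_prod_morPt.mono fun x ⟨M, M', N, N', f, g, hx⟩ => by
    subst hx
    change _ ≫ _ ≫ codHom k A = _ ≫ prod.map (codHom k A) (codHom k A) ≫ _
    rw [← Category.assoc, lift_tensorMorHom, prod.lift_map_assoc, morPt_codHom, morPt_codHom,
      morPt_codHom, lift_tensorObHom]).hom_ext
  one := (locally_prod_obPt.mono fun x ⟨M, N, hx⟩ => by
    subst hx
    change _ ≫ prod.map (oneHom k A) (oneHom k A) ≫ _ = _ ≫ _ ≫ oneHom k A
    rw [prod.lift_map_assoc, obPt_oneHom, obPt_oneHom, lift_tensorMorHom, ← Category.assoc,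
      lift_tensorObHom, obPt_oneHom, id_tensorHom_id]).hom_ext
  -- On small charts this is the interchange law for tensor products of composable morphisms in
  -- `Rep(A_t)`.
  comp f g f' g' h h' := (((locally_pair f g h).and (locally_pair f' g' h')).mono
    fun x ⟨⟨L, M, N, u, v, hu, hv⟩, L', M', N', u', v', hu', hv'⟩ =>
      (comp_lift_tensorMorHom x (lift_compHom x h hu hv) (lift_compHom x h' hu' hv')).trans <| by
        rw [← tensorHom_comp_tensorHom]
        exact (lift_compHom x _ (comp_lift_tensorMorHom x hu hu')
          (comp_lift_tensorMorHom x hv hv')).symm).hom_ext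

end internalTensor

end

end DeligneCat

end

/-! ### Assembly of the main theorem -/

theorem mainTheorem7 {k A : Type u} [Field k] [IsAlgClosed k] [CharZero k] [Ring A]
    [HopfAlgebra k A] :
    ∃ L : ∀ B : Base k, MonoidalLift k B.R A (permData B.R B.t),
      (∀ B : Base k,
        (∀ (M N : B.Rep A) (a : A) (m : ℕ) (x z : Fin m → A),
          Coalgebra.comul (R := k) a = ∑ i, TensorProduct.tmul k (x i) (z i) →
          ((L B).tensor M N).y a =
            ∑ i, (permData B.R B.t).tensorY (M.act.y (x i)) (N.act.y (z i))) ∧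
        (∀ a : A, (L B).unit.y a = algebraMap k B.R (Coalgebra.counit a) •
          ((permData B.R B.t).aug ▷ 𝟙_ (RepS B.R B.t) ≫ (λ_ (𝟙_ (RepS B.R B.t))).hom)) ∧
        letI := (L B).monoidal
        (∃ _ : MonoidalPreadditive (B.Rep A), MonoidalLinear B.R (B.Rep A)) ∧
        Nonempty (RightRigidCategory (B.Rep A)) ∧
        (Function.Bijective (HopfAlgebra.antipode k (A := A)) →
          Nonempty (RigidCategory (B.Rep A)))) ∧
      (∀ n : ℕ, Nonempty (Interpolation (L { R := k, t := (n : k) }))) ∧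
      ∃ (K : InternalCat (Over (A1 k))) (P : IsRep A K) (T : InternalBifunctor K),
        ∀ B : Base k, letI := (L B).monoidal
          (∀ M N : B.Rep A, P.pt (M ⊗ N) = Limits.prod.lift (P.pt M) (P.pt N) ≫ T.ob) ∧
          ∀ {M M' N N' : B.Rep A} (f : M ⟶ M') (g : N ⟶ N'),
            P.arr (f ⊗ₘ g) = Limits.prod.lift (P.arr f) (P.arr g) ≫ T.mor := by
  refine ⟨fun B => monoidalLift B.R B.t k A, fun B => ⟨fun M N a m x z h => ?_, unitAction_y, ?_,
    nonempty_rightRigidCategory B.R B.t k A, nonempty_rigidCategory B.R B.t k A⟩,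
    fun n => ⟨interpolation k A n⟩, repCat k A, repCatIsRep k A, repTensor k A,
    fun B => ⟨fun M N => (lift_tensorObHom M N).symm, fun f g => (lift_tensorMorHom f g).symm⟩⟩
  · exact tensorAction_y M N a m x z h
  · exact ⟨(monoidalLift B.R B.t k A).monoidalPreadditive,
      (monoidalLift B.R B.t k A).monoidalLinear⟩
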